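/- **Conventions.** Let $k$ be a field. An *operad* $P$ over $k$ consists of vector spaces $P(n)$, $n\ge 1$, with actions of the symmetric groups $S_n$, partial compositions $\circ_i : P(n)\otimes P(m)\to P(n+m-1)$, $1\le i\le n$, and a unit $1\in P(1)$, satisfying the usual equivariance, unit, and (sequential and parallel) associativity axioms. A *dg-operad* is the same with $\mathbb Z$-graded spaces $P(n)=\bigoplus_i P(n)^i$, actions and compositions of degree $0$, $1\in P(1)^0$, and linear maps $d:P(n)^i\to P(n)^{i+1}$ such that $d^2=0$, $d$ commutes with the $S_n$-actions, and $d(a\circ_i b)=da\circ_i b+(-1)^{\deg a}\,a\circ_i db$; parallel associativity then carries the Koszul sign $(-1)^{\deg b\,\deg c}$. An operad is regarded as a dg-operad in degree $0$ with $d=0$. The cohomology $H^*(Q)$ of a dg-operad $Q$ is a dg-operad with $d=0$, with the structure induced from $Q$. For a graded space $V$ put $(V^*)^i=(V^{-i})^*$ and $V[-1]^i=V^{i-1}$. **Cobar complex.** Let $Q$ be a dg-operad with $Q(1)=k\cdot 1$ and all $Q(n)$ of finite total dimension. As a graded operad, $\mathrm{Cob}(Q)$ is the free graded operad on the graded $S_n$-modules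 $Q(n)^*[-1]$, $n\ge 2$. Thus $\mathrm{Cob}(Q)(n)$ is spanned by the rooted trees with $n$ leaves labelled by $1,\dots,n$ in which each vertex $v$ has a set $\mathrm{in}(v)$ of at least two inputs and is decorated by an element of $Q(\mathrm{in}(v))^*[-1]$; reordering decorations produces Koszul signs (so that for $Q$ in degree $0$ the decorations have degree $1$, and the trees with $m$ vertices are in degree $m$). The composition is grafting, and $\mathrm{Cob}(Q)(1)=k$ is spanned by the tree without vertices. The differential is the sum of the part induced by the differential of $Q$ and of the part dual to the contraction of one edge: it is the derivation which sends a decoration $\varphi\in Q(n)^*[-1]$ of the tree with one vertex to the element $d\varphi$ whose value on the tree with one vertex decorated by $a\in Q(n)$ is $$(d\varphi)(a)=-\varphi(d a),$$ and whose value on a tree with two vertices, the lower one decorated by $a$ and the upper one, attached to the input $i$ of the lower one, decorated by $b$, is $$(d\varphi)(a,b)=(-1)^{\deg a}\,\varphi(a\circ_i b).$$ **Theorem.** Let $P$ be an operad over $k$ such that every $P(n)$ is finite-dimensional and $P(1)$ is one-dimensional, spanned by the unit. Then $\mathrm{Cob}(P)$ and $\mathrm{Cob}(\mathrm{Cob}(P))$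 are dg-operads, and there is an isomorphism of graded operads $$H^*(\mathrm{Cob}(\mathrm{Cob}(P)))\;\cong\;P,$$ where $P$ is placed in degree $0$. That is, for every $n$ the cohomology of $\mathrm{Cob}(\mathrm{Cob}(P))(n)$ vanishes in all non-zero degrees, and in degree $0$ it is isomorphic to $P(n)$, by isomorphisms that respect the units, the $S_n$-actions and all partial compositions. -/

import Mathlib

universe u v w

open Finset

/-! ### Operads -/

/-- A symmetric operad over the field `k`: vector spaces `obj n`, `n ≥ 1` (the value at `0` is the
zero space), with the action of bijections of the inputs, a unit and partial compositions.
`relabel f a` is `a` with the input formerly numbered `c` now numbered `f c`; since `Fin n ≃ Fin l`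
forces `n = l`, this is an action of the symmetric group on each `obj n`.
`comp x e a b` is the result of grafting `b` onto the input `x` of `a`; its inputs are the inputs
`c ≠ x` of `a` and the inputs of `b`, numbered through the bijection `e` (so `l = n + m - 1`).
The usual `a ∘_x b` is `comp x e a b` for the standard numbering `e`, and the other numberings are
its relabellings. -/
structure Operad (k : Type u) [Field k] where
  obj : ℕ → Type v
  [addCommGroup : ∀ n, AddCommGroup (obj n)]
  [module : ∀ n, Module k (obj n)]
  relabel : ∀ {n l : ℕ}, (Fin n ≃ Fin l) → obj n →ₗ[k] obj l
  one : obj 1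
  comp : ∀ {n m l : ℕ} (x : Fin n), ({c : Fin n // c ≠ x} ⊕ Fin m ≃ Fin l) →
    obj n →ₗ[k] obj m →ₗ[k] obj l
  obj_zero : Subsingleton (obj 0)
  relabel_refl : ∀ {n : ℕ} (a : obj n), relabel (Equiv.refl (Fin n)) a = a
  relabel_trans : ∀ {n l r : ℕ} (f : Fin n ≃ Fin l) (g : Fin l ≃ Fin r) (a : obj n),
    relabel (f.trans g) a = relabel g (relabel f a)
  /-- Equivariance of the composition in all three arguments. -/
  relabel_comp : ∀ {n m l n' m' l' : ℕ} (x : Fin n)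
    (e : {c : Fin n // c ≠ x} ⊕ Fin m ≃ Fin l) (f : Fin l ≃ Fin l') (g : Fin n ≃ Fin n')
    (h : Fin m ≃ Fin m') (e' : {c : Fin n' // c ≠ g x} ⊕ Fin m' ≃ Fin l'),
    (∀ c : {c : Fin n // c ≠ x},
      f (e (Sum.inl c)) = e' (Sum.inl ⟨g c.1, fun hc => c.2 (g.injective hc)⟩)) →
    (∀ c : Fin m, f (e (Sum.inr c)) = e' (Sum.inr (h c))) →
    ∀ (a : obj n) (b : obj m),
      relabel f (comp x e a b) = comp (g x) e' (relabel g a) (relabel h b)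
  one_comp : ∀ {m l : ℕ} (e : {c : Fin 1 // c ≠ 0} ⊕ Fin m ≃ Fin l) (f : Fin m ≃ Fin l),
    (∀ c : Fin m, e (Sum.inr c) = f c) → ∀ b : obj m, comp 0 e one b = relabel f b
  comp_one : ∀ {n l : ℕ} (x : Fin n) (e : {c : Fin n // c ≠ x} ⊕ Fin 1 ≃ Fin l)
    (f : Fin n ≃ Fin l), (∀ c : {c : Fin n // c ≠ x}, e (Sum.inl c) = f c.1) →
    e (Sum.inr 0) = f x → ∀ a : obj n, comp x e a one = relabel f a
  /-- Sequential associativity `(a ∘_x b) ∘_y c = a ∘_x (b ∘_y c)`, where the numberings are such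
  that the inputs of both sides correspond to each other. -/
  comp_assoc : ∀ {n m r p q l : ℕ} (x : Fin n) (y : Fin m)
    (e₁ : {c : Fin n // c ≠ x} ⊕ Fin m ≃ Fin p)
    (e₂ : {c : Fin p // c ≠ e₁ (Sum.inr y)} ⊕ Fin r ≃ Fin l)
    (f₁ : {c : Fin m // c ≠ y} ⊕ Fin r ≃ Fin q)
    (f₂ : {c : Fin n // c ≠ x} ⊕ Fin q ≃ Fin l),
    (∀ c : {c : Fin n // c ≠ x},
      e₂ (Sum.inl ⟨e₁ (Sum.inl c), by simp⟩) = f₂ (Sum.inl c)) →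
    (∀ c : {c : Fin m // c ≠ y},
      e₂ (Sum.inl ⟨e₁ (Sum.inr c.1), by simpa using c.2⟩) = f₂ (Sum.inr (f₁ (Sum.inl c)))) →
    (∀ c : Fin r, e₂ (Sum.inr c) = f₂ (Sum.inr (f₁ (Sum.inr c)))) →
    ∀ (a : obj n) (b : obj m) (c : obj r),
      comp (e₁ (Sum.inr y)) e₂ (comp x e₁ a b) c = comp x f₂ a (comp y f₁ b c)
  /-- Parallel associativity `(a ∘_x b) ∘_y c = (a ∘_y c) ∘_x b` for distinct inputs `x`, `y` of
  `a`. -/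
  comp_comm : ∀ {n m r p q l : ℕ} (x y : Fin n) (hxy : x ≠ y)
    (e₁ : {c : Fin n // c ≠ x} ⊕ Fin m ≃ Fin p)
    (e₂ : {c : Fin p // c ≠ e₁ (Sum.inl ⟨y, hxy.symm⟩)} ⊕ Fin r ≃ Fin l)
    (f₁ : {c : Fin n // c ≠ y} ⊕ Fin r ≃ Fin q)
    (f₂ : {c : Fin q // c ≠ f₁ (Sum.inl ⟨x, hxy⟩)} ⊕ Fin m ≃ Fin l),
    (∀ (c : Fin n) (hx : c ≠ x) (hy : c ≠ y),
      e₂ (Sum.inl ⟨e₁ (Sum.inl ⟨c, hx⟩), by simpa using hy⟩) =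
        f₂ (Sum.inl ⟨f₁ (Sum.inl ⟨c, hy⟩), by simpa using hx⟩)) →
    (∀ c : Fin m, e₂ (Sum.inl ⟨e₁ (Sum.inr c), by simp⟩) = f₂ (Sum.inr c)) →
    (∀ c : Fin r, e₂ (Sum.inr c) = f₂ (Sum.inl ⟨f₁ (Sum.inr c), by simp⟩)) →
    ∀ (a : obj n) (b : obj m) (c : obj r),
      comp (e₁ (Sum.inl ⟨y, hxy.symm⟩)) e₂ (comp x e₁ a b) c =
        comp (f₁ (Sum.inl ⟨x, hxy⟩)) f₂ (comp y f₁ a c) b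

attribute [instance] Operad.addCommGroup Operad.module

/-- The data of a differential graded operad: graded pieces `obj n i` (arity `n`, degree `i`),
relabelling, unit, partial compositions and differential. The composition and the differential are
given between arbitrary degrees and are required in `IsDGOperad` to vanish except
`obj n i ⊗ obj m j → obj l (i + j)` and `obj n i → obj n (i + 1)`. -/
structure DGOperadData (k : Type u) [Field k] where
  obj : ℕ → ℤ → Type v
  [addCommGroup : ∀ n i, AddCommGroup (obj n i)]
  [module : ∀ n i, Module k (obj n i)]
  relabel : ∀ {n l : ℕ}, (Fin n ≃ Fin l) → ∀ i : ℤ, obj n i →ₗ[k] obj l i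
  one : obj 1 0
  comp : ∀ {n m l : ℕ} (x : Fin n), ({c : Fin n // c ≠ x} ⊕ Fin m ≃ Fin l) →
    ∀ i j t : ℤ, obj n i →ₗ[k] obj m j →ₗ[k] obj l t
  d : ∀ (n : ℕ) (i j : ℤ), obj n i →ₗ[k] obj n j

attribute [instance] DGOperadData.addCommGroup DGOperadData.module

/-- The axioms of a differential graded operad (with a differential of degree `1`). -/
structure IsDGOperad {k : Type u} [Field k] (Q : DGOperadData.{u, v} k) : Prop where
  obj_zero : ∀ i, Subsingleton (Q.obj 0 i)
  comp_shape : ∀ {n m l : ℕ} (x : Fin n) (e : {c : Fin n // c ≠ x} ⊕ Fin m ≃ Fin l) (i j t : ℤ),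
    i + j ≠ t → Q.comp x e i j t = 0
  d_shape : ∀ (n : ℕ) (i j : ℤ), i + 1 ≠ j → Q.d n i j = 0
  relabel_refl : ∀ {n : ℕ} (i : ℤ) (a : Q.obj n i), Q.relabel (Equiv.refl (Fin n)) i a = a
  relabel_trans : ∀ {n l r : ℕ} (f : Fin n ≃ Fin l) (g : Fin l ≃ Fin r) (i : ℤ) (a : Q.obj n i),
    Q.relabel (f.trans g) i a = Q.relabel g i (Q.relabel f i a)
  relabel_comp : ∀ {n m l n' m' l' : ℕ} (x : Fin n)
    (e : {c : Fin n // c ≠ x} ⊕ Fin m ≃ Fin l) (f : Fin l ≃ Fin l') (g : Fin n ≃ Fin n')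
    (h : Fin m ≃ Fin m') (e' : {c : Fin n' // c ≠ g x} ⊕ Fin m' ≃ Fin l'),
    (∀ c : {c : Fin n // c ≠ x},
      f (e (Sum.inl c)) = e' (Sum.inl ⟨g c.1, fun hc => c.2 (g.injective hc)⟩)) →
    (∀ c : Fin m, f (e (Sum.inr c)) = e' (Sum.inr (h c))) →
    ∀ (i j t : ℤ) (a : Q.obj n i) (b : Q.obj m j),
      Q.relabel f t (Q.comp x e i j t a b) =
        Q.comp (g x) e' i j t (Q.relabel g i a) (Q.relabel h j b)
  one_comp : ∀ {m l : ℕ} (e : {c : Fin 1 // c ≠ 0} ⊕ Fin m ≃ Fin l) (f : Fin m ≃ Fin l),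
    (∀ c : Fin m, e (Sum.inr c) = f c) →
    ∀ (j : ℤ) (b : Q.obj m j), Q.comp 0 e 0 j j Q.one b = Q.relabel f j b
  comp_one : ∀ {n l : ℕ} (x : Fin n) (e : {c : Fin n // c ≠ x} ⊕ Fin 1 ≃ Fin l)
    (f : Fin n ≃ Fin l), (∀ c : {c : Fin n // c ≠ x}, e (Sum.inl c) = f c.1) →
    e (Sum.inr 0) = f x →
    ∀ (i : ℤ) (a : Q.obj n i), Q.comp x e i 0 i a Q.one = Q.relabel f i a
  comp_assoc : ∀ {n m r p q l : ℕ} (x : Fin n) (y : Fin m)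
    (e₁ : {c : Fin n // c ≠ x} ⊕ Fin m ≃ Fin p)
    (e₂ : {c : Fin p // c ≠ e₁ (Sum.inr y)} ⊕ Fin r ≃ Fin l)
    (f₁ : {c : Fin m // c ≠ y} ⊕ Fin r ≃ Fin q)
    (f₂ : {c : Fin n // c ≠ x} ⊕ Fin q ≃ Fin l),
    (∀ c : {c : Fin n // c ≠ x},
      e₂ (Sum.inl ⟨e₁ (Sum.inl c), by simp⟩) = f₂ (Sum.inl c)) →
    (∀ c : {c : Fin m // c ≠ y},
      e₂ (Sum.inl ⟨e₁ (Sum.inr c.1), by simpa using c.2⟩) = f₂ (Sum.inr (f₁ (Sum.inl c)))) →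
    (∀ c : Fin r, e₂ (Sum.inr c) = f₂ (Sum.inr (f₁ (Sum.inr c)))) →
    ∀ (i j s : ℤ) (a : Q.obj n i) (b : Q.obj m j) (c : Q.obj r s),
      Q.comp (e₁ (Sum.inr y)) e₂ (i + j) s (i + j + s) (Q.comp x e₁ i j (i + j) a b) c =
        Q.comp x f₂ i (j + s) (i + j + s) a (Q.comp y f₁ j s (j + s) b c)
  comp_comm : ∀ {n m r p q l : ℕ} (x y : Fin n) (hxy : x ≠ y)
    (e₁ : {c : Fin n // c ≠ x} ⊕ Fin m ≃ Fin p)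
    (e₂ : {c : Fin p // c ≠ e₁ (Sum.inl ⟨y, hxy.symm⟩)} ⊕ Fin r ≃ Fin l)
    (f₁ : {c : Fin n // c ≠ y} ⊕ Fin r ≃ Fin q)
    (f₂ : {c : Fin q // c ≠ f₁ (Sum.inl ⟨x, hxy⟩)} ⊕ Fin m ≃ Fin l),
    (∀ (c : Fin n) (hx : c ≠ x) (hy : c ≠ y),
      e₂ (Sum.inl ⟨e₁ (Sum.inl ⟨c, hx⟩), by simpa using hy⟩) =
        f₂ (Sum.inl ⟨f₁ (Sum.inl ⟨c, hy⟩), by simpa using hx⟩)) →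
    (∀ c : Fin m, e₂ (Sum.inl ⟨e₁ (Sum.inr c), by simp⟩) = f₂ (Sum.inr c)) →
    (∀ c : Fin r, e₂ (Sum.inr c) = f₂ (Sum.inl ⟨f₁ (Sum.inr c), by simp⟩)) →
    ∀ (i j s : ℤ) (a : Q.obj n i) (b : Q.obj m j) (c : Q.obj r s),
      Q.comp (e₁ (Sum.inl ⟨y, hxy.symm⟩)) e₂ (i + j) s (i + j + s)
          (Q.comp x e₁ i j (i + j) a b) c =
        (j * s).negOnePow •
          Q.comp (f₁ (Sum.inl ⟨x, hxy⟩)) f₂ (i + s) j (i + j + s)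
            (Q.comp y f₁ i s (i + s) a c) b
  d_d : ∀ (n : ℕ) (i j t : ℤ) (a : Q.obj n i), Q.d n j t (Q.d n i j a) = 0
  d_relabel : ∀ {n l : ℕ} (f : Fin n ≃ Fin l) (i j : ℤ) (a : Q.obj n i),
    Q.d l i j (Q.relabel f i a) = Q.relabel f j (Q.d n i j a)
  leibniz : ∀ {n m l : ℕ} (x : Fin n) (e : {c : Fin n // c ≠ x} ⊕ Fin m ≃ Fin l) (i j : ℤ)
    (a : Q.obj n i) (b : Q.obj m j),
    Q.d l (i + j) (i + j + 1) (Q.comp x e i j (i + j) a b) =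
      Q.comp x e (i + 1) j (i + j + 1) (Q.d n i (i + 1) a) b +
        i.negOnePow • Q.comp x e i (j + 1) (i + j + 1) a (Q.d m j (j + 1) b)

/-- An isomorphism of differential graded operads. -/
structure DGOperadIso {k : Type u} [Field k] (Q : DGOperadData.{u, v} k)
    (R : DGOperadData.{u, w} k) where
  equiv : ∀ (n : ℕ) (i : ℤ), Q.obj n i ≃ₗ[k] R.obj n i
  map_one : equiv 1 0 Q.one = R.one
  map_relabel : ∀ {n l : ℕ} (f : Fin n ≃ Fin l) (i : ℤ) (a : Q.obj n i),
    equiv l i (Q.relabel f i a) = R.relabel f i (equiv n i a)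
  map_comp : ∀ {n m l : ℕ} (x : Fin n) (e : {c : Fin n // c ≠ x} ⊕ Fin m ≃ Fin l) (i j t : ℤ)
    (a : Q.obj n i) (b : Q.obj m j),
    equiv l t (Q.comp x e i j t a b) = R.comp x e i j t (equiv n i a) (equiv m j b)
  map_d : ∀ (n : ℕ) (i j : ℤ) (a : Q.obj n i), equiv n j (Q.d n i j a) = R.d n i j (equiv n i a)

section Concentrated

variable (k : Type u) [Field k] (V : Type v) [AddCommGroup V] [Module k V]

/-- The degree `i` part of a vector space `V` regarded as a graded space concentrated in
degree `0`. -/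
def conc (i : ℤ) : Submodule k V := if i = 0 then ⊤ else ⊥

/-- The projection of `V` to its degree `i` part: the identity for `i = 0` and zero otherwise. -/
noncomputable def concProj (i : ℤ) : V →ₗ[k] conc k V i :=
  if h : i = 0 then LinearMap.codRestrict (conc k V i) LinearMap.id (by simp [conc, h]) else 0

end Concentrated

/-- An operad as a differential graded operad concentrated in degree `0`. -/
noncomputable def Operad.toDG {k : Type u} [Field k] (P : Operad.{u, v} k) :
    DGOperadData.{u, v} k where
  obj n i := conc k (P.obj n) i
  relabel f i := concProj k _ i ∘ₗ P.relabel f ∘ₗ (conc k _ i).subtype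
  one := concProj k _ 0 P.one
  comp x e i j t := ((P.comp x e).domRestrict₁₂ (conc k _ i) (conc k _ j)).compr₂ (concProj k _ t)
  d _ _ _ := 0

/-! ### Cohomology -/

namespace IsDGOperad

variable {k : Type u} [Field k] {Q : DGOperadData.{u, v} k}

/-- Cocycles of degree `i` in arity `n`. -/
def cocycles (Q : DGOperadData.{u, v} k) (n : ℕ) (i : ℤ) : Submodule k (Q.obj n i) :=
  LinearMap.ker (Q.d n i (i + 1))

/-- Coboundaries of degree `i` in arity `n`, as a subspace of the cocycles. -/
def coboundaries (Q : DGOperadData.{u, v} k) (n : ℕ) (i : ℤ) : Submodule k (cocycles Q n i) :=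
  (LinearMap.range (Q.d n (i - 1) i)).comap (cocycles Q n i).subtype


theorem leibniz' (h : IsDGOperad Q) {n m l : ℕ} (x : Fin n)
    (e : {c : Fin n // c ≠ x} ⊕ Fin m ≃ Fin l) {i j t i' j' t' : ℤ} (ht : i + j = t)
    (hi' : i + 1 = i') (hj' : j + 1 = j') (ht' : t + 1 = t') (a : Q.obj n i) (b : Q.obj m j) :
    Q.d l t t' (Q.comp x e i j t a b) =
      Q.comp x e i' j t' (Q.d n i i' a) b +
        i.negOnePow • Q.comp x e i j' t' a (Q.d m j j' b) := by
  subst ht hi' hj' ht'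
  exact h.leibniz x e i j a b

theorem comp_mem (h : IsDGOperad Q) {n m l : ℕ} (x : Fin n)
    (e : {c : Fin n // c ≠ x} ⊕ Fin m ≃ Fin l) (i j t : ℤ) {a : Q.obj n i} {b : Q.obj m j}
    (ha : a ∈ cocycles Q n i) (hb : b ∈ cocycles Q m j) :
    Q.comp x e i j t a b ∈ cocycles Q l t := by
  by_cases ht : i + j = t
  · have ha' : Q.d n i (i + 1) a = 0 := ha
    have hb' : Q.d m j (j + 1) b = 0 := hb
    have := h.leibniz' x e ht rfl rfl rfl a b
    simpa [cocycles, ha', hb'] using this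
  · simp [h.comp_shape x e i j t ht]

theorem comp_mem_left (h : IsDGOperad Q) {n m l : ℕ} (x : Fin n)
    (e : {c : Fin n // c ≠ x} ⊕ Fin m ≃ Fin l) (i j t : ℤ) {a : Q.obj n i} {b : Q.obj m j}
    (ha : a ∈ LinearMap.range (Q.d n (i - 1) i)) (hb : b ∈ cocycles Q m j) :
    Q.comp x e i j t a b ∈ LinearMap.range (Q.d l (t - 1) t) := by
  by_cases ht : i + j = t
  · obtain ⟨a', rfl⟩ := ha
    have hb' : Q.d m j (j + 1) b = 0 := hb
    have := h.leibniz' x e (i := i - 1) (t := t - 1) (t' := t) (i' := i) (by omega) (by omega) rfl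
      (by omega) a' b
    exact ⟨_, by simpa [hb'] using this⟩
  · simp [h.comp_shape x e i j t ht]

theorem comp_mem_right (h : IsDGOperad Q) {n m l : ℕ} (x : Fin n)
    (e : {c : Fin n // c ≠ x} ⊕ Fin m ≃ Fin l) (i j t : ℤ) {a : Q.obj n i} {b : Q.obj m j}
    (ha : a ∈ cocycles Q n i) (hb : b ∈ LinearMap.range (Q.d m (j - 1) j)) :
    Q.comp x e i j t a b ∈ LinearMap.range (Q.d l (t - 1) t) := by
  by_cases ht : i + j = t
  · obtain ⟨b', rfl⟩ := hb
    have ha' : Q.d n i (i + 1) a = 0 := ha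
    have := h.leibniz' x e (j := j - 1) (t := t - 1) (t' := t) (j' := j) (by omega) rfl (by omega)
      (by omega) a b'
    refine ⟨i.negOnePow • Q.comp x e i (j - 1) (t - 1) a b', ?_⟩
    rcases Int.even_or_odd i with hi | hi
    · simpa [ha', Int.negOnePow_even i hi] using this
    · have h2 := by simpa [ha', Int.negOnePow_odd i hi] using this
      simp [Int.negOnePow_odd i hi, h2]
  · simp [h.comp_shape x e i j t ht]

theorem relabel_mem (h : IsDGOperad Q) {n l : ℕ} (f : Fin n ≃ Fin l) (i : ℤ) {a : Q.obj n i}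
    (ha : a ∈ cocycles Q n i) : Q.relabel f i a ∈ cocycles Q l i := by
  have ha' : Q.d n i (i + 1) a = 0 := ha
  simp [cocycles, h.d_relabel, ha']

theorem one_mem (h : IsDGOperad Q) : Q.one ∈ cocycles Q 1 0 := by
  have hu := h.one_comp (m := 1) (Equiv.ofBijective (Sum.elim (fun _ => 0) id)
    ⟨by
      rintro (⟨c, hc⟩ | c) (⟨c', hc'⟩ | c') _
      all_goals first | exact absurd (Subsingleton.elim _ _) hc
                      | exact absurd (Subsingleton.elim _ _) hc'
                      | exact congrArg _ (Subsingleton.elim _ _),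
     fun c => ⟨Sum.inr c, rfl⟩⟩) (Equiv.refl _) (fun _ => rfl)
  set e : {c : Fin 1 // c ≠ 0} ⊕ Fin 1 ≃ Fin 1 := _
  have h1 : Q.comp 0 e 0 1 1 Q.one (Q.d 1 0 1 Q.one) = Q.d 1 0 1 Q.one := by
    rw [hu, h.relabel_refl]
  have h2 : Q.comp 0 e 1 0 1 (Q.d 1 0 1 Q.one) Q.one = Q.d 1 0 1 Q.one := by
    rw [h.comp_one 0 e (Equiv.refl _) (fun c => Subsingleton.elim _ _) (Subsingleton.elim _ _),
      h.relabel_refl]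
  have h3 := h.leibniz' 0 e (i := 0) (j := 0) (t := 0) (i' := 1) (j' := 1) (t' := 1) (by omega)
    (by omega) (by omega) (by omega) Q.one Q.one
  rw [h1, h2, hu, h.relabel_refl] at h3
  have h4 : Q.d 1 0 1 Q.one = 0 := by simpa using h3
  exact h4

/-- The composition of cocycles. -/
def compCocycles (h : IsDGOperad Q) {n m l : ℕ} (x : Fin n)
    (e : {c : Fin n // c ≠ x} ⊕ Fin m ≃ Fin l) (i j t : ℤ) :
    cocycles Q n i →ₗ[k] cocycles Q m j →ₗ[k] cocycles Q l t :=
  LinearMap.mk₂ k (fun a b => ⟨Q.comp x e i j t a.1 b.1, h.comp_mem x e i j t a.2 b.2⟩)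
    (by intros; ext; simp) (by intros; ext; simp) (by intros; ext; simp) (by intros; ext; simp)

/-- The cohomology `H^*(Q)` of a differential graded operad, with the induced unit, relabelling and
composition, and with zero differential. -/
def cohomology (h : IsDGOperad Q) : DGOperadData.{u, v} k where
  obj n i := cocycles Q n i ⧸ coboundaries Q n i
  relabel f i := Submodule.mapQ _ _
    ((Q.relabel f i).restrict (fun _ ha => h.relabel_mem f i ha)) (by
      rintro ⟨a, ha⟩ ⟨b, hb⟩
      refine ⟨Q.relabel f (i - 1) b, ?_⟩
      rw [h.d_relabel, hb]
      rfl)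
  one := Submodule.Quotient.mk ⟨Q.one, h.one_mem⟩
  comp x e i j t :=
    (Submodule.liftQ _
      (Submodule.liftQ _ ((h.compCocycles x e i j t).compr₂ (Submodule.mkQ (coboundaries Q _ t)))
        (by
          intro a ha
          ext b
          exact (Submodule.Quotient.mk_eq_zero _).2 (h.comp_mem_left x e i j t ha b.2))).flip
      (by
        intro b hb
        ext a
        exact (Submodule.Quotient.mk_eq_zero _).2 (h.comp_mem_right x e i j t a.2 hb))).flip
  d _ _ _ := 0

end IsDGOperad

/-! ### Reduced trees -/

/-- A reduced rooted tree (every vertex has at least two inputs) whose leaves are numbered by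
`Fin n`, `n ≥ 1`. Every edge is recorded as the set of leaves above it, so that the leaves are the
singletons and the root edge is the full set; two edges are nested or disjoint. A reduced tree with
numbered leaves has no automorphisms, and it is determined by these sets. -/
@[ext]
structure RTree (n : ℕ) where
  edges : Finset (Finset (Fin n))
  nonempty : ∀ A ∈ edges, A.Nonempty
  root_mem : univ ∈ edges
  leaf_mem : ∀ c : Fin n, {c} ∈ edges
  laminar : ∀ A ∈ edges, ∀ B ∈ edges, A ⊆ B ∨ B ⊆ A ∨ Disjoint A B

namespace RTree

variable {n m l : ℕ}

/-- A vertex is recorded as its outgoing edge: these are the edges which are not leaves. -/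
abbrev Vert (T : RTree n) : Type := {A : Finset (Fin n) // A ∈ T.edges ∧ 1 < A.card}

/-- The edge `B` is an input of (the vertex with outgoing edge) `A`. -/
def IsInput (T : RTree n) (A B : Finset (Fin n)) : Prop :=
  B ∈ T.edges ∧ B ⊂ A ∧ ∀ C ∈ T.edges, B ⊂ C → ¬ C ⊂ A

/-- The inputs of a vertex. -/
abbrev In (T : RTree n) (A : Finset (Fin n)) : Type := {B : Finset (Fin n) // T.IsInput A B}

/-- The internal edges: pairs consisting of a vertex and another vertex whose outgoing edge is an
input of the first. -/
abbrev InnerEdge (T : RTree n) : Type := {x : T.Vert × T.Vert // T.IsInput x.1.1 x.2.1}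

noncomputable instance (T : RTree n) : Fintype T.InnerEdge := Fintype.ofFinite _

/-- The chosen total order on the vertices of each tree. -/
def Before (A B : Finset (Fin n)) : Prop := toColex B < toColex A

/-! #### Contraction of an internal edge -/

theorem InnerEdge.ne_univ {T : RTree n} (x : T.InnerEdge) : univ ≠ x.1.2.1 :=
  fun h => absurd x.2.2.1 (by rw [← h]; exact fun h' => h'.2 (subset_univ _))

theorem InnerEdge.ne {T : RTree n} (x : T.InnerEdge) : x.1.1.1 ≠ x.1.2.1 :=
  fun h => x.2.2.1.ne h.symm

/-- The tree obtained by contracting an internal edge. -/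
def contract (T : RTree n) (x : T.InnerEdge) : RTree n where
  edges := T.edges.erase x.1.2.1
  nonempty A hA := T.nonempty A (mem_of_mem_erase hA)
  root_mem := mem_erase.2 ⟨x.ne_univ, T.root_mem⟩
  leaf_mem c := mem_erase.2 ⟨fun h => by simpa [← h] using x.1.2.2.2, T.leaf_mem c⟩
  laminar A hA B hB := T.laminar A (mem_of_mem_erase hA) B (mem_of_mem_erase hB)

theorem IsInput.unique {T : RTree n} {A A' B : Finset (Fin n)} (hA : A ∈ T.edges)
    (hA' : A' ∈ T.edges) (h : T.IsInput A B) (h' : T.IsInput A' B) : A = A' := by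
  rcases T.laminar A hA A' hA' with h1 | h1 | h1
  · by_contra hne
    exact h'.2.2 A hA h.2.1 (h1.ssubset_of_ne hne)
  · by_contra hne
    exact h.2.2 A' hA' h'.2.1 (h1.ssubset_of_ne (Ne.symm hne))
  · obtain ⟨c, hc⟩ := T.nonempty B h.1
    exact absurd (h'.2.1.1 hc) (disjoint_left.1 h1 (h.2.1.1 hc))

/-- The inputs of the vertex created by the contraction. -/
theorem isInput_contract_self (T : RTree n) (x : T.InnerEdge) (D : Finset (Fin n)) :
    (T.contract x).IsInput x.1.1.1 D ↔
      (T.IsInput x.1.1.1 D ∧ D ≠ x.1.2.1) ∨ T.IsInput x.1.2.1 D := by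
  obtain ⟨⟨⟨A, hA⟩, ⟨B, hB⟩⟩, hx⟩ := x
  change T.IsInput A B at hx
  change (D ∈ T.edges.erase B ∧ D ⊂ A ∧ ∀ C ∈ T.edges.erase B, D ⊂ C → ¬ C ⊂ A) ↔
    (T.IsInput A D ∧ D ≠ B) ∨ T.IsInput B D
  constructor
  · rintro ⟨h1, h2, h3⟩
    rw [mem_erase] at h1
    by_cases hDB : D ⊂ B
    · refine Or.inr ⟨h1.2, hDB, fun C hC hDC hCB => ?_⟩
      exact h3 C (mem_erase.2 ⟨hCB.ne, hC⟩) hDC (hCB.trans hx.2.1)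
    · refine Or.inl ⟨⟨h1.2, h2, fun C hC hDC => h3 C (mem_erase.2 ⟨?_, hC⟩) hDC⟩, h1.1⟩
      rintro rfl
      exact hDB hDC
  · rintro (⟨⟨h1, h2, h3⟩, h4⟩ | ⟨h1, h2, h3⟩)
    · exact ⟨mem_erase.2 ⟨h4, h1⟩, h2, fun C hC => h3 C (mem_of_mem_erase hC)⟩
    · refine ⟨mem_erase.2 ⟨h2.ne, h1⟩, h2.trans hx.2.1, fun C hC hDC hCA => ?_⟩
      rw [mem_erase] at hC
      rcases T.laminar C hC.2 B hB.1 with h | h | h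
      · exact h3 C hC.2 hDC (h.ssubset_of_ne hC.1)
      · exact hx.2.2 C hC.2 (h.ssubset_of_ne (Ne.symm hC.1)) hCA
      · obtain ⟨c, hc⟩ := T.nonempty D h1
        exact absurd (h2.1 hc) (disjoint_left.1 h (hDC.1 hc))

/-- The inputs of the other vertices do not change under the contraction. -/
theorem isInput_contract_of_ne (T : RTree n) (x : T.InnerEdge) {C : Finset (Fin n)}
    (hC : C ∈ T.edges) (hne : C ≠ x.1.1.1) (D : Finset (Fin n)) :
    (T.contract x).IsInput C D ↔ T.IsInput C D := by
  obtain ⟨⟨⟨A, hA⟩, ⟨B, hB⟩⟩, hx⟩ := x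
  change T.IsInput A B at hx
  change C ≠ A at hne
  change (D ∈ T.edges.erase B ∧ D ⊂ C ∧ ∀ E ∈ T.edges.erase B, D ⊂ E → ¬ E ⊂ C) ↔ T.IsInput C D
  constructor
  · rintro ⟨h1, h2, h3⟩
    refine ⟨mem_of_mem_erase h1, h2, fun E hE hDE hEC => ?_⟩
    by_cases hEB : E = B
    · subst hEB
      have hAB : A ≠ E := hx.2.1.ne'
      rcases T.laminar A hA.1 C hC with h | h | h
      · exact h3 A (mem_erase.2 ⟨hAB, hA.1⟩) (hDE.trans hx.2.1) (h.ssubset_of_ne hne.symm)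
      · exact hx.2.2 C hC hEC (h.ssubset_of_ne hne)
      · obtain ⟨c, hc⟩ := T.nonempty E hB.1
        exact absurd (hEC.1 hc) (disjoint_left.1 h (hx.2.1.1 hc))
    · exact h3 E (mem_erase.2 ⟨hEB, hE⟩) hDE hEC
  · intro h
    refine ⟨mem_erase.2 ⟨?_, h.1⟩, h.2.1, fun E hE => h.2.2 E (mem_of_mem_erase hE)⟩
    rintro rfl
    exact hne (IsInput.unique hC hA.1 h hx)

/-- The inputs of the vertex `A` created by contracting the edge between `A` and `B` are the other
inputs of `A` and the inputs of `B`. -/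
noncomputable def contractEquiv (T : RTree n) (x : T.InnerEdge) {C : Finset (Fin n)}
    (hC : C = x.1.1.1) :
    {D : T.In x.1.1.1 // D ≠ ⟨x.1.2.1, x.2⟩} ⊕ T.In x.1.2.1 ≃ (T.contract x).In C :=
  Equiv.ofBijective
    (Sum.elim
      (fun D => ⟨D.1.1, by
        subst hC
        exact (T.isInput_contract_self x D.1.1).2
          (Or.inl ⟨D.1.2, fun h => D.2 (Subtype.ext h)⟩)⟩)
      (fun D => ⟨D.1, by
        subst hC
        exact (T.isInput_contract_self x D.1).2 (Or.inr D.2)⟩))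
    (by
      subst hC
      constructor
      · have key : ∀ (D : T.In x.1.1.1) (D' : T.In x.1.2.1), D.1 ≠ D'.1 := fun D D' h =>
          D.2.2.2 _ x.1.2.2.1 (h ▸ D'.2.2.1) x.2.2.1
        rintro (D | D) (D' | D') h
        · have h' : D.1.1 = D'.1.1 :=
            congrArg (fun z : (T.contract x).In x.1.1.1 => z.1) h
          exact congrArg _ (Subtype.ext (Subtype.ext h'))
        · exact absurd (congrArg Subtype.val h) (key D.1 D')
        · exact absurd (congrArg Subtype.val h).symm (key D'.1 D)
        · have h' : D.1 = D'.1 :=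
            congrArg (fun z : (T.contract x).In x.1.1.1 => z.1) h
          exact congrArg _ (Subtype.ext h')
      · rintro ⟨D, hD⟩
        rcases (T.isInput_contract_self x D).1 hD with h | h
        · exact ⟨Sum.inl ⟨⟨D, h.1⟩, fun h' => h.2 (congrArg Subtype.val h')⟩, rfl⟩
        · exact ⟨Sum.inr ⟨D, h⟩, rfl⟩)

/-- The inputs of a vertex that is not affected by the contraction. -/
def contractEquivOfNe (T : RTree n) (x : T.InnerEdge) (C : (T.contract x).Vert)
    (hne : C.1 ≠ x.1.1.1) : T.In C.1 ≃ (T.contract x).In C.1 :=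
  Equiv.subtypeEquivRight fun D =>
    (T.isInput_contract_of_ne x (mem_of_mem_erase C.2.1) hne D).symm

/-- A vertex of the contracted tree, as a vertex of the original tree. The vertex created by
the contraction of the edge between `A` and `B` is sent to the lower vertex `A`. -/
def contractVert (T : RTree n) (x : T.InnerEdge) (C : (T.contract x).Vert) : T.Vert :=
  ⟨C.1, mem_of_mem_erase C.2.1, C.2.2⟩

/-! #### Restriction of a tree along a substitution of sets -/

/-- The tree whose edges are the sets with image under `φ` an edge of `T`. -/
def pull (T : RTree l) (φ : Finset (Fin n) → Finset (Fin l))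
    (hsub : ∀ A B, φ A ⊆ φ B ↔ A ⊆ B) (hdis : ∀ A B, Disjoint (φ A) (φ B) → Disjoint A B)
    (hne : ∀ A, (φ A).Nonempty → A.Nonempty) (hroot : φ univ ∈ T.edges)
    (hleaf : ∀ c, φ {c} ∈ T.edges) : RTree n where
  edges := univ.filter fun A => φ A ∈ T.edges
  nonempty A hA := hne A (T.nonempty _ (mem_filter.1 hA).2)
  root_mem := mem_filter.2 ⟨mem_univ _, hroot⟩
  leaf_mem c := mem_filter.2 ⟨mem_univ _, hleaf c⟩
  laminar A hA B hB := by
    rcases T.laminar _ (mem_filter.1 hA).2 _ (mem_filter.1 hB).2 with h | h | h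
    · exact Or.inl ((hsub _ _).1 h)
    · exact Or.inr (Or.inl ((hsub _ _).1 h))
    · exact Or.inr (Or.inr (hdis _ _ h))

/-- If every edge of `T` inside `φ A` is in the range of `φ`, up to edges that
lie in some `φ E` and contain no `φ B`, then the inputs of `A` and of `φ A` correspond. -/
theorem isInput_iff_of_sub {T : RTree l} {S : RTree n} {φ : Finset (Fin n) → Finset (Fin l)}
    (hsub : ∀ A B, φ A ⊆ φ B ↔ A ⊆ B) (hS : ∀ A, A ∈ S.edges ↔ φ A ∈ T.edges)
    {A : Finset (Fin n)}
    (hA : ∀ C ∈ T.edges, C ⊂ φ A → (∃ B, φ B = C) ∨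
      ∃ E ∈ S.edges, C ⊂ φ E ∧ φ E ⊂ φ A ∧ ∀ B ∈ S.edges, ¬ φ B ⊂ C)
    (B : Finset (Fin n)) : S.IsInput A B ↔ T.IsInput (φ A) (φ B) := by
  have hss : ∀ A B, φ A ⊂ φ B ↔ A ⊂ B := fun A B => by
    simp only [ssubset_iff_subset_not_subset, hsub]
  constructor
  · rintro ⟨h1, h2, h3⟩
    refine ⟨(hS _).1 h1, (hss _ _).2 h2, fun C hC hBC hCA => ?_⟩
    rcases hA C hC hCA with ⟨B', rfl⟩ | ⟨E, _, _, _, hE⟩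
    · exact h3 B' ((hS _).2 hC) ((hss _ _).1 hBC) ((hss _ _).1 hCA)
    · exact hE B h1 hBC
  · rintro ⟨h1, h2, h3⟩
    exact ⟨(hS _).2 h1, (hss _ _).1 h2, fun C hC hBC hCA =>
      h3 (φ C) ((hS _).1 hC) ((hss _ _).2 hBC) ((hss _ _).2 hCA)⟩

/-- The correspondence of the inputs of `A` and of `φ A`. -/
noncomputable def inEquivOfSub {T : RTree l} {S : RTree n} {φ : Finset (Fin n) → Finset (Fin l)}
    (hsub : ∀ A B, φ A ⊆ φ B ↔ A ⊆ B) (hS : ∀ A, A ∈ S.edges ↔ φ A ∈ T.edges)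
    {A : Finset (Fin n)}
    (hA : ∀ C ∈ T.edges, C ⊂ φ A → (∃ B, φ B = C) ∨
      ∃ E ∈ S.edges, C ⊂ φ E ∧ φ E ⊂ φ A ∧ ∀ B ∈ S.edges, ¬ φ B ⊂ C) :
    S.In A ≃ T.In (φ A) :=
  Equiv.ofBijective (fun B => ⟨φ B.1, (isInput_iff_of_sub hsub hS hA B.1).1 B.2⟩)
    ⟨fun B B' h => by
      have h' : φ B.1 = φ B'.1 := congrArg Subtype.val h
      exact Subtype.ext (((hsub _ _).1 h'.subset).antisymm ((hsub _ _).1 h'.symm.subset)),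
    fun ⟨C, hC⟩ => by
      rcases hA C hC.1 hC.2.1 with ⟨B, rfl⟩ | ⟨E, hE, h1, h2, _⟩
      · exact ⟨⟨B, (isInput_iff_of_sub hsub hS hA B).2 hC⟩, rfl⟩
      · exact absurd h2 (hC.2.2 (φ E) ((hS E).1 hE) h1)⟩

/-! #### Relabelling -/

/-- The tree with leaves numbered by `Fin n` that becomes `T` when the leaves are renumbered
through `f`. -/
def unlabel (f : Fin n ≃ Fin l) (T : RTree l) : RTree n :=
  T.pull (fun A => A.map f.toEmbedding) (fun _ _ => map_subset_map)
    (fun _ _ h => (disjoint_map _).1 h) (fun _ h => map_nonempty.1 h)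
    (by simpa using T.root_mem) (fun c => by simpa using T.leaf_mem (f c))

theorem mem_unlabel (f : Fin n ≃ Fin l) (T : RTree l) (A : Finset (Fin n)) :
    A ∈ (T.unlabel f).edges ↔ A.map f.toEmbedding ∈ T.edges := by
  simp [unlabel, pull]

theorem map_symm_map (f : Fin n ≃ Fin l) (C : Finset (Fin l)) :
    (C.map f.symm.toEmbedding).map f.toEmbedding = C := by
  ext c; simp

noncomputable def unlabelIn (f : Fin n ≃ Fin l) (T : RTree l) (A : Finset (Fin n)) :
    (T.unlabel f).In A ≃ T.In (A.map f.toEmbedding) :=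
  inEquivOfSub (φ := fun A => A.map f.toEmbedding) (fun _ _ => map_subset_map)
    (T.mem_unlabel f) (fun C _ _ => Or.inl ⟨C.map f.symm.toEmbedding, map_symm_map f C⟩)

noncomputable def unlabelVert (f : Fin n ≃ Fin l) (T : RTree l) : (T.unlabel f).Vert ≃ T.Vert :=
  Equiv.ofBijective
    (fun A => ⟨A.1.map f.toEmbedding, (T.mem_unlabel f A.1).1 A.2.1, by simpa using A.2.2⟩)
    ⟨fun A B h => Subtype.ext (map_injective _ (congrArg Subtype.val h)),
    fun ⟨C, hC⟩ => ⟨⟨C.map f.symm.toEmbedding,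
      (T.mem_unlabel f _).2 (by rw [map_symm_map]; exact hC.1), by simpa using hC.2⟩,
      Subtype.ext (map_symm_map f C)⟩⟩

/-! #### Grafting -/

section Graft

variable (x : Fin n) (e : {c : Fin n // c ≠ x} ⊕ Fin m ≃ Fin l)

/-- The map `Fin l → Fin n` which collapses the grafted inputs to `x`. -/
def collapse (z : Fin l) : Fin n := Sum.elim (fun c => c.1) (fun _ => x) (e.symm z)

/-- The edge of the grafted tree that comes from the edge `A` of the lower tree. -/
def outer (A : Finset (Fin n)) : Finset (Fin l) := univ.filter fun z => collapse x e z ∈ A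

/-- The edge of the grafted tree that comes from the edge `B` of the upper tree. -/
def inner (B : Finset (Fin m)) : Finset (Fin l) :=
  B.map ⟨fun c => e (Sum.inr c), fun _ _ h => Sum.inr_injective (e.injective h)⟩

variable {x e}

theorem mem_outer {A : Finset (Fin n)} {z : Fin l} : z ∈ outer x e A ↔ collapse x e z ∈ A := by
  simp [outer]

@[simp] theorem collapse_inl (c : {c : Fin n // c ≠ x}) : collapse x e (e (Sum.inl c)) = c.1 := by
  simp [collapse]

@[simp] theorem collapse_inr (c : Fin m) : collapse x e (e (Sum.inr c)) = x := by
  simp [collapse]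

theorem mem_inner {B : Finset (Fin m)} {z : Fin l} :
    z ∈ inner x e B ↔ ∃ c ∈ B, e (Sum.inr c) = z := by
  rw [inner, mem_map]
  rfl

theorem mem_outer_self {z : Fin l} : z ∈ outer x e {x} ↔ ∃ c : Fin m, e (Sum.inr c) = z := by
  rw [mem_outer, mem_singleton]
  constructor
  · intro h
    obtain ⟨s, rfl⟩ := e.surjective z
    rcases s with c | c
    · exact absurd ((collapse_inl c).symm.trans h) c.2
    · exact ⟨c, rfl⟩
  · rintro ⟨c, rfl⟩
    simp

theorem inner_univ : inner x e univ = outer x e {x} := by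
  ext z
  simp [mem_inner, mem_outer_self]

variable {T : RTree l}

theorem collapse_surjective (h : outer x e {x} ∈ T.edges) :
    Function.Surjective (collapse x e) := by
  intro c
  by_cases hc : c = x
  · obtain ⟨z, hz⟩ := T.nonempty _ h
    exact ⟨z, by rw [hc]; simpa [mem_outer] using hz⟩
  · exact ⟨e (Sum.inl ⟨c, hc⟩), by simp⟩

theorem outer_subset (h : outer x e {x} ∈ T.edges) (A B : Finset (Fin n)) :
    outer x e A ⊆ outer x e B ↔ A ⊆ B := by
  constructor
  · intro hs c hc
    obtain ⟨z, rfl⟩ := collapse_surjective h c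
    exact mem_outer.1 (hs (mem_outer.2 hc))
  · exact fun hs z hz => mem_outer.2 (hs (mem_outer.1 hz))

theorem outer_singleton {c : Fin n} (hc : c ≠ x) :
    outer x e {c} = {e (Sum.inl ⟨c, hc⟩)} := by
  ext z
  obtain ⟨s, rfl⟩ := e.surjective z
  rcases s with c' | c'
  · simp [mem_outer, Subtype.ext_iff]
  · simp [mem_outer, hc.symm]

/-- If `T` has the edge along which one grafts, this is the lower one of the two trees that `T`
is the grafting of. -/
def outerTree (h : outer x e {x} ∈ T.edges) : RTree n :=
  T.pull (outer x e) (outer_subset h)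
    (fun A B hd => disjoint_left.2 fun c hA hB => by
      obtain ⟨z, rfl⟩ := collapse_surjective h c
      exact disjoint_left.1 hd (mem_outer.2 hA) (mem_outer.2 hB))
    (fun A ⟨z, hz⟩ => ⟨_, mem_outer.1 hz⟩)
    (by simpa [outer] using T.root_mem)
    (fun c => by
      by_cases hc : c = x
      · rw [hc]; exact h
      · rw [outer_singleton hc]; exact T.leaf_mem _)

/-- The upper one of the two trees that `T` is the grafting of. -/
def innerTree (h : outer x e {x} ∈ T.edges) : RTree m :=
  T.pull (inner x e) (fun _ _ => map_subset_map) (fun _ _ hd => (disjoint_map _).1 hd)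
    (fun _ hn => map_nonempty.1 hn) (by rw [inner_univ]; exact h)
    (fun c => by simpa [inner] using T.leaf_mem _)

theorem mem_outerTree (h : outer x e {x} ∈ T.edges) (A : Finset (Fin n)) :
    A ∈ (outerTree h).edges ↔ outer x e A ∈ T.edges := by
  simp [outerTree, pull]

theorem mem_innerTree (h : outer x e {x} ∈ T.edges) (B : Finset (Fin m)) :
    B ∈ (innerTree h).edges ↔ inner x e B ∈ T.edges := by
  simp [innerTree, pull]

/-- An edge inside the grafting edge comes from the upper tree. -/
theorem exists_inner {C : Finset (Fin l)} (hC : C ⊆ outer x e {x}) : ∃ B, inner x e B = C := by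
  refine ⟨univ.filter fun c => e (Sum.inr c) ∈ C, ?_⟩
  ext z
  simp only [mem_inner, mem_filter, mem_univ, true_and]
  constructor
  · rintro ⟨c, hc, rfl⟩
    exact hc
  · intro hz
    obtain ⟨c, rfl⟩ := mem_outer_self.1 (hC hz)
    exact ⟨c, hz, rfl⟩

/-- An edge containing the grafting edge or disjoint from it comes from the lower tree. -/
theorem exists_outer {C : Finset (Fin l)}
    (hC : outer x e {x} ⊆ C ∨ Disjoint C (outer x e {x})) : ∃ A, outer x e A = C := by
  refine ⟨C.image (collapse x e), ?_⟩
  ext z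
  rw [mem_outer, mem_image]
  constructor
  · rintro ⟨z', hz', heq⟩
    obtain ⟨s, rfl⟩ := e.surjective z
    obtain ⟨s', rfl⟩ := e.surjective z'
    rcases s with c | c <;> rcases s' with c' | c'
    · rw [collapse_inl, collapse_inl] at heq
      rwa [← Subtype.ext heq]
    · rw [collapse_inl, collapse_inr] at heq
      exact absurd heq.symm c.2
    · rw [collapse_inl, collapse_inr] at heq
      exact absurd heq c'.2
    · rcases hC with hC | hC
      · exact hC (mem_outer_self.2 ⟨c, rfl⟩)
      · exact absurd (mem_outer_self.2 ⟨c', rfl⟩) (disjoint_left.1 hC hz')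
  · exact fun hz => ⟨z, hz, rfl⟩

theorem card_le_card_outer (h : outer x e {x} ∈ T.edges) (A : Finset (Fin n)) :
    A.card ≤ (outer x e A).card := by
  have hA : A ⊆ (outer x e A).image (collapse x e) := by
    intro c hc
    obtain ⟨z, rfl⟩ := collapse_surjective h c
    exact mem_image_of_mem _ (mem_outer.2 hc)
  exact (card_le_card hA).trans card_image_le

noncomputable def outerIn (h : outer x e {x} ∈ T.edges) (A : (outerTree h).Vert) :
    (outerTree h).In A.1 ≃ T.In (outer x e A.1) :=
  inEquivOfSub (outer_subset h) (mem_outerTree h) (by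
    intro C hC hCA
    rcases T.laminar C hC _ h with h1 | h1 | h1
    · by_cases heq : C = outer x e {x}
      · exact Or.inl ⟨_, heq.symm⟩
      have hCx := h1.ssubset_of_ne heq
      refine Or.inr ⟨{x}, (mem_outerTree h _).2 h, hCx, ?_, ?_⟩
      · obtain ⟨z, hz⟩ := T.nonempty C hC
        have h2 := mem_outer.1 (h1 hz)
        rw [mem_singleton] at h2
        have hxA := mem_outer.1 (hCA.1 hz)
        rw [h2] at hxA
        refine ((outer_subset h _ _).2 (singleton_subset_iff.2 hxA)).ssubset_of_ne fun h3 => ?_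
        have h4 : A.1 ⊆ {x} := (outer_subset h _ _).1 h3.symm.subset
        have := A.2.2
        have := card_le_card h4
        simp at this
        omega
      · intro B hB hBC
        have h2 : B ⊆ {x} := (outer_subset h _ _).1 (hBC.1.trans h1)
        rcases subset_singleton_iff.1 h2 with h3 | h3
        · exact absurd ((outerTree h).nonempty B hB) (by simp [h3])
        · subst h3
          exact hBC.2 h1
    · exact Or.inl (exists_outer (Or.inl h1))
    · exact Or.inl (exists_outer (Or.inr h1)))

noncomputable def innerIn (h : outer x e {x} ∈ T.edges) (B : (innerTree h).Vert) :
    (innerTree h).In B.1 ≃ T.In (inner x e B.1) :=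
  inEquivOfSub (fun _ _ => map_subset_map) (mem_innerTree h) (by
    intro C _ hC
    exact Or.inl (exists_inner
      (hC.1.trans (by rw [← inner_univ]; exact map_subset_map.2 (subset_univ _)))))

/-- The vertices of a grafted tree are those of the lower tree and those of the upper tree. -/
noncomputable def graftVert (h : outer x e {x} ∈ T.edges) :
    (outerTree h).Vert ⊕ (innerTree h).Vert ≃ T.Vert :=
  Equiv.ofBijective
    (Sum.elim
      (fun A => ⟨outer x e A.1, (mem_outerTree h _).1 A.2.1,
        A.2.2.trans_le (card_le_card_outer h _)⟩)
      (fun B => ⟨inner x e B.1, (mem_innerTree h _).1 B.2.1, by simpa [inner] using B.2.2⟩))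
    (by
      have hin : ∀ B, inner x e B ⊆ outer x e {x} := fun B => by
        rw [← inner_univ]; exact map_subset_map.2 (subset_univ _)
      have hne : ∀ (A : (outerTree h).Vert) (B : (innerTree h).Vert),
          outer x e A.1 ≠ inner x e B.1 := fun A B hAB => by
        have h1 : A.1 ⊆ {x} := (outer_subset h _ _).1 (hAB.subset.trans (hin B.1))
        have := A.2.2
        have := card_le_card h1
        simp at this
        omega
      constructor
      · rintro (A | A) (B | B) hAB
        · have h1 : outer x e A.1 = outer x e B.1 := congrArg Subtype.val hAB
          exact congrArg _ (Subtype.ext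
            (((outer_subset h _ _).1 h1.subset).antisymm ((outer_subset h _ _).1 h1.symm.subset)))
        · exact absurd (congrArg Subtype.val hAB) (hne A B)
        · exact absurd (congrArg Subtype.val hAB).symm (hne B A)
        · exact congrArg _ (Subtype.ext (map_injective _ (congrArg Subtype.val hAB)))
      · rintro ⟨C, hC, hcard⟩
        by_cases hCx : C ⊆ outer x e {x}
        · obtain ⟨B, rfl⟩ := exists_inner hCx
          exact ⟨Sum.inr ⟨B, (mem_innerTree h _).2 hC, by simpa [inner] using hcard⟩, rfl⟩
        · have h1 : outer x e {x} ⊆ C ∨ Disjoint C (outer x e {x}) := by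
            rcases T.laminar C hC _ h with h1 | h1 | h1
            · exact absurd h1 hCx
            · exact Or.inl h1
            · exact Or.inr h1
          obtain ⟨A, rfl⟩ := exists_outer h1
          refine ⟨Sum.inl ⟨A, (mem_outerTree h _).2 hC, ?_⟩, rfl⟩
          by_contra hA
          have : Nonempty (Fin n) := ⟨x⟩
          rw [not_lt, card_le_one_iff_subset_singleton] at hA
          obtain ⟨c, hc⟩ := hA
          by_cases hcx : c = x
          · exact hCx (hcx ▸ (outer_subset h _ _).2 hc)
          · have h2 := card_le_card ((outer_subset h _ _).2 hc)
            rw [outer_singleton hcx, card_singleton] at h2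
            omega)

end Graft

end RTree

/-! ### The cobar complex -/

section Multilinear

variable {k : Type*} [Field k] {ι ι₁ ι₂ : Type*} {M : ι → Type*} {N : ι₁ → Type*}
  {N' : ι₂ → Type*} [∀ c, AddCommGroup (M c)] [∀ c, Module k (M c)] [∀ a, AddCommGroup (N a)]
  [∀ a, Module k (N a)] [∀ a, AddCommGroup (N' a)] [∀ a, Module k (N' a)]

theorem update_comp_of_injective [DecidableEq ι] [DecidableEq ι₁] {σ : ι₁ → ι}
    (hσ : Function.Injective σ) (L : ∀ a, M (σ a) →ₗ[k] N a) (p : ∀ c, M c) (a₀ : ι₁)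
    (y : M (σ a₀)) : (fun a => L a (Function.update p (σ a₀) y (σ a))) =
      Function.update (fun a => L a (p (σ a))) a₀ (L a₀ y) := by
  funext a
  by_cases h : a = a₀
  · subst h; simp
  · rw [Function.update_of_ne h, Function.update_of_ne (fun h' => h (hσ h'))]

theorem update_comp_of_notMem [DecidableEq ι] {σ : ι₁ → ι} (L : ∀ a, M (σ a) →ₗ[k] N a)
    (p : ∀ c, M c) (c₀ : ι) (y : M c₀) (hc : ∀ a, σ a ≠ c₀) :
    (fun a => L a (Function.update p c₀ y (σ a))) = fun a => L a (p (σ a)) := by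
  funext a
  rw [Function.update_of_ne (hc a)]

/-- The pull-back of multilinear forms along a bijection of the indices and linear maps. -/
def pullMultilinear (σ : ι₁ ≃ ι) (L : ∀ a, M (σ a) →ₗ[k] N a) :
    MultilinearMap k N k →ₗ[k] MultilinearMap k M k where
  toFun g :=
    { toFun := fun p => g fun a => L a (p (σ a))
      map_update_add' := by
        classical
        intro _ p c y z
        obtain ⟨a, rfl⟩ := σ.surjective c
        rw [update_comp_of_injective σ.injective, update_comp_of_injective σ.injective,
          update_comp_of_injective σ.injective, map_add, g.map_update_add]
      map_update_smul' := by
        classical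
        intro _ p c r y
        obtain ⟨a, rfl⟩ := σ.surjective c
        rw [update_comp_of_injective σ.injective, update_comp_of_injective σ.injective, map_smul,
          g.map_update_smul] }
  map_add' _ _ := rfl
  map_smul' _ _ := rfl

/-- The product of two multilinear forms in disjoint sets of variables, pulled back along
linear maps. -/
def pullProduct (σ : ι₁ ⊕ ι₂ ≃ ι) (L : ∀ a, M (σ (Sum.inl a)) →ₗ[k] N a)
    (L' : ∀ b, M (σ (Sum.inr b)) →ₗ[k] N' b) :
    MultilinearMap k N k →ₗ[k] MultilinearMap k N' k →ₗ[k] MultilinearMap k M k :=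
  LinearMap.mk₂ k (fun g g' =>
    { toFun := fun p =>
        g (fun a => L a (p (σ (Sum.inl a)))) * g' (fun b => L' b (p (σ (Sum.inr b))))
      map_update_add' := by
        classical
        intro _ p c y z
        have h₁ : Function.Injective fun a => σ (Sum.inl a) := σ.injective.comp Sum.inl_injective
        have h₂ : Function.Injective fun b => σ (Sum.inr b) := σ.injective.comp Sum.inr_injective
        obtain ⟨a | b, rfl⟩ := σ.surjective c
        · have h := fun y => update_comp_of_injective h₁ L p a y
          have h' := fun y => update_comp_of_notMem (σ := fun b => σ (Sum.inr b)) L' p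
            (σ (Sum.inl a)) y (fun b => by simp)
          simp only [h, h']
          rw [map_add, g.map_update_add, add_mul]
        · have h := fun y => update_comp_of_injective h₂ L' p b y
          have h' := fun y => update_comp_of_notMem (σ := fun a => σ (Sum.inl a)) L p
            (σ (Sum.inr b)) y (fun a => by simp)
          simp only [h, h']
          rw [map_add, g'.map_update_add, mul_add]
      map_update_smul' := by
        classical
        intro _ p c r y
        have h₁ : Function.Injective fun a => σ (Sum.inl a) := σ.injective.comp Sum.inl_injective
        have h₂ : Function.Injective fun b => σ (Sum.inr b) := σ.injective.comp Sum.inr_injective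
        obtain ⟨a | b, rfl⟩ := σ.surjective c
        · have h := fun y => update_comp_of_injective h₁ L p a y
          have h' := fun y => update_comp_of_notMem (σ := fun b => σ (Sum.inr b)) L' p
            (σ (Sum.inl a)) y (fun b => by simp)
          simp only [h, h']
          rw [map_smul, g.map_update_smul, smul_mul_assoc]
        · have h := fun y => update_comp_of_injective h₂ L' p b y
          have h' := fun y => update_comp_of_notMem (σ := fun a => σ (Sum.inl a)) L p
            (σ (Sum.inr b)) y (fun a => by simp)
          simp only [h, h']
          rw [map_smul, g'.map_update_smul, mul_smul_comm] })
    (fun _ _ _ => by ext; simp [add_mul]) (fun _ _ _ => by ext; simp [mul_assoc])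
    (fun _ _ _ => by ext; simp [mul_add]) (fun _ _ _ => by ext; simp [mul_left_comm])

end Multilinear

open scoped Classical in
/-- The Koszul sign of rearranging homogeneous elements of degrees `deg` from the order `r` to the
order `s`: a factor `(-1)^(deg a * deg b)` for each pair `a`, `b` whose order is reversed. -/
noncomputable def koszulSign {ι : Type*} [Fintype ι] (r s : ι → ι → Prop) (deg : ι → ℤ) : ℤˣ :=
  ∏ x : ι × ι with r x.1 x.2 ∧ s x.2 x.1, (deg x.1 * deg x.2).negOnePow

namespace DGOperadData

variable {k : Type u} [Field k] (Q : DGOperadData.{u, v} k)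

/-- The value on a finite set `X` of the collection `Q`, that is, `Q.obj n i` for `n` the number of
elements of `X`, the inputs being numbered by `X` through the chosen numbering of `X`. -/
abbrev atSet (X : Type) (i : ℤ) : Type v := Q.obj (Nat.card X) i

/-- The identity if `i = j` (and zero otherwise). -/
noncomputable def castDeg (n : ℕ) (i j : ℤ) : Q.obj n i →ₗ[k] Q.obj n j :=
  if h : i = j then h ▸ LinearMap.id else 0

/-- Relabelling along a bijection of finite sets. -/
noncomputable def setRelabel {X Y : Type} [Finite X] [Finite Y] (f : X ≃ Y) (i : ℤ) :
    Q.atSet X i →ₗ[k] Q.atSet Y i :=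
  Q.relabel ((Finite.equivFin X).symm.trans (f.trans (Finite.equivFin Y))) i

/-- Partial composition for inputs numbered by finite sets. -/
noncomputable def setComp {X Y Z : Type} [Finite X] [Finite Y] [Finite Z] (x : X)
    (e : {c : X // c ≠ x} ⊕ Y ≃ Z) (i j t : ℤ) :
    Q.atSet X i →ₗ[k] Q.atSet Y j →ₗ[k] Q.atSet Z t :=
  Q.comp (Finite.equivFin X x)
    ((Equiv.sumCongr ((Finite.equivFin X).subtypeEquiv fun c => by simp).symm
      (Finite.equivFin Y).symm).trans (e.trans (Finite.equivFin Z))) i j t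

/-- The multilinear forms on the decorations of the tree `T` by elements of `Q`, the vertex `A`
being decorated by an element of degree `δ A` whose inputs are the inputs of `A`. If `Q` is
finite-dimensional, this is the tensor product over the vertices `A` of the dual
spaces `(Q (T.In A) (δ A))^*`, i.e. the space of decorations of `T` by elements of these duals. -/
abbrev Form {n : ℕ} (T : RTree n) (δ : T.Vert → ℤ) : Type (max u v) :=
  MultilinearMap k (fun A : T.Vert => Q.atSet (T.In A.1) (δ A)) k

/-- The degree `m` part of the cobar complex in arity `n`: the sum over all trees with `n` leaves of
the decorations of the vertices by elements of the shifted duals `Q^*[-1]`. An element of the dual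
of the degree `δ A` part of `Q` has degree `-δ A` in `Q^*` and degree `1 - δ A` in `Q^*[-1]`. The
tensor product is taken in the order `RTree.Before` of the vertices. -/
abbrev CobObj (n : ℕ) (m : ℤ) : Type (max u v) :=
  ∀ (T : RTree n) (δ : {δ : T.Vert → ℤ // ∑ A, (1 - δ A) = m}), Q.Form T δ.1

/-- The component of an element of the cobar complex at a tree and degrees of its vertices (zero if
the total degree is not `m`). -/
noncomputable def component {n : ℕ} (m : ℤ) (T : RTree n) (δ : T.Vert → ℤ) :
    Q.CobObj n m →ₗ[k] Q.Form T δ :=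
  if h : ∑ A, (1 - δ A) = m then
    LinearMap.proj (R := k) (φ := fun δ : {δ : T.Vert → ℤ // ∑ A, (1 - δ A) = m} => Q.Form T δ.1)
      ⟨δ, h⟩ ∘ₗ LinearMap.proj T
  else 0

section Forms

variable {n m l : ℕ}

/-- Transport of decorations along an isomorphism of trees: `S` becomes `T` after renaming the
leaves, where `σ` and `ρ` are the corresponding bijections of the vertices and of their inputs. -/
noncomputable def renameForm {S : RTree n} {T : RTree l} (σ : S.Vert ≃ T.Vert)
    (ρ : ∀ A, S.In A.1 ≃ T.In (σ A).1) (δ : T.Vert → ℤ) :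
    Q.Form S (fun A => δ (σ A)) →ₗ[k] Q.Form T δ :=
  pullMultilinear σ fun A => Q.setRelabel (ρ A).symm (δ (σ A))

/-- The product of decorations of two trees `S₁`, `S₂`, as decorations of a tree `T` which
is a grafting of the two, where `σ`, `ρ₁`, `ρ₂` are the bijections of the vertices and of
their inputs. -/
noncomputable def graftForm {S₁ : RTree n} {S₂ : RTree m} {T : RTree l}
    (σ : S₁.Vert ⊕ S₂.Vert ≃ T.Vert) (ρ₁ : ∀ A, S₁.In A.1 ≃ T.In (σ (Sum.inl A)).1)
    (ρ₂ : ∀ B, S₂.In B.1 ≃ T.In (σ (Sum.inr B)).1) (δ : T.Vert → ℤ) :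
    Q.Form S₁ (fun A => δ (σ (Sum.inl A))) →ₗ[k] Q.Form S₂ (fun B => δ (σ (Sum.inr B))) →ₗ[k]
      Q.Form T δ :=
  pullProduct σ (fun A => Q.setRelabel (ρ₁ A).symm (δ (σ (Sum.inl A))))
    (fun B => Q.setRelabel (ρ₂ B).symm (δ (σ (Sum.inr B))))

variable (T : RTree n) (δ : T.Vert → ℤ)

/-- The degrees of the decorations after the differential of `Q` is applied at the vertex `A`. -/
def raiseDeg (A : T.Vert) : T.Vert → ℤ := Function.update δ A (δ A + 1)

/-- The dual of applying the differential of `Q` to the decoration of the vertex `A`. -/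
noncomputable def internalForm (A : T.Vert) : Q.Form T (raiseDeg T δ A) →ₗ[k] Q.Form T δ :=
  MultilinearMap.compLinearMapₗ fun C =>
    if C = A then Q.d _ (δ C) (raiseDeg T δ A C) else Q.castDeg _ (δ C) (raiseDeg T δ A C)

/-- The degrees of the decorations after contracting an internal edge. -/
def contractDeg (x : T.InnerEdge) (C : (T.contract x).Vert) : ℤ :=
  if C.1 = x.1.1.1 then δ x.1.1 + δ x.1.2 else δ (T.contractVert x C)

/-- The decorations after contracting an internal edge: the two vertices of the edge are replaced by
one vertex, decorated by the composition in `Q` of the two decorations. -/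
noncomputable def contractDec (x : T.InnerEdge) (p : ∀ A : T.Vert, Q.atSet (T.In A.1) (δ A))
    (C : (T.contract x).Vert) : Q.atSet ((T.contract x).In C.1) (contractDeg T δ x C) :=
  if h : C.1 = x.1.1.1 then
    Q.setComp ⟨x.1.2.1, x.2⟩ (T.contractEquiv x h) (δ x.1.1) (δ x.1.2) _ (p x.1.1) (p x.1.2)
  else
    Q.castDeg _ (δ (T.contractVert x C)) _
      (Q.setRelabel (T.contractEquivOfNe x C h) _ (p (T.contractVert x C)))

theorem contractDec_update (x : T.InnerEdge) (p : ∀ A : T.Vert, Q.atSet (T.In A.1) (δ A))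
    (D : T.Vert) : ∃ (C : (T.contract x).Vert) (L : Q.atSet (T.In D.1) (δ D) →ₗ[k]
      Q.atSet ((T.contract x).In C.1) (contractDeg T δ x C)), ∀ y,
      Q.contractDec T δ x (Function.update p D y) =
        Function.update (Q.contractDec T δ x p) C (L y) := by
  have hAB : x.1.1 ≠ x.1.2 := fun h => x.ne (congrArg Subtype.val h)
  let A' : (T.contract x).Vert := ⟨x.1.1.1, mem_erase.2 ⟨x.ne, x.1.1.2.1⟩, x.1.1.2.2⟩
  have hvB : ∀ C, T.contractVert x C ≠ x.1.2 := fun C h =>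
    (mem_erase.1 C.2.1).1 (congrArg Subtype.val h)
  have hvA : ∀ C : (T.contract x).Vert, C.1 ≠ x.1.1.1 → T.contractVert x C ≠ x.1.1 :=
    fun C hC h => hC (congrArg Subtype.val h)
  by_cases h1 : D = x.1.1
  · subst h1
    refine ⟨A', (Q.setComp ⟨x.1.2.1, x.2⟩ (T.contractEquiv x (C := A'.1) rfl) (δ x.1.1) (δ x.1.2)
      (contractDeg T δ x A')).flip (p x.1.2), fun y => ?_⟩
    funext C
    by_cases hC : C.1 = x.1.1.1
    · obtain rfl : C = A' := Subtype.ext hC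
      simp [contractDec, hC, Function.update_of_ne hAB.symm]
    · rw [Function.update_of_ne (fun h => hC (congrArg Subtype.val h))]
      simp [contractDec, hC, Function.update_of_ne (hvA C hC)]
  by_cases h2 : D = x.1.2
  · subst h2
    refine ⟨A', (Q.setComp ⟨x.1.2.1, x.2⟩ (T.contractEquiv x (C := A'.1) rfl) (δ x.1.1) (δ x.1.2)
      (contractDeg T δ x A')) (p x.1.1), fun y => ?_⟩
    funext C
    by_cases hC : C.1 = x.1.1.1
    · obtain rfl : C = A' := Subtype.ext hC
      simp [contractDec, hC, Function.update_of_ne hAB]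
    · rw [Function.update_of_ne (fun h => hC (congrArg Subtype.val h))]
      simp [contractDec, hC, Function.update_of_ne (hvB C)]
  · let D' : (T.contract x).Vert :=
      ⟨D.1, mem_erase.2 ⟨fun h => h2 (Subtype.ext h), D.2.1⟩, D.2.2⟩
    have hD' : D'.1 ≠ x.1.1.1 := fun h => h1 (Subtype.ext h)
    refine ⟨D', Q.castDeg _ (δ D) (contractDeg T δ x D') ∘ₗ
      Q.setRelabel (T.contractEquivOfNe x D' hD') (δ D), fun y => ?_⟩
    funext C
    by_cases hC : C = D'
    · subst hC
      rw [Function.update_self, contractDec, dif_neg hD']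
      have : Function.update p D y (T.contractVert x D') = y := Function.update_self D y p
      rw [this]
      rfl
    · rw [Function.update_of_ne hC]
      have hCD : T.contractVert x C ≠ D := fun h => by
        subst h
        exact hC rfl
      simp [contractDec, Function.update_of_ne hCD, Function.update_of_ne (Ne.symm h1),
        Function.update_of_ne (Ne.symm h2)]

/-- The dual of the contraction of an internal edge. -/
noncomputable def contractForm (x : T.InnerEdge) :
    Q.Form (T.contract x) (contractDeg T δ x) →ₗ[k] Q.Form T δ where
  toFun g :=
    { toFun := fun p => g (Q.contractDec T δ x p)
      map_update_add' := by
        intro _ p D y z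
        obtain ⟨C, L, h⟩ := Q.contractDec_update T δ x p D
        convert g.map_update_add (Q.contractDec T δ x p) C (L y) (L z) using 2
        · rw [← map_add, ← h]; congr!
        · rw [← h]; congr!
        · rw [← h]; congr!
      map_update_smul' := by
        intro _ p D c y
        obtain ⟨C, L, h⟩ := Q.contractDec_update T δ x p D
        convert g.map_update_smul (Q.contractDec T δ x p) C c (L y) using 2
        · rw [← map_smul, ← h]; congr!
        · rw [← h]; congr! }
  map_add' _ _ := rfl
  map_smul' _ _ := rfl

open scoped Classical in
/-- The total degree of the decorations of the vertices before `A`. -/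
noncomputable def degBefore (A : T.Vert) : ℤ := ∑ C : T.Vert with RTree.Before C.1 A.1, (1 - δ C)

open scoped Classical in
/-- The total degree of the decorations of the vertices between `A` and `B`. -/
noncomputable def degBetween (A B : T.Vert) : ℤ :=
  ∑ C : T.Vert with RTree.Before A.1 C.1 ∧ RTree.Before C.1 B.1, (1 - δ C)

end Forms

/-- The unit of the cobar complex: the tree without vertices. -/
noncomputable def cobOne : Q.CobObj 1 0 := fun T _ =>
  haveI : IsEmpty T.Vert := ⟨fun A => absurd A.2.2 (by
    have := card_le_univ A.1
    simp only [Fintype.card_fin] at this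
    omega)⟩
  MultilinearMap.constOfIsEmpty k _ 1

/-- Renumbering of the leaves in the cobar complex. -/
noncomputable def cobRelabel {n l : ℕ} (f : Fin n ≃ Fin l) (i : ℤ) :
    Q.CobObj n i →ₗ[k] Q.CobObj l i :=
  LinearMap.pi fun T => LinearMap.pi fun δ =>
    koszulSign (fun A B : (T.unlabel f).Vert => RTree.Before A.1 B.1)
        (fun A B => RTree.Before (T.unlabelVert f A).1 (T.unlabelVert f B).1)
        (fun A => 1 - δ.1 (T.unlabelVert f A)) •
      (Q.renameForm (T.unlabelVert f) (fun A => T.unlabelIn f A.1) δ.1 ∘ₗ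
        Q.component i (T.unlabel f) (fun A => δ.1 (T.unlabelVert f A)))

open scoped Classical in
/-- Grafting of decorated trees. The sign is the Koszul sign of rearranging the decorations of the
lower tree followed by those of the upper tree to the order of the vertices of the grafted tree. -/
noncomputable def cobComp {n m l : ℕ} (x : Fin n) (e : {c : Fin n // c ≠ x} ⊕ Fin m ≃ Fin l)
    (i j t : ℤ) : Q.CobObj n i →ₗ[k] Q.CobObj m j →ₗ[k] Q.CobObj l t :=
  LinearMap.mk₂ k (fun α β T δ =>
      if h : RTree.outer x e {x} ∈ T.edges then
        koszulSign
            (fun s s' : (RTree.outerTree h).Vert ⊕ (RTree.innerTree h).Vert =>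
              Sum.Lex (fun A B => RTree.Before A.1 B.1) (fun A B => RTree.Before A.1 B.1) s s')
            (fun s s' => RTree.Before (RTree.graftVert h s).1 (RTree.graftVert h s').1)
            (fun s => 1 - δ.1 (RTree.graftVert h s)) •
          Q.graftForm (RTree.graftVert h) (RTree.outerIn h) (RTree.innerIn h) δ.1
            (Q.component i _ _ α) (Q.component j _ _ β)
      else 0)
    (fun _ _ _ => by funext T δ; by_cases h : RTree.outer x e {x} ∈ T.edges <;> simp [h])
    (fun c _ _ => by
      funext T δ
      by_cases h : RTree.outer x e {x} ∈ T.edges <;> simp [h, smul_comm c])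
    (fun _ _ _ => by funext T δ; by_cases h : RTree.outer x e {x} ∈ T.edges <;> simp [h])
    (fun c _ _ => by
      funext T δ
      by_cases h : RTree.outer x e {x} ∈ T.edges <;> simp [h, smul_comm c])

/-- The differential of the cobar complex, as the sum of two parts, the first of which is induced by
the differential of `Q` and the second of which is dual to the sum of all contractions of one edge.
The signs are those of the derivation given on a decoration `φ ∈ Q^*[-1]` of a tree with one vertex
by `(dφ)(a) = -φ(d a)` and `(dφ)(a, b) = (-1)^(deg a) φ(a ∘_x b)`. -/
noncomputable def cobD (n : ℕ) (i j : ℤ) : Q.CobObj n i →ₗ[k] Q.CobObj n j :=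
  LinearMap.pi fun T => LinearMap.pi fun δ =>
    ∑ A : T.Vert, (1 + degBefore T δ.1 A).negOnePow •
        (Q.internalForm T δ.1 A ∘ₗ Q.component i T (raiseDeg T δ.1 A)) +
      ∑ x : T.InnerEdge,
        (degBefore T δ.1 x.1.1 + δ.1 x.1.1 +
            (1 - δ.1 x.1.2) * degBetween T δ.1 x.1.1 x.1.2).negOnePow •
          (Q.contractForm T δ.1 x ∘ₗ Q.component i (T.contract x) (contractDeg T δ.1 x))

/-- The free graded operad on the shifted duals `Q(n)^*[-1]`, `n ≥ 2`: its elements are combinations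
of trees decorated by elements of the duals, and the composition is the grafting of trees. -/
noncomputable def freeDual : DGOperadData.{u, max u v} k where
  obj := Q.CobObj
  relabel := Q.cobRelabel
  one := Q.cobOne
  comp := Q.cobComp
  d _ _ _ := 0

/-- The cobar complex of a differential graded operad `Q`: the free graded operad on the
shifted duals `Q(n)^*[-1]`, `n ≥ 2`, with the cobar differential. For `Q` in degree zero, the
decorations have degree one, so that their Koszul signs are the orientations of the trees by orders
of the vertices, or, by assigning to each vertex its outgoing edge, by orders of the edges. -/
noncomputable def cob : DGOperadData.{u, max u v} k :=
  { Q.freeDual with d := Q.cobD }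

end DGOperadData

/-! ### Homogeneous elements -/

/-- The sign `1` or `-1` of a parity. -/
def sg (k : Type*) [Ring k] (a : ZMod 2) : k := if a = 0 then 1 else -1

section Sg

variable {k : Type*} [CommRing k]

theorem ZMod.two_cases (a : ZMod 2) : a = 0 ∨ a = 1 := by
  revert a; decide

@[simp] theorem sg_zero : sg k 0 = 1 := by simp [sg]

@[simp] theorem sg_one : sg k 1 = -1 := by simp [sg]

theorem sg_add (a b : ZMod 2) : sg k (a + b) = sg k a * sg k b := by
  have h : (1 : ZMod 2) + 1 = 0 := by decide
  rcases ZMod.two_cases a with rfl | rfl <;> rcases ZMod.two_cases b with rfl | rfl <;> simp [h]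

@[simp] theorem sg_mul_self (a : ZMod 2) : sg k a * sg k a = 1 := by
  rcases ZMod.two_cases a with rfl | rfl <;> simp

theorem sg_mul_sg_mul (a : ZMod 2) (x : k) : sg k a * (sg k a * x) = x := by
  rw [← mul_assoc, sg_mul_self, one_mul]

theorem sg_mul_cancel {a : ZMod 2} {x y : k} (h : sg k a * x = sg k a * y) : x = y := by
  rw [← sg_mul_sg_mul a x, h, sg_mul_sg_mul]

theorem sg_ne_zero {k : Type*} [Field k] (a : ZMod 2) : sg k a ≠ 0 := fun h => by
  simpa [h] using sg_mul_self (k := k) a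

theorem negOnePow_smul {M : Type*} [AddCommGroup M] [Module k M] (n : ℤ) (x : M) :
    n.negOnePow • x = sg k (n : ZMod 2) • x := by
  rcases Int.even_or_odd n with h | h
  · rw [Int.negOnePow_even n h, (ZMod.intCast_eq_zero_iff_even).2 h]; simp
  · rw [Int.negOnePow_odd n h, (ZMod.intCast_eq_one_iff_odd).2 h]; simp

end Sg

namespace DGOperadData

variable {k : Type u} [Field k] (Q : DGOperadData.{u, v} k)

/-- Homogeneous elements of arity `n`: pairs of a degree and an element of this degree. -/
abbrev El (n : ℕ) : Type v := Σ i : ℤ, Q.obj n i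

namespace El

variable {Q}

/-- Relabelling along a bijection of finite sets. -/
noncomputable def rel {X Y : Type} [Finite X] [Finite Y] (f : X ≃ Y) (a : Q.El (Nat.card X)) :
    Q.El (Nat.card Y) := ⟨a.1, Q.setRelabel f a.1 a.2⟩

/-- Partial composition for inputs numbered by finite sets. -/
noncomputable def comp {X Y Z : Type} [Finite X] [Finite Y] [Finite Z] (x : X)
    (e : {c : X // c ≠ x} ⊕ Y ≃ Z) (a : Q.El (Nat.card X)) (b : Q.El (Nat.card Y)) :
    Q.El (Nat.card Z) := ⟨a.1 + b.1, Q.setComp x e a.1 b.1 _ a.2 b.2⟩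

/-- The differential of a homogeneous element. -/
def d {n : ℕ} (a : Q.El n) : Q.El n := ⟨a.1 + 1, Q.d n a.1 _ a.2⟩

/-- Multiplication of a homogeneous element by a scalar. -/
def smul {n : ℕ} (c : k) (a : Q.El n) : Q.El n := ⟨a.1, c • a.2⟩

@[simp] theorem rel_fst {X Y : Type} [Finite X] [Finite Y] (f : X ≃ Y) (a : Q.El (Nat.card X)) :
    (rel f a).1 = a.1 := rfl

@[simp] theorem comp_fst {X Y Z : Type} [Finite X] [Finite Y] [Finite Z] (x : X)
    (e : {c : X // c ≠ x} ⊕ Y ≃ Z) (a : Q.El (Nat.card X)) (b : Q.El (Nat.card Y)) :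
    (comp x e a b).1 = a.1 + b.1 := rfl

@[simp] theorem d_fst {n : ℕ} (a : Q.El n) : (d a).1 = a.1 + 1 := rfl

@[simp] theorem smul_fst {n : ℕ} (c : k) (a : Q.El n) : (smul c a).1 = a.1 := rfl

theorem mk_congr {n : ℕ} {i j : ℤ} (h : i = j) (F : ∀ t : ℤ, Q.obj n t) :
    (⟨i, F i⟩ : Q.El n) = ⟨j, F j⟩ := by rw [h]

theorem mk_castDeg {n : ℕ} {i j : ℤ} (h : i = j) (a : Q.obj n i) :
    (⟨j, Q.castDeg n i j a⟩ : Q.El n) = ⟨i, a⟩ := by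
  subst h; simp [castDeg]

theorem rel_refl (hQ : IsDGOperad Q) {X : Type} [Finite X] (f : X ≃ X) (hf : ∀ x, f x = x)
    (a : Q.El (Nat.card X)) : rel f a = a := by
  obtain rfl : f = Equiv.refl X := Equiv.ext hf
  refine congrArg (Sigma.mk a.1) ?_
  simp only [setRelabel, Equiv.refl_trans, Equiv.symm_trans_self, hQ.relabel_refl]

theorem rel_rel (hQ : IsDGOperad Q) {X Y Z : Type} [Finite X] [Finite Y] [Finite Z] (f : X ≃ Y)
    (g : Y ≃ Z) (a : Q.El (Nat.card X)) : rel g (rel f a) = rel (f.trans g) a := by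
  refine congrArg (Sigma.mk a.1) ?_
  change Q.setRelabel g a.1 (Q.setRelabel f a.1 a.2) = _
  simp only [setRelabel, ← hQ.relabel_trans]
  congr 2
  refine Equiv.ext fun c => ?_
  simp

theorem rel_d (hQ : IsDGOperad Q) {X Y : Type} [Finite X] [Finite Y] (f : X ≃ Y)
    (a : Q.El (Nat.card X)) : rel f (d a) = d (rel f a) :=
  congrArg (Sigma.mk (a.1 + 1)) (hQ.d_relabel _ _ _ _).symm

/-- The bijection of numbers that corresponds to a bijection of the inputs of a composition. -/
noncomputable def num {X Y Z : Type} [Finite X] [Finite Y] [Finite Z] {x : X}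
    (e : {c : X // c ≠ x} ⊕ Y ≃ Z) {z : Fin (Nat.card X)} (hz : Finite.equivFin X x = z) :
    {c : Fin (Nat.card X) // c ≠ z} ⊕ Fin (Nat.card Y) ≃ Fin (Nat.card Z) :=
  (Equiv.sumCongr ((Finite.equivFin X).subtypeEquiv fun c => by simp [← hz]).symm
      (Finite.equivFin Y).symm).trans (e.trans (Finite.equivFin Z))

section Num

variable {X Y Z : Type} [Finite X] [Finite Y] [Finite Z] {x : X}
    (e : {c : X // c ≠ x} ⊕ Y ≃ Z) {z : Fin (Nat.card X)} (hz : Finite.equivFin X x = z)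

@[simp] theorem num_inl (c : X) (h : Finite.equivFin X c ≠ z) :
    num e hz (Sum.inl ⟨Finite.equivFin X c, h⟩) =
      Finite.equivFin Z (e (Sum.inl ⟨c, fun h' => h (by rw [h', hz])⟩)) := by
  simp [num, Equiv.subtypeEquiv]

@[simp] theorem num_inr (c : Y) :
    num e hz (Sum.inr (Finite.equivFin Y c)) = Finite.equivFin Z (e (Sum.inr c)) := by
  simp [num]

theorem setComp_eq (i j t : ℤ) : Q.setComp x e i j t = Q.comp z (num e hz) i j t := by
  subst hz
  rfl

end Num

theorem comp_assoc' (hQ : IsDGOperad Q) {n m r p q l : ℕ} (x : Fin n) (y : Fin m)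
    (e₁ : {c : Fin n // c ≠ x} ⊕ Fin m ≃ Fin p) (z : Fin p) (hz : z = e₁ (Sum.inr y))
    (e₂ : {c : Fin p // c ≠ z} ⊕ Fin r ≃ Fin l)
    (f₁ : {c : Fin m // c ≠ y} ⊕ Fin r ≃ Fin q)
    (f₂ : {c : Fin n // c ≠ x} ⊕ Fin q ≃ Fin l)
    (h1 : ∀ (c : {c : Fin n // c ≠ x}) h, e₂ (Sum.inl ⟨e₁ (Sum.inl c), h⟩) = f₂ (Sum.inl c))
    (h2 : ∀ (c : {c : Fin m // c ≠ y}) h, e₂ (Sum.inl ⟨e₁ (Sum.inr c.1), h⟩) =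
      f₂ (Sum.inr (f₁ (Sum.inl c))))
    (h3 : ∀ c : Fin r, e₂ (Sum.inr c) = f₂ (Sum.inr (f₁ (Sum.inr c))))
    (i j s : ℤ) (a : Q.obj n i) (b : Q.obj m j) (c : Q.obj r s) :
    Q.comp z e₂ (i + j) s (i + j + s) (Q.comp x e₁ i j (i + j) a b) c =
        Q.comp x f₂ i (j + s) (i + j + s) a (Q.comp y f₁ j s (j + s) b c) := by
  subst hz
  exact hQ.comp_assoc x y e₁ e₂ f₁ f₂ (fun c => h1 c _) (fun c => h2 c _) h3 i j s a b c

theorem comp_comm' (hQ : IsDGOperad Q) {n m r p q l : ℕ} (x y : Fin n) (hxy : x ≠ y)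
    (e₁ : {c : Fin n // c ≠ x} ⊕ Fin m ≃ Fin p) (z : Fin p) (hz : z = e₁ (Sum.inl ⟨y, hxy.symm⟩))
    (e₂ : {c : Fin p // c ≠ z} ⊕ Fin r ≃ Fin l)
    (f₁ : {c : Fin n // c ≠ y} ⊕ Fin r ≃ Fin q) (z' : Fin q) (hz' : z' = f₁ (Sum.inl ⟨x, hxy⟩))
    (f₂ : {c : Fin q // c ≠ z'} ⊕ Fin m ≃ Fin l)
    (h1 : ∀ (c : Fin n) (hx : c ≠ x) (hy : c ≠ y) h h',
      e₂ (Sum.inl ⟨e₁ (Sum.inl ⟨c, hx⟩), h⟩) = f₂ (Sum.inl ⟨f₁ (Sum.inl ⟨c, hy⟩), h'⟩))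
    (h2 : ∀ (c : Fin m) h, e₂ (Sum.inl ⟨e₁ (Sum.inr c), h⟩) = f₂ (Sum.inr c))
    (h3 : ∀ (c : Fin r) h, e₂ (Sum.inr c) = f₂ (Sum.inl ⟨f₁ (Sum.inr c), h⟩))
    (i j s : ℤ) (a : Q.obj n i) (b : Q.obj m j) (c : Q.obj r s) :
    Q.comp z e₂ (i + j) s (i + j + s) (Q.comp x e₁ i j (i + j) a b) c =
      (j * s).negOnePow • Q.comp z' f₂ (i + s) j (i + j + s) (Q.comp y f₁ i s (i + s) a c) b := by
  subst hz hz'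
  exact hQ.comp_comm x y hxy e₁ e₂ f₁ f₂ (fun c hx hy => h1 c hx hy _ _) (fun c => h2 c _)
    (fun c => h3 c _) i j s a b c

theorem relabel_comp' (hQ : IsDGOperad Q) {n m l n' m' l' : ℕ} (x : Fin n)
    (e : {c : Fin n // c ≠ x} ⊕ Fin m ≃ Fin l) (f : Fin l ≃ Fin l') (g : Fin n ≃ Fin n')
    (h : Fin m ≃ Fin m') (x' : Fin n') (hx : x' = g x) (e' : {c : Fin n' // c ≠ x'} ⊕ Fin m' ≃ Fin l')
    (h1 : ∀ (c : {c : Fin n // c ≠ x}) h, f (e (Sum.inl c)) = e' (Sum.inl ⟨g c.1, h⟩))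
    (h2 : ∀ c : Fin m, f (e (Sum.inr c)) = e' (Sum.inr (h c)))
    (i j t : ℤ) (a : Q.obj n i) (b : Q.obj m j) :
    Q.relabel f t (Q.comp x e i j t a b) = Q.comp x' e' i j t (Q.relabel g i a) (Q.relabel h j b) := by
  subst hx
  exact hQ.relabel_comp x e f g h e' (fun c => h1 c _) h2 i j t a b

theorem rel_comp (hQ : IsDGOperad Q) {X Y Z X' Y' Z' : Type} [Finite X] [Finite Y] [Finite Z]
    [Finite X'] [Finite Y'] [Finite Z'] (x : X) (e : {c : X // c ≠ x} ⊕ Y ≃ Z) (f : Z ≃ Z')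
    (g : X ≃ X') (h : Y ≃ Y') (x' : X') (hx : x' = g x) (e' : {c : X' // c ≠ x'} ⊕ Y' ≃ Z')
    (h1 : ∀ (c : {c : X // c ≠ x}) h, f (e (Sum.inl c)) = e' (Sum.inl ⟨g c.1, h⟩))
    (h2 : ∀ c : Y, f (e (Sum.inr c)) = e' (Sum.inr (h c)))
    (a : Q.El (Nat.card X)) (b : Q.El (Nat.card Y)) :
    rel f (comp x e a b) = comp x' e' (rel g a) (rel h b) := by
  refine congrArg (Sigma.mk (a.1 + b.1)) ?_
  change Q.setRelabel f _ (Q.setComp x e a.1 b.1 _ a.2 b.2) =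
    Q.setComp x' e' a.1 b.1 _ (Q.setRelabel g a.1 a.2) (Q.setRelabel h b.1 b.2)
  rw [setComp_eq e rfl, setComp_eq e' rfl]
  refine relabel_comp' hQ _ _ _ _ _ _ (by simp [hx]) _ ?_ ?_ _ _ _ _ _
  · rintro ⟨c, hc⟩ h'
    obtain ⟨c, rfl⟩ := (Finite.equivFin X).surjective c
    have hc' : c ≠ x := fun h => hc (by rw [h])
    simpa using h1 ⟨c, hc'⟩ (by rw [hx]; exact fun h => hc' (g.injective h))
  · intro c
    obtain ⟨c, rfl⟩ := (Finite.equivFin Y).surjective c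
    simpa using h2 c

theorem comp_assoc (hQ : IsDGOperad Q) {X Y W Z Z' V : Type} [Finite X] [Finite Y] [Finite Z]
    [Finite W] [Finite Z'] [Finite V] (x : X) (y : Y) (e₁ : {c : X // c ≠ x} ⊕ Y ≃ Z) (z : Z)
    (hz : z = e₁ (Sum.inr y)) (e₂ : {c : Z // c ≠ z} ⊕ W ≃ V) (f₁ : {c : Y // c ≠ y} ⊕ W ≃ Z')
    (f₂ : {c : X // c ≠ x} ⊕ Z' ≃ V)
    (h1 : ∀ (c : {c : X // c ≠ x}) h, e₂ (Sum.inl ⟨e₁ (Sum.inl c), h⟩) = f₂ (Sum.inl c))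
    (h2 : ∀ (c : {c : Y // c ≠ y}) h, e₂ (Sum.inl ⟨e₁ (Sum.inr c.1), h⟩) =
      f₂ (Sum.inr (f₁ (Sum.inl c))))
    (h3 : ∀ c : W, e₂ (Sum.inr c) = f₂ (Sum.inr (f₁ (Sum.inr c))))
    (a : Q.El (Nat.card X)) (b : Q.El (Nat.card Y)) (c : Q.El (Nat.card W)) :
    comp z e₂ (comp x e₁ a b) c = comp x f₂ a (comp y f₁ b c) := by
  have key : Q.setComp z e₂ (a.1 + b.1) c.1 (a.1 + b.1 + c.1)
        (Q.setComp x e₁ a.1 b.1 _ a.2 b.2) c.2 =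
      Q.setComp x f₂ a.1 (b.1 + c.1) (a.1 + b.1 + c.1) a.2 (Q.setComp y f₁ b.1 c.1 _ b.2 c.2) := by
    simp only [setComp_eq _ rfl]
    refine comp_assoc' hQ _ _ _ _ (by simp [hz]) _ _ _ ?_ ?_ ?_ _ _ _ _ _ _
    · rintro ⟨c, hc⟩ h'
      obtain ⟨c, rfl⟩ := (Finite.equivFin X).surjective c
      have := h1 ⟨c, fun h => hc (by rw [h])⟩ (by simp [hz])
      simpa using this
    · rintro ⟨c, hc⟩ h'
      obtain ⟨c, rfl⟩ := (Finite.equivFin Y).surjective c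
      have hc' : c ≠ y := fun h => hc (by rw [h])
      have := h2 ⟨c, hc'⟩ (by simpa [hz] using hc')
      simpa using this
    · intro c
      obtain ⟨c, rfl⟩ := (Finite.equivFin W).surjective c
      simpa using h3 c
  refine (congrArg (Sigma.mk (a.1 + b.1 + c.1)) key).trans ?_
  exact mk_congr (add_assoc _ _ _) fun t => Q.setComp x f₂ a.1 (b.1 + c.1) t a.2
    (Q.setComp y f₁ b.1 c.1 _ b.2 c.2)

theorem comp_comm (hQ : IsDGOperad Q) {X Y W Z Z' V : Type} [Finite X] [Finite Y] [Finite Z]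
    [Finite W] [Finite Z'] [Finite V] (x y : X) (hxy : x ≠ y) (e₁ : {c : X // c ≠ x} ⊕ Y ≃ Z)
    (z : Z) (hz : z = e₁ (Sum.inl ⟨y, hxy.symm⟩)) (e₂ : {c : Z // c ≠ z} ⊕ W ≃ V)
    (f₁ : {c : X // c ≠ y} ⊕ W ≃ Z') (z' : Z') (hz' : z' = f₁ (Sum.inl ⟨x, hxy⟩))
    (f₂ : {c : Z' // c ≠ z'} ⊕ Y ≃ V)
    (h1 : ∀ (c : X) (hx : c ≠ x) (hy : c ≠ y) h h',
      e₂ (Sum.inl ⟨e₁ (Sum.inl ⟨c, hx⟩), h⟩) = f₂ (Sum.inl ⟨f₁ (Sum.inl ⟨c, hy⟩), h'⟩))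
    (h2 : ∀ (c : Y) h, e₂ (Sum.inl ⟨e₁ (Sum.inr c), h⟩) = f₂ (Sum.inr c))
    (h3 : ∀ (c : W) h, e₂ (Sum.inr c) = f₂ (Sum.inl ⟨f₁ (Sum.inr c), h⟩))
    (a : Q.El (Nat.card X)) (b : Q.El (Nat.card Y)) (c : Q.El (Nat.card W)) :
    comp z e₂ (comp x e₁ a b) c =
      smul (sg k ((b.1 : ZMod 2) * c.1)) (comp z' f₂ (comp y f₁ a c) b) := by
  have key : Q.setComp z e₂ (a.1 + b.1) c.1 (a.1 + b.1 + c.1)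
        (Q.setComp x e₁ a.1 b.1 _ a.2 b.2) c.2 =
      sg k ((b.1 : ZMod 2) * c.1) • Q.setComp z' f₂ (a.1 + c.1) b.1 (a.1 + b.1 + c.1)
        (Q.setComp y f₁ a.1 c.1 _ a.2 c.2) b.2 := by
    rw [← Int.cast_mul, ← negOnePow_smul]
    simp only [setComp_eq _ rfl]
    refine comp_comm' hQ _ _ (by simpa using hxy) _ _ (by simp [hz]) _ _ _ (by simp [hz']) _
      ?_ ?_ ?_ _ _ _ _ _ _
    · intro c hx hy h h'
      obtain ⟨c, rfl⟩ := (Finite.equivFin X).surjective c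
      have hx' : c ≠ x := fun h => hx (by rw [h])
      have hy' : c ≠ y := fun h => hy (by rw [h])
      have := h1 c hx' hy' (by simpa [hz] using hy') (by simpa [hz'] using hx')
      simpa using this
    · intro c h
      obtain ⟨c, rfl⟩ := (Finite.equivFin Y).surjective c
      have := h2 c (by simp [hz])
      simpa using this
    · intro c h
      obtain ⟨c, rfl⟩ := (Finite.equivFin W).surjective c
      have := h3 c (by simp [hz'])
      simpa using this
  refine (congrArg (Sigma.mk (a.1 + b.1 + c.1)) key).trans ?_
  exact mk_congr (show a.1 + b.1 + c.1 = a.1 + c.1 + b.1 by ring)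
    fun t => sg k ((b.1 : ZMod 2) * c.1) •
      Q.setComp z' f₂ (a.1 + c.1) b.1 t (Q.setComp y f₁ a.1 c.1 _ a.2 c.2) b.2

end El

end DGOperadData

/-! ### Block maps and restrictions of trees -/

namespace RTree

variable {n m l r : ℕ}

/-- A map of finite sets of leaves which substitutes for the leaf `c` the edge `φ {c}` of `T`, where
these edges are disjoint and make up an edge of `T`. -/
structure IsBlock (T : RTree l) (φ : Finset (Fin n) → Finset (Fin l)) : Prop where
  union : ∀ A, φ A = A.biUnion fun c => φ {c}
  disj : ∀ c c', c ≠ c' → Disjoint (φ {c}) (φ {c'})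
  leaf : ∀ c, φ {c} ∈ T.edges
  root : φ univ ∈ T.edges

namespace IsBlock

variable {T : RTree l} {φ : Finset (Fin n) → Finset (Fin l)} (h : T.IsBlock φ)

include h

theorem mem {A : Finset (Fin n)} {z : Fin l} : z ∈ φ A ↔ ∃ c ∈ A, z ∈ φ {c} := by
  rw [h.union A, mem_biUnion]

theorem eq_of_mem {c c' : Fin n} {z : Fin l} (hz : z ∈ φ {c}) (hz' : z ∈ φ {c'}) : c = c' := by
  by_contra hc
  exact disjoint_left.1 (h.disj c c' hc) hz hz'

theorem sub (A B : Finset (Fin n)) : φ A ⊆ φ B ↔ A ⊆ B := by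
  constructor
  · intro hs c hc
    obtain ⟨z, hz⟩ := T.nonempty _ (h.leaf c)
    obtain ⟨c', hc', hz'⟩ := h.mem.1 (hs (h.mem.2 ⟨c, hc, hz⟩))
    rwa [h.eq_of_mem hz hz']
  · intro hs z hz
    obtain ⟨c, hc, hz⟩ := h.mem.1 hz
    exact h.mem.2 ⟨c, hs hc, hz⟩

theorem ssub (A B : Finset (Fin n)) : φ A ⊂ φ B ↔ A ⊂ B := by
  simp only [ssubset_iff_subset_not_subset, h.sub]

theorem injective : Function.Injective φ := fun A B hAB =>
  ((h.sub A B).1 hAB.subset).antisymm ((h.sub B A).1 hAB.symm.subset)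

theorem dis (A B : Finset (Fin n)) (hd : Disjoint (φ A) (φ B)) : Disjoint A B :=
  disjoint_left.2 fun c hA hB => by
    obtain ⟨z, hz⟩ := T.nonempty _ (h.leaf c)
    exact disjoint_left.1 hd (h.mem.2 ⟨c, hA, hz⟩) (h.mem.2 ⟨c, hB, hz⟩)

theorem nonempty (A : Finset (Fin n)) (hA : (φ A).Nonempty) : A.Nonempty := by
  obtain ⟨z, hz⟩ := hA
  obtain ⟨c, hc, -⟩ := h.mem.1 hz
  exact ⟨c, hc⟩

theorem one_lt_card {A : Finset (Fin n)} (hA : 1 < A.card) : 1 < (φ A).card := by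
  obtain ⟨c, hc, c', hc', hne⟩ := Finset.one_lt_card.1 hA
  obtain ⟨z, hz⟩ := T.nonempty _ (h.leaf c)
  obtain ⟨z', hz'⟩ := T.nonempty _ (h.leaf c')
  exact Finset.one_lt_card.2 ⟨z, h.mem.2 ⟨c, hc, hz⟩, z', h.mem.2 ⟨c', hc', hz'⟩,
    fun hzz => hne (h.eq_of_mem hz (hzz ▸ hz'))⟩

theorem exists_eq_or {C : Finset (Fin l)} (hC : C ∈ T.edges) (hu : C ⊆ φ univ) :
    (∃ B, φ B = C) ∨ ∃ c, C ⊂ φ {c} := by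
  by_cases hex : ∃ c, C ⊂ φ {c}
  · exact Or.inr hex
  refine Or.inl ⟨univ.filter fun c => φ {c} ⊆ C, ?_⟩
  ext z
  rw [h.mem]
  constructor
  · rintro ⟨c, hc, hz⟩
    exact (mem_filter.1 hc).2 hz
  · intro hz
    obtain ⟨c, -, hzc⟩ := h.mem.1 (hu hz)
    refine ⟨c, mem_filter.2 ⟨mem_univ _, ?_⟩, hzc⟩
    rcases T.laminar C hC _ (h.leaf c) with h1 | h1 | h1
    · by_contra h2
      exact hex ⟨c, h1, h2⟩
    · exact h1
    · exact absurd hzc (disjoint_left.1 h1 hz)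

end IsBlock

/-- The restriction of a tree along a block map: its edges are the edges of `T` that are unions of
blocks. -/
def restr (T : RTree l) (φ : Finset (Fin n) → Finset (Fin l)) (h : T.IsBlock φ) : RTree n :=
  T.pull φ h.sub h.dis h.nonempty h.root h.leaf

theorem mem_restr {T : RTree l} {φ : Finset (Fin n) → Finset (Fin l)} (h : T.IsBlock φ)
    {A : Finset (Fin n)} : A ∈ (T.restr φ h).edges ↔ φ A ∈ T.edges := by
  simp [restr, pull]

theorem eq_of_edges {T T' : RTree n} (h : ∀ A, A ∈ T.edges ↔ A ∈ T'.edges) : T = T' :=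
  RTree.ext (Finset.ext h)

namespace IsBlock

variable {T : RTree l} {φ : Finset (Fin n) → Finset (Fin l)} (h : T.IsBlock φ)

theorem fill {A : Finset (Fin n)} (hA : 1 < A.card) (C : Finset (Fin l)) (hC : C ∈ T.edges)
    (hCA : C ⊂ φ A) : (∃ B, φ B = C) ∨ ∃ E ∈ (T.restr φ h).edges, C ⊂ φ E ∧ φ E ⊂ φ A ∧
      ∀ B ∈ (T.restr φ h).edges, ¬ φ B ⊂ C := by
  rcases h.exists_eq_or hC (hCA.1.trans ((h.sub _ _).2 (subset_univ _))) with hB | ⟨c, hc⟩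
  · exact Or.inl hB
  refine Or.inr ⟨{c}, (mem_restr h).2 (h.leaf c), hc, ?_, fun B hB hBC => ?_⟩
  · rw [h.ssub]
    obtain ⟨z, hz⟩ := T.nonempty C hC
    obtain ⟨c', hc', hz'⟩ := h.mem.1 (hCA.1 hz)
    rw [h.eq_of_mem (hc.1 hz) hz']
    refine (singleton_subset_iff.2 hc').ssubset_of_ne fun h' => ?_
    rw [← h', card_singleton] at hA
    exact lt_irrefl _ hA
  · have h1 : B ⊂ {c} := (h.ssub _ _).1 (hBC.trans hc)
    obtain ⟨b, hb⟩ := (T.restr φ h).nonempty B hB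
    rw [ssubset_singleton_iff.1 h1] at hb
    simp at hb

/-- The inputs of a vertex of the restricted tree. -/
noncomputable def inEquiv {A : Finset (Fin n)} (hA : 1 < A.card) :
    (T.restr φ h).In A ≃ T.In (φ A) :=
  inEquivOfSub h.sub (fun _ => mem_restr h) (h.fill hA)

@[simp] theorem inEquiv_val {A : Finset (Fin n)} (hA : 1 < A.card) (B : (T.restr φ h).In A) :
    (h.inEquiv hA B).1 = φ B.1 := rfl

/-- The vertices of the restricted tree as vertices of the tree. -/
abbrev vert (A : (T.restr φ h).Vert) : T.Vert :=
  ⟨φ A.1, (mem_restr h).1 A.2.1, h.one_lt_card A.2.2⟩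

theorem vert_injective : Function.Injective h.vert := fun _ _ hAB =>
  Subtype.ext (h.injective (congrArg Subtype.val hAB))

theorem isInput_iff {A : Finset (Fin n)} (hA : 1 < A.card) (B : Finset (Fin n)) :
    (T.restr φ h).IsInput A B ↔ T.IsInput (φ A) (φ B) :=
  isInput_iff_of_sub h.sub (fun _ => mem_restr h) (h.fill hA) B

theorem comp {ψ : Finset (Fin m) → Finset (Fin n)} (h' : (T.restr φ h).IsBlock ψ) :
    T.IsBlock (fun A => φ (ψ A)) where
  union A := by
    ext z
    simp only [mem_biUnion]
    rw [h.mem]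
    constructor
    · rintro ⟨c, hc, hz⟩
      obtain ⟨b, hb, hc⟩ := h'.mem.1 hc
      exact ⟨b, hb, h.mem.2 ⟨c, hc, hz⟩⟩
    · rintro ⟨b, hb, hz⟩
      obtain ⟨c, hc, hz⟩ := h.mem.1 hz
      exact ⟨c, h'.mem.2 ⟨b, hb, hc⟩, hz⟩
  disj c c' hc := disjoint_left.2 fun z hz hz' => by
    obtain ⟨b, hb, hz⟩ := h.mem.1 hz
    obtain ⟨b', hb', hz'⟩ := h.mem.1 hz'
    rw [h.eq_of_mem hz hz'] at hb
    exact hc (h'.eq_of_mem hb hb')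
  leaf c := (mem_restr h).1 (h'.leaf c)
  root := (mem_restr h).1 h'.root

end IsBlock

theorem isBlock_map (T : RTree l) (f : Fin n ≃ Fin l) :
    T.IsBlock fun A : Finset (Fin n) => A.map f.toEmbedding where
  union A := by
    ext z
    simp only [mem_map, mem_biUnion, mem_singleton, Equiv.coe_toEmbedding]
    constructor
    · rintro ⟨a, ha, rfl⟩
      exact ⟨a, ha, a, rfl, rfl⟩
    · rintro ⟨a, ha, b, rfl, rfl⟩
      exact ⟨b, ha, rfl⟩
  disj c c' hc := by simpa using hc
  leaf c := by simpa using T.leaf_mem _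
  root := by simpa using T.root_mem

section

variable {T : RTree l} {x : Fin n} {e : {c : Fin n // c ≠ x} ⊕ Fin m ≃ Fin l}

theorem isBlock_outer (h : outer x e {x} ∈ T.edges) : T.IsBlock (outer x e) where
  union A := by ext z; simp [mem_outer]
  disj c c' hc := disjoint_left.2 fun z hz hz' => hc (by
    rw [mem_outer, mem_singleton] at hz hz'
    rw [← hz, hz'])
  leaf c := by
    by_cases hc : c = x
    · rw [hc]; exact h
    · rw [outer_singleton hc]; exact T.leaf_mem _
  root := by simpa [outer] using T.root_mem

theorem isBlock_inner (h : outer x e {x} ∈ T.edges) : T.IsBlock (inner x e) where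
  union A := by ext z; simp [mem_inner]
  disj c c' hc := by simpa [inner] using hc
  leaf c := by simpa [inner] using T.leaf_mem _
  root := by rw [inner_univ]; exact h

theorem inner_subset (B : Finset (Fin m)) : inner x e B ⊆ outer x e {x} := by
  rw [← inner_univ]
  exact map_subset_map.2 (subset_univ _)

theorem outer_not_subset (h : outer x e {x} ∈ T.edges) {A : Finset (Fin n)} (hA : 1 < A.card) :
    ¬ outer x e A ⊆ outer x e {x} := fun h1 => by
  have := card_le_card ((outer_subset h _ _).1 h1)
  rw [card_singleton] at this
  omega

end

@[simp] theorem contractEquiv_inl (T : RTree n) (x : T.InnerEdge) {C : Finset (Fin n)}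
    (hC : C = x.1.1.1) (D : {D : T.In x.1.1.1 // D ≠ ⟨x.1.2.1, x.2⟩}) :
    (T.contractEquiv x hC (Sum.inl D)).1 = D.1.1 := rfl

@[simp] theorem contractEquiv_inr (T : RTree n) (x : T.InnerEdge) {C : Finset (Fin n)}
    (hC : C = x.1.1.1) (D : T.In x.1.2.1) :
    (T.contractEquiv x hC (Sum.inr D)).1 = D.1 := rfl

@[simp] theorem contractEquivOfNe_val (T : RTree n) (x : T.InnerEdge) (C : (T.contract x).Vert)
    (hne : C.1 ≠ x.1.1.1) (D : T.In C.1) : (T.contractEquivOfNe x C hne D).1 = D.1 := rfl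

theorem mem_contract {T : RTree n} {x : T.InnerEdge} {A : Finset (Fin n)} :
    A ∈ (T.contract x).edges ↔ A ≠ x.1.2.1 ∧ A ∈ T.edges := mem_erase

end RTree

/-! ### Decorated trees -/

/-- A vertex of a contracted tree as a vertex of the tree. -/
abbrev RTree.InnerEdge.vert {n : ℕ} {T : RTree n} (x : T.InnerEdge) (C : (T.contract x).Vert) :
    T.Vert := ⟨C.1, mem_of_mem_erase C.2.1, C.2.2⟩

/-- The vertex created by a contraction. -/
abbrev RTree.InnerEdge.merged {n : ℕ} {T : RTree n} (x : T.InnerEdge) : (T.contract x).Vert :=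
  ⟨x.1.1.1, mem_erase.2 ⟨x.ne, x.1.1.2.1⟩, x.1.1.2.2⟩

namespace DGOperadData

variable {k : Type u} [Field k] (Q : DGOperadData.{u, v} k)

/-- The decorations of the vertices of a tree by homogeneous elements of `Q`. -/
abbrev Dec {n : ℕ} (T : RTree n) : Type v := ∀ A : T.Vert, Q.El (Nat.card (T.In A.1))

/-- A tree with vertices decorated by homogeneous elements of `Q`. -/
structure DTree (n : ℕ) where
  T : RTree n
  dec : Q.Dec T

namespace Dec

open El RTree

variable {Q} {n m l r : ℕ}

theorem congr {T : RTree n} {p : Q.Dec T} {A B : T.Vert}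
    {Y : Type} [Finite Y] (hAB : A.1 = B.1) (e : T.In A.1 ≃ Y) (e' : T.In B.1 ≃ Y)
    (he : ∀ y, (e.symm y).1 = (e'.symm y).1) : rel e (p A) = rel e' (p B) := by
  obtain rfl := Subtype.ext hAB
  have : e = e' := by
    rw [← e.symm_symm, ← e'.symm_symm]
    congr 1
    exact Equiv.ext fun y => Subtype.ext (he y)
  rw [this]

theorem eq_mk (hQ : IsDGOperad Q) {T T' : RTree n} {p : Q.Dec T} {p' : Q.Dec T'}
    (hT : T.edges = T'.edges)
    (h : ∀ A hA hA' (e : T.In A ≃ T'.In A), (∀ z, (e z).1 = z.1) →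
      (∀ z, (e.symm z).1 = z.1) → rel e (p ⟨A, hA⟩) = p' ⟨A, hA'⟩) :
    (⟨T, p⟩ : Q.DTree n) = ⟨T', p'⟩ := by
  obtain rfl : T = T' := RTree.ext hT
  congr 1
  funext A
  rw [← rel_refl hQ (Equiv.refl _) (fun _ => rfl) (p A)]
  exact h A.1 A.2 A.2 (Equiv.refl _) (fun _ => rfl) (fun _ => rfl)

/-- The restriction of a decoration. -/
noncomputable def restr {T : RTree l} (p : Q.Dec T) (φ : Finset (Fin n) → Finset (Fin l))
    (h : T.IsBlock φ) : Q.Dec (T.restr φ h) :=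
  fun A => rel (h.inEquiv A.2.2).symm (p (h.vert A))

variable {T : RTree l}

theorem restr_restr (hQ : IsDGOperad Q) (p : Q.Dec T) {φ : Finset (Fin n) → Finset (Fin l)}
    (h : T.IsBlock φ) {ψ : Finset (Fin m) → Finset (Fin n)} (h' : (T.restr φ h).IsBlock ψ) :
    (⟨_, (restr p φ h).restr ψ h'⟩ : Q.DTree m) = ⟨_, restr p (fun A => φ (ψ A)) (h.comp h')⟩ := by
  refine eq_mk hQ (Finset.ext fun A => by simp only [mem_restr]) ?_
  intro A hA hA' e he he'
  unfold restr
  rw [rel_rel hQ, rel_rel hQ]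
  refine congr rfl _ _ fun y => ?_
  change φ (ψ (e.symm y).1) = φ (ψ y.1)
  rw [he']

theorem restr_congr (p : Q.Dec T) {φ φ' : Finset (Fin n) → Finset (Fin l)}
    (h : T.IsBlock φ) (h' : T.IsBlock φ') (hφ : ∀ A, φ A = φ' A) :
    (⟨_, restr p φ h⟩ : Q.DTree n) = ⟨_, restr p φ' h'⟩ := by
  obtain rfl : φ = φ' := funext hφ
  rfl

theorem restr_id (hQ : IsDGOperad Q) (p : Q.Dec T) {φ : Finset (Fin l) → Finset (Fin l)}
    (h : T.IsBlock φ) (hφ : ∀ A, φ A = A) : (⟨_, restr p φ h⟩ : Q.DTree l) = ⟨T, p⟩ := by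
  refine eq_mk hQ (Finset.ext fun A => by rw [mem_restr, hφ]) ?_
  intro A hA hA' e he he'
  unfold restr
  rw [rel_rel hQ, ← rel_refl hQ (Equiv.refl _) (fun _ => rfl) (p ⟨A, hA'⟩)]
  refine congr (hφ A) _ _ fun y => ?_
  exact (hφ _).trans (he' y)

/-- Application of the differential to the decoration of a vertex. -/
noncomputable def dAt (p : Q.Dec T) (A : T.Vert) : Q.Dec T := Function.update p A (p A).d

theorem restr_update (p : Q.Dec T) {φ : Finset (Fin n) → Finset (Fin l)} (h : T.IsBlock φ)
    (A : (T.restr φ h).Vert) (v : Q.El (Nat.card (T.In (h.vert A).1))) :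
    restr (Function.update p (h.vert A) v) φ h =
      Function.update (restr p φ h) A (rel (h.inEquiv A.2.2).symm v) := by
  funext C
  by_cases hC : C = A
  · subst hC
    simp [restr]
  · rw [Function.update_of_ne hC, restr, Function.update_of_ne (fun h' => hC (h.vert_injective h'))]
    rfl

theorem restr_update_of_notMem (p : Q.Dec T) {φ : Finset (Fin n) → Finset (Fin l)}
    (h : T.IsBlock φ) (A : T.Vert) (hA : ∀ C, h.vert C ≠ A)
    (v : Q.El (Nat.card (T.In A.1))) : restr (Function.update p A v) φ h = restr p φ h := by
  funext C
  rw [restr, Function.update_of_ne (hA C), restr]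

theorem restr_dAt (hQ : IsDGOperad Q) (p : Q.Dec T) {φ : Finset (Fin n) → Finset (Fin l)}
    (h : T.IsBlock φ) (A : (T.restr φ h).Vert) :
    restr (dAt p (h.vert A)) φ h = dAt (restr p φ h) A := by
  rw [dAt, restr_update, rel_d hQ]
  rfl

/-- Contraction of an inner edge of a decorated tree. -/
noncomputable def contract (p : Q.Dec T) (x : T.InnerEdge) : Q.Dec (T.contract x) := fun C =>
  if h : C.1 = x.1.1.1 then
    El.comp ⟨x.1.2.1, x.2⟩ (T.contractEquiv x h) (p x.1.1) (p x.1.2)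
  else rel (T.contractEquivOfNe x C h) (p (x.vert C))

theorem contract_self (p : Q.Dec T) (x : T.InnerEdge) (C : (T.contract x).Vert)
    (h : C.1 = x.1.1.1) : contract p x C =
      El.comp ⟨x.1.2.1, x.2⟩ (T.contractEquiv x h) (p x.1.1) (p x.1.2) := dif_pos h

theorem contract_of_ne (p : Q.Dec T) (x : T.InnerEdge) (C : (T.contract x).Vert)
    (h : C.1 ≠ x.1.1.1) : contract p x C =
      rel (T.contractEquivOfNe x C h) (p (x.vert C)) := dif_neg h

theorem contract_update_lower (p : Q.Dec T) (x : T.InnerEdge)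
    (v : Q.El (Nat.card (T.In x.1.1.1))) : contract (Function.update p x.1.1 v) x =
      Function.update (contract p x) x.merged
        (El.comp ⟨x.1.2.1, x.2⟩ (T.contractEquiv x rfl) v (p x.1.2)) := by
  funext C
  by_cases hC : C.1 = x.1.1.1
  · obtain rfl : C = x.merged := Subtype.ext hC
    rw [Function.update_self, contract_self _ _ _ hC, Function.update_self,
      Function.update_of_ne (fun h => x.ne (congrArg Subtype.val h).symm)]
  · rw [Function.update_of_ne (fun h => hC (congrArg Subtype.val h)), contract_of_ne _ _ _ hC,
      contract_of_ne _ _ _ hC, Function.update_of_ne (fun h => hC (congrArg Subtype.val h))]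

theorem contract_update_upper (p : Q.Dec T) (x : T.InnerEdge)
    (v : Q.El (Nat.card (T.In x.1.2.1))) : contract (Function.update p x.1.2 v) x =
      Function.update (contract p x) x.merged
        (El.comp ⟨x.1.2.1, x.2⟩ (T.contractEquiv x rfl) (p x.1.1) v) := by
  funext C
  by_cases hC : C.1 = x.1.1.1
  · obtain rfl : C = x.merged := Subtype.ext hC
    rw [Function.update_self, contract_self _ _ _ hC, Function.update_self,
      Function.update_of_ne (fun h => x.ne (congrArg Subtype.val h))]
  · rw [Function.update_of_ne (fun h => hC (congrArg Subtype.val h)), contract_of_ne _ _ _ hC,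
      contract_of_ne _ _ _ hC,
      Function.update_of_ne (fun h => (mem_erase.1 C.2.1).1 (congrArg Subtype.val h))]

theorem contract_update_of_ne (p : Q.Dec T) (x : T.InnerEdge) (C : (T.contract x).Vert)
    (hC : C.1 ≠ x.1.1.1) (v : Q.El (Nat.card (T.In C.1))) :
    contract (Function.update p (x.vert C) v) x =
      Function.update (contract p x) C (rel (T.contractEquivOfNe x C hC) v) := by
  funext E
  by_cases hE : E.1 = x.1.1.1
  · rw [Function.update_of_ne (fun h => hC ((congrArg Subtype.val h).symm.trans hE)), contract_self _ _ _ hE, contract_self _ _ _ hE,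
      Function.update_of_ne (fun h => hC (congrArg Subtype.val h).symm),
      Function.update_of_ne (fun h => (mem_erase.1 C.2.1).1 (congrArg Subtype.val h).symm)]
  · rw [contract_of_ne _ _ _ hE]
    by_cases hEC : E = C
    · subst hEC
      rw [Function.update_self, Function.update_self]
    · have hv : x.vert E ≠ x.vert C := fun h => hEC (Subtype.ext (Subtype.mk.inj h))
      rw [Function.update_of_ne hEC, contract_of_ne _ _ _ hE, Function.update_of_ne hv]

theorem contract_dAt_of_ne (hQ : IsDGOperad Q) (p : Q.Dec T) (x : T.InnerEdge)
    (C : (T.contract x).Vert) (hC : C.1 ≠ x.1.1.1) :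
    contract (dAt p (x.vert C)) x = dAt (contract p x) C := by
  rw [dAt, contract_update_of_ne p x C hC, rel_d hQ, dAt, contract_of_ne _ _ _ hC]

end Dec

end DGOperadData

namespace DGOperadData.El

variable {k : Type u} [Field k] {Q : DGOperadData.{u, v} k}

theorem comp_rel_rel (hQ : IsDGOperad Q) {X Y Z X' Y' : Type} [Finite X] [Finite Y] [Finite Z]
    [Finite X'] [Finite Y'] (x : X) (g : X ≃ X') (h : Y ≃ Y') (x' : X') (hx : x' = g x)
    (e' : {c : X' // c ≠ x'} ⊕ Y' ≃ Z) (a : Q.El (Nat.card X)) (b : Q.El (Nat.card Y)) :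
    comp x' e' (rel g a) (rel h b) =
      comp x ((Equiv.sumCongr (g.subtypeEquiv fun c => by simp [hx]) h).trans e') a b := by
  rw [← rel_refl hQ (Equiv.refl Z) (fun _ => rfl) (comp x _ a b)]
  exact (rel_comp hQ _ _ _ _ _ _ hx _ (fun _ _ => rfl) (fun _ => rfl) _ _).symm

theorem rel_comp_eq (hQ : IsDGOperad Q) {X Y Z Z' : Type} [Finite X] [Finite Y] [Finite Z]
    [Finite Z'] (x : X) (e : {c : X // c ≠ x} ⊕ Y ≃ Z) (f : Z ≃ Z') (a : Q.El (Nat.card X))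
    (b : Q.El (Nat.card Y)) : rel f (comp x e a b) = comp x (e.trans f) a b := by
  rw [rel_comp hQ x e f (Equiv.refl _) (Equiv.refl _) x rfl (e.trans f) (fun _ _ => rfl)
    (fun _ => rfl), rel_refl hQ _ (fun _ => rfl), rel_refl hQ _ (fun _ => rfl)]

theorem comp_assoc_rel (hQ : IsDGOperad Q) {X Y W Z Z' V X' W' V' : Type} [Finite X] [Finite Y]
    [Finite Z] [Finite W] [Finite Z'] [Finite V] [Finite X'] [Finite W'] [Finite V'] (x : X) (y : Y)
    (e₁ : {c : X // c ≠ x} ⊕ Y ≃ Z) (z : Z) (hz : z = e₁ (Sum.inr y))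
    (e₂ : {c : Z // c ≠ z} ⊕ W' ≃ V') (f₁ : {c : Y // c ≠ y} ⊕ W ≃ Z') (x' : X')
    (f₂ : {c : X' // c ≠ x'} ⊕ Z' ≃ V) (e : V' ≃ V) (g : W ≃ W') (g' : X ≃ X') (hx : x' = g' x)
    (h1 : ∀ (c : {c : X // c ≠ x}) h h', e (e₂ (Sum.inl ⟨e₁ (Sum.inl c), h⟩)) =
      f₂ (Sum.inl ⟨g' c.1, h'⟩))
    (h2 : ∀ (c : {c : Y // c ≠ y}) h, e (e₂ (Sum.inl ⟨e₁ (Sum.inr c.1), h⟩)) =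
      f₂ (Sum.inr (f₁ (Sum.inl c))))
    (h3 : ∀ c : W, e (e₂ (Sum.inr (g c))) = f₂ (Sum.inr (f₁ (Sum.inr c))))
    (a : Q.El (Nat.card X)) (b : Q.El (Nat.card Y)) (c : Q.El (Nat.card W)) :
    rel e (comp z e₂ (comp x e₁ a b) (rel g c)) = comp x' f₂ (rel g' a) (comp y f₁ b c) := by
  have hr := comp_rel_rel hQ x g' (Equiv.refl Z') x' hx f₂ a (comp y f₁ b c)
  rw [rel_refl hQ (Equiv.refl Z') (fun _ => rfl)] at hr
  have hl := comp_rel_rel hQ z (Equiv.refl Z) g z rfl e₂ (comp x e₁ a b) c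
  rw [rel_refl hQ (Equiv.refl Z) (fun _ => rfl)] at hl
  rw [hr, hl, rel_comp_eq hQ]
  refine comp_assoc hQ x y e₁ z hz _ f₁ _ ?_ ?_ ?_ a b c
  · intro c h
    exact h1 c h fun h' => c.2 (g'.injective (h'.trans hx))
  · intro c h
    exact h2 c h
  · intro c
    exact h3 c

theorem comp_comm_rel (hQ : IsDGOperad Q) {X Y W Z Z' V Y' W' V' : Type} [Finite X] [Finite Y]
    [Finite Z] [Finite W] [Finite Z'] [Finite V] [Finite Y'] [Finite W'] [Finite V'] (x y : X)
    (hxy : x ≠ y) (e₁ : {c : X // c ≠ x} ⊕ Y ≃ Z) (z : Z) (hz : z = e₁ (Sum.inl ⟨y, hxy.symm⟩))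
    (e₂ : {c : Z // c ≠ z} ⊕ W' ≃ V') (f₁ : {c : X // c ≠ y} ⊕ W ≃ Z') (z' : Z')
    (hz' : z' = f₁ (Sum.inl ⟨x, hxy⟩)) (f₂ : {c : Z' // c ≠ z'} ⊕ Y' ≃ V) (e : V' ≃ V)
    (g : W ≃ W') (g' : Y ≃ Y')
    (h1 : ∀ (c : X) (hx : c ≠ x) (hy : c ≠ y) h h',
      e (e₂ (Sum.inl ⟨e₁ (Sum.inl ⟨c, hx⟩), h⟩)) = f₂ (Sum.inl ⟨f₁ (Sum.inl ⟨c, hy⟩), h'⟩))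
    (h2 : ∀ (c : Y) h, e (e₂ (Sum.inl ⟨e₁ (Sum.inr c), h⟩)) = f₂ (Sum.inr (g' c)))
    (h3 : ∀ (c : W) h, e (e₂ (Sum.inr (g c))) = f₂ (Sum.inl ⟨f₁ (Sum.inr c), h⟩))
    (a : Q.El (Nat.card X)) (b : Q.El (Nat.card Y)) (c : Q.El (Nat.card W)) :
    rel e (comp z e₂ (comp x e₁ a b) (rel g c)) =
      smul (sg k ((b.1 : ZMod 2) * c.1)) (comp z' f₂ (comp y f₁ a c) (rel g' b)) := by
  have hr := comp_rel_rel hQ z' (Equiv.refl Z') g' z' rfl f₂ (comp y f₁ a c) b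
  rw [rel_refl hQ (Equiv.refl Z') (fun _ => rfl)] at hr
  have hl := comp_rel_rel hQ z (Equiv.refl Z) g z rfl e₂ (comp x e₁ a b) c
  rw [rel_refl hQ (Equiv.refl Z) (fun _ => rfl)] at hl
  rw [hr, hl, rel_comp_eq hQ]
  refine comp_comm hQ x y hxy e₁ z hz _ f₁ z' hz' _ ?_ ?_ ?_ a b c
  · intro c hx hy h h'
    exact h1 c hx hy h h'
  · intro c h
    exact h2 c h
  · intro c h
    exact h3 c h

end DGOperadData.El

namespace RTree

variable {n l : ℕ} {T : RTree l}

/-- An inner edge of the restricted tree as an inner edge of the tree. -/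
abbrev IsBlock.edge {φ : Finset (Fin n) → Finset (Fin l)} (h : T.IsBlock φ)
    (x : (T.restr φ h).InnerEdge) : T.InnerEdge :=
  ⟨(h.vert x.1.1, h.vert x.1.2), (h.isInput_iff x.1.1.2.2 _).1 x.2⟩

theorem IsBlock.inEquiv_symm_val {φ : Finset (Fin n) → Finset (Fin l)} (h : T.IsBlock φ)
    {A : Finset (Fin n)} (hA : 1 < A.card) (B : T.In (φ A)) :
    φ ((h.inEquiv hA).symm B).1 = B.1 := by
  rw [← h.inEquiv_val hA, Equiv.apply_symm_apply]

theorem contractEquivOfNe_symm_val (x : T.InnerEdge) (C : (T.contract x).Vert)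
    (hne : C.1 ≠ x.1.1.1) (D : (T.contract x).In C.1) :
    ((T.contractEquivOfNe x C hne).symm D).1 = D.1 := rfl

end RTree

namespace DGOperadData.Dec

open El RTree

variable {k : Type u} [Field k] {Q : DGOperadData.{u, v} k} {n m l : ℕ} {T : RTree l}

theorem restr_contract (hQ : IsDGOperad Q) (p : Q.Dec T) {φ : Finset (Fin n) → Finset (Fin l)}
    (h : T.IsBlock φ) (x : (T.restr φ h).InnerEdge) (h' : (T.contract (h.edge x)).IsBlock φ) :
    (⟨_, (contract p (h.edge x)).restr φ h'⟩ : Q.DTree n) = ⟨_, (restr p φ h).contract x⟩ := by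
  refine eq_mk hQ (Finset.ext fun A => ?_) ?_
  · rw [mem_restr, mem_contract, mem_contract, mem_restr]
    simp [h.injective.eq_iff]
  intro A hA hA' e he he'
  by_cases hAx : A = x.1.1.1
  · subst hAx
    rw [contract_self _ _ _ rfl]
    unfold restr
    rw [contract_self _ _ _ rfl, rel_rel hQ]
    refine rel_comp hQ _ _ _ _ _ _ ?_ _ ?_ ?_ _ _
    · rw [Equiv.eq_symm_apply]
      rfl
    · rintro c h1
      refine Subtype.ext (h.injective ?_)
      simp only [Equiv.trans_apply, he, IsBlock.inEquiv_symm_val]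
      exact (h.inEquiv_symm_val x.1.1.2.2 c.1).symm
    · rintro c
      refine Subtype.ext (h.injective ?_)
      simp only [Equiv.trans_apply, he, IsBlock.inEquiv_symm_val]
      exact (h.inEquiv_symm_val x.1.2.2.2 c).symm
  · rw [contract_of_ne _ _ _ hAx]
    unfold restr
    rw [contract_of_ne _ _ _ (fun h1 => hAx (h.injective h1)), rel_rel hQ, rel_rel hQ, rel_rel hQ]
    refine congr rfl _ _ fun y => ?_
    change φ (e.symm y).1 = φ y.1
    rw [he']

theorem restr_contract_of_notMem (hQ : IsDGOperad Q) (p : Q.Dec T)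
    {φ : Finset (Fin n) → Finset (Fin l)} (h : T.IsBlock φ) (x : T.InnerEdge)
    (h' : (T.contract x).IsBlock φ) (hA : ∀ C, h.vert C ≠ x.1.1) (hB : ∀ C, φ C ≠ x.1.2.1) :
    (⟨_, (contract p x).restr φ h'⟩ : Q.DTree n) = ⟨_, restr p φ h⟩ := by
  refine eq_mk hQ (Finset.ext fun A => ?_) ?_
  · rw [mem_restr, mem_contract, mem_restr]
    simp [hB]
  intro A h1 h1' e he he'
  unfold restr
  rw [contract_of_ne _ _ _ (fun h2 => hA ⟨A, h1'⟩ (Subtype.ext h2)), rel_rel hQ, rel_rel hQ]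
  refine congr rfl _ _ fun y => ?_
  change φ (e.symm y).1 = φ y.1
  rw [he']

theorem contract_contract_far (hQ : IsDGOperad Q) (p : Q.Dec T) (x y : T.InnerEdge)
    (y' : (T.contract x).InnerEdge) (x' : (T.contract y).InnerEdge)
    (hy1 : y'.1.1.1 = y.1.1.1) (hy2 : y'.1.2.1 = y.1.2.1) (hx1 : x'.1.1.1 = x.1.1.1)
    (hx2 : x'.1.2.1 = x.1.2.1) (hA : x.1.1.1 ≠ y.1.1.1) :
    (⟨_, (contract p x).contract y'⟩ : Q.DTree l) = ⟨_, (contract p y).contract x'⟩ := by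
  obtain ⟨⟨⟨A, hA1⟩, ⟨B, hB1⟩⟩, hx⟩ := x
  obtain ⟨⟨⟨A', hA1'⟩, ⟨B', hB1'⟩⟩, hy⟩ := y
  obtain ⟨⟨⟨A₁, hA2⟩, ⟨B₁, hB2⟩⟩, hx'⟩ := x'
  obtain ⟨⟨⟨A₁', hA2'⟩, ⟨B₁', hB2'⟩⟩, hy'⟩ := y'
  dsimp only at hy1 hy2 hx1 hx2 hA
  subst hy1 hy2 hx1 hx2
  refine eq_mk hQ erase_right_comm ?_
  intro C hC hC' e he he'
  by_cases hCA : C = A₁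
  · subst hCA
    rw [contract_of_ne _ _ _ hA, contract_self _ _ _ rfl, contract_self _ _ _ rfl,
      contract_of_ne _ _ _ hA, contract_of_ne (C := ⟨B₁, hB2⟩) _ _ (fun h => (mem_contract.1 hA2'.1).1 h.symm), rel_rel hQ]
    refine rel_comp hQ _ _ _ _ _ _ rfl _ ?_ ?_ _ _
    · rintro c h1
      exact Subtype.ext (he _)
    · rintro c
      exact Subtype.ext (he _)
  by_cases hCA' : C = A₁'
  · subst hCA'
    rw [contract_self _ _ _ rfl, contract_of_ne _ _ _ hA.symm,
      contract_of_ne (C := ⟨B₁', hB2'⟩) _ _ (fun h => (mem_contract.1 hA2.1).1 h.symm), contract_of_ne _ _ _ hA.symm,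
      contract_self (C := ⟨C, _⟩) p ⟨(⟨C, hA1'⟩, ⟨B₁', hB1'⟩), hy⟩ rfl, rel_comp_eq hQ]
    symm
    refine rel_comp hQ _ _ _ _ _ _ rfl _ ?_ ?_ _ _
    · rintro c h1
      exact (Subtype.ext (he _)).symm
    · rintro c
      exact (Subtype.ext (he _)).symm
  · rw [contract_of_ne _ _ _ hCA', contract_of_ne _ _ _ hCA, contract_of_ne _ _ _ hCA,
      contract_of_ne _ _ _ hCA', rel_rel hQ, rel_rel hQ, rel_rel hQ]
    exact congr rfl _ _ fun y => he' y

theorem contract_contract_seq (hQ : IsDGOperad Q) (p : Q.Dec T) (x y : T.InnerEdge)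
    (y' : (T.contract x).InnerEdge) (x' : (T.contract y).InnerEdge)
    (hy1 : y'.1.1.1 = x.1.1.1) (hy2 : y'.1.2.1 = y.1.2.1) (hx1 : x'.1.1.1 = x.1.1.1)
    (hx2 : x'.1.2.1 = x.1.2.1) (hAB : y.1.1.1 = x.1.2.1) :
    (⟨_, (contract p x).contract y'⟩ : Q.DTree l) = ⟨_, (contract p y).contract x'⟩ := by
  have hne := x.ne
  obtain ⟨⟨⟨A, hA1⟩, ⟨B, hB1⟩⟩, hx⟩ := x
  obtain ⟨⟨⟨A', hA1'⟩, ⟨B', hB1'⟩⟩, hy⟩ := y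
  obtain ⟨⟨⟨A₁, hA2⟩, ⟨B₁, hB2⟩⟩, hx'⟩ := x'
  obtain ⟨⟨⟨A₁', hA2'⟩, ⟨B₁', hB2'⟩⟩, hy'⟩ := y'
  dsimp only at hy1 hy2 hx1 hx2 hAB hne
  subst hAB hx1 hx2 hy1 hy2
  refine eq_mk hQ erase_right_comm ?_
  intro C hC hC' e he he'
  by_cases hCA : C = A₁'
  · subst hCA
    rw [contract_self _ _ _ rfl, contract_self p ⟨(⟨C, hA1⟩, ⟨B₁, hB1⟩), hx⟩ ⟨C, hA2'⟩ rfl,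
      contract_self (contract p ⟨(⟨B₁, hA1'⟩, ⟨B₁', hB1'⟩), hy⟩) ⟨(⟨C, hA2⟩, ⟨B₁, hB2⟩), hx'⟩ ⟨C, hC'⟩ rfl,
      contract_self p ⟨(⟨B₁, hA1'⟩, ⟨B₁', hB1'⟩), hy⟩ ⟨B₁, hB2⟩ rfl,
      contract_of_ne p ⟨(⟨B₁, hA1'⟩, ⟨B₁', hB1'⟩), hy⟩ ⟨C, hA2⟩ hne,
      contract_of_ne p ⟨(⟨C, hA1⟩, ⟨B₁, hB1⟩), hx⟩ ⟨B₁', hB2'⟩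
        (fun h => (mem_contract.1 hA2.1).1 h.symm)]
    refine comp_assoc_rel hQ _ _ _ _ ?_ _ _ _ _ _ _ _ ?_ ?_ ?_ ?_ _ _ _
    · rfl
    · rfl
    · rintro c h h'
      exact Subtype.ext (he _)
    · rintro c h
      exact Subtype.ext (he _)
    · rintro c
      exact Subtype.ext (he _)
  · have hCB : C ≠ B₁ := (mem_contract.1 hC'.1).1
    rw [contract_of_ne _ _ _ hCA, contract_of_ne _ _ _ hCA, contract_of_ne _ _ _ hCA,
      contract_of_ne _ _ _ hCB, rel_rel hQ, rel_rel hQ, rel_rel hQ]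
    exact congr rfl _ _ fun y => he' y

theorem contract_contract_par (hQ : IsDGOperad Q) (p : Q.Dec T) (x y : T.InnerEdge)
    (y' : (T.contract x).InnerEdge) (x' : (T.contract y).InnerEdge)
    (hy1 : y'.1.1.1 = y.1.1.1) (hy2 : y'.1.2.1 = y.1.2.1) (hx1 : x'.1.1.1 = x.1.1.1)
    (hx2 : x'.1.2.1 = x.1.2.1) (hA : x.1.1.1 = y.1.1.1) (hB : x.1.2.1 ≠ y.1.2.1) :
    (⟨_, (contract p x).contract y'⟩ : Q.DTree l) = ⟨_, Function.update ((contract p y).contract x')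
      x'.merged (smul (sg k (((p x.1.2).1 : ZMod 2) * (p y.1.2).1))
        ((contract p y).contract x' x'.merged))⟩ := by
  have hne := x.ne
  have hne' := y.ne
  obtain ⟨⟨⟨A, hA1⟩, ⟨B, hB1⟩⟩, hx⟩ := x
  obtain ⟨⟨⟨A', hA1'⟩, ⟨B', hB1'⟩⟩, hy⟩ := y
  obtain ⟨⟨⟨A₁, hA2⟩, ⟨B₁, hB2⟩⟩, hx'⟩ := x'
  obtain ⟨⟨⟨A₁', hA2'⟩, ⟨B₁', hB2'⟩⟩, hy'⟩ := y'
  dsimp only at hy1 hy2 hx1 hx2 hA hne hne' hB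
  subst hA hx1 hx2 hy1 hy2
  refine eq_mk hQ erase_right_comm ?_
  intro C hC hC' e he he'
  by_cases hCA : C = A₁'
  · subst hCA
    rw [Function.update_self, contract_self _ _ ⟨C, hC⟩ rfl,
      contract_self p ⟨(⟨C, hA1⟩, ⟨B₁, hB1⟩), hx⟩ ⟨C, hA2'⟩ rfl,
      contract_self (contract p ⟨(⟨C, hA1'⟩, ⟨B₁', hB1'⟩), hy⟩) ⟨(⟨C, hA2⟩, ⟨B₁, hB2⟩), hx'⟩
        ⟨C, hC'⟩ rfl,
      contract_self p ⟨(⟨C, hA1'⟩, ⟨B₁', hB1'⟩), hy⟩ ⟨C, hA2⟩ rfl,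
      contract_of_ne p ⟨(⟨C, hA1⟩, ⟨B₁, hB1⟩), hx⟩ ⟨B₁', hB2'⟩ hne'.symm,
      contract_of_ne p ⟨(⟨C, hA1'⟩, ⟨B₁', hB1'⟩), hy⟩ ⟨B₁, hB2⟩ hne.symm]
    refine comp_comm_rel hQ _ _ ?_ _ _ ?_ _ _ _ ?_ _ _ _ _ ?_ ?_ ?_ _ _ _
    · exact fun h => hB (congrArg Subtype.val h)
    · rfl
    · rfl
    · rintro c h1 h2 h h'
      exact Subtype.ext (he _)
    · rintro c h
      exact Subtype.ext (he _)
    · rintro c h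
      exact Subtype.ext (he _)
  · rw [Function.update_of_ne (fun h => hCA (congrArg Subtype.val h)), contract_of_ne _ _ _ hCA,
      contract_of_ne _ _ _ hCA, contract_of_ne _ _ _ hCA,
      contract_of_ne _ _ _ hCA, rel_rel hQ, rel_rel hQ, rel_rel hQ]
    exact congr rfl _ _ fun y => he' y

end DGOperadData.Dec

/-! ### Koszul signs -/

section Koszul

variable {α β : Type*}

open scoped Classical in
/-- The indicator of a proposition, modulo `2`. -/
noncomputable def ind (p : Prop) : ZMod 2 := if p then 1 else 0

theorem ind_true {p : Prop} (h : p) : ind p = 1 := if_pos h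

theorem ind_false {p : Prop} (h : ¬ p) : ind p = 0 := if_neg h

/-- The relation `r` is a tournament on `V`; for example, a strict total order. -/
structure TourOn (V : Finset α) (r : α → α → Prop) : Prop where
  asymm : ∀ x ∈ V, ∀ y ∈ V, r x y → ¬ r y x
  total : ∀ x ∈ V, ∀ y ∈ V, x ≠ y → r x y ∨ r y x

theorem TourOn.mono {V W : Finset α} {r : α → α → Prop} (h : TourOn V r) (hW : W ⊆ V) :
    TourOn W r :=
  ⟨fun x hx y hy => h.asymm x (hW hx) y (hW hy), fun x hx y hy => h.total x (hW hx) y (hW hy)⟩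

/-- The total parity of the elements before `a`. -/
noncomputable def bef (V : Finset α) (r : α → α → Prop) (d : α → ZMod 2) (a : α) : ZMod 2 :=
  ∑ c ∈ V, ind (r c a) * d c

/-- The exponent of the Koszul sign of the change from the order `r` to the order `s`. -/
noncomputable def kz (V : Finset α) (r s : α → α → Prop) (d : α → ZMod 2) : ZMod 2 :=
  ∑ x ∈ V, ∑ y ∈ V, ind (r x y ∧ s y x) * (d x * d y)

theorem bef_congr {V : Finset α} {r r' : α → α → Prop} {d d' : α → ZMod 2} {a : α}
    (h : ∀ c ∈ V, (r c a ↔ r' c a)) (hd : ∀ c ∈ V, d c = d' c) : bef V r d a = bef V r' d' a :=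
  sum_congr rfl fun c hc => by rw [h c hc, hd c hc]

theorem kz_congr {V : Finset α} {r r' s s' : α → α → Prop} {d d' : α → ZMod 2}
    (hr : ∀ x ∈ V, ∀ y ∈ V, (r x y ↔ r' x y)) (hs : ∀ x ∈ V, ∀ y ∈ V, (s x y ↔ s' x y))
    (hd : ∀ c ∈ V, d c = d' c) : kz V r s d = kz V r' s' d' :=
  sum_congr rfl fun x hx => sum_congr rfl fun y hy => by
    rw [hr x hx y hy, hs y hy x hx, hd x hx, hd y hy]

theorem ZMod.add_self_two (a : ZMod 2) : a + a = 0 := CharTwo.add_self_eq_zero a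

theorem ind_swap {V : Finset α} {r s : α → α → Prop} (hr : TourOn V r) (hs : TourOn V s) {a c : α}
    (ha : a ∈ V) (hc : c ∈ V) (hac : a ≠ c) :
    ind (r a c ∧ s c a) + ind (r c a ∧ s a c) = ind (r c a) + ind (s c a) := by
  have h1 := hr.asymm a ha c hc
  have h2 := hs.asymm a ha c hc
  have h11 : (1 : ZMod 2) + 1 = 0 := by decide
  rcases hr.total a ha c hc hac with h | h <;> rcases hs.total a ha c hc hac with h' | h'
  · simp [ind, h, h', h1 h, h2 h']
  · have h2' : ¬ s a c := fun h3 => h2 h3 h'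
    simp [ind, h, h', h1 h, h2']
  · have h1' : ¬ r a c := fun h3 => h1 h3 h
    simp [ind, h, h', h1', h2 h']
  · have h1' : ¬ r a c := fun h3 => h1 h3 h
    have h2' : ¬ s a c := fun h3 => h2 h3 h'
    simp [ind, h, h', h1', h2', h11]

theorem kz_insert [DecidableEq α] {V : Finset α} {r s : α → α → Prop} {d : α → ZMod 2} {a : α}
    (ha : a ∉ V) (hr : TourOn (insert a V) r) (hs : TourOn (insert a V) s) :
    kz (insert a V) r s d = kz V r s d + d a * (bef V r d a + bef V s d a) := by
  have ha' := mem_insert_self a V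
  simp only [kz, sum_insert ha, sum_add_distrib]
  rw [ind_false (fun h => hr.asymm a ha' a ha' h.1 h.1)]
  have : ∑ c ∈ V, ind (r a c ∧ s c a) * (d a * d c) + ∑ c ∈ V, ind (r c a ∧ s a c) * (d c * d a) =
      d a * (bef V r d a + bef V s d a) := by
    rw [bef, bef, ← sum_add_distrib, ← sum_add_distrib, mul_sum]
    refine sum_congr rfl fun c hc => ?_
    have := ind_swap hr hs ha' (mem_insert_of_mem hc) (fun h => ha (h ▸ hc))
    linear_combination (d a * d c) * this
  rw [← this]
  ring

theorem kz_erase [DecidableEq α] {V : Finset α} {r s : α → α → Prop} {d : α → ZMod 2} {a : α}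
    (ha : a ∈ V) (hr : TourOn V r) (hs : TourOn V s) :
    kz V r s d = kz (V.erase a) r s d + d a * (bef (V.erase a) r d a + bef (V.erase a) s d a) := by
  have h := insert_erase ha
  rw [← kz_insert (notMem_erase a V) (h.symm ▸ hr) (h.symm ▸ hs), h]

theorem bef_erase [DecidableEq α] {V : Finset α} {r : α → α → Prop} {d : α → ZMod 2} {a b : α}
    (hb : b ∈ V) : bef V r d a = bef (V.erase b) r d a + ind (r b a) * d b :=
  (sum_erase_add _ _ hb).symm

theorem bef_erase_self [DecidableEq α] {V : Finset α} {r : α → α → Prop} {d : α → ZMod 2} {a : α}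
    (ha : a ∈ V) (hr : TourOn V r) : bef V r d a = bef (V.erase a) r d a := by
  rw [bef_erase ha, ind_false (fun h => hr.asymm a ha a ha h h), zero_mul, add_zero]

/-- The Koszul signs form a cocycle. -/
theorem kz_add {V : Finset α} {r s t : α → α → Prop} (hr : TourOn V r) (hs : TourOn V s)
    (ht : TourOn V t) (d : α → ZMod 2) : kz V r s d + kz V s t d = kz V r t d := by
  classical
  induction V using Finset.induction_on with
  | empty => simp [kz]
  | insert a V ha ih =>
    have hV := subset_insert a V
    rw [kz_insert ha hr hs, kz_insert ha hs ht, kz_insert ha hr ht,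
      ← ih (hr.mono hV) (hs.mono hV) (ht.mono hV)]
    linear_combination d a * ZMod.add_self_two (bef V s d a)

theorem kz_self {V : Finset α} {r : α → α → Prop} (hr : TourOn V r) (d : α → ZMod 2) :
    kz V r r d = 0 :=
  sum_eq_zero fun x hx => sum_eq_zero fun y hy => by
    rw [ind_false (fun h => hr.asymm x hx y hy h.1 h.2), zero_mul]

theorem kz_comm {V : Finset α} {r s : α → α → Prop} (hr : TourOn V r) (hs : TourOn V s)
    (d : α → ZMod 2) : kz V r s d = kz V s r d := by
  have h := kz_add hr hs hr d
  rw [kz_self hr] at h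
  linear_combination h - ZMod.add_self_two (kz V s r d)

theorem kz_image [DecidableEq α] {V : Finset β} {φ : β → α} (hφ : Function.Injective φ)
    (r s : α → α → Prop) (d : α → ZMod 2) : kz (V.image φ) r s d =
      kz V (Function.onFun r φ) (Function.onFun s φ) fun b => d (φ b) := by
  simp only [kz, sum_image hφ.injOn, Function.onFun]

theorem bef_image [DecidableEq α] {V : Finset β} {φ : β → α} (hφ : Function.Injective φ)
    (r : α → α → Prop) (d : α → ZMod 2) (b : β) : bef (V.image φ) r d (φ b) =
      bef V (Function.onFun r φ) (fun b => d (φ b)) b := by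
  simp only [bef, sum_image hφ.injOn, Function.onFun]

theorem kz_union [DecidableEq α] {V W : Finset α} {r s : α → α → Prop} (hVW : Disjoint V W)
    (hr : TourOn (V ∪ W) r) (hs : TourOn (V ∪ W) s) (hr' : ∀ x ∈ V, ∀ y ∈ W, r x y)
    (hs' : ∀ x ∈ V, ∀ y ∈ W, s x y) (d : α → ZMod 2) :
    kz (V ∪ W) r s d = kz V r s d + kz W r s d := by
  have hV := @subset_union_left _ _ V W
  have hW := @subset_union_right _ _ V W
  have h1 : ∀ x ∈ V, ∀ y ∈ W, ind (r x y ∧ s y x) * (d x * d y) = 0 := fun x hx y hy => by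
    rw [ind_false (fun h => hs.asymm x (hV hx) y (hW hy) (hs' x hx y hy) h.2), zero_mul]
  have h2 : ∀ x ∈ W, ∀ y ∈ V, ind (r x y ∧ s y x) * (d x * d y) = 0 := fun x hx y hy => by
    rw [ind_false (fun h => hr.asymm y (hV hy) x (hW hx) (hr' y hy x hx) h.1), zero_mul]
  simp only [kz, sum_union hVW, sum_add_distrib]
  rw [sum_eq_zero (fun x hx => sum_eq_zero (h1 x hx)),
    sum_eq_zero (fun x hx => sum_eq_zero (h2 x hx))]
  ring

theorem kz_block {V U W : Finset α} {r s : α → α → Prop} (hU : U ⊆ V) (hW : W ⊆ V)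
    (h : ∀ x ∈ V, ∀ y ∈ V, (r x y ∧ s y x ↔ x ∈ U ∧ y ∈ W)) (d : α → ZMod 2) :
    kz V r s d = (∑ x ∈ U, d x) * ∑ y ∈ W, d y := by
  classical
  have h1 : kz V r s d = ∑ x ∈ V, ∑ y ∈ V, (if x ∈ U then d x else 0) * (if y ∈ W then d y else 0) := by
    refine sum_congr rfl fun x hx => sum_congr rfl fun y hy => ?_
    rw [h x hx y hy, ind]
    by_cases hx' : x ∈ U <;> by_cases hy' : y ∈ W <;> simp [hx', hy']
  rw [h1, ← sum_mul_sum, sum_ite_mem, sum_ite_mem, inter_eq_right.2 hU, inter_eq_right.2 hW]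

theorem koszulSign_mul {k : Type*} [CommRing k] {ι : Type*} [Fintype ι] (r s : ι → ι → Prop)
    (deg : ι → ℤ) (c : k) : koszulSign r s deg • c =
      sg k (kz univ r s fun x => (deg x : ZMod 2)) * c := by
  classical
  have h1 : ∀ (S : Finset (ι × ι)), (∏ x ∈ S, (deg x.1 * deg x.2).negOnePow) • c =
      sg k (∑ x ∈ S, (deg x.1 : ZMod 2) * deg x.2) * c := by
    intro S
    induction S using Finset.induction_on with
    | empty => simp
    | insert a S ha ih =>
      rw [prod_insert ha, sum_insert ha, mul_smul, ih, negOnePow_smul (k := k), sg_add, smul_eq_mul,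
        Int.cast_mul, mul_assoc]
  rw [koszulSign, h1, sum_filter, kz, ← univ_product_univ, sum_product]
  refine congrArg (fun z => sg k z * c) (sum_congr rfl fun x _ => sum_congr rfl fun y _ => ?_)
  rw [ind]
  split_ifs <;> simp

/-- The order of the elements by `c`, and by `r` for equal values of `c`. -/
def lexRel (c : α → ℕ) (r : α → α → Prop) (x y : α) : Prop := c x < c y ∨ c x = c y ∧ r x y

theorem TourOn.lexRel {V : Finset α} {r : α → α → Prop} (h : TourOn V r) (c : α → ℕ) :
    TourOn V (lexRel c r) where
  asymm x hx y hy := by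
    rintro (h1 | ⟨h1, h2⟩) (h3 | ⟨h3, h4⟩)
    · omega
    · omega
    · omega
    · exact h.asymm x hx y hy h2 h4
  total x hx y hy hxy := by
    rcases lt_trichotomy (c x) (c y) with h1 | h1 | h1
    · exact Or.inl (Or.inl h1)
    · rcases h.total x hx y hy hxy with h2 | h2
      · exact Or.inl (Or.inr ⟨h1, h2⟩)
      · exact Or.inr (Or.inr ⟨h1.symm, h2⟩)
    · exact Or.inr (Or.inl h1)

end Koszul

namespace RTree

variable {n m l : ℕ}

theorem tourOn_before (V : Finset (Finset (Fin n))) : TourOn V Before where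
  asymm _ _ _ _ h h' := lt_asymm h h'
  total x _ y _ hxy := by
    rcases lt_trichotomy (toColex x) (toColex y) with h | h | h
    · exact Or.inr h
    · exact absurd (toColex_inj.1 h) hxy
    · exact Or.inl h

theorem Before.of_ssubset {A B : Finset (Fin n)} (h : B ⊂ A) : Before A B :=
  Colex.toColex_lt_toColex_of_ssubset h

theorem Before.trans {A B C : Finset (Fin n)} (h : Before A B) (h' : Before B C) : Before A C :=
  lt_trans (α := Colex (Finset (Fin n))) h' h

/-- The set of the vertices. -/
def verts (T : RTree n) : Finset (Finset (Fin n)) := T.edges.filter fun A => 1 < A.card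

theorem mem_verts {T : RTree n} {A : Finset (Fin n)} : A ∈ T.verts ↔ A ∈ T.edges ∧ 1 < A.card :=
  mem_filter

theorem sum_vert {M : Type*} [AddCommMonoid M] (T : RTree n) (F : Finset (Fin n) → M) :
    ∑ A : T.Vert, F A.1 = ∑ A ∈ T.verts, F A :=
  (sum_subtype T.verts (fun _ => mem_verts) F).symm

theorem verts_contract (T : RTree n) (x : T.InnerEdge) :
    (T.contract x).verts = T.verts.erase x.1.2.1 := by
  ext A
  rw [mem_erase, mem_verts, mem_verts, mem_contract, and_assoc]

end RTree

namespace DGOperadData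

variable {k : Type u} [Field k] {Q : DGOperadData.{u, v} k}

open El RTree Function

/-- The parities of the shifted duals of the decorations. -/
noncomputable def Dec.par {n : ℕ} {T : RTree n} (p : Q.Dec T) (A : Finset (Fin n)) : ZMod 2 :=
  if h : A ∈ T.edges ∧ 1 < A.card then ((1 - (p ⟨A, h⟩).1 : ℤ) : ZMod 2) else 0

theorem Dec.par_vert {n : ℕ} {T : RTree n} (p : Q.Dec T) (A : T.Vert) :
    p.par A.1 = ((1 - (p A).1 : ℤ) : ZMod 2) := dif_pos A.2

theorem Dec.par_restr {n l : ℕ} {T : RTree l} (p : Q.Dec T) {φ : Finset (Fin n) → Finset (Fin l)}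
    (h : T.IsBlock φ) {A : Finset (Fin n)} (hA : A ∈ (T.restr φ h).verts) :
    (p.restr φ h).par A = p.par (φ A) := by
  have hA' := mem_verts.1 hA
  rw [par, dif_pos hA', par, dif_pos (h.vert ⟨A, hA'⟩).2]
  rfl

/-- Functions of decorated trees with `n` leaves. -/
abbrev Fn (Q : DGOperadData.{u, v} k) (n : ℕ) : Type (max u v) := ∀ T : RTree n, Q.Dec T → k

/-- The value of a function on a decorated tree with vertices ordered by the relation `r`. -/
noncomputable def tw {n : ℕ} (f : Q.Fn n) (T : RTree n) (p : Q.Dec T)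
    (r : Finset (Fin n) → Finset (Fin n) → Prop) : k :=
  sg k (kz T.verts Before r p.par) * f T p

theorem tw_before {n : ℕ} (f : Q.Fn n) (T : RTree n) (p : Q.Dec T) : tw f T p Before = f T p := by
  rw [tw, kz_self (tourOn_before _), sg_zero, one_mul]

theorem tw_change {n : ℕ} (f : Q.Fn n) {T : RTree n} (p : Q.Dec T)
    {r r' : Finset (Fin n) → Finset (Fin n) → Prop} (h : TourOn T.verts r)
    (h' : TourOn T.verts r') : tw f T p r = sg k (kz T.verts r' r p.par) * tw f T p r' := by
  rw [tw, tw, ← mul_assoc, ← sg_add, add_comm, kz_add (tourOn_before _) h' h]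

theorem tw_congr {n : ℕ} (f : Q.Fn n) {T T' : RTree n} {p : Q.Dec T} {p' : Q.Dec T'}
    (h : (⟨T, p⟩ : Q.DTree n) = ⟨T', p'⟩) {r r' : Finset (Fin n) → Finset (Fin n) → Prop}
    (hr : ∀ A ∈ T.verts, ∀ B ∈ T.verts, (r A B ↔ r' A B)) : tw f T p r = tw f T' p' r' := by
  cases h
  rw [tw, tw, kz_congr (fun _ _ _ _ => Iff.rfl) hr (fun _ _ => rfl)]

theorem Fn.congr {n : ℕ} (f : Q.Fn n) {T T' : RTree n} {p : Q.Dec T} {p' : Q.Dec T'}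
    (h : (⟨T, p⟩ : Q.DTree n) = ⟨T', p'⟩) : f T p = f T' p' := by
  cases h
  rfl

section Ev

variable {n m l : ℕ}

/-- The value of an element of the cobar complex on a decorated tree. -/
noncomputable def ev {i : ℤ} (α : Q.CobObj n i) : Q.Fn n := fun T p =>
  Q.component i T (fun A => (p A).1) α fun A => (p A).2

theorem ev_of_eq {i : ℤ} (α : Q.CobObj n i) (T : RTree n) (p : Q.Dec T)
    (h : ∑ A, (1 - (p A).1) = i) : ev α T p = α T ⟨fun A => (p A).1, h⟩ fun A => (p A).2 := by
  simp [ev, component, h]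

theorem ev_of_ne {i : ℤ} (α : Q.CobObj n i) (T : RTree n) (p : Q.Dec T)
    (h : ∑ A, (1 - (p A).1) ≠ i) : ev α T p = 0 := by
  have h1 : Q.component i T (fun A => (p A).1) = 0 := dif_neg h
  rw [ev, h1]
  rfl

theorem ev_ext {i : ℤ} {α β : Q.CobObj n i} (h : ∀ T p, ev α T p = ev β T p) : α = β := by
  funext T δ
  ext y
  have := h T fun A => ⟨δ.1 A, y A⟩
  rwa [ev_of_eq _ _ _ δ.2, ev_of_eq _ _ _ δ.2] at this

@[simp] theorem ev_zero {i : ℤ} : ev (0 : Q.CobObj n i) = 0 := by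
  funext T p
  simp [ev]

theorem ev_add {i : ℤ} (α β : Q.CobObj n i) : ev (α + β) = ev α + ev β := by
  funext T p
  simp [ev]

theorem ev_smul {i : ℤ} (c : k) (α : Q.CobObj n i) : ev (c • α) = c • ev α := by
  funext T p
  simp [ev]

theorem tw_smul (c : k) (f : Q.Fn n) (T : RTree n) (p : Q.Dec T)
    (r : Finset (Fin n) → Finset (Fin n) → Prop) : tw (c • f) T p r = c * tw f T p r := by
  simp only [tw, Pi.smul_apply, smul_eq_mul]
  ring

theorem tw_add (f g : Q.Fn n) (T : RTree n) (p : Q.Dec T)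
    (r : Finset (Fin n) → Finset (Fin n) → Prop) :
    tw (f + g) T p r = tw f T p r + tw g T p r := by
  simp only [tw, Pi.add_apply, mul_add]

/-- The parity of a homogeneous element is the sum of the parities of the decorations. -/
theorem sum_par_of_ev {i : ℤ} (α : Q.CobObj n i) (T : RTree n) (p : Q.Dec T)
    (h : ev α T p ≠ 0) : ∑ A ∈ T.verts, p.par A = (i : ZMod 2) := by
  have h1 : ∑ A, (1 - (p A).1) = i := by
    by_contra h2
    exact h (ev_of_ne α T p h2)
  rw [← sum_vert, ← h1, Int.cast_sum]
  exact sum_congr rfl fun A _ => p.par_vert A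

theorem tourOn_restr {T : RTree l} {φ : Finset (Fin n) → Finset (Fin l)} (hb : T.IsBlock φ)
    {r : Finset (Fin l) → Finset (Fin l) → Prop} (hr : TourOn T.verts r) :
    TourOn (T.restr φ hb).verts (r on φ) :=
  have hm : ∀ A ∈ (T.restr φ hb).verts, φ A ∈ T.verts := fun A hA => by
    rw [mem_verts] at hA ⊢
    exact ⟨(mem_restr hb).1 hA.1, hb.one_lt_card hA.2⟩
  ⟨fun _ hx _ hy => hr.asymm _ (hm _ hx) _ (hm _ hy),
    fun _ hx _ hy hxy => hr.total _ (hm _ hx) _ (hm _ hy) (hb.injective.ne hxy)⟩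

/-- The function of decorated trees obtained by renaming the leaves. -/
noncomputable def relFn (f : Fin n ≃ Fin l) (F : Q.Fn n) : Q.Fn l := fun T p =>
  sg k (kz (T.restr _ (T.isBlock_map f)).verts Before (Before on fun A => A.map f.toEmbedding)
    (p.restr _ (T.isBlock_map f)).par) *
    F (T.restr _ (T.isBlock_map f)) (p.restr _ (T.isBlock_map f))

theorem verts_map (f : Fin n ≃ Fin l) (T : RTree l) :
    T.verts = (T.restr _ (T.isBlock_map f)).verts.image fun A => A.map f.toEmbedding := by
  have hb := T.isBlock_map f
  ext A
  rw [mem_image]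
  constructor
  · intro hA
    have h1 := map_symm_map f A
    refine ⟨A.map f.symm.toEmbedding, ?_, h1⟩
    rw [mem_verts, mem_restr, h1]
    exact ⟨(mem_verts.1 hA).1, by simpa using (mem_verts.1 hA).2⟩
  · rintro ⟨B, hB, rfl⟩
    rw [mem_verts] at hB ⊢
    exact ⟨(mem_restr hb).1 hB.1, hb.one_lt_card hB.2⟩

theorem tw_relFn (f : Fin n ≃ Fin l) (F : Q.Fn n) (T : RTree l) (p : Q.Dec T)
    {r : Finset (Fin l) → Finset (Fin l) → Prop} (hr : TourOn T.verts r) :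
    tw (relFn f F) T p r = tw F (T.restr _ (T.isBlock_map f)) (p.restr _ (T.isBlock_map f))
        (r on fun A => A.map f.toEmbedding) := by
  have hb := T.isBlock_map f
  rw [tw, tw, relFn, ← mul_assoc, ← sg_add, verts_map f T, kz_image hb.injective,
    kz_congr (fun _ _ _ _ => Iff.rfl) (fun _ _ _ _ => Iff.rfl)
      (fun A hA => (p.par_restr hb hA).symm),
    add_comm, kz_add (tourOn_before _) (tourOn_restr hb (tourOn_before _)) (tourOn_restr hb hr)]

theorem ev_cobRelabel (f : Fin n ≃ Fin l) (i : ℤ) (α : Q.CobObj n i) :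
    ev (Q.cobRelabel f i α) = relFn f (ev α) := by
  funext T p
  set φ := fun A : Finset (Fin n) => A.map f.toEmbedding with hφ
  have hb := T.isBlock_map f
  have hsum : ∑ A : T.Vert, (1 - (p A).1) =
      ∑ A : (T.restr φ hb).Vert, (1 - ((p.restr φ hb) A).1) :=
    (Fintype.sum_equiv (T.unlabelVert f) _ _ fun _ => rfl).symm
  change _ = sg k (kz (T.restr φ hb).verts Before (Before on φ)
      (p.restr φ hb).par) * ev α (T.restr φ hb) (p.restr φ hb)
  by_cases hi : ∑ A : T.Vert, (1 - (p A).1) = i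
  · rw [ev_of_eq _ _ _ hi]
    change koszulSign _ _ _ • ev α (T.restr φ hb) (p.restr φ hb) = _
    rw [koszulSign_mul]
    congr 2
    have := kz_image (V := (univ : Finset (T.restr φ hb).Vert)) Subtype.val_injective
      Before (Before on φ) (p.restr φ hb).par
    rw [show (univ : Finset (T.restr φ hb).Vert).image Subtype.val = (T.restr φ hb).verts by
      ext A; simp [mem_verts]] at this
    rw [this]
    exact kz_congr (fun _ _ _ _ => Iff.rfl) (fun _ _ _ _ => Iff.rfl)
      (fun A _ => (Dec.par_vert (p.restr φ hb) A).symm)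
  · rw [ev_of_ne _ _ _ hi, ev_of_ne _ _ _ (fun h => hi (hsum.trans h)), mul_zero]

/-- The vertices of the upper tree come last in the order `r`. -/
def OuterFirst (T : RTree l) (g : Finset (Fin l)) (r : Finset (Fin l) → Finset (Fin l) → Prop) :
    Prop := ∀ A ∈ T.verts, ∀ B ∈ T.verts, ¬ A ⊆ g → B ⊆ g → r A B

section Graft

variable {x : Fin n} {e : {c : Fin n // c ≠ x} ⊕ Fin m ≃ Fin l} {T : RTree l}
  (h : outer x e {x} ∈ T.edges)

/-- The order of the vertices of a grafted tree in which those of the lower tree come first. -/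
def graftRel (x : Fin n) (e : {c : Fin n // c ≠ x} ⊕ Fin m ≃ Fin l) (A B : Finset (Fin l)) : Prop :=
  (¬ A ⊆ outer x e {x} ∧ B ⊆ outer x e {x}) ∨
    (∃ A' B', outer x e A' = A ∧ outer x e B' = B ∧ ¬ A ⊆ outer x e {x} ∧ ¬ B ⊆ outer x e {x} ∧
      Before A' B') ∨ ∃ A' B', inner x e A' = A ∧ inner x e B' = B ∧ Before A' B'

theorem outerFirst_graftRel : OuterFirst T (outer x e {x}) (graftRel x e) :=
  fun _ _ _ _ hA hB => Or.inl ⟨hA, hB⟩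

include h

theorem verts_graft : T.verts = (T.restr _ (isBlock_outer h)).verts.image (outer x e) ∪
    (T.restr _ (isBlock_inner h)).verts.image (inner x e) := by
  ext A
  rw [mem_union, mem_image, mem_image]
  constructor
  · intro hA
    obtain ⟨s, hs⟩ := (graftVert h).surjective ⟨A, mem_verts.1 hA⟩
    rcases s with s | s
    · exact Or.inl ⟨s.1, mem_verts.2 s.2, congrArg Subtype.val hs⟩
    · exact Or.inr ⟨s.1, mem_verts.2 s.2, congrArg Subtype.val hs⟩
  · rintro (⟨B, hB, rfl⟩ | ⟨B, hB, rfl⟩)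
    · exact mem_verts.2 (graftVert h (Sum.inl ⟨B, mem_verts.1 hB⟩)).2
    · exact mem_verts.2 (graftVert h (Sum.inr ⟨B, mem_verts.1 hB⟩)).2

theorem disjoint_verts_graft : Disjoint ((T.restr _ (isBlock_outer h)).verts.image (outer x e))
    ((T.restr _ (isBlock_inner h)).verts.image (inner x e)) := by
  rw [disjoint_left]
  intro A hA hA'
  obtain ⟨B, hB, rfl⟩ := mem_image.1 hA
  obtain ⟨C, -, hC⟩ := mem_image.1 hA'
  exact outer_not_subset h (mem_verts.1 hB).2 (hC ▸ inner_subset C)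

theorem sum_verts_graft {M : Type*} [AddCommMonoid M] (F : Finset (Fin l) → M) :
    ∑ A ∈ T.verts, F A = ∑ A ∈ (T.restr _ (isBlock_outer h)).verts, F (outer x e A) +
      ∑ A ∈ (T.restr _ (isBlock_inner h)).verts, F (inner x e A) := by
  rw [verts_graft h, sum_union (disjoint_verts_graft h), sum_image (isBlock_outer h).injective.injOn,
    sum_image (isBlock_inner h).injective.injOn]

theorem kz_graft {r s : Finset (Fin l) → Finset (Fin l) → Prop} (hr : TourOn T.verts r)
    (hs : TourOn T.verts s) (hr' : OuterFirst T (outer x e {x}) r)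
    (hs' : OuterFirst T (outer x e {x}) s) (p : Q.Dec T) : kz T.verts r s p.par =
      kz (T.restr _ (isBlock_outer h)).verts (r on outer x e) (s on outer x e)
        (p.restr _ (isBlock_outer h)).par +
      kz (T.restr _ (isBlock_inner h)).verts (r on inner x e) (s on inner x e)
        (p.restr _ (isBlock_inner h)).par := by
  have key : ∀ r, OuterFirst T (outer x e {x}) r →
      ∀ A ∈ (T.restr _ (isBlock_outer h)).verts.image (outer x e),
      ∀ B ∈ (T.restr _ (isBlock_inner h)).verts.image (inner x e), r A B := by
    intro r hr A hA B hB
    have hAT : A ∈ T.verts := by rw [verts_graft h]; exact mem_union_left _ hA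
    have hBT : B ∈ T.verts := by rw [verts_graft h]; exact mem_union_right _ hB
    obtain ⟨A', hA', rfl⟩ := mem_image.1 hA
    obtain ⟨B', hB', rfl⟩ := mem_image.1 hB
    exact hr _ hAT _ hBT (outer_not_subset h (mem_verts.1 hA').2) (inner_subset B')
  have hV := verts_graft h
  have hr₁ : TourOn _ r := hr.mono hV.symm.subset
  have hs₁ : TourOn _ s := hs.mono hV.symm.subset
  have h1 := kz_union (disjoint_verts_graft h) hr₁ hs₁ (key r hr') (key s hs') p.par
  rw [← hV] at h1
  rw [h1, kz_image (isBlock_outer h).injective, kz_image (isBlock_inner h).injective]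
  refine congrArg₂ _ ?_ ?_
  · exact kz_congr (fun _ _ _ _ => Iff.rfl) (fun _ _ _ _ => Iff.rfl)
      (fun A hA => (p.par_restr _ hA).symm)
  · exact kz_congr (fun _ _ _ _ => Iff.rfl) (fun _ _ _ _ => Iff.rfl)
      (fun A hA => (p.par_restr _ hA).symm)

theorem graftRel_outer : ∀ A ∈ (T.restr _ (isBlock_outer h)).verts,
    ∀ B ∈ (T.restr _ (isBlock_outer h)).verts,
      ((graftRel x e on outer x e) A B ↔ Before A B) := by
  intro A hA B hB
  have hA' := outer_not_subset h (mem_verts.1 hA).2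
  have hB' := outer_not_subset h (mem_verts.1 hB).2
  constructor
  · rintro (h1 | ⟨A', B', h1, h2, -, -, h3⟩ | ⟨A', B', h1, h2, h3⟩)
    · exact absurd h1.2 hB'
    · rwa [← (isBlock_outer h).injective h1, ← (isBlock_outer h).injective h2]
    · exact absurd (h1 ▸ inner_subset A') hA'
  · exact fun h1 => Or.inr (Or.inl ⟨A, B, rfl, rfl, hA', hB', h1⟩)

theorem graftRel_inner (A B : Finset (Fin m)) :
    (graftRel x e on inner x e) A B ↔ Before A B := by
  constructor
  · rintro (h1 | ⟨A', B', h1, h2, h3, -, -⟩ | ⟨A', B', h1, h2, h3⟩)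
    · exact absurd (inner_subset A) h1.1
    · exact absurd (inner_subset A) h3
    · rwa [← (isBlock_inner h).injective h1, ← (isBlock_inner h).injective h2]
  · exact fun h1 => Or.inr (Or.inr ⟨A, B, rfl, rfl, h1⟩)

theorem tourOn_graftRel : TourOn T.verts (graftRel x e) := by
  constructor
  · rintro A - B - (h1 | ⟨A', B', rfl, rfl, h1, h2, h3⟩ | ⟨A', B', rfl, rfl, h3⟩)
    · rintro (h2 | ⟨A', B', rfl, rfl, h2, h3, h4⟩ | ⟨A', B', rfl, rfl, h4⟩)
      · exact h2.1 h1.2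
      · exact h2 h1.2
      · exact h1.1 (inner_subset _)
    · rintro (h4 | ⟨A'', B'', h4, h5, -, -, h6⟩ | ⟨A'', B'', h4, h5, h6⟩)
      · exact h1 h4.2
      · rw [(isBlock_outer h).injective h4, (isBlock_outer h).injective h5] at h6
        exact lt_asymm h3 h6
      · exact h1 (h5 ▸ inner_subset B'')
    · intro h4
      exact lt_asymm h3 ((graftRel_inner h _ _).1 h4)
  · intro A₀ hA₀ B₀ hB₀ hAB
    rw [verts_graft h] at hA₀ hB₀
    rcases mem_union.1 hA₀ with h1 | h1 <;> obtain ⟨A, hA, rfl⟩ := mem_image.1 h1 <;>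
      rcases mem_union.1 hB₀ with h2 | h2 <;> obtain ⟨B, hB, rfl⟩ := mem_image.1 h2
    · rcases (tourOn_before _).total A hA B hB (fun h => hAB (congrArg _ h)) with h3 | h3
      · exact Or.inl ((graftRel_outer h A hA B hB).2 h3)
      · exact Or.inr ((graftRel_outer h B hB A hA).2 h3)
    · exact Or.inl (Or.inl ⟨outer_not_subset h (mem_verts.1 hA).2, inner_subset _⟩)
    · exact Or.inr (Or.inl ⟨outer_not_subset h (mem_verts.1 hB).2, inner_subset _⟩)
    · rcases (tourOn_before _).total A hA B hB (fun h => hAB (congrArg _ h)) with h3 | h3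
      · exact Or.inl ((graftRel_inner h A B).2 h3)
      · exact Or.inr ((graftRel_inner h B A).2 h3)

end Graft

open scoped Classical in
/-- The product of two functions of decorated trees, as a function of grafted trees. -/
noncomputable def graftFn (x : Fin n) (e : {c : Fin n // c ≠ x} ⊕ Fin m ≃ Fin l) (f : Q.Fn n)
    (g : Q.Fn m) : Q.Fn l := fun T p =>
  if h : outer x e {x} ∈ T.edges then sg k (kz T.verts (graftRel x e) Before p.par) *
    (f _ (p.restr _ (isBlock_outer h)) * g _ (p.restr _ (isBlock_inner h))) else 0

section

variable {x : Fin n} {e : {c : Fin n // c ≠ x} ⊕ Fin m ≃ Fin l} {T : RTree l}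

theorem graftFn_of_notMem (h : outer x e {x} ∉ T.edges) (f : Q.Fn n) (g : Q.Fn m) (p : Q.Dec T) :
    graftFn x e f g T p = 0 := dif_neg h

theorem tw_graftFn (h : outer x e {x} ∈ T.edges) (f : Q.Fn n) (g : Q.Fn m) (p : Q.Dec T)
    {r : Finset (Fin l) → Finset (Fin l) → Prop} (hr : TourOn T.verts r)
    (hr' : OuterFirst T (outer x e {x}) r) : tw (graftFn x e f g) T p r =
      tw f _ (p.restr _ (isBlock_outer h)) (r on outer x e) *
        tw g _ (p.restr _ (isBlock_inner h)) (r on inner x e) := by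
  have h0 : graftFn x e f g T p = sg k (kz T.verts (graftRel x e) Before p.par) *
    (f _ (p.restr _ (isBlock_outer h)) * g _ (p.restr _ (isBlock_inner h))) := dif_pos h
  have hs := tourOn_graftRel h
  rw [tw, h0, ← mul_assoc, ← sg_add, kz_comm (tourOn_before _) hr, add_comm,
    kz_comm hr (tourOn_before _), kz_add hs (tourOn_before _) hr,
    kz_graft h hs hr outerFirst_graftRel hr', sg_add, tw, tw,
    kz_congr (graftRel_outer h) (fun _ _ _ _ => Iff.rfl) (fun _ _ => rfl),
    kz_congr (fun A _ B _ => graftRel_inner h A B) (fun _ _ _ _ => Iff.rfl) (fun _ _ => rfl)]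
  ring

theorem ev_cobComp_of_sum (i j : ℤ) {t : ℤ} (α : Q.CobObj n i) (β : Q.CobObj m j) (p : Q.Dec T)
    (hi : ∑ A : T.Vert, (1 - (p A).1) = t) :
    ev (Q.cobComp x e i j t α β) T p = graftFn x e (ev α) (ev β) T p := by
  by_cases h : outer x e {x} ∈ T.edges
  swap
  · rw [graftFn_of_notMem h, ev_of_eq _ _ _ hi]
    have h1 : Q.cobComp x e i j t α β T ⟨fun A => (p A).1, hi⟩ = 0 := dif_neg h
    rw [h1]
    rfl
  have h0 : graftFn x e (ev α) (ev β) T p = sg k (kz T.verts (graftRel x e) Before p.par) *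
    (ev α _ (p.restr _ (isBlock_outer h)) * ev β _ (p.restr _ (isBlock_inner h))) := dif_pos h
  rw [h0]
  rw [ev_of_eq _ _ _ hi]
  have h1 : Q.cobComp x e i j t α β T ⟨fun A => (p A).1, hi⟩ = koszulSign
          (fun s s' : (RTree.outerTree h).Vert ⊕ (RTree.innerTree h).Vert =>
            Sum.Lex (fun A B => RTree.Before A.1 B.1) (fun A B => RTree.Before A.1 B.1) s s')
          (fun s s' => RTree.Before (RTree.graftVert h s).1 (RTree.graftVert h s').1)
          (fun s => 1 - (p (RTree.graftVert h s)).1) •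
        Q.graftForm (RTree.graftVert h) (RTree.outerIn h) (RTree.innerIn h) (fun A => (p A).1)
          (Q.component i _ _ α) (Q.component j _ _ β) := dif_pos h
  rw [h1]
  change koszulSign _ _ _ • (ev α _ (p.restr _ (isBlock_outer h)) *
    ev β _ (p.restr _ (isBlock_inner h))) = _
  rw [koszulSign_mul]
  refine congrArg (fun z => sg k z * _) ?_
  have hinj : Function.Injective fun s => (graftVert h s).1 :=
    Subtype.val_injective.comp (graftVert h).injective
  have h2 := kz_image (V := univ) hinj (graftRel x e) Before p.par
  rw [show univ.image (fun s => (graftVert h s).1) = T.verts by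
    ext A
    rw [mem_image]
    constructor
    · rintro ⟨s, -, rfl⟩
      exact mem_verts.2 (graftVert h s).2
    · intro hA
      obtain ⟨s, hs⟩ := (graftVert h).surjective ⟨A, mem_verts.1 hA⟩
      exact ⟨s, mem_univ _, congrArg Subtype.val hs⟩] at h2
  rw [h2]
  refine kz_congr ?_ (fun _ _ _ _ => Iff.rfl) (fun c _ => (p.par_vert _).symm)
  rintro (A | A) - (B | B) -
  · rw [Sum.lex_inl_inl]
    exact (graftRel_outer h A.1 (mem_verts.2 A.2) B.1 (mem_verts.2 B.2)).symm
  · exact iff_of_true (Sum.Lex.sep _ _)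
      (Or.inl ⟨outer_not_subset h A.2.2, inner_subset _⟩)
  · refine iff_of_false (by simp) ?_
    intro h3
    exact (tourOn_graftRel h).asymm _ (mem_verts.2 (graftVert h (Sum.inr A)).2) _
      (mem_verts.2 (graftVert h (Sum.inl B)).2) h3
      (Or.inl ⟨outer_not_subset h B.2.2, inner_subset _⟩)
  · rw [Sum.lex_inr_inr]
    exact (graftRel_inner h A.1 B.1).symm

theorem graftFn_ev_eq_zero {i j : ℤ} (α : Q.CobObj n i) (β : Q.CobObj m j) (p : Q.Dec T)
    (hi : ∑ A : T.Vert, (1 - (p A).1) ≠ i + j) : graftFn x e (ev α) (ev β) T p = 0 := by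
  by_cases h : outer x e {x} ∈ T.edges
  swap
  · exact graftFn_of_notMem h _ _ _
  have h0 : graftFn x e (ev α) (ev β) T p = sg k (kz T.verts (graftRel x e) Before p.par) *
    (ev α _ (p.restr _ (isBlock_outer h)) * ev β _ (p.restr _ (isBlock_inner h))) := dif_pos h
  rw [h0]
  have hsum : ∑ A : T.Vert, (1 - (p A).1) =
      ∑ A, (1 - (p.restr _ (isBlock_outer h) A).1) +
        ∑ A, (1 - (p.restr _ (isBlock_inner h) A).1) := by
    rw [← Fintype.sum_equiv (graftVert h) (fun s => 1 - (p (graftVert h s)).1) _ (fun _ => rfl),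
      Fintype.sum_sum_type]
    rfl
  have : ev α _ (p.restr _ (isBlock_outer h)) = 0 ∨ ev β _ (p.restr _ (isBlock_inner h)) = 0 := by
    by_contra! hne
    have h1 := fun h' => hne.1 (ev_of_ne α _ (p.restr _ (isBlock_outer h)) h')
    have h2 := fun h' => hne.2 (ev_of_ne β _ (p.restr _ (isBlock_inner h)) h')
    exact hi (by rw [hsum, not_not.1 h1, not_not.1 h2])
  rcases this with h1 | h1 <;> simp [h1]

theorem ev_cobComp {i j t : ℤ} (ht : i + j = t) (α : Q.CobObj n i) (β : Q.CobObj m j) :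
    ev (Q.cobComp x e i j t α β) = graftFn x e (ev α) (ev β) := by
  funext T p
  by_cases hi : ∑ A : T.Vert, (1 - (p A).1) = t
  · exact ev_cobComp_of_sum i j α β p hi
  · rw [ev_of_ne _ _ _ hi, graftFn_ev_eq_zero _ _ _ (by rwa [ht])]

theorem cobComp_of_ne {i j t : ℤ} (ht : i + j ≠ t) : Q.cobComp x e i j t = 0 := by
  refine LinearMap.ext₂ fun α β => ev_ext fun T p => ?_
  by_cases hi : ∑ A : T.Vert, (1 - (p A).1) = t
  · rw [ev_cobComp_of_sum i j α β p hi, graftFn_ev_eq_zero _ _ _ (by rw [hi]; exact ht.symm)]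
    simp
  · rw [ev_of_ne _ _ _ hi]
    simp

end

end Ev

end DGOperadData

namespace DGOperadData

variable {k : Type u} [Field k] {Q : DGOperadData.{u, v} k}

open El RTree Function

section Ops

variable {n : ℕ}

theorem ev_mk {i : ℤ} (α : Q.CobObj n i) {T : RTree n} (p : Q.Dec T) (δ : T.Vert → ℤ)
    (y : ∀ A, Q.obj (Nat.card (T.In A.1)) (δ A)) (h : ∀ A, (⟨δ A, y A⟩ : Q.El _) = p A) :
    Q.component i T δ α y = ev α T p := by
  obtain rfl : p = fun A => ⟨δ A, y A⟩ := funext fun A => (h A).symm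
  rfl

/-- Additivity and homogeneity of a function of decorated trees in each decoration. -/
structure IsMulti (F : Q.Fn n) : Prop where
  add : ∀ (T : RTree n) (p : Q.Dec T) (A : T.Vert) (i : ℤ) (a b : Q.obj _ i),
    F T (update p A ⟨i, a + b⟩) = F T (update p A ⟨i, a⟩) + F T (update p A ⟨i, b⟩)
  smul : ∀ (T : RTree n) (p : Q.Dec T) (A : T.Vert) (c : k) (a : Q.El _),
    F T (update p A (El.smul c a)) = c * F T (update p A a)

theorem isMulti_ev {j : ℤ} (α : Q.CobObj n j) : IsMulti (ev α) := by
  have key : ∀ (T : RTree n) (p : Q.Dec T) (A : T.Vert) (a : Q.obj _ (p A).1),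
      ev α T (update p A ⟨_, a⟩) =
        Q.component j T (fun C => (p C).1) α (update (fun C => (p C).2) A a) := by
    intro T p A a
    refine (ev_mk α _ _ _ fun C => ?_).symm
    by_cases hC : C = A
    · subst hC; simp
    · simp [hC]
  constructor
  · intro T p A i a b
    have hp : ∀ v, update p A v = update (update p A ⟨i, 0⟩) A v := fun v => by simp
    have hi : i = (update p A (⟨i, 0⟩ : Q.El _) A).1 := by simp
    rw [hp ⟨i, a + b⟩, hp ⟨i, a⟩, hp ⟨i, b⟩]
    clear hp
    generalize update p A (⟨i, 0⟩ : Q.El _) = q at hi ⊢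
    subst hi
    rw [key, key, key, MultilinearMap.map_update_add]
  · intro T p A c a
    obtain ⟨i, a⟩ := a
    have hp : ∀ v, update p A v = update (update p A ⟨i, 0⟩) A v := fun v => by simp
    have hi : i = (update p A (⟨i, 0⟩ : Q.El _) A).1 := by simp
    change ev α T (update p A ⟨i, c • a⟩) = c * ev α T (update p A ⟨i, a⟩)
    rw [hp ⟨i, c • a⟩, hp ⟨i, a⟩]
    clear hp
    generalize update p A (⟨i, 0⟩ : Q.El _) = q at hi ⊢
    subst hi
    rw [key, key, MultilinearMap.map_update_smul, smul_eq_mul]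

open scoped Classical in
/-- The part of the differential that applies the differential of `Q` to the decoration of `A`. -/
noncomputable def opI (A : Finset (Fin n)) (F : Q.Fn n) : Q.Fn n := fun T p =>
  if h : A ∈ T.edges ∧ 1 < A.card then
    sg k (1 + bef T.verts Before p.par A) * F T (Dec.dAt p ⟨A, h⟩) else 0

/-- The vertices `A` and `B` are joined by an edge. -/
def _root_.RTree.Inner (T : RTree n) (A B : Finset (Fin n)) : Prop :=
  (A ∈ T.edges ∧ 1 < A.card) ∧ (B ∈ T.edges ∧ 1 < B.card) ∧ T.IsInput A B

/-- The edge between two vertices. -/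
abbrev _root_.RTree.Inner.edge {T : RTree n} {A B : Finset (Fin n)} (h : T.Inner A B) :
    T.InnerEdge := ⟨(⟨A, h.1⟩, ⟨B, h.2.1⟩), h.2.2⟩

/-- The total parity of the vertices between `A` and `B`. -/
noncomputable def betw (V : Finset (Finset (Fin n))) (d : Finset (Fin n) → ZMod 2)
    (A B : Finset (Fin n)) : ZMod 2 := ∑ C ∈ V, ind (Before A C ∧ Before C B) * d C

open scoped Classical in
/-- The part of the differential that contracts the edge between `A` and `B`. -/
noncomputable def opC (A B : Finset (Fin n)) (F : Q.Fn n) : Q.Fn n := fun T p =>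
  if h : T.Inner A B then
    sg k (bef T.verts Before p.par A + (1 + p.par A) + p.par B * betw T.verts p.par A B) *
      F (T.contract h.edge) (p.contract h.edge) else 0

/-- The differential on functions of decorated trees. -/
noncomputable def dFn (F : Q.Fn n) : Q.Fn n :=
  ∑ A, opI A F + ∑ A, ∑ B, opC A B F

theorem opI_of_notMem {A : Finset (Fin n)} (F : Q.Fn n) {T : RTree n} (p : Q.Dec T)
    (h : ¬ (A ∈ T.edges ∧ 1 < A.card)) : opI A F T p = 0 := dif_neg h

theorem opC_of_not {A B : Finset (Fin n)} (F : Q.Fn n) {T : RTree n} (p : Q.Dec T)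
    (h : ¬ T.Inner A B) : opC A B F T p = 0 := dif_neg h

theorem tw_eq_zero {F : Q.Fn n} {T : RTree n} {p : Q.Dec T} (h : F T p = 0)
    (r : Finset (Fin n) → Finset (Fin n) → Prop) : tw F T p r = 0 := by
  rw [tw, h, mul_zero]

theorem eq_of_tw {F G : Q.Fn n} {T : RTree n} {p : Q.Dec T}
    {r : Finset (Fin n) → Finset (Fin n) → Prop} (h : tw F T p r = tw G T p r) :
    F T p = G T p := sg_mul_cancel h

theorem opI_apply {A : Finset (Fin n)} (F : Q.Fn n) {T : RTree n} (p : Q.Dec T)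
    (h : A ∈ T.edges ∧ 1 < A.card) : opI A F T p =
      sg k (1 + bef T.verts Before p.par A) * F T (Dec.dAt p ⟨A, h⟩) := dif_pos h

theorem opC_apply {A B : Finset (Fin n)} (F : Q.Fn n) {T : RTree n} (p : Q.Dec T)
    (h : T.Inner A B) : opC A B F T p =
      sg k (bef T.verts Before p.par A + (1 + p.par A) + p.par B * betw T.verts p.par A B) *
      F (T.contract h.edge) (p.contract h.edge) := dif_pos h

theorem Dec.par_dAt_of_ne {T : RTree n} (p : Q.Dec T) (A : T.Vert) {C : Finset (Fin n)}
    (hC : C ≠ A.1) : (dAt p A).par C = p.par C := by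
  by_cases h : C ∈ T.edges ∧ 1 < C.card
  · rw [par, dif_pos h, par, dif_pos h, dAt, update_of_ne (fun h' => hC (congrArg Subtype.val h'))]
  · rw [par, dif_neg h, par, dif_neg h]

theorem Dec.par_dAt_self {T : RTree n} (p : Q.Dec T) (A : T.Vert) :
    (dAt p A).par A.1 = p.par A.1 + 1 := by
  rw [par_vert, par_vert, dAt, update_self, d_fst]
  push_cast
  linear_combination - ZMod.add_self_two (1 : ZMod 2)

theorem Dec.par_contract_of_ne {T : RTree n} (p : Q.Dec T) (x : T.InnerEdge) {C : Finset (Fin n)}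
    (hC : C ≠ x.1.1.1) (hC' : C ≠ x.1.2.1) : (contract p x).par C = p.par C := by
  by_cases h : C ∈ T.edges ∧ 1 < C.card
  · have h' : C ∈ (T.contract x).edges ∧ 1 < C.card := ⟨mem_contract.2 ⟨hC', h.1⟩, h.2⟩
    rw [par, dif_pos h', par, dif_pos h, contract_of_ne _ _ _ hC]
    rfl
  · have h' : ¬ (C ∈ (T.contract x).edges ∧ 1 < C.card) := fun h' => h ⟨(mem_contract.1 h'.1).2, h'.2⟩
    rw [par, dif_neg h', par, dif_neg h]

theorem Dec.par_contract_self {T : RTree n} (p : Q.Dec T) (x : T.InnerEdge) :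
    (contract p x).par x.1.1.1 = p.par x.1.1.1 + p.par x.1.2.1 + 1 := by
  have := par_vert (contract p x) x.merged
  rw [par_vert p x.1.1, par_vert p x.1.2]
  rw [contract_self _ _ _ rfl, comp_fst] at this
  rw [this]
  push_cast
  linear_combination - ZMod.add_self_two (1 : ZMod 2)

theorem tw_opI {A : Finset (Fin n)} (F : Q.Fn n) {T : RTree n} (p : Q.Dec T)
    (h : A ∈ T.edges ∧ 1 < A.card) {r : Finset (Fin n) → Finset (Fin n) → Prop}
    (hr : TourOn T.verts r) : tw (opI A F) T p r =
      sg k (1 + bef T.verts r p.par A) * tw F T (Dec.dAt p ⟨A, h⟩) r := by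
  have hA := mem_verts.2 h
  have hb := tourOn_before T.verts
  have hne : ∀ C ∈ T.verts.erase A, (Dec.dAt p ⟨A, h⟩).par C = p.par C :=
    fun C hC => p.par_dAt_of_ne ⟨A, h⟩ (ne_of_mem_erase hC)
  have hself : (Dec.dAt p ⟨A, h⟩).par A = p.par A + 1 := p.par_dAt_self ⟨A, h⟩
  rw [tw, tw, opI_apply F p h, ← mul_assoc, ← mul_assoc, ← sg_add, ← sg_add]
  congr 2
  rw [kz_erase hA hb hr, kz_erase hA hb hr, bef_erase_self hA hb, bef_erase_self hA hr,
    kz_congr (fun _ _ _ _ => Iff.rfl) (fun _ _ _ _ => Iff.rfl) hne,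
    bef_congr (fun _ _ => Iff.rfl) hne, bef_congr (r := r) (fun _ _ => Iff.rfl) hne, hself]
  linear_combination - ZMod.add_self_two (bef (T.verts.erase A) r p.par A)

/-- In the order `r`, the element `B` comes immediately after `A`. -/
structure IsAdj {α : Type*} (V : Finset α) (r : α → α → Prop) (A B : α) : Prop where
  rel : r A B
  iff : ∀ C ∈ V, C ≠ A → C ≠ B → (r C A ↔ r C B)

theorem IsAdj.iff' {α : Type*} {V : Finset α} {r : α → α → Prop} {A B : α} (h : IsAdj V r A B)
    (hr : TourOn V r) (hA : A ∈ V) (hB : B ∈ V) {D : α} (hD : D ∈ V) (hDA : D ≠ A) (hDB : D ≠ B) :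
    r A D ↔ r B D := by
  have key : ∀ C ∈ V, D ≠ C → (r C D ↔ ¬ r D C) := fun C hC hDC =>
    ⟨hr.asymm C hC D hD, fun h' => (hr.total C hC D hD hDC.symm).resolve_right h'⟩
  rw [key A hA hDA, key B hB hDB, h.iff D hD hDA hDB]

theorem bef_contract {T : RTree n} (p : Q.Dec T) (x : T.InnerEdge)
    {r : Finset (Fin n) → Finset (Fin n) → Prop} {D : Finset (Fin n)}
    (hA : r x.1.1.1 D ↔ r x.1.2.1 D) :
    bef (T.contract x).verts r (p.contract x).par D = bef T.verts r p.par D + ind (r x.1.1.1 D) := by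
  have hAV : x.1.1.1 ∈ T.verts := mem_verts.2 x.1.1.2
  have hBV : x.1.2.1 ∈ T.verts := mem_verts.2 x.1.2.2
  have hAB : x.1.1.1 ∈ T.verts.erase x.1.2.1 := mem_erase.2 ⟨x.ne, hAV⟩
  rw [verts_contract, bef_erase hAB, bef_erase hBV, bef_erase hAB, Dec.par_contract_self,
    bef_congr (d' := p.par) (fun _ _ => Iff.rfl) (fun C hC => p.par_contract_of_ne x (ne_of_mem_erase hC)
      (ne_of_mem_erase (mem_of_mem_erase hC))), ← hA]
  ring

theorem bef_contract_self {T : RTree n} (p : Q.Dec T) (x : T.InnerEdge)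
    {r : Finset (Fin n) → Finset (Fin n) → Prop} (hr : TourOn T.verts r) (hx : r x.1.1.1 x.1.2.1) :
    bef (T.contract x).verts r (p.contract x).par x.1.1.1 = bef T.verts r p.par x.1.1.1 := by
  have hAV : x.1.1.1 ∈ T.verts := mem_verts.2 x.1.1.2
  have hBV : x.1.2.1 ∈ T.verts := mem_verts.2 x.1.2.2
  have h1 : ¬ r x.1.1.1 x.1.1.1 := fun h => hr.asymm _ hAV _ hAV h h
  have h2 : ¬ r x.1.2.1 x.1.1.1 := fun h => hr.asymm _ hAV _ hBV hx h
  rw [bef_contract p x (iff_of_false h1 h2), ind_false h1, add_zero]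

theorem tw_opC {A B : Finset (Fin n)} (F : Q.Fn n) {T : RTree n} (p : Q.Dec T)
    (h : T.Inner A B) {r : Finset (Fin n) → Finset (Fin n) → Prop}
    (hr : TourOn T.verts r) (hadj : IsAdj T.verts r A B) : tw (opC A B F) T p r =
      sg k (bef T.verts r p.par A + (1 + p.par A)) *
        tw F (T.contract h.edge) (p.contract h.edge) r := by
  have hb := tourOn_before T.verts
  have hA := mem_verts.2 h.1
  have hB := mem_verts.2 h.2.1
  have hBA : Before A B := Before.of_ssubset h.2.2.2.1
  have hne : A ≠ B := h.edge.ne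
  have hA' : A ∈ T.verts.erase B := mem_erase.2 ⟨hne, hA⟩
  set W := (T.verts.erase B).erase A with hW
  have hpar : ∀ C ∈ W, (p.contract h.edge).par C = p.par C := fun C hC =>
    p.par_contract_of_ne h.edge (ne_of_mem_erase hC) (ne_of_mem_erase (mem_of_mem_erase hC))
  have hself : (p.contract h.edge).par A = p.par A + p.par B + 1 := p.par_contract_self h.edge
  have hbV := hb.mono (erase_subset B _)
  have hrV := hr.mono (erase_subset B _)
  have hirr : ∀ r, TourOn T.verts r → ind (r A A) = 0 := fun r hr =>
    ind_false fun h => hr.asymm A hA A hA h h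
  have hirrB : ∀ r, TourOn T.verts r → r A B → ind (r B A) = 0 := fun r hr hAB =>
    ind_false fun h => hr.asymm A hA B hB hAB h
  have e1 : ∀ r, TourOn T.verts r → r A B → bef T.verts r p.par A = bef W r p.par A := by
    intro r hr hAB
    rw [bef_erase hB, bef_erase hA', hirr r hr, hirrB r hr hAB]
    ring
  have e2 : ∀ r, r A B → bef (T.verts.erase B) r p.par B = bef W r p.par B + p.par A := by
    intro r hAB
    rw [bef_erase hA', ind_true hAB, one_mul]
  have e3 : ∀ (r) (d : Finset (Fin n) → ZMod 2), TourOn T.verts r →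
      bef (T.verts.erase B) r d A = bef W r d A := by
    intro r d hr
    rw [bef_erase hA', hirr r hr]
    ring
  have e4 : bef W r p.par B = bef W r p.par A := by
    refine sum_congr rfl fun C hC => ?_
    rw [hadj.iff C (mem_of_mem_erase (mem_of_mem_erase hC)) (ne_of_mem_erase hC)
      (ne_of_mem_erase (mem_of_mem_erase hC))]
  have e5 : bef W Before p.par B = bef W Before p.par A + betw T.verts p.par A B := by
    have h1 : betw T.verts p.par A B = betw W p.par A B := by
      have hBB : ¬ (Before A B ∧ Before B B) := fun h => hb.asymm B hB B hB h.2 h.2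
      have hAA : ¬ (Before A A ∧ Before A B) := fun h => hb.asymm A hA A hA h.1 h.1
      rw [betw, ← sum_erase_add _ _ hB, ← sum_erase_add _ _ hA', ind_false hBB, ind_false hAA, betw]
      ring
    rw [h1, bef, bef, betw, ← sum_add_distrib]
    refine sum_congr rfl fun C hC => ?_
    have hCV := mem_of_mem_erase (mem_of_mem_erase hC)
    rw [← add_mul]
    congr 1
    by_cases h2 : Before C A
    · rw [ind_true (h2.trans hBA), ind_true h2, ind_false (fun h3 => hb.asymm A hA C hCV h3.1 h2),
        add_zero]
    · have h3 := (hb.total A hA C hCV (ne_of_mem_erase hC).symm).resolve_right h2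
      rw [ind_false h2, zero_add]
      simp only [h3, true_and]
  have e6 : kz (T.contract h.edge).verts Before r (p.contract h.edge).par =
      kz W Before r p.par + (p.par A + p.par B + 1) * (bef W Before p.par A + bef W r p.par A) := by
    rw [verts_contract, kz_erase hA' hbV hrV, hself]
    rw [← hW, kz_congr (fun _ _ _ _ => Iff.rfl) (fun _ _ _ _ => Iff.rfl) hpar,
      bef_congr (fun _ _ => Iff.rfl) hpar, bef_congr (r := r) (fun _ _ => Iff.rfl) hpar]
  rw [tw, tw, opC_apply F p h, ← mul_assoc, ← mul_assoc, ← sg_add, ← sg_add, e6, kz_erase hB hb hr,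
    kz_erase hA' hbV hrV, e1 _ hb hBA, e1 _ hr hadj.rel, e2 _ hBA, e2 _ hadj.rel, e4, e5]
  congr 2
  linear_combination p.par B * ZMod.add_self_two (betw T.verts p.par A B) +
    p.par B * ZMod.add_self_two (p.par A) - ZMod.add_self_two (bef W r p.par A)

/-- The order obtained from `r` by moving `B` to the place immediately after `A`. -/
def adjRel {α : Type*} (r : α → α → Prop) (A B : α) (C D : α) : Prop :=
  (C = A ∧ D = B) ∨ (C ≠ B ∧ D ≠ B ∧ r C D) ∨ (C = B ∧ D ≠ B ∧ r A D) ∨ (D = B ∧ C ≠ B ∧ r C A)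

theorem tourOn_adjRel {α : Type*} {V : Finset α} {r : α → α → Prop} (h : TourOn V r) {A B : α}
    (hA : A ∈ V) (hAB : A ≠ B) : TourOn V (adjRel r A B) := by
  have hAA : ¬ r A A := fun h' => h.asymm A hA A hA h' h'
  constructor
  · intro C hC D hD
    have h1 := h.asymm C hC D hD
    have h2 := h.asymm A hA D hD
    have h3 := h.asymm C hC A hA
    unfold adjRel
    grind
  · intro C hC D hD hCD
    have h1 := h.total C hC D hD hCD
    have h2 := h.total A hA D hD
    have h3 := h.total C hC A hA
    unfold adjRel
    grind

theorem isAdj_adjRel {α : Type*} (V : Finset α) (r : α → α → Prop) {A B : α} (hAB : A ≠ B) : IsAdj V (adjRel r A B) A B := by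
  refine ⟨Or.inl ⟨rfl, rfl⟩, fun C hC h1 h2 => ?_⟩
  unfold adjRel
  grind

end Ops

end DGOperadData

namespace DGOperadData

variable {k : Type u} [Field k] {Q : DGOperadData.{u, v} k}

open El RTree Function

section Degree

variable {n : ℕ}

theorem sum_dAt {T : RTree n} (p : Q.Dec T) (A : T.Vert) :
    ∑ C, (1 - ((p.dAt A) C).1) = ∑ C, (1 - (p C).1) - 1 := by
  rw [← add_sum_erase _ _ (mem_univ A), ← add_sum_erase _ (fun C => 1 - (p C).1) (mem_univ A),
    sum_congr rfl fun C hC => by rw [Dec.dAt, update_of_ne (ne_of_mem_erase hC)], Dec.dAt,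
    update_self, d_fst]
  ring

theorem sum_contract {T : RTree n} (p : Q.Dec T) (x : T.InnerEdge) :
    ∑ C, (1 - ((p.contract x) C).1) = ∑ C, (1 - (p C).1) - 1 := by
  have hAB : x.1.1 ≠ x.1.2 := fun h => x.ne (congrArg Subtype.val h)
  let g : T.Vert → ℤ := fun C => (1 - (p C).1) - ((if C = x.1.2 then 1 - (p x.1.2).1 else 0) +
    if C = x.1.1 then (p x.1.2).1 else 0)
  have h1 : ∑ C, (1 - ((p.contract x) C).1) = ∑ C, g C := by
    refine Fintype.sum_of_injective (fun C => InnerEdge.vert x C)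
      (fun C D h => Subtype.ext (Subtype.mk.inj h)) _ _ ?_ ?_
    · intro C hC
      have : C = x.1.2 := by
        by_contra hne
        exact hC ⟨⟨C.1, mem_contract.2 ⟨fun h => hne (Subtype.ext h), C.2.1⟩, C.2.2⟩, rfl⟩
      subst this
      simp [g, hAB.symm]
    · intro C
      have h2 : InnerEdge.vert x C ≠ x.1.2 := fun h =>
        (mem_contract.1 C.2.1).1 (congrArg Subtype.val h)
      by_cases hC : C.1 = x.1.1.1
      · have h3 : InnerEdge.vert x C = x.1.1 := Subtype.ext hC
        rw [Dec.contract_self _ _ _ hC]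
        simp only [g, h3, comp_fst, if_neg hAB]
        simp
        ring
      · have h3 : InnerEdge.vert x C ≠ x.1.1 := fun h => hC (congrArg Subtype.val h)
        rw [Dec.contract_of_ne _ _ _ hC]
        simp [g, h2, h3]
  rw [h1, sum_sub_distrib, sum_add_distrib]
  simp

end Degree

section Differential

variable {n : ℕ}

theorem inner_edge {T : RTree n} (x : T.InnerEdge) : T.Inner x.1.1.1 x.1.2.1 :=
  ⟨x.1.1.2, x.1.2.2, x.2⟩

theorem sum_opI (F : Q.Fn n) (T : RTree n) (p : Q.Dec T) :
    ∑ A, opI A F T p = ∑ A : T.Vert, opI A.1 F T p := by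
  rw [sum_vert T fun A => opI A F T p]
  refine (sum_subset (subset_univ _) fun A _ hA => opI_of_notMem F p fun h => hA ?_).symm
  exact mem_verts.2 h

theorem sum_opC (F : Q.Fn n) (T : RTree n) (p : Q.Dec T) :
    ∑ A, ∑ B, opC A B F T p = ∑ x : T.InnerEdge, opC x.1.1.1 x.1.2.1 F T p := by
  rw [← Fintype.sum_prod_type' (f := fun A B => opC A B F T p)]
  symm
  refine Fintype.sum_of_injective (fun x : T.InnerEdge => (x.1.1.1, x.1.2.1)) ?_ _ _ ?_ fun _ => rfl
  · intro x y h
    exact Subtype.ext (Prod.ext (Subtype.ext (congrArg Prod.fst h))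
      (Subtype.ext (congrArg Prod.snd h)))
  · rintro ⟨A, B⟩ h
    exact opC_of_not F p fun h' => h ⟨h'.edge, rfl⟩

theorem dFn_apply (F : Q.Fn n) (T : RTree n) (p : Q.Dec T) :
    dFn F T p = ∑ A, opI A F T p + ∑ A, ∑ B, opC A B F T p := by
  simp only [dFn, Pi.add_apply, Finset.sum_apply]

theorem ev_cobD_of_eq (i j : ℤ) (α : Q.CobObj n i) (T : RTree n) (p : Q.Dec T)
    (h : ∑ A, (1 - (p A).1) = j) : ev (Q.cobD n i j α) T p = dFn (ev α) T p := by
  rw [ev_of_eq _ _ _ h, dFn_apply, sum_opI, sum_opC]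
  have h0 : Q.cobD n i j α T ⟨fun A => (p A).1, h⟩ =
    ∑ A : T.Vert, (1 + degBefore T (fun A => (p A).1) A).negOnePow •
        (Q.internalForm T (fun A => (p A).1) A (Q.component i T (raiseDeg T (fun A => (p A).1) A) α)) +
      ∑ x : T.InnerEdge,
        (degBefore T (fun A => (p A).1) x.1.1 + (p x.1.1).1 +
            (1 - (p x.1.2).1) * degBetween T (fun A => (p A).1) x.1.1 x.1.2).negOnePow •
          (Q.contractForm T (fun A => (p A).1) x
            (Q.component i (T.contract x) (contractDeg T (fun A => (p A).1) x) α)) := by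
    simp only [cobD, LinearMap.pi_apply, LinearMap.add_apply, LinearMap.sum_apply]
    rfl
  have hbef : ∀ A : T.Vert, ((degBefore T (fun A => (p A).1) A : ℤ) : ZMod 2) =
      bef T.verts Before p.par A.1 := by
    intro A
    rw [degBefore, Int.cast_sum, sum_filter, bef, ← sum_vert T fun C => ind (Before C A.1) * p.par C]
    refine sum_congr rfl fun C _ => ?_
    rw [Dec.par_vert, ind]
    split_ifs <;> simp
  have hbetw : ∀ A B : T.Vert, ((degBetween T (fun A => (p A).1) A B : ℤ) : ZMod 2) =
      betw T.verts p.par A.1 B.1 := by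
    intro A B
    rw [degBetween, Int.cast_sum, sum_filter, betw,
      ← sum_vert T fun C => ind (Before A.1 C ∧ Before C B.1) * p.par C]
    refine sum_congr rfl fun C _ => ?_
    rw [Dec.par_vert, ind]
    split_ifs <;> simp
  rw [h0, add_apply, _root_.sum_apply, _root_.sum_apply]
  congr 1
  · refine sum_congr rfl fun A _ => ?_
    rw [opI_apply _ _ A.2, negOnePow_smul (k := k), smul_apply, smul_eq_mul]
    push_cast
    rw [hbef]
    congr 1
    refine ev_mk α _ (raiseDeg T (fun A => (p A).1) A) _ fun C => ?_
    by_cases hC : C = A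
    · subst hC
      dsimp only
      rw [if_pos rfl, Dec.dAt, update_self]
      exact mk_congr (by simp [raiseDeg]) fun t => Q.d _ (p C).1 t (p C).2
    · dsimp only
      rw [if_neg hC, Dec.dAt, update_of_ne hC]
      exact mk_castDeg (by simp [raiseDeg, hC]) _
  · refine sum_congr rfl fun x _ => ?_
    rw [opC_apply _ _ (inner_edge x), negOnePow_smul (k := k), smul_apply,
      smul_eq_mul]
    push_cast
    rw [hbef, hbetw, Dec.par_vert p x.1.1, Dec.par_vert p x.1.2]
    congr 1
    · congr 1
      push_cast
      linear_combination ((p x.1.1).1 : ZMod 2) * ZMod.add_self_two 1 - ZMod.add_self_two (1 : ZMod 2)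
    refine ev_mk α _ (contractDeg T (fun A => (p A).1) x) _ fun C => ?_
    by_cases hC : C.1 = x.1.1.1
    · rw [Dec.contract_self _ _ _ hC, contractDec, dif_pos hC]
      exact mk_congr (if_pos hC) fun t => Q.setComp _ _ (p x.1.1).1 (p x.1.2).1 t (p x.1.1).2
        (p x.1.2).2
    · rw [Dec.contract_of_ne _ _ _ hC, contractDec, dif_neg hC]
      exact mk_castDeg (if_neg hC).symm _

theorem dFn_ev_eq_zero {i : ℤ} (α : Q.CobObj n i) (T : RTree n) (p : Q.Dec T)
    (h : ∑ A, (1 - (p A).1) ≠ i + 1) : dFn (ev α) T p = 0 := by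
  rw [dFn_apply, sum_opI, sum_opC, sum_eq_zero, sum_eq_zero, add_zero]
  · intro x _
    rw [opC_apply _ _ (inner_edge x), ev_of_ne, mul_zero]
    rw [sum_contract]
    omega
  · intro A _
    rw [opI_apply _ _ A.2, ev_of_ne, mul_zero]
    rw [sum_dAt]
    omega

theorem ev_cobD {i j : ℤ} (h : i + 1 = j) (α : Q.CobObj n i) :
    ev (Q.cobD n i j α) = dFn (ev α) := by
  funext T p
  by_cases hj : ∑ A, (1 - (p A).1) = j
  · exact ev_cobD_of_eq i j α T p hj
  · rw [ev_of_ne _ _ _ hj, dFn_ev_eq_zero _ _ _ (by rwa [h])]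

theorem cobD_of_ne {i j : ℤ} (h : i + 1 ≠ j) : Q.cobD n i j = 0 := by
  refine LinearMap.ext fun α => ev_ext fun T p => ?_
  by_cases hj : ∑ A, (1 - (p A).1) = j
  · rw [ev_cobD_of_eq i j α T p hj, dFn_ev_eq_zero _ _ _ (by rw [hj]; exact h.symm)]
    simp
  · rw [ev_of_ne _ _ _ hj]
    simp

end Differential

section Anticommute

variable {n : ℕ} {T : RTree n}

theorem IsMulti.zero {F : Q.Fn n} (hF : IsMulti F) (p : Q.Dec T) (A : T.Vert) (i : ℤ) :
    F T (update p A ⟨i, 0⟩) = 0 := by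
  have h1 : (⟨i, 0⟩ : Q.El (Nat.card (T.In A.1))) = El.smul 0 ⟨i, 0⟩ := by simp [El.smul]
  rw [h1, hF.smul, zero_mul]

theorem bef_dAt {V : Finset (Finset (Fin n))} (r : Finset (Fin n) → Finset (Fin n) → Prop)
    (p : Q.Dec T) (A : T.Vert) (hA : A.1 ∈ V) (D : Finset (Fin n)) :
    bef V r (p.dAt A).par D = bef V r p.par D + ind (r A.1 D) := by
  rw [bef_erase hA, bef_erase hA, Dec.par_dAt_self,
    bef_congr (fun _ _ => Iff.rfl) fun C hC => p.par_dAt_of_ne A (ne_of_mem_erase hC)]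
  ring

theorem ind_add_ind {α : Type*} {V : Finset α} {r : α → α → Prop} (hr : TourOn V r) {A B : α}
    (hA : A ∈ V) (hB : B ∈ V) (hAB : A ≠ B) : ind (r A B) + ind (r B A) = 1 := by
  rcases hr.total A hA B hB hAB with h | h
  · rw [ind_true h, ind_false (hr.asymm A hA B hB h), add_zero]
  · rw [ind_true h, ind_false (hr.asymm B hB A hA h), zero_add]

theorem sg_mul_add_sg_mul {a b : ZMod 2} (h : a + b = 1) (z : k) : sg k a * z + sg k b * z = 0 := by
  obtain rfl : b = 1 + a := by linear_combination h - ZMod.add_self_two a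
  rw [sg_add, sg_one]
  ring

theorem opI_opI {F : Q.Fn n} {A B : Finset (Fin n)} (hAB : A ≠ B) (p : Q.Dec T) :
    opI A (opI B F) T p + opI B (opI A F) T p = 0 := by
  by_cases hA : A ∈ T.edges ∧ 1 < A.card
  swap
  · rw [opI_of_notMem _ _ hA]
    by_cases hB : B ∈ T.edges ∧ 1 < B.card
    · rw [opI_apply _ _ hB, opI_of_notMem _ _ hA, mul_zero, add_zero]
    · rw [opI_of_notMem _ _ hB, add_zero]
  by_cases hB : B ∈ T.edges ∧ 1 < B.card
  swap
  · rw [opI_of_notMem (A := B) _ _ hB, opI_apply _ _ hA, opI_of_notMem _ _ hB, mul_zero, add_zero]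
  have h1 : (p.dAt ⟨A, hA⟩).dAt ⟨B, hB⟩ = (p.dAt ⟨B, hB⟩).dAt ⟨A, hA⟩ := by
    have hne : (⟨A, hA⟩ : T.Vert) ≠ ⟨B, hB⟩ := fun h => hAB (congrArg Subtype.val h)
    unfold Dec.dAt
    rw [update_of_ne hne, update_of_ne hne.symm, update_comm hne]
  rw [opI_apply _ _ hA, opI_apply _ _ hB, opI_apply _ _ hB, opI_apply _ _ hA,
    bef_dAt _ p ⟨A, hA⟩ (mem_verts.2 hA), bef_dAt _ p ⟨B, hB⟩ (mem_verts.2 hB), h1, ← mul_assoc,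
    ← mul_assoc, ← sg_add, ← sg_add]
  refine sg_mul_add_sg_mul ?_ _
  have := ind_add_ind (tourOn_before T.verts) (mem_verts.2 hA) (mem_verts.2 hB) hAB
  linear_combination (norm := (ring_nf; reduce_mod_char)) this

theorem opI_opI_self (hQ : IsDGOperad Q) {F : Q.Fn n} (hF : IsMulti F) (A : Finset (Fin n))
    (p : Q.Dec T) : opI A (opI A F) T p = 0 := by
  by_cases hA : A ∈ T.edges ∧ 1 < A.card
  swap
  · rw [opI_of_notMem _ _ hA]
  have h1 : (p.dAt ⟨A, hA⟩).dAt ⟨A, hA⟩ = update p ⟨A, hA⟩ ⟨(p ⟨A, hA⟩).1 + 1 + 1, 0⟩ := by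
    unfold Dec.dAt
    rw [update_self, update_idem]
    congr 1
    exact congrArg (Sigma.mk _) (hQ.d_d _ _ _ _ _)
  rw [opI_apply _ _ hA, opI_apply _ _ hA, h1, hF.zero, mul_zero, mul_zero]

variable {A B : Finset (Fin n)}

theorem verts_inner (h : T.Inner A B) : (T.contract h.edge).verts = T.verts.erase B :=
  verts_contract T h.edge

theorem opI_opC (hQ : IsDGOperad Q) (F : Q.Fn n) {D : Finset (Fin n)} (hA : D ≠ A) (hB : D ≠ B)
    (p : Q.Dec T) : opI D (opC A B F) T p + opC A B (opI D F) T p = 0 := by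
  by_cases h : T.Inner A B
  swap
  · rw [opC_of_not _ _ h]
    by_cases hD : D ∈ T.edges ∧ 1 < D.card
    · rw [opI_apply _ _ hD, opC_of_not _ _ h, mul_zero, add_zero]
    · rw [opI_of_notMem _ _ hD, add_zero]
  by_cases hD : D ∈ T.edges ∧ 1 < D.card
  swap
  · rw [opI_of_notMem _ _ hD, opC_apply _ _ h,
      opI_of_notMem _ _ fun h' => hD ⟨(mem_contract.1 h'.1).2, h'.2⟩, mul_zero, add_zero]
  have hAV := mem_verts.2 h.1
  have hBV := mem_verts.2 h.2.1
  have hDV := mem_verts.2 hD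
  have hAB : A ≠ B := h.edge.ne
  set s := adjRel Before A B
  have hs : TourOn T.verts s := tourOn_adjRel (tourOn_before _) hAV hAB
  have hadj : IsAdj T.verts s A B := isAdj_adjRel _ _ hAB
  have hs' : TourOn (T.contract h.edge).verts s := by
    rw [verts_inner]; exact hs.mono (erase_subset _ _)
  have hD' : D ∈ (T.contract h.edge).edges ∧ 1 < D.card := ⟨mem_contract.2 ⟨hB, hD.1⟩, hD.2⟩
  have hsD : s A D ↔ s B D :=
    hadj.iff' hs hAV hBV hDV hA hB
  have hdec : (p.dAt ⟨D, hD⟩).contract h.edge = (p.contract h.edge).dAt ⟨D, hD'⟩ :=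
    Dec.contract_dAt_of_ne hQ p h.edge ⟨D, hD'⟩ hA
  have key : tw (opI D (opC A B F)) T p s + tw (opC A B (opI D F)) T p s = 0 := by
    have hb := bef_contract p h.edge hsD
    rw [tw_opI _ _ hD hs, tw_opC _ _ h hs hadj, tw_opC _ _ h hs hadj, tw_opI _ _ hD' hs',
      bef_dAt _ p ⟨D, hD⟩ hDV, Dec.par_dAt_of_ne p ⟨D, hD⟩ hA.symm, hdec, hb, ← mul_assoc,
      ← mul_assoc, ← sg_add, ← sg_add]
    refine sg_mul_add_sg_mul ?_ _
    have := ind_add_ind hs hAV hDV hA.symm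
    linear_combination (norm := (ring_nf; reduce_mod_char)) this
  rw [← tw_add] at key
  exact eq_of_tw (G := 0) (key.trans (tw_eq_zero rfl s).symm)

theorem opC_opI_upper (F : Q.Fn n) (p : Q.Dec T) : opC A B (opI B F) T p = 0 := by
  by_cases h : T.Inner A B
  · have h1 : ¬ (B ∈ (T.contract h.edge).edges ∧ 1 < B.card) := fun h' => (mem_contract.1 h'.1).1 rfl
    rw [opC_apply _ _ h, opI_of_notMem _ _ h1, mul_zero]
  · exact opC_of_not _ _ h

theorem IsAdj.bef_right {α : Type*} [DecidableEq α] {V : Finset α} {r : α → α → Prop} {A B : α}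
    (h : IsAdj V r A B) (hr : TourOn V r) (hA : A ∈ V) (hB : B ∈ V) (d : α → ZMod 2) :
    bef V r d B = bef V r d A + d A := by
  have hBA : ¬ r B A := fun h' => hr.asymm A hA B hB h.rel h'
  have hAB : A ≠ B := fun h' => hBA (by have := h.rel; rw [← h'] at this ⊢; exact this)
  have hB' : B ∈ V.erase A := mem_erase.2 ⟨hAB.symm, hB⟩
  rw [bef_erase hA, ind_true h.rel, bef_erase_self (a := A) hA hr, one_mul,
    bef_erase (a := B) hB', ind_false (fun h' => hr.asymm B hB B hB h' h'),
    bef_erase (a := A) hB', ind_false hBA, zero_mul, add_zero, add_zero]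
  congr 1
  refine sum_congr rfl fun C hC => ?_
  rw [h.iff C (mem_of_mem_erase (mem_of_mem_erase hC))
    (ne_of_mem_erase (mem_of_mem_erase hC)) (ne_of_mem_erase hC)]

theorem El.d_comp (hQ : IsDGOperad Q) {X Y Z : Type} [Finite X] [Finite Y] [Finite Z] (x : X)
    (e : {c : X // c ≠ x} ⊕ Y ≃ Z) (a : Q.El (Nat.card X)) (b : Q.El (Nat.card Y)) :
    ∃ (t : ℤ) (y z : Q.obj (Nat.card Z) t), El.comp x e a.d b = ⟨t, y⟩ ∧ El.comp x e a b.d = ⟨t, z⟩ ∧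
      (El.comp x e a b).d = ⟨t, y + sg k (a.1 : ZMod 2) • z⟩ := by
  refine ⟨a.1 + b.1 + 1, Q.setComp x e (a.1 + 1) b.1 _ (Q.d _ _ _ a.2) b.2,
    Q.setComp x e a.1 (b.1 + 1) _ a.2 (Q.d _ _ _ b.2), ?_, ?_, ?_⟩
  · exact mk_congr (show a.1 + 1 + b.1 = a.1 + b.1 + 1 by ring)
      fun t => Q.setComp x e (a.1 + 1) b.1 t (Q.d _ _ _ a.2) b.2
  · exact mk_congr (show a.1 + (b.1 + 1) = a.1 + b.1 + 1 by ring)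
      fun t => Q.setComp x e a.1 (b.1 + 1) t a.2 (Q.d _ _ _ b.2)
  · refine congrArg (Sigma.mk (a.1 + b.1 + 1)) ?_
    rw [← negOnePow_smul]
    exact hQ.leibniz _ _ _ _ _ _

theorem Dec.par_update_congr (q : Q.Dec T) (D : T.Vert) {v w : Q.El _} (h : v.1 = w.1) :
    Dec.par (update q D v) = Dec.par (update q D w) := by
  funext C
  by_cases hC : C ∈ T.edges ∧ 1 < C.card
  · rw [Dec.par, dif_pos hC, Dec.par, dif_pos hC]
    by_cases hCD : ⟨C, hC⟩ = D
    · subst hCD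
      rw [update_self, update_self, h]
    · rw [update_of_ne hCD, update_of_ne hCD]
  · rw [Dec.par, dif_neg hC, Dec.par, dif_neg hC]

theorem IsMulti.tw_update {F : Q.Fn n} (hF : IsMulti F) (q : Q.Dec T) (D : T.Vert) {t : ℤ}
    (y z : Q.obj (Nat.card (T.In D.1)) t) (c : k) (r : Finset (Fin n) → Finset (Fin n) → Prop) :
    tw F T (update q D ⟨t, y + c • z⟩) r =
      tw F T (update q D ⟨t, y⟩) r + c * tw F T (update q D ⟨t, z⟩) r := by
  have h5 : F T (update q D ⟨t, c • z⟩) = c * F T (update q D ⟨t, z⟩) := hF.smul T q D c ⟨t, z⟩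
  have h6 : Dec.par (update q D ⟨t, y⟩) = Dec.par (update q D ⟨t, z⟩) :=
    Dec.par_update_congr q D rfl
  have h7 : Dec.par (update q D ⟨t, y + c • z⟩) = Dec.par (update q D ⟨t, z⟩) :=
    Dec.par_update_congr q D rfl
  rw [tw, tw, tw, hF.add, h5, h6, h7]
  ring

theorem opI_opC_merged (hQ : IsDGOperad Q) {F : Q.Fn n} (hF : IsMulti F) (p : Q.Dec T) :
    opI A (opC A B F) T p + opI B (opC A B F) T p + opC A B (opI A F) T p = 0 := by
  by_cases h : T.Inner A B
  swap
  · have h1 : ∀ D, opI D (opC A B F) T p = 0 := fun D => by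
      by_cases hD : D ∈ T.edges ∧ 1 < D.card
      · rw [opI_apply _ _ hD, opC_of_not _ _ h, mul_zero]
      · rw [opI_of_notMem _ _ hD]
    rw [h1, h1, opC_of_not _ _ h, add_zero, add_zero]
  have hAV := mem_verts.2 h.1
  have hBV := mem_verts.2 h.2.1
  have hAB : A ≠ B := h.edge.ne
  set s := adjRel Before A B
  have hs : TourOn T.verts s := tourOn_adjRel (tourOn_before _) hAV hAB
  have hadj : IsAdj T.verts s A B := isAdj_adjRel _ _ hAB
  have hs' : TourOn (T.contract h.edge).verts s := by
    rw [verts_inner]; exact hs.mono (erase_subset _ _)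
  have hA' : A ∈ (T.contract h.edge).edges ∧ 1 < A.card := h.edge.merged.2
  have hAA : ¬ s A A := fun h' => hs.asymm A hAV A hAV h' h'
  have hBA : ¬ s B A := fun h' => hs.asymm A hAV B hBV hadj.rel h'
  have hbB := hadj.bef_right hs hAV hBV p.par
  obtain ⟨t, y, z, h1, h2, h3⟩ := El.d_comp hQ ⟨B, h.2.2⟩ (T.contractEquiv h.edge rfl)
    (p ⟨A, h.1⟩) (p ⟨B, h.2.1⟩)
  have e1 : (p.dAt ⟨A, h.1⟩).contract h.edge = update (p.contract h.edge) h.edge.merged ⟨t, y⟩ := by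
    rw [Dec.dAt, Dec.contract_update_lower p h.edge]
    exact congrArg _ h1
  have e2 : (p.dAt ⟨B, h.2.1⟩).contract h.edge = update (p.contract h.edge) h.edge.merged ⟨t, z⟩ := by
    rw [Dec.dAt, Dec.contract_update_upper p h.edge]
    exact congrArg _ h2
  have e3 : (p.contract h.edge).dAt ⟨A, hA'⟩ =
      update (p.contract h.edge) h.edge.merged ⟨t, y + sg k ((p ⟨A, h.1⟩).1 : ZMod 2) • z⟩ := by
    rw [Dec.dAt, Dec.contract_self _ _ _ rfl]
    exact congrArg _ h3
  have e4 : tw F (T.contract h.edge) ((p.contract h.edge).dAt ⟨A, hA'⟩) s =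
      tw F _ ((p.dAt ⟨A, h.1⟩).contract h.edge) s +
        sg k (1 + p.par A) * tw F _ ((p.dAt ⟨B, h.2.1⟩).contract h.edge) s := by
    have h4 : (1 + p.par A : ZMod 2) = ((p ⟨A, h.1⟩).1 : ZMod 2) := by
      rw [Dec.par_vert p ⟨A, h.1⟩]
      push_cast
      linear_combination ZMod.add_self_two (1 : ZMod 2) - ZMod.add_self_two ((p ⟨A, h.1⟩).1 : ZMod 2)
    rw [e1, e2, e3, h4]
    exact hF.tw_update _ _ _ _ _ _
  have key : tw (opI A (opC A B F)) T p s + tw (opI B (opC A B F)) T p s +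
      tw (opC A B (opI A F)) T p s = 0 := by
    have hb : bef (T.contract h.edge).verts s (p.contract h.edge).par A = bef T.verts s p.par A :=
      bef_contract_self p h.edge hs hadj.rel
    have hpA : (p.dAt ⟨A, h.1⟩).par A = p.par A + 1 := p.par_dAt_self ⟨A, h.1⟩
    rw [tw_opI _ _ h.1 hs, tw_opC _ _ h hs hadj, tw_opI _ _ h.2.1 hs, tw_opC _ _ h hs hadj,
      tw_opC _ _ h hs hadj, tw_opI _ _ hA' hs', hb, bef_dAt _ p ⟨A, h.1⟩ hAV,
      bef_dAt _ p ⟨B, h.2.1⟩ hBV, Dec.par_dAt_of_ne p ⟨B, h.2.1⟩ hAB, hpA, ind_false hAA,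
      ind_false hBA, hbB, e4]
    simp only [sg_add, sg_one, sg_zero]
    ring
  rw [← tw_add, ← tw_add] at key
  exact eq_of_tw (G := 0) (key.trans (tw_eq_zero rfl s).symm)

end Anticommute

end DGOperadData

namespace DGOperadData

variable {k : Type u} [Field k] {Q : DGOperadData.{u, v} k}

open El RTree Function

variable {n : ℕ} {T : RTree n} {A B A' B' : Finset (Fin n)}

theorem tw_add_eq_zero {F G : Q.Fn n} {p : Q.Dec T} {r : Finset (Fin n) → Finset (Fin n) → Prop}
    (h : tw F T p r + tw G T p r = 0) : F T p + G T p = 0 := by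
  rw [← tw_add] at h
  exact eq_of_tw (G := 0) (h.trans (tw_eq_zero rfl r).symm)

theorem _root_.TourOn.contract (h : T.Inner A B) {r : Finset (Fin n) → Finset (Fin n) → Prop}
    (hr : TourOn T.verts r) : TourOn (T.contract h.edge).verts r := by
  rw [verts_inner]; exact hr.mono (erase_subset _ _)

theorem IsAdj.contract (h : T.Inner A B) {r : Finset (Fin n) → Finset (Fin n) → Prop}
    (hr : IsAdj T.verts r A' B') : IsAdj (T.contract h.edge).verts r A' B' :=
  ⟨hr.rel, fun C hC => hr.iff C (by rw [verts_inner] at hC; exact mem_of_mem_erase hC)⟩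

theorem inner_contract_ne (h : T.Inner A B) (h' : (T.contract h.edge).Inner A' B') :
    A' ≠ B ∧ B' ≠ B :=
  ⟨(mem_contract.1 h'.1.1).1, (mem_contract.1 h'.2.1.1).1⟩

theorem inner_of_contract (h : T.Inner A B) (h' : (T.contract h.edge).Inner A' B') (hA : A' ≠ A) :
    T.Inner A' B' :=
  ⟨⟨(mem_contract.1 h'.1.1).2, h'.1.2⟩, ⟨(mem_contract.1 h'.2.1.1).2, h'.2.1.2⟩,
    (T.isInput_contract_of_ne h.edge (mem_contract.1 h'.1.1).2 hA B').1 h'.2.2⟩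

theorem _root_.RTree.Inner.contract (h : T.Inner A B) (h' : T.Inner A' B') (hA : A' ≠ A) (hA' : A' ≠ B)
    (hB : B' ≠ B) : (T.contract h.edge).Inner A' B' :=
  ⟨⟨mem_contract.2 ⟨hA', h'.1.1⟩, h'.1.2⟩, ⟨mem_contract.2 ⟨hB, h'.2.1.1⟩, h'.2.1.2⟩,
    (T.isInput_contract_of_ne h.edge h'.1.1 hA B').2 h'.2.2⟩

theorem _root_.RTree.Inner.contract_lower (h : T.Inner A B) (h' : T.Inner A B') (hB : B' ≠ B) :
    (T.contract h.edge).Inner A B' :=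
  ⟨⟨mem_contract.2 ⟨h.edge.ne, h'.1.1⟩, h'.1.2⟩, ⟨mem_contract.2 ⟨hB, h'.2.1.1⟩, h'.2.1.2⟩,
    (T.isInput_contract_self h.edge B').2 (Or.inl ⟨h'.2.2, hB⟩)⟩

theorem _root_.RTree.Inner.contract_upper (h : T.Inner A B) (h' : T.Inner B B') :
    (T.contract h.edge).Inner A B' :=
  ⟨⟨mem_contract.2 ⟨h.edge.ne, h.1.1⟩, h.1.2⟩,
    ⟨mem_contract.2 ⟨h'.edge.ne.symm, h'.2.1.1⟩, h'.2.1.2⟩,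
    (T.isInput_contract_self h.edge B').2 (Or.inr h'.2.2)⟩

theorem inner_or_inner (h : T.Inner A B) (h' : (T.contract h.edge).Inner A B') :
    T.Inner A B' ∨ T.Inner B B' := by
  have hB' := (mem_contract.1 h'.2.1.1).2
  rcases (T.isInput_contract_self h.edge B').1 h'.2.2 with h1 | h1
  · exact Or.inl ⟨h.1, ⟨hB', h'.2.1.2⟩, h1.1⟩
  · exact Or.inr ⟨h.2.1, ⟨hB', h'.2.1.2⟩, h1⟩

theorem opC_opC_far (hQ : IsDGOperad Q) (F : Q.Fn n) (p : Q.Dec T) (h : T.Inner A B)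
    (h' : T.Inner A' B') (hA : A' ≠ A) (h1 : A' ≠ B) (h2 : B' ≠ A) (hB : B' ≠ B) :
    opC A B (opC A' B' F) T p + opC A' B' (opC A B F) T p = 0 := by
  have hAV := mem_verts.2 h.1
  have hBV := mem_verts.2 h.2.1
  have hAV' := mem_verts.2 h'.1
  have hBV' := mem_verts.2 h'.2.1
  have hAB : A ≠ B := h.edge.ne
  have hAB' : A' ≠ B' := h'.edge.ne
  have hs₁ := tourOn_adjRel (tourOn_before T.verts) hAV hAB
  set s := adjRel (adjRel Before A B) A' B' with hsdef
  have hs : TourOn T.verts s := tourOn_adjRel hs₁ hAV' hAB'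
  have hadj' : IsAdj T.verts s A' B' := isAdj_adjRel _ _ hAB'
  have hadj : IsAdj T.verts s A B := by
    have h3 : IsAdj T.verts (adjRel Before A B) A B := isAdj_adjRel _ _ hAB
    have h5 := h3.iff' hs₁ hAV hBV hAV' hA h1
    have hrel : ∀ C D, D ≠ B' → C ≠ B' → (s C D ↔ adjRel Before A B C D) := by
      intro C D hD hC
      rw [hsdef, adjRel]
      grind
    have hrel' : ∀ D, D ≠ B' → (s B' D ↔ adjRel Before A B A' D) := by
      intro D hD
      rw [hsdef, adjRel]
      grind
    refine ⟨(hrel A B hB.symm h2.symm).2 h3.rel, fun C hC hCA hCB => ?_⟩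
    by_cases hCB' : C = B'
    · subst hCB'
      rw [hrel' A h2.symm, hrel' B hB.symm]
      exact h3.iff A' hAV' hA h1
    · rw [hrel C A h2.symm hCB', hrel C B hB.symm hCB']
      exact h3.iff C hC hCA hCB
  have hc : (T.contract h.edge).Inner A' B' := h.contract h' hA h1 hB
  have hc' : (T.contract h'.edge).Inner A B := h'.contract h hA.symm h2.symm hB.symm
  have hdec := Dec.contract_contract_far hQ p h.edge h'.edge hc.edge hc'.edge rfl rfl rfl rfl hA.symm
  have hb : bef (T.contract h.edge).verts s (p.contract h.edge).par A' = _ :=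
    bef_contract p h.edge (hadj.iff' hs hAV hBV hAV' hA h1)
  have hb' : bef (T.contract h'.edge).verts s (p.contract h'.edge).par A = _ :=
    bef_contract p h'.edge (hadj'.iff' hs hAV' hBV' hAV hA.symm h2.symm)
  have hp : (p.contract h.edge).par A' = p.par A' := Dec.par_contract_of_ne p h.edge hA h1
  have hp' : (p.contract h'.edge).par A = p.par A :=
    Dec.par_contract_of_ne p h'.edge hA.symm h2.symm
  refine tw_add_eq_zero (r := s) ?_
  rw [tw_opC _ _ h hs hadj, tw_opC _ _ hc (hs.contract h) (hadj'.contract h),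
    tw_opC _ _ h' hs hadj', tw_opC _ _ hc' (hs.contract h') (hadj.contract h'), hb, hb', hp, hp',
    tw_congr F hdec (fun _ _ _ _ => Iff.rfl), ← mul_assoc, ← mul_assoc, ← sg_add, ← sg_add]
  refine sg_mul_add_sg_mul ?_ _
  have := ind_add_ind hs hAV hAV' hA.symm
  change ind (s A A') + ind (s A' A) = 1 at this
  linear_combination (norm := (ring_nf; reduce_mod_char)) this

/-- In the order `adjRel (adjRel Before A B) B B'` the elements `A`, `B`, `B'` are consecutive. -/
theorem consecutive (r : Finset (Fin n) → Finset (Fin n) → Prop) {V : Finset (Finset (Fin n))}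
    (hr : TourOn V r) (hA : A ∈ V) (hB : B ∈ V) (hAB : A ≠ B) (hBB : B ≠ B') (hAB' : A ≠ B') :
    TourOn V (adjRel (adjRel r A B) B B') ∧ IsAdj V (adjRel (adjRel r A B) B B') A B ∧
      IsAdj (V.erase B) (adjRel (adjRel r A B) B B') A B' ∧
      IsAdj V (adjRel (adjRel r A B) B B') B B' := by
  have h1 := tourOn_adjRel hr hA hAB
  have h2 : IsAdj V (adjRel r A B) A B := isAdj_adjRel _ _ hAB
  have h3 : ∀ C D, D ≠ B' → C ≠ B' → (adjRel (adjRel r A B) B B' C D ↔ adjRel r A B C D) := by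
    intro C D hD hC
    rw [adjRel]
    grind
  have h4 : IsAdj V (adjRel (adjRel r A B) B B') B B' := isAdj_adjRel _ _ hBB
  have hs := tourOn_adjRel h1 hB hBB
  have hsAB := (h3 A B hBB hAB').2 h2.rel
  have hsAB' := (h4.iff A hA hAB hAB').1 hsAB
  have h5 : IsAdj V (adjRel (adjRel r A B) B B') A B := by
    refine ⟨hsAB, fun C hC hCA hCB => ?_⟩
    by_cases hCB' : C = B'
    · subst hCB'
      exact iff_of_false (hs.asymm A hA C hC hsAB') (hs.asymm B hB C hC h4.rel)
    · rw [h3 C A hAB' hCB', h3 C B hBB hCB']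
      exact h2.iff C hC hCA hCB
  refine ⟨hs, h5, ⟨hsAB', fun C hC hCA hCB => ?_⟩, h4⟩
  rw [h5.iff C (mem_of_mem_erase hC) hCA (ne_of_mem_erase hC)]
  exact h4.iff C (mem_of_mem_erase hC) (ne_of_mem_erase hC) hCB

theorem kz_consecutive (r : Finset (Fin n) → Finset (Fin n) → Prop) {V : Finset (Finset (Fin n))}
    (hr : TourOn V r) (hA : A ∈ V) (hB : B ∈ V) (hB' : B' ∈ V) (hBB : B ≠ B')
    (hAB' : A ≠ B') (d : Finset (Fin n) → ZMod 2) :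
    kz V (adjRel (adjRel r A B) B B') (adjRel (adjRel r A B') B' B) d = d B * d B' := by
  have hAA : ¬ r A A := fun h => hr.asymm A hA A hA h h
  rw [kz_block (U := {B}) (W := {B'}) (singleton_subset_iff.2 hB) (singleton_subset_iff.2 hB'),
    sum_singleton, sum_singleton]
  intro C hC D hD
  have h1 := hr.asymm C hC D hD
  have h2 := hr.asymm A hA D hD
  have h3 := hr.asymm C hC A hA
  rw [mem_singleton, mem_singleton]
  unfold adjRel
  by_cases h4 : C = B <;> by_cases h5 : D = B' <;> by_cases h6 : C = B' <;> by_cases h7 : D = B <;>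
    simp_all <;> grind

theorem adjRel_consecutive_iff (r : Finset (Fin n) → Finset (Fin n) → Prop) {C D : Finset (Fin n)}
    (hC : C ≠ B) (hC' : C ≠ B') (hD : D ≠ B) (hD' : D ≠ B') :
    adjRel (adjRel r A B) B B' C D ↔ adjRel (adjRel r A B') B' B C D := by
  unfold adjRel
  simp [hC, hC', hD, hD']

theorem Dec.par_update_smul (p : Q.Dec T) (D : T.Vert) (c : k) :
    Dec.par (update p D (El.smul c (p D))) = p.par := by
  rw [Dec.par_update_congr p D (v := El.smul c (p D)) (w := p D) rfl, update_eq_self]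

theorem opC_opC_par (hQ : IsDGOperad Q) {F : Q.Fn n} (hF : IsMulti F) (p : Q.Dec T)
    (h : T.Inner A B) (h' : T.Inner A B') (hB : B' ≠ B) :
    opC A B (opC A B' F) T p + opC A B' (opC A B F) T p = 0 := by
  have hAV := mem_verts.2 h.1
  have hBV := mem_verts.2 h.2.1
  have hBV' := mem_verts.2 h'.2.1
  have hAB : A ≠ B := h.edge.ne
  have hAB' : A ≠ B' := h'.edge.ne
  have hb := tourOn_before T.verts
  obtain ⟨hs, h1, h2, -⟩ := consecutive Before hb hAV hBV hAB hB.symm hAB'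
  obtain ⟨ht, h3, h4, -⟩ := consecutive Before hb hAV hBV' hAB' hB hAB
  have hkz := kz_consecutive Before hb hAV hBV hBV' hB.symm hAB' p.par
  have hst : ∀ C ∈ ((T.verts.erase B).erase B'), ∀ D ∈ ((T.verts.erase B).erase B'),
      (adjRel (adjRel Before A B) B B' C D ↔ adjRel (adjRel Before A B') B' B C D) :=
    fun C hC D hD => adjRel_consecutive_iff Before (ne_of_mem_erase (mem_of_mem_erase hC))
      (ne_of_mem_erase hC) (ne_of_mem_erase (mem_of_mem_erase hD)) (ne_of_mem_erase hD)
  generalize adjRel (adjRel Before A B) B B' = s at *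
  generalize adjRel (adjRel Before A B') B' B = t at *
  have hc : (T.contract h.edge).Inner A B' := h.contract_lower h' hB
  have hc' : (T.contract h'.edge).Inner A B := h'.contract_lower h hB.symm
  have hdec := Dec.contract_contract_par hQ p h.edge h'.edge hc.edge hc'.edge rfl rfl rfl rfl rfl
    hB.symm
  have hbs : bef (T.contract h.edge).verts s (p.contract h.edge).par A = bef T.verts s p.par A :=
    bef_contract_self p h.edge hs h1.rel
  have hbt : bef (T.contract h'.edge).verts t (p.contract h'.edge).par A = bef T.verts t p.par A :=
    bef_contract_self p h'.edge ht h3.rel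
  have hp : (p.contract h.edge).par A = p.par A + p.par B + 1 := Dec.par_contract_self p h.edge
  have hp' : (p.contract h'.edge).par A = p.par A + p.par B' + 1 := Dec.par_contract_self p h'.edge
  have hX : tw (opC A B (opC A B' F)) T p s = sg k (1 + p.par B) *
      tw F _ ((p.contract h.edge).contract hc.edge) s := by
    rw [tw_opC _ _ h hs h1, tw_opC _ _ hc (hs.contract h) (by rw [verts_inner]; exact h2),
      hbs, hp, ← mul_assoc, ← sg_add]
    congr 2
    linear_combination (norm := (ring_nf; reduce_mod_char))
  have hY : tw (opC A B' (opC A B F)) T p t = sg k (1 + p.par B') *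
      tw F _ ((p.contract h'.edge).contract hc'.edge) t := by
    rw [tw_opC _ _ h' ht h3, tw_opC _ _ hc' (ht.contract h') (by rw [verts_inner]; exact h4),
      hbt, hp', ← mul_assoc, ← sg_add]
    congr 2
    linear_combination (norm := (ring_nf; reduce_mod_char))
  have hZ : tw F _ ((p.contract h.edge).contract hc.edge) s =
      sg k ((1 + p.par B) * (1 + p.par B')) *
        tw F _ ((p.contract h'.edge).contract hc'.edge) t := by
    rw [tw_congr F hdec (r' := t), tw, tw, hF.smul, update_eq_self,
      Dec.par_update_smul,
      Dec.par_vert p ⟨B, h.2.1⟩, Dec.par_vert p ⟨B', h'.2.1⟩]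
    · push_cast
      have e1 : ∀ z : ZMod 2, 1 + (1 - z) = z := fun z => by
        linear_combination (norm := (ring_nf; reduce_mod_char))
      rw [e1, e1]
      ring
    · rw [verts_inner hc, verts_inner h]
      exact hst
  have hY' := tw_change (opC A B' (opC A B F)) p hs ht
  refine tw_add_eq_zero (r := s) ?_
  rw [hX, hY', hY, hZ, kz_comm ht hs, hkz, ← mul_assoc, ← mul_assoc, ← sg_add, ← sg_add]
  refine sg_mul_add_sg_mul ?_ _
  linear_combination (norm := (ring_nf; reduce_mod_char))

theorem opC_opC_seq (hQ : IsDGOperad Q) (F : Q.Fn n) (p : Q.Dec T)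
    (h : T.Inner A B) (h' : T.Inner B B') :
    opC A B (opC A B' F) T p + opC B B' (opC A B F) T p = 0 := by
  have hAV := mem_verts.2 h.1
  have hBV := mem_verts.2 h.2.1
  have hBV' := mem_verts.2 h'.2.1
  have hAB : A ≠ B := h.edge.ne
  have hBB : B ≠ B' := h'.edge.ne
  have hAB' : A ≠ B' := (h'.2.2.2.1.trans h.2.2.2.1).ne'
  obtain ⟨hs, h1, h2, h3⟩ := consecutive Before (tourOn_before T.verts) hAV hBV hAB hBB hAB'
  generalize adjRel (adjRel Before A B) B B' = s at *
  have hc : (T.contract h.edge).Inner A B' := h.contract_upper h'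
  have hc' : (T.contract h'.edge).Inner A B := h'.contract h hAB hAB' hBB
  have hdec := Dec.contract_contract_seq hQ p h.edge h'.edge hc.edge hc'.edge rfl rfl rfl rfl rfl
  have hb1 : bef (T.contract h.edge).verts s (p.contract h.edge).par A = bef T.verts s p.par A :=
    bef_contract_self p h.edge hs h1.rel
  have hBA : ¬ s B A := hs.asymm A hAV B hBV h1.rel
  have hBA' : ¬ s B' A := fun h4 => hs.asymm B' hBV' B hBV
    ((h1.iff B' hBV' hAB'.symm hBB.symm).1 h4) h3.rel
  have hb2 : bef (T.contract h'.edge).verts s (p.contract h'.edge).par A =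
      bef T.verts s p.par A + ind (s B A) := bef_contract p h'.edge (iff_of_false hBA hBA')
  have hp : (p.contract h.edge).par A = p.par A + p.par B + 1 := Dec.par_contract_self p h.edge
  have hp' : (p.contract h'.edge).par A = p.par A := Dec.par_contract_of_ne p h'.edge hAB hAB'
  refine tw_add_eq_zero (r := s) ?_
  rw [tw_opC _ _ h hs h1, tw_opC _ _ hc (hs.contract h) (by rw [verts_inner]; exact h2),
    tw_opC _ _ h' hs h3, tw_opC _ _ hc' (hs.contract h') (h1.contract h'), hb1, hb2, hp, hp',
    h1.bef_right hs hAV hBV, ind_false hBA, tw_congr F hdec (fun _ _ _ _ => Iff.rfl), ← mul_assoc,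
    ← mul_assoc, ← sg_add, ← sg_add]
  refine sg_mul_add_sg_mul ?_ _
  linear_combination (norm := (ring_nf; reduce_mod_char))

theorem opI_dFn (A : Finset (Fin n)) (F : Q.Fn n) (p : Q.Dec T) : opI A (dFn F) T p =
    ∑ A', opI A (opI A' F) T p + ∑ A', ∑ B', opI A (opC A' B' F) T p := by
  by_cases h : A ∈ T.edges ∧ 1 < A.card
  · simp only [opI_apply _ _ h, dFn_apply, mul_add, mul_sum]
  · simp only [opI_of_notMem _ _ h, sum_const_zero, add_zero]

theorem opC_dFn (A B : Finset (Fin n)) (F : Q.Fn n) (p : Q.Dec T) : opC A B (dFn F) T p =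
    ∑ A', opC A B (opI A' F) T p + ∑ A', ∑ B', opC A B (opC A' B' F) T p := by
  by_cases h : T.Inner A B
  · simp only [opC_apply _ _ h, dFn_apply, mul_add, mul_sum]
  · simp only [opC_of_not _ _ h, sum_const_zero, add_zero]

theorem sum_opI_opI (hQ : IsDGOperad Q) {F : Q.Fn n} (hF : IsMulti F) (p : Q.Dec T) :
    ∑ A, ∑ A', opI A (opI A' F) T p = 0 := by
  rw [← Fintype.sum_prod_type' (f := fun A A' => opI A (opI A' F) T p)]
  refine sum_involution (fun x _ => x.swap) ?_ ?_ (fun _ _ => mem_univ _) (fun _ _ => rfl)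
  · rintro ⟨A, A'⟩ -
    by_cases hA : A = A'
    · subst hA
      simp [opI_opI_self hQ hF]
    · exact opI_opI hA p
  · rintro ⟨A, A'⟩ - hne heq
    obtain rfl : A' = A := congrArg Prod.fst heq
    exact hne (opI_opI_self hQ hF _ p)

theorem sum_opI_opC (hQ : IsDGOperad Q) {F : Q.Fn n} (hF : IsMulti F) (A B : Finset (Fin n))
    (p : Q.Dec T) : ∑ D, (opI D (opC A B F) T p + opC A B (opI D F) T p) = 0 := by
  by_cases hAB : A = B
  · subst hAB
    have h0 : ∀ G : Q.Fn n, opC A A G = 0 := fun G => by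
      funext S q
      exact opC_of_not G q fun h => h.edge.ne rfl
    have h1 : ∀ D, opI D (0 : Q.Fn n) T p = 0 := fun D => by
      by_cases h : D ∈ T.edges ∧ 1 < D.card
      · rw [opI_apply _ _ h]
        exact mul_zero _
      · exact opI_of_notMem _ _ h
    exact sum_eq_zero fun D _ => by rw [h0, h0, h1]; exact add_zero _
  · rw [← add_sum_erase _ _ (mem_univ A), ← add_sum_erase _ _ (mem_erase.2 ⟨Ne.symm hAB, mem_univ B⟩),
      sum_eq_zero fun D hD => opI_opC hQ F (ne_of_mem_erase (mem_of_mem_erase hD))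
        (ne_of_mem_erase hD) p, opC_opI_upper]
    have := opI_opC_merged hQ hF (A := A) (B := B) p
    linear_combination this

/-- The other way to contract two edges, when first the edge between `x.1` and `x.2.1`, then the
edge between `x.2.2.1` and `x.2.2.2` has been contracted. -/
def otherWay (x : Finset (Fin n) × Finset (Fin n) × Finset (Fin n) × Finset (Fin n)) :
    Finset (Fin n) × Finset (Fin n) × Finset (Fin n) × Finset (Fin n) :=
  if x.2.2.1 = x.1 ∧ x.2.2.2 ⊂ x.2.1 then (x.2.1, x.2.2.2, x.1, x.2.1)
  else if x.2.2.2 = x.1 then (x.2.2.1, x.1, x.2.2.1, x.2.1)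
  else (x.2.2.1, x.2.2.2, x.1, x.2.1)

/-- Two edges that can be contracted one after the other. -/
def Twice (T : RTree n) (x : Finset (Fin n) × Finset (Fin n) × Finset (Fin n) × Finset (Fin n)) :
    Prop := ∃ h : T.Inner x.1 x.2.1, (T.contract h.edge).Inner x.2.2.1 x.2.2.2

theorem twice_cases {x : Finset (Fin n) × Finset (Fin n) × Finset (Fin n) × Finset (Fin n)}
    (hx : Twice T x) :
    (T.Inner x.1 x.2.1 ∧ T.Inner x.2.1 x.2.2.2 ∧ x.2.2.1 = x.1 ∧
      otherWay x = (x.2.1, x.2.2.2, x.1, x.2.1)) ∨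
    (T.Inner x.2.2.1 x.1 ∧ T.Inner x.1 x.2.1 ∧ x.2.2.2 = x.1 ∧
      otherWay x = (x.2.2.1, x.1, x.2.2.1, x.2.1)) ∨
    (T.Inner x.1 x.2.1 ∧ T.Inner x.2.2.1 x.2.2.2 ∧ x.2.2.1 = x.1 ∧ x.2.2.2 ≠ x.2.1 ∧
      otherWay x = (x.2.2.1, x.2.2.2, x.1, x.2.1)) ∨
    (T.Inner x.1 x.2.1 ∧ T.Inner x.2.2.1 x.2.2.2 ∧ x.2.2.1 ≠ x.1 ∧ x.2.2.1 ≠ x.2.1 ∧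
      x.2.2.2 ≠ x.1 ∧ x.2.2.2 ≠ x.2.1 ∧ otherWay x = (x.2.2.1, x.2.2.2, x.1, x.2.1)) := by
  obtain ⟨A, B, A', B'⟩ := x
  obtain ⟨h, h'⟩ := hx
  dsimp only at h h' ⊢
  have hne := inner_contract_ne h h'
  by_cases hA : A' = A
  · subst hA
    rcases inner_or_inner h h' with h1 | h1
    · refine Or.inr (Or.inr (Or.inl ⟨h, h1, rfl, hne.2, ?_⟩))
      have h2 : ¬ B' ⊂ B := fun h2 => h1.2.2.2.2 B h.2.1.1 h2 h.2.2.2.1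
      rw [otherWay, if_neg (fun h3 => h2 h3.2), if_neg h1.edge.ne.symm]
    · exact Or.inl ⟨h, h1, rfl, if_pos ⟨rfl, h1.2.2.2.1⟩⟩
  · have h1 := inner_of_contract h h' hA
    by_cases hB : B' = A
    · subst hB
      refine Or.inr (Or.inl ⟨h1, h, rfl, ?_⟩)
      rw [otherWay, if_neg (fun h3 => hA h3.1), if_pos rfl]
    · refine Or.inr (Or.inr (Or.inr ⟨h, h1, hA, hne.1, hB, hne.2, ?_⟩))
      rw [otherWay, if_neg (fun h3 => hA h3.1), if_neg hB]

theorem sum_opC_opC (hQ : IsDGOperad Q) {F : Q.Fn n} (hF : IsMulti F) (p : Q.Dec T) :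
    ∑ A, ∑ B, ∑ A', ∑ B', opC A B (opC A' B' F) T p = 0 := by
  classical
  simp only [← Fintype.sum_prod_type']
  rw [← sum_filter_of_ne (p := Twice T)]
  swap
  · rintro ⟨A, B, A', B'⟩ - hne
    have h : T.Inner A B := by
      by_contra h
      exact hne (opC_of_not _ _ h)
    refine ⟨h, ?_⟩
    by_contra h'
    exact hne ((opC_apply _ _ h).trans (by rw [opC_of_not _ _ h', mul_zero]))
  refine sum_involution (fun x _ => otherWay x) ?_ ?_ ?_ ?_
  · rintro x hx
    rcases twice_cases (mem_filter.1 hx).2 with ⟨h1, h2, h3, h4⟩ | ⟨h1, h2, h3, h4⟩ |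
      ⟨h1, h2, h3, h4, h5⟩ | ⟨h1, h2, h3, h4, h5, h6, h7⟩
    · rw [h4, h3]
      exact opC_opC_seq hQ F p h1 h2
    · rw [h4, h3, add_comm]
      exact opC_opC_seq hQ F p h1 h2
    · rw [h5]
      rw [h3] at h2 ⊢
      exact opC_opC_par hQ hF p h1 h2 h4
    · rw [h7]
      exact opC_opC_far hQ F p h1 h2 h3 h4 h5 h6
  · rintro x hx -
    obtain ⟨h, h'⟩ := (mem_filter.1 hx).2
    have hne := inner_contract_ne h h'
    rcases twice_cases (mem_filter.1 hx).2 with ⟨h1, h2, h3, h4⟩ | ⟨h1, h2, h3, h4⟩ |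
      ⟨h1, h2, h3, h4, h5⟩ | ⟨h1, h2, h3, h4, h5, h6, h7⟩
    · rw [h4]
      exact fun h5 => h1.edge.ne.symm (congrArg Prod.fst h5)
    · rw [h4]
      exact fun h5 => h1.edge.ne (congrArg Prod.fst h5)
    · rw [h5]
      exact fun h6 => h4 (congrArg (fun z => z.2.1) h6)
    · rw [h7]
      exact fun h8 => h3 (congrArg Prod.fst h8)
  · rintro x hx
    refine mem_filter.2 ⟨mem_univ _, ?_⟩
    rcases twice_cases (mem_filter.1 hx).2 with ⟨h1, h2, h3, h4⟩ | ⟨h1, h2, h3, h4⟩ |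
      ⟨h1, h2, h3, h4, h5⟩ | ⟨h1, h2, h3, h4, h5, h6, h7⟩
    · rw [h4]
      exact ⟨h2, h2.contract h1 h1.edge.ne (h2.2.2.2.1.trans h1.2.2.2.1).ne' h2.edge.ne⟩
    · rw [h4]
      exact ⟨h1, h1.contract_upper h2⟩
    · rw [h5]
      rw [h3] at h2 ⊢
      exact ⟨h2, h2.contract_lower h1 h4.symm⟩
    · rw [h7]
      exact ⟨h2, h2.contract h1 h3.symm h5.symm h6.symm⟩
  · rintro x hx
    rcases twice_cases (mem_filter.1 hx).2 with ⟨h1, h2, h3, h4⟩ | ⟨h1, h2, h3, h4⟩ |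
      ⟨h1, h2, h3, h4, h5⟩ | ⟨h1, h2, h3, h4, h5, h6, h7⟩
    · rw [h4, otherWay, if_neg (fun h5 => h1.edge.ne h5.1), if_pos rfl]
      exact Prod.ext rfl (Prod.ext rfl (Prod.ext h3.symm rfl))
    · rw [h4, otherWay, if_pos ⟨rfl, h2.2.2.2.1⟩]
      exact Prod.ext rfl (Prod.ext rfl (Prod.ext rfl h3.symm))
    · rw [h5]
      rw [h3] at h2 ⊢
      have h6 : ¬ x.2.1 ⊂ x.2.2.2 := fun h6 => h1.2.2.2.2 _ h2.2.1.1 h6 h2.2.2.2.1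
      rw [otherWay, if_neg (fun h7 => h6 h7.2), if_neg h1.edge.ne.symm]
      exact Prod.ext rfl (Prod.ext rfl (Prod.ext h3.symm rfl))
    · rw [h7, otherWay, if_neg (fun h8 => h3 h8.1.symm), if_neg h4.symm]

/-- The square of the differential is zero. -/
theorem dFn_dFn (hQ : IsDGOperad Q) {F : Q.Fn n} (hF : IsMulti F) : dFn (dFn F) = 0 := by
  funext T p
  rw [dFn_apply]
  simp only [opI_dFn, opC_dFn, sum_add_distrib]
  rw [sum_opI_opI hQ hF, sum_opC_opC hQ hF]
  have h1 : ∑ D, ∑ A, ∑ B, opI D (opC A B F) T p = ∑ A, ∑ B, ∑ D, opI D (opC A B F) T p := by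
    rw [sum_comm]
    exact sum_congr rfl fun A _ => sum_comm
  have h2 : ∑ A, ∑ B, ∑ D, opI D (opC A B F) T p + ∑ A, ∑ B, ∑ D, opC A B (opI D F) T p = 0 := by
    simp only [← sum_add_distrib]
    exact sum_eq_zero fun A _ => sum_eq_zero fun B _ => sum_opI_opC hQ hF A B p
  rw [h1, zero_add, add_zero]
  exact h2

end DGOperadData

namespace DGOperadData

variable {k : Type u} [Field k] {Q : DGOperadData.{u, v} k}

open El RTree Function

variable {n m l : ℕ}

theorem tw_dec {F : Q.Fn n} {T : RTree n} {p p' : Q.Dec T} (h : p = p')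
    (r : Finset (Fin n) → Finset (Fin n) → Prop) : tw F T p r = tw F T p' r := by rw [h]

section Relabel

variable {T : RTree l} (f : Fin n ≃ Fin l)

theorem opI_relFn (hQ : IsDGOperad Q) (A : Finset (Fin n)) (F : Q.Fn n) (p : Q.Dec T) :
    opI (A.map f.toEmbedding) (relFn f F) T p = relFn f (opI A F) T p := by
  set φ := fun A : Finset (Fin n) => A.map f.toEmbedding with hφ
  have hb := T.isBlock_map f
  have ht := tourOn_before T.verts
  have hmem : (A ∈ (T.restr φ hb).edges ∧ 1 < A.card) ↔ (φ A ∈ T.edges ∧ 1 < (φ A).card) := by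
    rw [mem_restr, hφ, card_map]
  by_cases h : A ∈ (T.restr φ hb).edges ∧ 1 < A.card
  swap
  · rw [opI_of_notMem _ _ (fun h' => h (hmem.2 h')), relFn, opI_of_notMem _ _ h, mul_zero]
  refine eq_of_tw (r := Before) ?_
  rw [tw_opI _ _ (hmem.1 h) ht, tw_relFn _ _ _ _ ht, tw_relFn _ _ _ _ ht,
    tw_opI _ _ h (tourOn_restr hb ht)]
  have h1 : bef T.verts Before p.par (φ A) = bef (T.restr φ hb).verts (Before on φ)
      (p.restr φ hb).par A := by
    rw [verts_map f T, bef_image hb.injective]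
    exact bef_congr (fun _ _ => Iff.rfl) fun C hC => (p.par_restr hb hC).symm
  have h2 : (p.dAt ⟨φ A, hmem.1 h⟩).restr φ hb = (p.restr φ hb).dAt ⟨A, h⟩ :=
    Dec.restr_dAt hQ p hb ⟨A, h⟩
  rw [h1, h2]

theorem opC_relFn (hQ : IsDGOperad Q) (A B : Finset (Fin n)) (F : Q.Fn n) (p : Q.Dec T) :
    opC (A.map f.toEmbedding) (B.map f.toEmbedding) (relFn f F) T p =
      relFn f (opC A B F) T p := by
  set φ := fun A : Finset (Fin n) => A.map f.toEmbedding with hφ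
  have hb := T.isBlock_map f
  have hmem : (T.restr φ hb).Inner A B ↔ T.Inner (φ A) (φ B) := by
    have h1 : ∀ A, 1 < (φ A).card ↔ 1 < A.card := fun A => by rw [hφ, card_map]
    rw [RTree.Inner, RTree.Inner, mem_restr, mem_restr, h1, h1]
    refine and_congr_right fun h2 => and_congr_right fun _ => hb.isInput_iff h2.2 B
  by_cases h : (T.restr φ hb).Inner A B
  swap
  · rw [opC_of_not _ _ (fun h' => h (hmem.2 h')), relFn, opC_of_not _ _ h, mul_zero]
  have h' := hmem.1 h
  set s := adjRel Before (φ A) (φ B)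
  have hs : TourOn T.verts s := tourOn_adjRel (tourOn_before _) (mem_verts.2 h'.1) h'.edge.ne
  have hadj : IsAdj T.verts s (φ A) (φ B) := isAdj_adjRel _ _ h'.edge.ne
  have hm : ∀ C ∈ (T.restr φ hb).verts, φ C ∈ T.verts := fun C hC => by
    rw [verts_map f T]; exact mem_image_of_mem _ hC
  have hadj' : IsAdj (T.restr φ hb).verts (s on φ) A B := ⟨hadj.rel, fun C hC hA hB =>
    hadj.iff _ (hm C hC) (hb.injective.ne hA) (hb.injective.ne hB)⟩
  refine eq_of_tw (r := s) ?_
  rw [tw_opC _ _ h' hs hadj, tw_relFn _ _ _ _ hs, tw_relFn _ _ _ _ (hs.contract h'),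
    tw_opC _ _ h (tourOn_restr hb hs) hadj', p.par_restr hb (mem_verts.2 h.1)]
  have h1 : bef T.verts s p.par (φ A) = bef (T.restr φ hb).verts (s on φ)
      (p.restr φ hb).par A := by
    rw [verts_map f T, bef_image hb.injective]
    exact bef_congr (fun _ _ => Iff.rfl) fun C hC => (p.par_restr hb hC).symm
  have h2 := Dec.restr_contract hQ p hb h.edge ((T.contract h'.edge).isBlock_map f)
  rw [h1, tw_congr F h2 fun _ _ _ _ => Iff.rfl]

theorem dFn_relFn (hQ : IsDGOperad Q) (F : Q.Fn n) : dFn (relFn f F) = relFn f (dFn F) := by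
  funext T p
  have h1 : ∀ G : Finset (Fin l) → k, ∑ A, G A = ∑ A : Finset (Fin n), G (A.map f.toEmbedding) :=
    fun G => (Fintype.sum_equiv f.finsetCongr _ _ fun _ => rfl).symm
  rw [dFn_apply, h1, h1]
  simp only [h1 fun B => opC _ B (relFn f F) T p, opI_relFn f hQ, opC_relFn f hQ]
  simp only [relFn, dFn_apply, mul_add, mul_sum]

theorem relFn_refl (hQ : IsDGOperad Q) (F : Q.Fn n) : relFn (Equiv.refl _) F = F := by
  funext T p
  have h1 : ∀ A : Finset (Fin n), A.map (Equiv.refl (Fin n)).toEmbedding = A := fun A => by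
    ext; simp
  refine eq_of_tw (r := Before) ?_
  rw [tw_relFn _ _ _ _ (tourOn_before _)]
  refine tw_congr F (Dec.restr_id hQ p _ h1) fun A _ B _ => ?_
  simp only [Function.onFun, h1]

theorem relFn_trans (hQ : IsDGOperad Q) (f : Fin n ≃ Fin m) (g : Fin m ≃ Fin l) (F : Q.Fn n) :
    relFn (f.trans g) F = relFn g (relFn f F) := by
  funext T p
  have h1 : ∀ A : Finset (Fin n), (A.map f.toEmbedding).map g.toEmbedding =
      A.map (f.trans g).toEmbedding := fun A => by rw [map_map]; rfl
  have ht := tourOn_before T.verts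
  refine eq_of_tw (r := Before) ?_
  rw [tw_relFn _ _ _ _ ht, tw_relFn _ _ _ _ ht,
    tw_relFn _ _ _ _ (tourOn_restr (T.isBlock_map g) ht)]
  refine tw_congr F ?_ fun A _ B _ => ?_
  · rw [Dec.restr_restr hQ]
    exact Dec.restr_congr p _ _ fun A => (h1 A).symm
  · simp only [Function.onFun, h1]

end Relabel

section Graft

variable {x : Fin n} {e : {c : Fin n // c ≠ x} ⊕ Fin m ≃ Fin l} {T : RTree l}

theorem bef_graft_outer (h : outer x e {x} ∈ T.edges) {r : Finset (Fin l) → Finset (Fin l) → Prop}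
    (hr : TourOn T.verts r) (hr' : OuterFirst T (outer x e {x}) r) (p : Q.Dec T)
    {A : Finset (Fin n)} (hA : A ∈ (T.restr _ (isBlock_outer h)).verts) :
    bef T.verts r p.par (outer x e A) = bef (T.restr _ (isBlock_outer h)).verts (r on outer x e)
      (p.restr _ (isBlock_outer h)).par A := by
  have hm : ∀ C ∈ (T.restr _ (isBlock_inner h)).verts, inner x e C ∈ T.verts := fun C hC => by
    rw [verts_graft h]; exact mem_union_right _ (mem_image_of_mem _ hC)
  have hA' : outer x e A ∈ T.verts := by
    rw [verts_graft h]; exact mem_union_left _ (mem_image_of_mem _ hA)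
  rw [bef, sum_verts_graft h, sum_eq_zero (s := (T.restr _ (isBlock_inner h)).verts), add_zero, bef]
  · exact sum_congr rfl fun C hC => by rw [p.par_restr _ hC]
  · intro C hC
    rw [ind_false, zero_mul]
    exact hr.asymm _ hA' _ (hm C hC) (hr' _ hA' _ (hm C hC)
      (outer_not_subset h (mem_verts.1 hA).2) (inner_subset C))

theorem bef_graft_inner (h : outer x e {x} ∈ T.edges) {r : Finset (Fin l) → Finset (Fin l) → Prop}
    (hr' : OuterFirst T (outer x e {x}) r) (p : Q.Dec T)
    {A : Finset (Fin m)} (hA : A ∈ (T.restr _ (isBlock_inner h)).verts) :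
    bef T.verts r p.par (inner x e A) = ∑ C ∈ (T.restr _ (isBlock_outer h)).verts,
        (p.restr _ (isBlock_outer h)).par C +
      bef (T.restr _ (isBlock_inner h)).verts (r on inner x e)
        (p.restr _ (isBlock_inner h)).par A := by
  have hm : ∀ C ∈ (T.restr _ (isBlock_outer h)).verts, outer x e C ∈ T.verts := fun C hC => by
    rw [verts_graft h]; exact mem_union_left _ (mem_image_of_mem _ hC)
  have hA' : inner x e A ∈ T.verts := by
    rw [verts_graft h]; exact mem_union_right _ (mem_image_of_mem _ hA)
  rw [bef, sum_verts_graft h, bef]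
  congr 1
  · refine sum_congr rfl fun C hC => ?_
    rw [ind_true, one_mul, p.par_restr _ hC]
    exact hr' _ (hm C hC) _ hA' (outer_not_subset h (mem_verts.1 hC).2) (inner_subset A)
  · exact sum_congr rfl fun C hC => by rw [p.par_restr _ hC]

theorem opI_graftFn_outer (hQ : IsDGOperad Q) (h : outer x e {x} ∈ T.edges) (F : Q.Fn n)
    (G : Q.Fn m) (p : Q.Dec T) (A : (T.restr _ (isBlock_outer h)).Vert) :
    opI (outer x e A.1) (graftFn x e F G) T p = graftFn x e (opI A.1 F) G T p := by
  have hb := isBlock_outer h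
  have hr := tourOn_graftRel h
  have hf : OuterFirst T (outer x e {x}) (graftRel x e) := outerFirst_graftRel
  refine eq_of_tw (r := graftRel x e) ?_
  rw [tw_opI _ _ (hb.vert A).2 hr, tw_graftFn h _ _ _ hr hf, tw_graftFn h _ _ _ hr hf,
    tw_opI _ _ A.2 (tourOn_restr hb hr), bef_graft_outer h hr hf p (mem_verts.2 A.2), mul_assoc]
  have h1 := Dec.restr_dAt hQ p hb A
  have h2 := Dec.restr_update_of_notMem p (isBlock_inner h) (hb.vert A) (fun C hC =>
    outer_not_subset h A.2.2 ((congrArg Subtype.val hC).symm.subset.trans (inner_subset C.1))) (p (hb.vert A)).d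
  have h3 : tw F _ ((p.dAt (hb.vert A)).restr _ (isBlock_outer h)) (graftRel x e on outer x e) =
      tw F _ ((p.restr _ (isBlock_outer h)).dAt A) (graftRel x e on outer x e) := tw_dec h1 _
  have h4 : tw G _ ((p.dAt (hb.vert A)).restr _ (isBlock_inner h)) (graftRel x e on inner x e) =
      tw G _ (p.restr _ (isBlock_inner h)) (graftRel x e on inner x e) := tw_dec h2 _
  rw [h3, h4]

theorem opI_graftFn_inner (hQ : IsDGOperad Q) (h : outer x e {x} ∈ T.edges) {F : Q.Fn n}
    (G : Q.Fn m) (p : Q.Dec T) {i : ZMod 2} (hF : ∀ (S : RTree n) (q : Q.Dec S), F S q ≠ 0 →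
      ∑ A ∈ S.verts, q.par A = i) (A : (T.restr _ (isBlock_inner h)).Vert) :
    opI (inner x e A.1) (graftFn x e F G) T p = sg k i * graftFn x e F (opI A.1 G) T p := by
  have hb := isBlock_inner h
  have hr := tourOn_graftRel h
  have hf : OuterFirst T (outer x e {x}) (graftRel x e) := outerFirst_graftRel
  suffices key : tw (opI (inner x e A.1) (graftFn x e F G)) T p (graftRel x e) =
      sg k i * tw (graftFn x e F (opI A.1 G)) T p (graftRel x e) by
    refine eq_of_tw (r := graftRel x e) (G := sg k i • graftFn x e F (opI A.1 G)) ?_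
    rw [tw_smul, key]
  rw [tw_opI _ _ (hb.vert A).2 hr, tw_graftFn h _ _ _ hr hf, tw_graftFn h _ _ _ hr hf,
    tw_opI _ _ A.2 (tourOn_restr hb hr), bef_graft_inner h hf p (mem_verts.2 A.2)]
  have h1 := Dec.restr_dAt hQ p hb A
  have h2 := Dec.restr_update_of_notMem p (isBlock_outer h) (hb.vert A) (fun C hC =>
    outer_not_subset h C.2.2 ((congrArg Subtype.val hC).subset.trans (inner_subset A.1))) (p (hb.vert A)).d
  have h3 : tw F _ ((p.dAt (hb.vert A)).restr _ (isBlock_outer h)) (graftRel x e on outer x e) =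
      tw F _ (p.restr _ (isBlock_outer h)) (graftRel x e on outer x e) :=
    tw_dec h2 _
  have h4 : tw G _ ((p.dAt (hb.vert A)).restr _ (isBlock_inner h)) (graftRel x e on inner x e) =
      tw G _ ((p.restr _ (isBlock_inner h)).dAt A) (graftRel x e on inner x e) :=
    tw_dec h1 _
  rw [h3, h4]
  by_cases h0 : F _ (p.restr _ (isBlock_outer h)) = 0
  · rw [tw_eq_zero h0]; ring
  · rw [hF _ _ h0, sg_add, sg_add, sg_add]; ring

theorem OuterFirst.adjRel_outer {g : Finset (Fin l)} {r : Finset (Fin l) → Finset (Fin l) → Prop}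
    (hr : OuterFirst T g r) {A B : Finset (Fin l)} (hA : A ∈ T.verts) (hA' : ¬ A ⊆ g)
    (hB : ¬ B ⊆ g) : OuterFirst T g (adjRel r A B) := by
  intro C hC D hD hCg hDg
  have h1 : D ≠ B := fun h => hB (h ▸ hDg)
  by_cases h2 : C = B
  · exact Or.inr (Or.inr (Or.inl ⟨h2, h1, hr A hA D hD hA' hDg⟩))
  · exact Or.inr (Or.inl ⟨h2, h1, hr C hC D hD hCg hDg⟩)

theorem OuterFirst.adjRel_inner {g : Finset (Fin l)} {r : Finset (Fin l) → Finset (Fin l) → Prop}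
    (hr : OuterFirst T g r) {A B : Finset (Fin l)} (hA : A ∈ T.verts) (hA' : A ⊆ g)
    (hB : B ⊆ g) : OuterFirst T g (adjRel r A B) := by
  intro C hC D hD hCg hDg
  have h1 : C ≠ B := fun h => hCg (h ▸ hB)
  by_cases h2 : D = B
  · exact Or.inr (Or.inr (Or.inr ⟨h2, h1, hr C hC A hA hCg hA'⟩))
  · exact Or.inr (Or.inl ⟨h1, h2, hr C hC D hD hCg hDg⟩)

theorem OuterFirst.contract {g : Finset (Fin l)} {r : Finset (Fin l) → Finset (Fin l) → Prop}
    (hr : OuterFirst T g r) (y : T.InnerEdge) : OuterFirst (T.contract y) g r := by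
  intro C hC D hD
  rw [verts_contract] at hC hD
  exact hr C (mem_of_mem_erase hC) D (mem_of_mem_erase hD)

theorem opC_graftFn_outer (hQ : IsDGOperad Q) (h : outer x e {x} ∈ T.edges) (F : Q.Fn n)
    (G : Q.Fn m) (p : Q.Dec T) (y : (T.restr _ (isBlock_outer h)).InnerEdge) :
    opC (outer x e y.1.1.1) (outer x e y.1.2.1) (graftFn x e F G) T p =
      graftFn x e (opC y.1.1.1 y.1.2.1 F) G T p := by
  have hb := isBlock_outer h
  have hy := inner_edge (hb.edge y)
  have hy' := inner_edge y
  have hAV := mem_verts.2 hy.1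
  have hA' := outer_not_subset h y.1.1.2.2
  have hB' := outer_not_subset h y.1.2.2.2
  set s := adjRel (graftRel x e) (outer x e y.1.1.1) (outer x e y.1.2.1)
  have hs : TourOn T.verts s := tourOn_adjRel (tourOn_graftRel h) hAV hy.edge.ne
  have hf : OuterFirst T (outer x e {x}) s := outerFirst_graftRel.adjRel_outer hAV hA' hB'
  have hadj : IsAdj T.verts s (outer x e y.1.1.1) (outer x e y.1.2.1) :=
    isAdj_adjRel _ _ hy.edge.ne
  have hm : ∀ C ∈ (T.restr _ hb).verts, outer x e C ∈ T.verts := fun C hC => by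
    rw [verts_graft h]; exact mem_union_left _ (mem_image_of_mem _ hC)
  have hadj' : IsAdj (T.restr _ hb).verts (s on outer x e) y.1.1.1 y.1.2.1 :=
    ⟨hadj.rel, fun C hC hA hB =>
      hadj.iff _ (hm C hC) (hb.injective.ne hA) (hb.injective.ne hB)⟩
  have hg : outer x e {x} ∈ (T.contract hy.edge).edges :=
    mem_contract.2 ⟨fun h' => hB' h'.symm.subset, h⟩
  refine eq_of_tw (r := s) ?_
  rw [tw_opC _ _ hy hs hadj, tw_graftFn h _ _ _ hs hf, tw_graftFn hg _ _ _ (hs.contract hy)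
    (hf.contract _), tw_opC _ _ hy' (tourOn_restr hb hs) hadj',
    bef_graft_outer h hs hf p (mem_verts.2 y.1.1.2), p.par_restr hb (mem_verts.2 y.1.1.2), mul_assoc]
  have h3 : tw F _ ((p.contract hy.edge).restr _ (isBlock_outer hg)) (s on outer x e) =
      tw F _ ((p.restr _ (isBlock_outer h)).contract y) (s on outer x e) :=
    tw_congr F (Dec.restr_contract hQ p hb y (isBlock_outer hg)) fun _ _ _ _ => Iff.rfl
  have h4 : tw G _ ((p.contract hy.edge).restr _ (isBlock_inner hg)) (s on inner x e) =
      tw G _ (p.restr _ (isBlock_inner h)) (s on inner x e) :=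
    tw_congr G (Dec.restr_contract_of_notMem hQ p (isBlock_inner h) (hb.edge y) (isBlock_inner hg)
      (fun C hC => hA' ((congrArg Subtype.val hC).symm.subset.trans (inner_subset C.1)))
      (fun C hC => hB' (hC.symm.subset.trans (inner_subset C)))) fun _ _ _ _ => Iff.rfl
  rw [h3, h4]

theorem opC_graftFn_inner (hQ : IsDGOperad Q) (h : outer x e {x} ∈ T.edges) {F : Q.Fn n}
    (G : Q.Fn m) (p : Q.Dec T) {i : ZMod 2} (hF : ∀ (S : RTree n) (q : Q.Dec S), F S q ≠ 0 →
      ∑ A ∈ S.verts, q.par A = i) (y : (T.restr _ (isBlock_inner h)).InnerEdge) :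
    opC (inner x e y.1.1.1) (inner x e y.1.2.1) (graftFn x e F G) T p =
      sg k i * graftFn x e F (opC y.1.1.1 y.1.2.1 G) T p := by
  have hb := isBlock_inner h
  have hy := inner_edge (hb.edge y)
  have hy' := inner_edge y
  have hAV := mem_verts.2 hy.1
  have hA' : inner x e y.1.1.1 ⊆ outer x e {x} := inner_subset _
  have hB' : inner x e y.1.2.1 ⊂ outer x e {x} := hy.2.2.2.1.trans_le hA'
  set s := adjRel (graftRel x e) (inner x e y.1.1.1) (inner x e y.1.2.1)
  have hs : TourOn T.verts s := tourOn_adjRel (tourOn_graftRel h) hAV hy.edge.ne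
  have hf : OuterFirst T (outer x e {x}) s := outerFirst_graftRel.adjRel_inner hAV hA' hB'.1
  have hadj : IsAdj T.verts s (inner x e y.1.1.1) (inner x e y.1.2.1) :=
    isAdj_adjRel _ _ hy.edge.ne
  have hm : ∀ C ∈ (T.restr _ hb).verts, inner x e C ∈ T.verts := fun C hC => by
    rw [verts_graft h]; exact mem_union_right _ (mem_image_of_mem _ hC)
  have hadj' : IsAdj (T.restr _ hb).verts (s on inner x e) y.1.1.1 y.1.2.1 :=
    ⟨hadj.rel, fun C hC hA hB =>
      hadj.iff _ (hm C hC) (hb.injective.ne hA) (hb.injective.ne hB)⟩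
  have hg : outer x e {x} ∈ (T.contract hy.edge).edges :=
    mem_contract.2 ⟨fun h' => hB'.2 h'.subset, h⟩
  suffices key : tw (opC (inner x e y.1.1.1) (inner x e y.1.2.1) (graftFn x e F G)) T p s =
      sg k i * tw (graftFn x e F (opC y.1.1.1 y.1.2.1 G)) T p s by
    refine eq_of_tw (r := s) (G := sg k i • graftFn x e F (opC y.1.1.1 y.1.2.1 G)) ?_
    rw [tw_smul, key]
  rw [tw_opC _ _ hy hs hadj, tw_graftFn h _ _ _ hs hf, tw_graftFn hg _ _ _ (hs.contract hy)
    (hf.contract _), tw_opC _ _ hy' (tourOn_restr hb hs) hadj',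
    bef_graft_inner h hf p (mem_verts.2 y.1.1.2), p.par_restr hb (mem_verts.2 y.1.1.2)]
  have h3 : tw F _ ((p.contract hy.edge).restr _ (isBlock_outer hg)) (s on outer x e) =
      tw F _ (p.restr _ (isBlock_outer h)) (s on outer x e) :=
    tw_congr F (Dec.restr_contract_of_notMem hQ p (isBlock_outer h) (hb.edge y) (isBlock_outer hg)
      (fun C hC => outer_not_subset h C.2.2 ((congrArg Subtype.val hC).subset.trans hA'))
      (fun C hC => by
        have h5 := (isBlock_outer h).nonempty C (hC ▸ T.nonempty _ hy.2.1.1)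
        have h6 : outer x e C ⊂ outer x e {x} := hC.subset.trans_ssubset hB'
        rw [(isBlock_outer h).ssub, ssubset_singleton_iff] at h6
        exact h5.ne_empty h6)) fun _ _ _ _ => Iff.rfl
  have h4 : tw G _ ((p.contract hy.edge).restr _ (isBlock_inner hg)) (s on inner x e) =
      tw G _ ((p.restr _ (isBlock_inner h)).contract y) (s on inner x e) :=
    tw_congr G (Dec.restr_contract hQ p hb y (isBlock_inner hg)) fun _ _ _ _ => Iff.rfl
  rw [h3, h4]
  by_cases h0 : F _ (p.restr _ (isBlock_outer h)) = 0
  · rw [tw_eq_zero h0]; ring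
  · rw [hF _ _ h0]; simp only [sg_add]; ring

theorem inner_edge_cases (h : outer x e {x} ∈ T.edges) (y : T.InnerEdge) :
    (∃ z, (isBlock_outer h).edge z = y) ∨ (∃ z, (isBlock_inner h).edge z = y) ∨
      y.1.2.1 = outer x e {x} := by
  obtain ⟨⟨⟨A, hA⟩, ⟨B, hB⟩⟩, hy⟩ := y
  have hA1 : A ∈ T.verts := mem_verts.2 hA
  have hB1 : B ∈ T.verts := mem_verts.2 hB
  rw [verts_graft h, mem_union, mem_image, mem_image] at hA1 hB1
  rcases hA1 with ⟨A', hA', rfl⟩ | ⟨A', hA', rfl⟩ <;>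
    rcases hB1 with ⟨B', hB', rfl⟩ | ⟨B', hB', rfl⟩ <;>
    have hA2 := mem_verts.1 hA' <;> have hB2 := mem_verts.1 hB'
  · exact Or.inl ⟨⟨(⟨A', hA2⟩, ⟨B', hB2⟩), ((isBlock_outer h).isInput_iff hA2.2 _).2 hy⟩, rfl⟩
  · refine Or.inr (Or.inr ?_)
    by_contra hne
    have h1 : inner x e B' ⊂ outer x e {x} := (inner_subset B').ssubset_of_ne hne
    refine hy.2.2 _ h h1 ?_
    rcases T.laminar _ hA.1 _ h with h2 | h2 | h2
    · exact absurd h2 (outer_not_subset h hA2.2)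
    · exact h2.ssubset_of_ne fun h3 => outer_not_subset h hA2.2 h3.symm.subset
    · obtain ⟨c, hc⟩ := T.nonempty _ hB.1
      exact absurd (h1.1 hc) (disjoint_left.1 h2 (hy.2.1.1 hc))
  · exact absurd (hy.2.1.1.trans (inner_subset A')) (outer_not_subset h hB2.2)
  · exact Or.inr (Or.inl ⟨⟨(⟨A', hA2⟩, ⟨B', hB2⟩), ((isBlock_inner h).isInput_iff hA2.2 _).2 hy⟩,
      rfl⟩)

theorem dFn_graftFn (hQ : IsDGOperad Q) {F : Q.Fn n} {i : ZMod 2} (hF : ∀ (S : RTree n) (q : Q.Dec S),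
      F S q ≠ 0 → ∑ A ∈ S.verts, q.par A = i) (G : Q.Fn m) :
    dFn (graftFn x e F G) = graftFn x e (dFn F) G + sg k i • graftFn x e F (dFn G) := by
  funext T p
  have hC : ∀ A B, outer x e {x} ∉ T.edges ∨ B = outer x e {x} →
      opC A B (graftFn x e F G) T p = 0 := by
    intro A B hB
    by_cases h' : T.Inner A B
    · rw [opC_apply _ _ h', graftFn_of_notMem, mul_zero]
      rw [mem_contract]
      rintro ⟨h1, h2⟩
      exact hB.elim (fun h => h h2) fun h => h1 h.symm
    · exact opC_of_not _ _ h'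
  rw [dFn_apply]
  by_cases h : outer x e {x} ∈ T.edges
  swap
  · have h1 : ∀ A, opI A (graftFn x e F G) T p = 0 := fun A => by
      by_cases h' : A ∈ T.edges ∧ 1 < A.card
      · rw [opI_apply _ _ h', graftFn_of_notMem h, mul_zero]
      · exact opI_of_notMem _ _ h'
    simp only [h1, hC _ _ (Or.inl h), sum_const_zero, Pi.add_apply, Pi.smul_apply,
      graftFn_of_notMem h, smul_zero, add_zero]
  have hsum : ∑ A, opI A (graftFn x e F G) T p =
      ∑ A, graftFn x e (opI A F) G T p + ∑ A, sg k i * graftFn x e F (opI A G) T p := by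
    have h0 : ∑ A, opI A (graftFn x e F G) T p = ∑ A ∈ T.verts, opI A (graftFn x e F G) T p :=
      (sum_subset (subset_univ _) fun A _ hA => opI_of_notMem _ p fun h' => hA (mem_verts.2 h')).symm
    rw [h0, sum_verts_graft h]
    congr 1
    · rw [sum_congr (g := fun A => graftFn x e (opI A F) G T p) rfl fun A hA =>
        opI_graftFn_outer hQ h F G p ⟨A, mem_verts.1 hA⟩]
      refine sum_subset (subset_univ _) fun A _ hA => ?_
      have h1 : opI A F _ (p.restr _ (isBlock_outer h)) = 0 :=
        opI_of_notMem _ _ fun h' => hA (mem_verts.2 h')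
      rw [graftFn, dif_pos h, h1]
      ring
    · rw [sum_congr (g := fun A => sg k i * graftFn x e F (opI A G) T p) rfl fun A hA =>
        opI_graftFn_inner hQ h G p hF ⟨A, mem_verts.1 hA⟩]
      refine sum_subset (subset_univ _) fun A _ hA => ?_
      have h1 : opI A G _ (p.restr _ (isBlock_inner h)) = 0 :=
        opI_of_notMem _ _ fun h' => hA (mem_verts.2 h')
      rw [graftFn, dif_pos h, h1]
      ring
  have hsum' : ∑ A, ∑ B, opC A B (graftFn x e F G) T p =
      ∑ A, ∑ B, graftFn x e (opC A B F) G T p +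
        ∑ A, ∑ B, sg k i * graftFn x e F (opC A B G) T p := by
    have e1 : ∑ A, ∑ B, graftFn x e (opC A B F) G T p =
        ∑ y : (T.restr _ (isBlock_outer h)).InnerEdge,
          graftFn x e (opC y.1.1.1 y.1.2.1 F) G T p := by
      simp only [graftFn, dif_pos h, ← mul_sum, ← sum_mul, sum_opC]
    have e2 : ∑ A, ∑ B, sg k i * graftFn x e F (opC A B G) T p =
        ∑ y : (T.restr _ (isBlock_inner h)).InnerEdge,
          sg k i * graftFn x e F (opC y.1.1.1 y.1.2.1 G) T p := by
      simp only [graftFn, dif_pos h, ← mul_sum, sum_opC]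
    rw [e1, e2, sum_opC]
    have key := Fintype.sum_of_injective
      (Sum.elim (isBlock_outer h).edge (isBlock_inner h).edge) ?_
      (Sum.elim (fun y => graftFn x e (opC y.1.1.1 y.1.2.1 F) G T p)
        fun y => sg k i * graftFn x e F (opC y.1.1.1 y.1.2.1 G) T p)
      (fun y : T.InnerEdge => opC y.1.1.1 y.1.2.1 (graftFn x e F G) T p) ?_ ?_
    · rw [Fintype.sum_sum_type] at key
      exact key.symm
    · have hne : ∀ y z, (isBlock_outer h).edge y ≠ (isBlock_inner h).edge z := fun y z hyz =>
        outer_not_subset h y.1.1.2.2 ((congrArg (fun w => w.1.1.1) hyz).subset.trans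
          (inner_subset z.1.1.1))
      rintro (y | y) (z | z) hyz
      · exact congrArg _ (Subtype.ext (Prod.ext
          (Subtype.ext ((isBlock_outer h).injective (congrArg (fun w => w.1.1.1) hyz)))
          (Subtype.ext ((isBlock_outer h).injective (congrArg (fun w => w.1.2.1) hyz)))))
      · exact absurd hyz (hne y z)
      · exact absurd hyz.symm (hne z y)
      · exact congrArg _ (Subtype.ext (Prod.ext
          (Subtype.ext ((isBlock_inner h).injective (congrArg (fun w => w.1.1.1) hyz)))
          (Subtype.ext ((isBlock_inner h).injective (congrArg (fun w => w.1.2.1) hyz)))))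
    · intro y hy
      refine hC _ _ (Or.inr ?_)
      rcases inner_edge_cases h y with ⟨z, rfl⟩ | ⟨z, rfl⟩ | h3
      · exact absurd ⟨Sum.inl z, rfl⟩ hy
      · exact absurd ⟨Sum.inr z, rfl⟩ hy
      · exact h3
    · rintro (y | y)
      · exact (opC_graftFn_outer hQ h F G p y).symm
      · exact (opC_graftFn_inner hQ h G p hF y).symm
  rw [hsum, hsum']
  have e1 : graftFn x e (dFn F) G T p =
      ∑ A, graftFn x e (opI A F) G T p + ∑ A, ∑ B, graftFn x e (opC A B F) G T p := by
    simp only [graftFn, dif_pos h, dFn_apply, add_mul, sum_mul, mul_add, mul_sum]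
  have e2 : graftFn x e F (dFn G) T p =
      ∑ A, graftFn x e F (opI A G) T p + ∑ A, ∑ B, graftFn x e F (opC A B G) T p := by
    simp only [graftFn, dif_pos h, dFn_apply, mul_add, mul_sum]
  rw [Pi.add_apply, Pi.add_apply, Pi.smul_apply, Pi.smul_apply, e1, e2, smul_eq_mul]
  simp only [mul_add, mul_sum]
  ring

end Graft

end DGOperadData

namespace DGOperadData

variable {k : Type u} [Field k] {Q : DGOperadData.{u, v} k}

open El RTree Function

variable {n m l : ℕ}

theorem OuterFirst.restr {T : RTree l} {φ : Finset (Fin n) → Finset (Fin l)} (hb : T.IsBlock φ)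
    {g : Finset (Fin n)} {r : Finset (Fin l) → Finset (Fin l) → Prop} (hr : OuterFirst T (φ g) r) :
    OuterFirst (T.restr φ hb) g (r on φ) := fun A hA B hB hAg hBg =>
  have hm : ∀ A ∈ (T.restr φ hb).verts, φ A ∈ T.verts := fun A hA => by
    rw [mem_verts] at hA ⊢
    exact ⟨(mem_restr hb).1 hA.1, hb.one_lt_card hA.2⟩
  hr _ (hm A hA) _ (hm B hB) (fun h => hAg ((hb.sub _ _).1 h)) ((hb.sub _ _).2 hBg)

theorem relFn_graftFn (hQ : IsDGOperad Q) {n' m' l' : ℕ} (x : Fin n)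
    (e : {c : Fin n // c ≠ x} ⊕ Fin m ≃ Fin l) (f : Fin l ≃ Fin l') (g : Fin n ≃ Fin n')
    (h : Fin m ≃ Fin m') (e' : {c : Fin n' // c ≠ g x} ⊕ Fin m' ≃ Fin l')
    (h1 : ∀ c : {c : Fin n // c ≠ x},
      f (e (Sum.inl c)) = e' (Sum.inl ⟨g c.1, fun hc => c.2 (g.injective hc)⟩))
    (h2 : ∀ c : Fin m, f (e (Sum.inr c)) = e' (Sum.inr (h c))) (F : Q.Fn n) (G : Q.Fn m) :
    relFn f (graftFn x e F G) = graftFn (g x) e' (relFn g F) (relFn h G) := by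
  have s1 : ∀ A, (outer x e A).map f.toEmbedding = outer (g x) e' (A.map g.toEmbedding) := by
    intro A
    ext z
    obtain ⟨z, rfl⟩ := f.surjective z
    obtain ⟨c | c, rfl⟩ := e.surjective z
    · rw [h1, mem_outer, collapse_inl, ← h1]
      simp [mem_outer]
    · rw [h2, mem_outer, collapse_inr, ← h2]
      simp [mem_outer]
  have s2 : ∀ B, (inner x e B).map f.toEmbedding = inner (g x) e' (B.map h.toEmbedding) := by
    intro B
    ext z
    rw [mem_inner, mem_map]
    constructor
    · rintro ⟨y, hy, rfl⟩
      obtain ⟨c, hc, rfl⟩ := mem_inner.1 hy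
      exact ⟨h c, mem_map_of_mem _ hc, (h2 c).symm⟩
    · rintro ⟨c, hc, rfl⟩
      obtain ⟨c, hc, rfl⟩ := mem_map.1 hc
      exact ⟨_, mem_inner.2 ⟨c, by simpa using hc, rfl⟩, h2 c⟩
  have s3 : (outer x e {x}).map f.toEmbedding = outer (g x) e' {g x} := by
    rw [s1, map_singleton]; rfl
  funext T p
  have hb := T.isBlock_map f
  by_cases hT : outer (g x) e' {g x} ∈ T.edges
  swap
  · rw [graftFn_of_notMem hT, relFn, graftFn_of_notMem, mul_zero]
    rwa [mem_restr, s3]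
  have hT' : outer x e {x} ∈ (T.restr _ hb).edges := by rwa [mem_restr, s3]
  have hr := tourOn_graftRel hT
  have hf : OuterFirst T (outer (g x) e' {g x}) (graftRel (g x) e') := outerFirst_graftRel
  refine eq_of_tw (r := graftRel (g x) e') ?_
  have hf' : OuterFirst T ((outer x e {x}).map f.toEmbedding) (graftRel (g x) e') := by
    rw [s3]; exact hf
  rw [tw_relFn _ _ _ _ hr, tw_graftFn hT' _ _ _ (tourOn_restr hb hr) (hf'.restr hb),
    tw_graftFn hT _ _ _ hr hf, tw_relFn _ _ _ _ (tourOn_restr _ hr),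
    tw_relFn _ _ _ _ (tourOn_restr _ hr)]
  have e1 := Dec.restr_restr hQ p hb (isBlock_outer hT')
  have e2 := Dec.restr_restr hQ p (isBlock_outer hT) ((T.restr _ (isBlock_outer hT)).isBlock_map g)
  have e3 := Dec.restr_restr hQ p hb (isBlock_inner hT')
  have e4 := Dec.restr_restr hQ p (isBlock_inner hT) ((T.restr _ (isBlock_inner hT)).isBlock_map h)
  refine congrArg₂ (fun a b : k => a * b) (tw_congr F ?_ fun A _ B _ => ?_)
    (tw_congr G ?_ fun A _ B _ => ?_)
  · exact e1.trans ((Dec.restr_congr p _ _ s1).trans e2.symm)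
  · simp only [Function.onFun, s1]
  · exact e3.trans ((Dec.restr_congr p _ _ s2).trans e4.symm)
  · simp only [Function.onFun, s2]

theorem tw_ev_cobOne (T : RTree 1) (p : Q.Dec T) (r : Finset (Fin 1) → Finset (Fin 1) → Prop) :
    tw (ev Q.cobOne) T p r = 1 := by
  have h0 : ∀ A : Finset (Fin 1), ¬ 1 < A.card := fun A => by
    have := card_le_univ A
    simpa using this
  have h1 : T.verts = ∅ := eq_empty_of_forall_notMem fun A hA => h0 A (mem_verts.1 hA).2
  have h2 : IsEmpty T.Vert := ⟨fun A => h0 _ A.2.2⟩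
  have h3 : kz T.verts Before r p.par = 0 := by rw [h1]; rfl
  rw [tw, h3, sg_zero, one_mul, ev_of_eq _ _ _ (Fintype.sum_empty _)]
  rfl

theorem graftFn_one (e : {c : Fin 1 // c ≠ 0} ⊕ Fin m ≃ Fin l)
    (f : Fin m ≃ Fin l) (hf : ∀ c : Fin m, e (Sum.inr c) = f c) (G : Q.Fn m) :
    graftFn 0 e (ev Q.cobOne) G = relFn f G := by
  have s1 : outer 0 e {0} = univ := by
    ext z
    simp [mem_outer, Subsingleton.elim (collapse 0 e z) 0]
  have s2 : ∀ B, inner 0 e B = B.map f.toEmbedding := by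
    intro B
    ext z
    rw [mem_inner, mem_map]
    simp only [hf]
    rfl
  funext T p
  have hT : outer 0 e {0} ∈ T.edges := by rw [s1]; exact T.root_mem
  have ht := tourOn_before T.verts
  refine eq_of_tw (r := Before) ?_
  rw [tw_graftFn hT _ _ _ ht fun A _ B _ hA _ => absurd (s1 ▸ subset_univ A) hA, tw_ev_cobOne,
    one_mul, tw_relFn _ _ _ _ ht]
  refine tw_congr G (Dec.restr_congr p _ _ s2) fun A _ B _ => ?_
  simp only [Function.onFun, s2]

theorem graftFn_right_one (x : Fin n)
    (e : {c : Fin n // c ≠ x} ⊕ Fin 1 ≃ Fin l) (f : Fin n ≃ Fin l)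
    (hf : ∀ c : {c : Fin n // c ≠ x}, e (Sum.inl c) = f c.1) (hf' : e (Sum.inr 0) = f x)
    (F : Q.Fn n) : graftFn x e F (ev Q.cobOne) = relFn f F := by
  have s1 : ∀ A, outer x e A = A.map f.toEmbedding := by
    intro A
    ext z
    obtain ⟨c | c, rfl⟩ := e.surjective z
    · rw [mem_outer, collapse_inl, hf]
      simp
    · rw [mem_outer, collapse_inr, Subsingleton.elim c 0, hf']
      simp
  have s2 : outer x e {x} = {f x} := by rw [s1, map_singleton]; rfl
  funext T p
  have hT : outer x e {x} ∈ T.edges := by rw [s2]; exact T.leaf_mem _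
  have ht := tourOn_before T.verts
  have ho : OuterFirst T (outer x e {x}) Before := fun A _ B hB _ hBg => by
    have h1 := card_le_card hBg
    rw [s2, card_singleton] at h1
    exact absurd (mem_verts.1 hB).2 h1.not_gt
  refine eq_of_tw (r := Before) ?_
  rw [tw_graftFn hT _ _ _ ht ho, tw_ev_cobOne, mul_one, tw_relFn _ _ _ _ ht]
  refine tw_congr F (Dec.restr_congr p _ _ s1) fun A _ B _ => ?_
  simp only [Function.onFun, s1]

theorem graftFn_assoc (hQ : IsDGOperad Q) {r p q : ℕ} (x : Fin n) (y : Fin m)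
    (e₁ : {c : Fin n // c ≠ x} ⊕ Fin m ≃ Fin p) (z : Fin p) (hz : z = e₁ (Sum.inr y))
    (e₂ : {c : Fin p // c ≠ z} ⊕ Fin r ≃ Fin l)
    (f₁ : {c : Fin m // c ≠ y} ⊕ Fin r ≃ Fin q)
    (f₂ : {c : Fin n // c ≠ x} ⊕ Fin q ≃ Fin l)
    (h1 : ∀ (c : {c : Fin n // c ≠ x}) h, e₂ (Sum.inl ⟨e₁ (Sum.inl c), h⟩) = f₂ (Sum.inl c))
    (h2 : ∀ (c : {c : Fin m // c ≠ y}) h,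
      e₂ (Sum.inl ⟨e₁ (Sum.inr c.1), h⟩) = f₂ (Sum.inr (f₁ (Sum.inl c))))
    (h3 : ∀ c : Fin r, e₂ (Sum.inr c) = f₂ (Sum.inr (f₁ (Sum.inr c))))
    (F : Q.Fn n) (G : Q.Fn m) (H : Q.Fn r) :
    graftFn z e₂ (graftFn x e₁ F G) H =
      graftFn x f₂ F (graftFn y f₁ G H) := by
  have hi : ∀ (B : Finset (Fin q)) c, f₂ (Sum.inr c) ∈ inner x f₂ B ↔ c ∈ B := fun B c => by
    simp [mem_inner]
  have hi' : ∀ (B : Finset (Fin m)) c, e₁ (Sum.inr c) ∈ inner x e₁ B ↔ c ∈ B := fun B c => by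
    simp [mem_inner]
  have hn : ∀ (B : Finset (Fin q)) c, f₂ (Sum.inl c) ∉ inner x f₂ B := fun B c => by
    simp [mem_inner]
  have hn' : ∀ (B : Finset (Fin m)) c, e₁ (Sum.inl c) ∉ inner x e₁ B := fun B c => by
    simp [mem_inner]
  have cases_l : ∀ w, (∃ c, w = f₂ (Sum.inl c) ∧ collapse z e₂ w = e₁ (Sum.inl c)) ∨
      (∃ c : {c : Fin m // c ≠ y}, w = f₂ (Sum.inr (f₁ (Sum.inl c))) ∧
        collapse z e₂ w = e₁ (Sum.inr c.1)) ∨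
      ∃ c, w = f₂ (Sum.inr (f₁ (Sum.inr c))) ∧ w = e₂ (Sum.inr c) ∧
        collapse z e₂ w = e₁ (Sum.inr y) := by
    intro w
    obtain ⟨c | c, rfl⟩ := f₂.surjective w
    · exact Or.inl ⟨c, rfl, by rw [← h1 c (by simp [hz]), collapse_inl]⟩
    obtain ⟨c | c, rfl⟩ := f₁.surjective c
    · exact Or.inr (Or.inl ⟨c, rfl, by rw [← h2 c (by simpa [hz] using c.2), collapse_inl]⟩)
    · exact Or.inr (Or.inr ⟨c, rfl, (h3 c).symm, by rw [← h3, collapse_inr, hz]⟩)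
  have s1 : ∀ A, outer z e₂ (outer x e₁ A) = outer x f₂ A := by
    intro A
    ext w
    rw [mem_outer, mem_outer, mem_outer]
    obtain ⟨c, rfl, h⟩ | ⟨c, rfl, h⟩ | ⟨c, rfl, -, h⟩ := cases_l w <;> rw [h] <;> simp
  have s2 : ∀ B, outer z e₂ (inner x e₁ B) = inner x f₂ (outer y f₁ B) := by
    intro B
    ext w
    rw [mem_outer]
    obtain ⟨c, rfl, h⟩ | ⟨c, rfl, h⟩ | ⟨c, rfl, -, h⟩ := cases_l w <;> rw [h]
    · exact iff_of_false (hn' _ _) (hn _ _)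
    · rw [hi, hi', mem_outer, collapse_inl]
    · rw [hi, hi', mem_outer, collapse_inr]
  have s3 : ∀ C, inner z e₂ C = inner x f₂ (inner y f₁ C) := by
    intro C
    ext w
    rw [mem_inner, mem_inner]
    constructor
    · rintro ⟨c, hc, rfl⟩
      exact ⟨_, mem_inner.2 ⟨c, hc, rfl⟩, (h3 c).symm⟩
    · rintro ⟨d, hd, rfl⟩
      obtain ⟨c, hc, rfl⟩ := mem_inner.1 hd
      exact ⟨c, hc, h3 c⟩
  have s4 : outer z e₂ {z} = inner x f₂ (outer y f₁ {y}) := by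
    rw [← s2]
    congr 1
    ext w
    simp [mem_inner, hz, eq_comm]
  funext T q
  by_cases hx : outer x f₂ {x} ∈ T.edges
  swap
  · rw [graftFn_of_notMem hx]
    by_cases hy : outer z e₂ {z} ∈ T.edges
    · rw [graftFn, dif_pos hy, graftFn_of_notMem, zero_mul, mul_zero]
      rwa [mem_restr, s1]
    · rw [graftFn_of_notMem hy]
  by_cases hy : outer z e₂ {z} ∈ T.edges
  swap
  · rw [graftFn_of_notMem hy, graftFn, dif_pos hx, graftFn_of_notMem, mul_zero, mul_zero]
    rwa [mem_restr, ← s4]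
  have hx' : outer x e₁ {x} ∈ (T.restr _ (isBlock_outer hy)).edges := by rwa [mem_restr, s1]
  have hy' : outer y f₁ {y} ∈ (T.restr _ (isBlock_inner hx)).edges := by rwa [mem_restr, ← s4]
  set g₁ := outer x f₂ {x} with hg₁
  set g₂ := outer z e₂ {z} with hg₂
  have hg : g₂ ⊆ g₁ := s4 ▸ inner_subset _
  have hs : TourOn T.verts (lexRel (fun A => if A ⊆ g₂ then 2 else if A ⊆ g₁ then 1 else 0)
    Before) := (tourOn_before _).lexRel _
  set s := lexRel (fun A => if A ⊆ g₂ then 2 else if A ⊆ g₁ then 1 else 0)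
    (Before : Finset (Fin l) → Finset (Fin l) → Prop) with hsd
  have ho₁ : OuterFirst T g₁ s := by
    intro A _ B _ hA hB
    left
    simp only [if_neg hA, if_neg fun h : A ⊆ g₂ => hA (h.trans hg), if_pos hB]
    split_ifs <;> omega
  have ho₂ : OuterFirst T g₂ s := by
    intro A _ B _ hA hB
    left
    simp only [if_neg hA, if_pos hB]
    split_ifs <;> omega
  have ho₃ : OuterFirst T (outer z e₂ (outer x e₁ {x})) s := by rwa [s1]
  have ho₄ : OuterFirst T (inner x f₂ (outer y f₁ {y})) s := by rwa [← s4]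
  refine eq_of_tw (r := s) ?_
  rw [tw_graftFn hy _ _ _ hs ho₂, tw_graftFn hx' _ _ _ (tourOn_restr _ hs) (ho₃.restr _),
    tw_graftFn hx _ _ _ hs ho₁, tw_graftFn hy' _ _ _ (tourOn_restr _ hs) (ho₄.restr _), mul_assoc]
  have e1 := Dec.restr_restr hQ q (isBlock_outer hy) (isBlock_outer hx')
  have e2 := Dec.restr_restr hQ q (isBlock_outer hy) (isBlock_inner hx')
  have e3 := Dec.restr_restr hQ q (isBlock_inner hx) (isBlock_outer hy')
  have e4 := Dec.restr_restr hQ q (isBlock_inner hx) (isBlock_inner hy')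
  refine congrArg₂ (fun a b : k => a * b) (tw_congr F ?_ fun A _ B _ => ?_)
    (congrArg₂ (fun a b : k => a * b) (tw_congr G ?_ fun A _ B _ => ?_)
      (tw_congr H ?_ fun A _ B _ => ?_))
  · exact e1.trans (Dec.restr_congr q _ _ s1)
  · simp only [Function.onFun, s1]
  · exact e2.trans ((Dec.restr_congr q _ _ s2).trans e3.symm)
  · simp only [Function.onFun, s2]
  · exact (Dec.restr_congr q _ _ s3).trans e4.symm
  · simp only [Function.onFun, s3]

theorem sum_filter_inner {M : Type*} [AddCommMonoid M] {x : Fin n}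
    {e : {c : Fin n // c ≠ x} ⊕ Fin m ≃ Fin l} {T : RTree l} (h : outer x e {x} ∈ T.edges)
    (F : Finset (Fin l) → M) : ∑ A ∈ T.verts with A ⊆ outer x e {x}, F A =
      ∑ A ∈ (T.restr _ (isBlock_inner h)).verts, F (inner x e A) := by
  rw [sum_filter, sum_verts_graft h, sum_eq_zero, zero_add]
  · exact sum_congr rfl fun A _ => if_pos (inner_subset A)
  · exact fun A hA => if_neg (outer_not_subset h (mem_verts.1 hA).2)

theorem block_swap {a a' b b' p q : Prop} [Decidable a] [Decidable a'] [Decidable b] [Decidable b']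
    (ha : a → ¬ a') (hb : b → ¬ b') (h : p → ¬ q) :
    (((if a' then 1 else if a then 2 else 0) < (if b' then 1 else if b then 2 else 0) ∨
        (if a' then 1 else if a then 2 else 0) = (if b' then 1 else if b then 2 else 0) ∧ p) ∧
      ((if b then 1 else if b' then 2 else 0) < (if a then 1 else if a' then 2 else 0) ∨
        (if b then 1 else if b' then 2 else 0) = (if a then 1 else if a' then 2 else 0) ∧ q)) ↔
    a' ∧ b := by
  by_cases a <;> by_cases a' <;> by_cases b <;> by_cases b' <;> simp_all

set_option maxHeartbeats 800000 in
theorem graftFn_comm (hQ : IsDGOperad Q) {r p q : ℕ} (x y : Fin n) (hxy : x ≠ y)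
    (e₁ : {c : Fin n // c ≠ x} ⊕ Fin m ≃ Fin p) (z : Fin p) (hz : z = e₁ (Sum.inl ⟨y, hxy.symm⟩))
    (e₂ : {c : Fin p // c ≠ z} ⊕ Fin r ≃ Fin l)
    (f₁ : {c : Fin n // c ≠ y} ⊕ Fin r ≃ Fin q) (z' : Fin q) (hz' : z' = f₁ (Sum.inl ⟨x, hxy⟩))
    (f₂ : {c : Fin q // c ≠ z'} ⊕ Fin m ≃ Fin l)
    (h1 : ∀ (c : Fin n) (hx : c ≠ x) (hy : c ≠ y) h h',
      e₂ (Sum.inl ⟨e₁ (Sum.inl ⟨c, hx⟩), h⟩) = f₂ (Sum.inl ⟨f₁ (Sum.inl ⟨c, hy⟩), h'⟩))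
    (h2 : ∀ (c : Fin m) h, e₂ (Sum.inl ⟨e₁ (Sum.inr c), h⟩) = f₂ (Sum.inr c))
    (h3 : ∀ (c : Fin r) h, e₂ (Sum.inr c) = f₂ (Sum.inl ⟨f₁ (Sum.inr c), h⟩))
    (F : Q.Fn n) {G : Q.Fn m} {H : Q.Fn r} {j s : ZMod 2}
    (hG : ∀ (S : RTree m) (q : Q.Dec S), G S q ≠ 0 → ∑ A ∈ S.verts, q.par A = j)
    (hH : ∀ (S : RTree r) (q : Q.Dec S), H S q ≠ 0 → ∑ A ∈ S.verts, q.par A = s) :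
    graftFn z e₂ (graftFn x e₁ F G) H =
      sg k (j * s) • graftFn z' f₂ (graftFn y f₁ F H) G := by
  have hn1 : ∀ c (hx : c ≠ x), c ≠ y → e₁ (Sum.inl ⟨c, hx⟩) ≠ z := fun c hx hy h => hy (by
    simpa [hz] using h)
  have hn2 : ∀ c (hy : c ≠ y), c ≠ x → f₁ (Sum.inl ⟨c, hy⟩) ≠ z' := fun c hx hy h => hy (by
    simpa [hz'] using h)
  have hn3 : ∀ c, e₁ (Sum.inr c) ≠ z := fun c => by simp [hz]
  have hn4 : ∀ c, f₁ (Sum.inr c) ≠ z' := fun c => by simp [hz']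
  have cases_l : ∀ w, (∃ c hx hy, collapse z e₂ w = e₁ (Sum.inl ⟨c, hx⟩) ∧
        collapse z' f₂ w = f₁ (Sum.inl ⟨c, hy⟩) ∧ (∀ C, w ∉ inner z e₂ C) ∧
        ∀ B, w ∉ inner z' f₂ B) ∨
      (∃ c, collapse z e₂ w = e₁ (Sum.inr c) ∧ collapse z' f₂ w = z' ∧
        (∀ C, w ∉ inner z e₂ C) ∧ ∀ B, w ∈ inner z' f₂ B ↔ c ∈ B) ∨
      ∃ c, collapse z e₂ w = z ∧ collapse z' f₂ w = f₁ (Sum.inr c) ∧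
        (∀ C, w ∈ inner z e₂ C ↔ c ∈ C) ∧ ∀ B, w ∉ inner z' f₂ B := by
    intro w
    obtain ⟨⟨d, hd⟩ | c, rfl⟩ := e₂.surjective w
    · obtain ⟨⟨c, hx⟩ | c, rfl⟩ := e₁.surjective d
      · have hy : c ≠ y := fun h => hd (by subst h; exact hz.symm)
        refine Or.inl ⟨c, hx, hy, ?_, ?_, ?_, ?_⟩
        · rw [collapse_inl]
        · rw [h1 c hx hy _ (hn2 c hy hx), collapse_inl]
        · simp [mem_inner]
        · rw [h1 c hx hy _ (hn2 c hy hx)]; simp [mem_inner]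
      · refine Or.inr (Or.inl ⟨c, ?_, ?_, ?_, ?_⟩)
        · rw [collapse_inl]
        · rw [h2, collapse_inr]
        · simp [mem_inner]
        · rw [h2]; simp [mem_inner]
    · refine Or.inr (Or.inr ⟨c, ?_, ?_, ?_, ?_⟩)
      · rw [collapse_inr]
      · rw [h3 c (hn4 c), collapse_inl]
      · simp [mem_inner]
      · rw [h3 c (hn4 c)]; simp [mem_inner]
  have s1 : ∀ A, outer z e₂ (outer x e₁ A) = outer z' f₂ (outer y f₁ A) := by
    intro A
    ext w
    rw [mem_outer, mem_outer, mem_outer, mem_outer]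
    obtain ⟨c, hx, hy, h, h', -⟩ | ⟨c, h, h', -⟩ | ⟨c, h, h', -⟩ := cases_l w <;> rw [h, h'] <;>
      simp [hz, hz']
  have s2 : ∀ B, outer z e₂ (inner x e₁ B) = inner z' f₂ B := by
    intro B
    ext w
    rw [mem_outer]
    obtain ⟨c, hx, hy, h, -, -, h'⟩ | ⟨c, h, -, -, h'⟩ | ⟨c, h, -, -, h'⟩ := cases_l w <;>
      rw [h]
    · exact iff_of_false (by simp [mem_inner]) (h' B)
    · rw [h']; simp [mem_inner]
    · exact iff_of_false (by simp [mem_inner, hz]) (h' B)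
  have s3 : ∀ C, inner z e₂ C = outer z' f₂ (inner y f₁ C) := by
    intro C
    ext w
    rw [mem_outer]
    obtain ⟨c, hx, hy, -, h, h', -⟩ | ⟨c, -, h, h', -⟩ | ⟨c, -, h, h', -⟩ := cases_l w <;>
      rw [h]
    · exact iff_of_false (h' C) (by simp [mem_inner])
    · exact iff_of_false (h' C) (by simp [mem_inner, hz'])
    · rw [h']; simp [mem_inner]
  have s4 : outer z e₂ (outer x e₁ {x}) = outer z' f₂ {z'} := by
    rw [s1, outer_singleton hxy, ← hz']
  have s5 : outer z' f₂ (outer y f₁ {y}) = outer z e₂ {z} := by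
    rw [← s1, outer_singleton hxy.symm, ← hz]
  funext T q
  by_cases hx : outer z' f₂ {z'} ∈ T.edges
  swap
  · rw [Pi.smul_apply, Pi.smul_apply, graftFn_of_notMem hx, smul_zero]
    by_cases hy : outer z e₂ {z} ∈ T.edges
    · rw [graftFn, dif_pos hy, graftFn_of_notMem, zero_mul, mul_zero]
      rwa [mem_restr, s4]
    · rw [graftFn_of_notMem hy]
  by_cases hy : outer z e₂ {z} ∈ T.edges
  swap
  · rw [graftFn_of_notMem hy, Pi.smul_apply, Pi.smul_apply, graftFn, dif_pos hx, graftFn_of_notMem,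
      zero_mul, mul_zero, smul_zero]
    rwa [mem_restr, s5]
  have hx' : outer x e₁ {x} ∈ (T.restr _ (isBlock_outer hy)).edges := by rwa [mem_restr, s4]
  have hy' : outer y f₁ {y} ∈ (T.restr _ (isBlock_outer hx)).edges := by rwa [mem_restr, s5]
  set gx := outer z' f₂ {z'} with hgx
  set gy := outer z e₂ {z} with hgy
  have hd : ∀ A ∈ T.verts, A ⊆ gx → ¬ A ⊆ gy := by
    intro A hA hAx hAy
    obtain ⟨w, hw⟩ := T.nonempty A (mem_verts.1 hA).1
    have h4 := mem_singleton.1 (mem_outer.1 (hAx hw))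
    have h5 := mem_singleton.1 (mem_outer.1 (hAy hw))
    obtain ⟨c, hx, hy, h, h', -⟩ | ⟨c, h, h', -⟩ | ⟨c, h, h', -⟩ := cases_l w <;>
      rw [h] at h5 <;> rw [h'] at h4 <;> simp_all
  set c : Finset (Fin l) → ℕ := fun A => if A ⊆ gx then 1 else if A ⊆ gy then 2 else 0 with hc
  set c' : Finset (Fin l) → ℕ := fun A => if A ⊆ gy then 1 else if A ⊆ gx then 2 else 0 with hc'
  have hs : TourOn T.verts (lexRel c Before) := (tourOn_before _).lexRel _
  have hs' : TourOn T.verts (lexRel c' Before) := (tourOn_before _).lexRel _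
  have ho₁ : OuterFirst T gy (lexRel c Before) := by
    intro A _ B hB hA hBg
    left
    simp only [hc, if_neg hA, if_pos hBg, if_neg fun h : B ⊆ gx => hd B hB h hBg]
    split_ifs <;> omega
  have ho₂ : OuterFirst T gx (lexRel c' Before) := by
    intro A _ B hB hA hBg
    left
    simp only [hc', if_neg hA, if_pos hBg, if_neg (hd B hB hBg)]
    split_ifs <;> omega
  have ho₃ : OuterFirst (T.restr _ (isBlock_outer hy)) (outer x e₁ {x})
      (lexRel c Before on outer z e₂) := by
    intro A hA B hB hAg hBg
    left
    have h4 := (outer_subset hy A (outer x e₁ {x})).not.2 hAg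
    have h5 := (outer_subset hy B (outer x e₁ {x})).2 hBg
    rw [s4] at h4 h5
    have h6 : ¬ outer z e₂ A ⊆ gy := outer_not_subset hy (mem_verts.1 hA).2
    simp only [hc, if_neg h4, if_pos h5, if_neg h6]
    omega
  have ho₄ : OuterFirst (T.restr _ (isBlock_outer hx)) (outer y f₁ {y})
      (lexRel c' Before on outer z' f₂) := by
    intro A hA B hB hAg hBg
    left
    have h4 := (outer_subset hx A (outer y f₁ {y})).not.2 hAg
    have h5 := (outer_subset hx B (outer y f₁ {y})).2 hBg
    rw [s5] at h4 h5
    have h6 : ¬ outer z' f₂ A ⊆ gx := outer_not_subset hx (mem_verts.1 hA).2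
    simp only [hc', if_neg h4, if_pos h5, if_neg h6]
    omega
  have key : tw (graftFn z e₂ (graftFn x e₁ F G) H) T q (lexRel c Before) =
      tw (graftFn z' f₂ (graftFn y f₁ F H) G) T q (lexRel c' Before) := by
    rw [tw_graftFn hy _ _ _ hs ho₁, tw_graftFn hx' _ _ _ (tourOn_restr _ hs) ho₃,
      tw_graftFn hx _ _ _ hs' ho₂, tw_graftFn hy' _ _ _ (tourOn_restr _ hs') ho₄, mul_right_comm]
    have e1 := Dec.restr_restr hQ q (isBlock_outer hy) (isBlock_outer hx')
    have e2 := Dec.restr_restr hQ q (isBlock_outer hy) (isBlock_inner hx')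
    have e3 := Dec.restr_restr hQ q (isBlock_outer hx) (isBlock_outer hy')
    have e4 := Dec.restr_restr hQ q (isBlock_outer hx) (isBlock_inner hy')
    have hcc : ∀ A B, c A = c B → c' A = c' B → (lexRel c Before A B ↔ lexRel c' Before A B) :=
      fun A B h h' => by simp only [lexRel, h, h', lt_irrefl]
    have hsub : ∀ {A B}, A ⊆ gx → B ⊆ gx → A ∈ T.verts → B ∈ T.verts →
        (lexRel c Before A B ↔ lexRel c' Before A B) := fun {A B} hA hB hA' hB' =>
      hcc A B (by simp only [hc, if_pos hA, if_pos hB])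
        (by simp only [hc', if_pos hA, if_pos hB, if_neg (hd A hA' hA), if_neg (hd B hB' hB)])
    have hsub' : ∀ {A B}, A ⊆ gy → B ⊆ gy → A ∈ T.verts → B ∈ T.verts →
        (lexRel c Before A B ↔ lexRel c' Before A B) := fun {A B} hA hB hA' hB' =>
      hcc A B (by simp only [hc, if_pos hA, if_pos hB, if_neg fun h : A ⊆ gx => hd A hA' h hA,
        if_neg fun h : B ⊆ gx => hd B hB' h hB]) (by simp only [hc', if_pos hA, if_pos hB])
    have hm : ∀ {A}, A ∈ (T.restr _ (isBlock_inner hx)).verts → inner z' f₂ A ∈ T.verts :=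
      fun {A} hA => by rw [verts_graft hx]; exact mem_union_right _ (mem_image_of_mem _ hA)
    have hm' : ∀ {A}, A ∈ (T.restr _ (isBlock_inner hy)).verts → inner z e₂ A ∈ T.verts :=
      fun {A} hA => by rw [verts_graft hy]; exact mem_union_right _ (mem_image_of_mem _ hA)
    refine congrArg₂ (fun a b : k => a * b) (congrArg₂ (fun a b : k => a * b)
      (tw_congr F ?_ fun A hA B hB => ?_) (tw_congr H ?_ fun A hA B hB => ?_))
      (tw_congr G ?_ fun A hA B hB => ?_)
    · exact e1.trans ((Dec.restr_congr q _ _ s1).trans e3.symm)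
    · simp only [Function.onFun, ← s1]
      have h4 : ∀ {A}, A ∈ ((T.restr _ (isBlock_outer hy)).restr _ (isBlock_outer hx')).verts →
          ¬ outer z e₂ (outer x e₁ A) ⊆ gx ∧ ¬ outer z e₂ (outer x e₁ A) ⊆ gy := by
        intro A hA
        have h5 := (mem_verts.1 hA).2
        refine ⟨?_, outer_not_subset hy ((isBlock_outer hx').one_lt_card h5)⟩
        rw [← s4, outer_subset hy]
        exact outer_not_subset hx' h5
      refine hcc _ _ ?_ ?_
      · simp only [hc, if_neg (h4 hA).1, if_neg (h4 hB).1, if_neg (h4 hA).2, if_neg (h4 hB).2]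
      · simp only [hc', if_neg (h4 hA).1, if_neg (h4 hB).1, if_neg (h4 hA).2, if_neg (h4 hB).2]
    · exact (Dec.restr_congr q _ _ s3).trans e4.symm
    · simp only [Function.onFun, ← s3]
      exact hsub' (inner_subset _) (inner_subset _) (hm' hA) (hm' hB)
    · exact e2.trans (Dec.restr_congr q _ _ s2)
    · simp only [Function.onFun, s2]
      have h6 : ∀ {A}, A ∈ ((T.restr _ (isBlock_outer hy)).restr _ (isBlock_inner hx')).verts →
          A ∈ (T.restr _ (isBlock_inner hx)).verts := fun {A} hA => by
        rw [mem_verts, mem_restr, mem_restr, s2] at hA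
        rw [mem_verts, mem_restr]
        exact hA
      exact hsub (inner_subset _) (inner_subset _) (hm (h6 hA)) (hm (h6 hB))
  refine eq_of_tw (r := lexRel c Before) ?_
  rw [key, tw_smul]
  by_cases h0 : graftFn z' f₂ (graftFn y f₁ F H) G T q = 0
  · rw [tw_eq_zero h0, tw_eq_zero h0, mul_zero]
  rw [tw_change _ q hs hs', ← mul_assoc, ← sg_add]
  suffices hk : kz T.verts (lexRel c' Before) (lexRel c Before) q.par = s * j by
    rw [hk, mul_comm s, ZMod.add_self_two, sg_zero, one_mul]
  rw [graftFn, dif_pos hx] at h0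
  have h4 := hG _ _ (right_ne_zero_of_mul (right_ne_zero_of_mul h0))
  have h5 := left_ne_zero_of_mul (right_ne_zero_of_mul h0)
  rw [graftFn, dif_pos hy'] at h5
  have h6 := hH _ _ (right_ne_zero_of_mul (right_ne_zero_of_mul h5))
  rw [kz_block (U := T.verts.filter (· ⊆ gy)) (W := T.verts.filter (· ⊆ gx)) (filter_subset _ _)
    (filter_subset _ _), sum_filter_inner hy, sum_filter_inner hx]
  · refine congrArg₂ (fun a b : ZMod 2 => a * b) ?_ ?_
    · rw [← h6]
      have h7 : (T.restr _ (isBlock_inner hy)).verts =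
          ((T.restr _ (isBlock_outer hx)).restr _ (isBlock_inner hy')).verts := by
        ext A
        rw [mem_verts, mem_verts, mem_restr, mem_restr, mem_restr, s3]
      rw [h7]
      refine sum_congr rfl fun A hA => ?_
      rw [Dec.par_restr _ _ hA, Dec.par_restr, s3]
      rw [mem_verts, mem_restr] at hA
      exact mem_verts.2 ⟨hA.1, (isBlock_inner hy').one_lt_card hA.2⟩
    · rw [← h4]
      exact sum_congr rfl fun A hA => (Dec.par_restr _ _ hA).symm
  · intro A hA B hB
    simp only [lexRel, hc, hc', mem_filter, hA, hB, true_and]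
    exact block_swap (hd A hA) (hd B hB) ((tourOn_before T.verts).asymm A hA B hB)

end DGOperadData

namespace DGOperadData

variable {k : Type u} [Field k] {Q : DGOperadData.{u, v} k}

open El RTree Function

theorem RTree_zero_empty (T : RTree 0) : False := by
  obtain ⟨c, -⟩ := T.nonempty _ T.root_mem
  exact c.elim0

section Cob

variable {n m l : ℕ} {i j t : ℤ}

theorem cob_ext {α β : Q.cob.obj n i} (h : ev α = ev β) : α = β :=
  ev_ext fun T p => congrFun (congrFun h T) p

theorem ev_relabel (f : Fin n ≃ Fin l) (α : Q.cob.obj n i) :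
    ev (Q.cob.relabel f i α) = relFn f (ev α) := ev_cobRelabel f i α

theorem ev_comp {x : Fin n} {e : {c : Fin n // c ≠ x} ⊕ Fin m ≃ Fin l} (ht : i + j = t)
    (α : Q.cob.obj n i) (β : Q.cob.obj m j) :
    ev (Q.cob.comp x e i j t α β) = graftFn x e (ev α) (ev β) := ev_cobComp ht α β

theorem ev_d (h : i + 1 = j) (α : Q.cob.obj n i) : ev (Q.cob.d n i j α) = dFn (ev α) :=
  ev_cobD h α

theorem cob_comp_of_ne (x : Fin n) (e : {c : Fin n // c ≠ x} ⊕ Fin m ≃ Fin l) (ht : i + j ≠ t) :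
    Q.cob.comp x e i j t = 0 := cobComp_of_ne ht

theorem cob_d_of_ne (h : i + 1 ≠ j) : Q.cob.d n i j = 0 := cobD_of_ne h

theorem ev_add' (α β : Q.cob.obj n i) : ev (α + β) = ev α + ev β := ev_add α β

theorem ev_smul' (c : k) (α : Q.cob.obj n i) : ev (c • α) = c • ev α := ev_smul c α

theorem ev_zero' : ev (0 : Q.cob.obj n i) = 0 := ev_zero

theorem isMulti_ev' (α : Q.cob.obj n i) : IsMulti (ev α) := isMulti_ev α

theorem sum_par_of_ev' (α : Q.cob.obj n i) (T : RTree n) (p : Q.Dec T) (h : ev α T p ≠ 0) :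
    ∑ A ∈ T.verts, p.par A = (i : ZMod 2) := sum_par_of_ev α T p h

end Cob

theorem isDGOperad_cob (hQ : IsDGOperad Q) : IsDGOperad Q.cob where
  obj_zero i := ⟨fun a b => funext fun T => (RTree_zero_empty T).elim⟩
  comp_shape x e i j t h := cob_comp_of_ne x e h
  d_shape n i j h := cob_d_of_ne h
  relabel_refl i a := cob_ext (by rw [ev_relabel, relFn_refl hQ])
  relabel_trans f g i a := cob_ext (by rw [ev_relabel, ev_relabel, ev_relabel, relFn_trans hQ])
  relabel_comp x e f g h e' h1 h2 i j t a b := by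
    by_cases ht : i + j = t
    · refine cob_ext ?_
      rw [ev_relabel, ev_comp ht, ev_comp ht, ev_relabel, ev_relabel,
        relFn_graftFn hQ x e f g h e' h1 h2]
    · rw [cob_comp_of_ne _ _ ht, cob_comp_of_ne _ _ ht]
      simp
  one_comp e f h j b := cob_ext (by
    rw [ev_comp (zero_add j), ev_relabel]
    exact graftFn_one e f h _)
  comp_one x e f h h' i a := cob_ext (by
    rw [ev_comp (add_zero i), ev_relabel]
    exact graftFn_right_one x e f h h' _)
  comp_assoc x y e₁ e₂ f₁ f₂ h1 h2 h3 i j s a b c := cob_ext (by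
    rw [ev_comp rfl, ev_comp rfl, ev_comp (add_assoc i j s).symm, ev_comp rfl,
      graftFn_assoc hQ x y e₁ _ rfl e₂ f₁ f₂ (fun c _ => h1 c) (fun c _ => h2 c) h3])
  comp_comm x y hxy e₁ e₂ f₁ f₂ h1 h2 h3 i j s a b c := cob_ext (by
    rw [negOnePow_smul (k := k), Int.cast_mul, ev_smul', ev_comp rfl, ev_comp rfl,
      ev_comp (add_right_comm i s j), ev_comp rfl, graftFn_comm hQ x y hxy e₁ _ rfl e₂ f₁ _ rfl f₂
        (fun c hx hy _ _ => h1 c hx hy) (fun c _ => h2 c) (fun c _ => h3 c) _ (sum_par_of_ev' b)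
        (sum_par_of_ev' c)])
  d_d n i j t a := by
    by_cases h : i + 1 = j
    · by_cases h' : j + 1 = t
      · exact cob_ext (by rw [ev_d h', ev_d h, dFn_dFn hQ (isMulti_ev' a), ev_zero'])
      · rw [cob_d_of_ne h', LinearMap.zero_apply]
    · rw [cob_d_of_ne h, LinearMap.zero_apply, map_zero]
  d_relabel f i j a := by
    by_cases h : i + 1 = j
    · exact cob_ext (by rw [ev_d h, ev_relabel, ev_relabel, ev_d h, dFn_relFn f hQ])
    · rw [cob_d_of_ne h, cob_d_of_ne h, LinearMap.zero_apply, LinearMap.zero_apply, map_zero]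
  leibniz x e i j a b := cob_ext (by
    rw [negOnePow_smul (k := k), ev_add', ev_smul', ev_d rfl, ev_comp rfl, ev_comp (by ring),
      ev_comp (by ring), ev_d rfl, ev_d rfl, dFn_graftFn hQ (sum_par_of_ev' a)])

end DGOperadData

section Concentrated

variable {k : Type u} [Field k] {V : Type v} [AddCommGroup V] [Module k V]

variable (k) in
theorem concProj_zero_coe (a : V) : (concProj k V 0 a : V) = a := by simp [concProj]

theorem concProj_coe_zero (a : conc k V 0) : concProj k V 0 a = a := Subtype.ext (concProj_zero_coe k _)

theorem concProj_of_ne {i : ℤ} (hi : i ≠ 0) (a : V) : concProj k V i a = 0 := by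
  simp [concProj, hi]

theorem subsingleton_conc {i : ℤ} (hi : i ≠ 0) : Subsingleton (conc k V i) := by
  rw [conc, if_neg hi]
  infer_instance

theorem conc_eq_zero {i : ℤ} (hi : i ≠ 0) (a : conc k V i) : a = 0 :=
  (subsingleton_conc hi).elim _ _

end Concentrated

theorem Operad.toDG_eq_zero {k : Type u} [Field k] (P : Operad.{u, v} k) {n : ℕ} {i : ℤ}
    (hi : i ≠ 0) (a : P.toDG.obj n i) : a = 0 := conc_eq_zero hi a

theorem Operad.isDGOperad_toDG {k : Type u} [Field k] (P : Operad.{u, v} k) :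
    IsDGOperad P.toDG where
  obj_zero i := by
    have := P.obj_zero
    exact ⟨fun a b => Subtype.ext (Subsingleton.elim _ _)⟩
  comp_shape x e i j t h := by
    refine LinearMap.ext₂ fun a b => ?_
    by_cases hi : i = 0
    · by_cases hj : j = 0
      · exact concProj_of_ne (fun ht => h (by rw [hi, hj, ht, add_zero])) _
      · rw [P.toDG_eq_zero hj b]; simp only [map_zero, LinearMap.zero_apply]
    · rw [P.toDG_eq_zero hi a]; simp only [map_zero, LinearMap.zero_apply]
  d_shape _ _ _ _ := rfl
  relabel_refl i a := by
    by_cases hi : i = 0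
    · subst hi
      exact Subtype.ext ((concProj_zero_coe k _).trans (P.relabel_refl _))
    · exact (subsingleton_conc hi).elim _ _
  relabel_trans f g i a := by
    by_cases hi : i = 0
    · subst hi
      refine Subtype.ext ((concProj_zero_coe k _).trans ((P.relabel_trans f g _).trans
        (Eq.trans ?_ (concProj_zero_coe k _).symm)))
      exact congrArg (P.relabel g) (concProj_zero_coe k _).symm
    · exact (subsingleton_conc hi).elim _ _
  relabel_comp x e f g h e' h1 h2 i j t a b := by
    by_cases ht : t = 0
    swap
    · exact (subsingleton_conc ht).elim _ _
    by_cases hi : i = 0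
    swap
    · rw [P.toDG_eq_zero hi a]; simp only [map_zero, LinearMap.zero_apply]
    by_cases hj : j = 0
    swap
    · rw [P.toDG_eq_zero hj b]; simp only [map_zero]
    subst hi hj ht
    refine Subtype.ext ((concProj_zero_coe k _).trans (Eq.trans (congrArg (P.relabel f)
      (concProj_zero_coe k _)) ((P.relabel_comp x e f g h e' h1 h2 _ _).trans
        (Eq.trans ?_ (concProj_zero_coe k _).symm))))
    exact congrArg₂ (fun a b => P.comp (g x) e' a b) (concProj_zero_coe k _).symm
      (concProj_zero_coe k _).symm
  one_comp e f h j b := by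
    by_cases hj : j = 0
    · subst hj
      refine Subtype.ext ((concProj_zero_coe k _).trans (Eq.trans ?_ ((P.one_comp e f h b.1).trans
        (concProj_zero_coe k _).symm)))
      exact congrArg (fun a => P.comp 0 e a b.1) (concProj_zero_coe k _)
    · exact (subsingleton_conc hj).elim _ _
  comp_one x e f h h' i a := by
    by_cases hi : i = 0
    · subst hi
      refine Subtype.ext ((concProj_zero_coe k _).trans (Eq.trans ?_ ((P.comp_one x e f h h' a.1).trans
        (concProj_zero_coe k _).symm)))
      exact congrArg (fun b => P.comp x e a.1 b) (concProj_zero_coe k _)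
    · exact (subsingleton_conc hi).elim _ _
  comp_assoc x y e₁ e₂ f₁ f₂ h1 h2 h3 i j s a b c := by
    by_cases hi : i = 0
    swap
    · rw [P.toDG_eq_zero hi a]; simp only [map_zero, LinearMap.zero_apply]
    by_cases hj : j = 0
    swap
    · rw [P.toDG_eq_zero hj b]; simp only [map_zero, LinearMap.zero_apply]
    by_cases hs : s = 0
    swap
    · rw [P.toDG_eq_zero hs c]; simp only [map_zero]
    subst hi hj hs
    refine Subtype.ext ((concProj_zero_coe k _).trans (Eq.trans ?_
      ((P.comp_assoc x y e₁ e₂ f₁ f₂ h1 h2 h3 a.1 b.1 c.1).trans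
        (Eq.trans ?_ (concProj_zero_coe k _).symm))))
    · exact congrArg (fun a => P.comp _ e₂ a c.1) (concProj_zero_coe k _)
    · exact congrArg (fun b => P.comp x f₂ a.1 b) (concProj_zero_coe k _).symm
  comp_comm x y hxy e₁ e₂ f₁ f₂ h1 h2 h3 i j s a b c := by
    by_cases hi : i = 0
    swap
    · rw [P.toDG_eq_zero hi a]; simp only [map_zero, LinearMap.zero_apply, smul_zero]
    by_cases hj : j = 0
    swap
    · rw [P.toDG_eq_zero hj b]; simp only [map_zero, LinearMap.zero_apply, smul_zero]
    by_cases hs : s = 0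
    swap
    · rw [P.toDG_eq_zero hs c]; simp only [map_zero, LinearMap.zero_apply, smul_zero]
    subst hi hj hs
    rw [mul_zero, Int.negOnePow_zero, one_smul]
    refine Subtype.ext ((concProj_zero_coe k _).trans (Eq.trans ?_
      ((P.comp_comm x y hxy e₁ e₂ f₁ f₂ h1 h2 h3 a.1 b.1 c.1).trans
        (Eq.trans ?_ (concProj_zero_coe k _).symm))))
    · exact congrArg (fun a => P.comp _ e₂ a c.1) (concProj_zero_coe k _)
    · exact congrArg (fun a => P.comp _ f₂ a b.1) (concProj_zero_coe k _).symm
  d_d _ _ _ _ _ := rfl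
  d_relabel f i j a := (map_zero (P.toDG.relabel f j)).symm
  leibniz x e i j a b := by
    have h1 : ∀ n i j (a : P.toDG.obj n i), P.toDG.d n i j a = 0 := fun _ _ _ _ => rfl
    simp only [h1, map_zero, LinearMap.zero_apply, smul_zero, add_zero]

/-! ### The subtree of the inputs of a vertex -/

namespace RTree

variable {n m : ℕ}

theorem exists_isInput (T : RTree n) {A : Finset (Fin n)} (hA : 1 < A.card) {z : Fin n}
    (hz : z ∈ A) : ∃ B, T.IsInput A B ∧ z ∈ B := by
  have hne : (T.edges.filter fun B => B ⊂ A ∧ z ∈ B).Nonempty := by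
    refine ⟨{z}, mem_filter.2 ⟨T.leaf_mem z, ?_, mem_singleton_self z⟩⟩
    refine (singleton_subset_iff.2 hz).ssubset_of_ne fun h => ?_
    rw [← h, card_singleton] at hA
    exact lt_irrefl _ hA
  obtain ⟨B, hB, hmax⟩ := exists_max_image _ card hne
  rw [mem_filter] at hB
  refine ⟨B, ⟨hB.1, hB.2.1, fun C hC hBC hCA => ?_⟩, hB.2.2⟩
  exact (card_lt_card hBC).not_ge (hmax C (mem_filter.2 ⟨hC, hCA, hBC.1 hB.2.2⟩))

theorem IsInput.disjoint {T : RTree n} {A B B' : Finset (Fin n)} (h : T.IsInput A B)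
    (h' : T.IsInput A B') (hne : B ≠ B') : Disjoint B B' := by
  rcases T.laminar B h.1 B' h'.1 with h1 | h1 | h1
  · exact absurd h'.2.1 (h.2.2 B' h'.1 (h1.ssubset_of_ne hne))
  · exact absurd h.2.1 (h'.2.2 B h.1 (h1.ssubset_of_ne hne.symm))
  · exact h1

/-- The union of a set of inputs of `A`. -/
noncomputable def sub (T : RTree n) (A : Finset (Fin n)) (Y : Finset (Fin (Nat.card (T.In A)))) :
    Finset (Fin n) := Y.biUnion fun c => ((Finite.equivFin (T.In A)).symm c).1

theorem sub_singleton (T : RTree n) (A : Finset (Fin n)) (c : Fin (Nat.card (T.In A))) :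
    T.sub A {c} = ((Finite.equivFin (T.In A)).symm c).1 := singleton_biUnion

theorem isInput_sub (T : RTree n) (A : Finset (Fin n)) (c : Fin (Nat.card (T.In A))) :
    T.IsInput A (T.sub A {c}) := by
  rw [sub_singleton]
  exact ((Finite.equivFin (T.In A)).symm c).2

theorem IsInput.exists_sub {T : RTree n} {A B : Finset (Fin n)} (h : T.IsInput A B) :
    ∃ c, T.sub A {c} = B :=
  ⟨Finite.equivFin (T.In A) ⟨B, h⟩, by rw [sub_singleton, Equiv.symm_apply_apply]⟩

theorem sub_eq_biUnion (T : RTree n) (A : Finset (Fin n)) (Y : Finset (Fin (Nat.card (T.In A)))) :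
    T.sub A Y = Y.biUnion fun c => T.sub A {c} := by
  simp only [sub_singleton]
  rfl

theorem sub_univ (T : RTree n) {A : Finset (Fin n)} (hA : 1 < A.card) : T.sub A univ = A := by
  ext z
  rw [sub_eq_biUnion, mem_biUnion]
  constructor
  · rintro ⟨c, -, hz⟩
    exact (T.isInput_sub A c).2.1.1 hz
  · intro hz
    obtain ⟨B, hB, hzB⟩ := T.exists_isInput hA hz
    obtain ⟨c, rfl⟩ := hB.exists_sub
    exact ⟨c, mem_univ _, hzB⟩

theorem isBlock_sub {T S : RTree n} (h : T.edges ⊆ S.edges) (A : T.Vert) :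
    S.IsBlock (T.sub A.1) where
  union Y := T.sub_eq_biUnion A.1 Y
  disj c c' hc := by
    refine (T.isInput_sub A.1 c).disjoint (T.isInput_sub A.1 c') fun h => hc ?_
    rw [sub_singleton, sub_singleton] at h
    exact (Finite.equivFin (T.In A.1)).symm.injective (Subtype.ext h)
  leaf c := h (T.isInput_sub A.1 c).1
  root := by
    rw [T.sub_univ A.2.2]
    exact h A.2.1

theorem eq_of_verts {T S : RTree n} (h : T.verts = S.verts) : T = S := by
  have key : ∀ {T S : RTree n}, T.verts = S.verts → ∀ A ∈ T.edges, A ∈ S.edges := by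
    intro T S h A hA
    by_cases h1 : 1 < A.card
    · exact (mem_verts.1 (h ▸ mem_verts.2 ⟨hA, h1⟩)).1
    · obtain ⟨c, rfl⟩ := card_eq_one.1 ((not_lt.1 h1).antisymm (T.nonempty A hA).card_pos)
      exact S.leaf_mem c
  exact eq_of_edges fun A => ⟨key h A, key h.symm A⟩

/-- The tree formed by the edges of `S` below the inputs of the vertex `A` of a tree `T`
with fewer edges. -/
noncomputable abbrev part {T S : RTree n} (h : T.edges ⊆ S.edges) (A : T.Vert) :
    RTree (Nat.card (T.In A.1)) := S.restr (T.sub A.1) (isBlock_sub h A)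

theorem one_lt_card_in (T : RTree n) (A : T.Vert) : 1 < Nat.card (T.In A.1) := by
  by_contra! h
  have h1 : (univ : Finset (Fin (Nat.card (T.In A.1)))).card ≤ 1 := by simpa using h
  rcases (T.nonempty _ A.2.1) with ⟨z, hz⟩
  rw [← T.sub_univ A.2.2, sub_eq_biUnion, mem_biUnion] at hz
  obtain ⟨c, -, -⟩ := hz
  have h2 : (univ : Finset (Fin (Nat.card (T.In A.1)))) = {c} :=
    eq_singleton_iff_unique_mem.2 ⟨mem_univ _, fun d _ => card_le_one.1 h1 _ (mem_univ _) _ (mem_univ _)⟩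
  have h3 := T.sub_univ A.2.2
  rw [h2] at h3
  exact (T.isInput_sub A.1 c).2.1.ne h3

theorem eq_univ_or_of_sub_mem {T : RTree n} (A : T.Vert) {Y : Finset (Fin (Nat.card (T.In A.1)))}
    (h : T.sub A.1 Y ∈ T.edges) : Y = univ ∨ ∃ c, Y = {c} := by
  have hb := isBlock_sub (subset_refl T.edges) A
  by_cases hY : Y = univ
  · exact Or.inl hY
  obtain ⟨c, hc⟩ := hb.nonempty _ (T.nonempty _ h)
  refine Or.inr ⟨c, ?_⟩
  by_contra hne
  have h1 : ({c} : Finset _) ⊂ Y := (singleton_subset_iff.2 hc).ssubset_of_ne (Ne.symm hne)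
  refine (T.isInput_sub A.1 c).2.2 _ h ((hb.ssub _ _).2 h1) ?_
  have h2 := (hb.ssub _ _).2 ((subset_univ Y).ssubset_of_ne hY)
  rwa [T.sub_univ A.2.2] at h2

theorem exists_subset_sub {T : RTree n} (A : T.Vert) {B : Finset (Fin n)} (hB : B ∈ T.edges)
    (hBA : B ⊂ A.1) : ∃ c, B ⊆ T.sub A.1 {c} := by
  have hb := isBlock_sub (subset_refl T.edges) A
  have hu := T.sub_univ A.2.2
  rcases hb.exists_eq_or hB (by rw [hu]; exact hBA.1) with ⟨Y, rfl⟩ | ⟨c, hc⟩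
  · rcases eq_univ_or_of_sub_mem A hB with rfl | ⟨c, rfl⟩
    · exact absurd hu hBA.ne
    · exact ⟨c, subset_refl _⟩
  · exact ⟨c, hc.1⟩

theorem subset_or_disjoint_sub {T : RTree n} (A : T.Vert) {B : Finset (Fin n)} (hB : B ∈ T.edges)
    (hBA : B ⊂ A.1) (Y : Finset (Fin (Nat.card (T.In A.1)))) :
    B ⊆ T.sub A.1 Y ∨ Disjoint B (T.sub A.1 Y) := by
  obtain ⟨c, hc⟩ := exists_subset_sub A hB hBA
  have hb := isBlock_sub (subset_refl T.edges) A
  by_cases h : c ∈ Y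
  · exact Or.inl (hc.trans ((hb.sub _ _).2 (singleton_subset_iff.2 h)))
  · refine Or.inr (disjoint_left.2 fun z hz hz' => ?_)
    obtain ⟨c', hc', hz'⟩ := hb.mem.1 hz'
    rw [hb.eq_of_mem (hc hz) hz'] at h
    exact h hc'

theorem sub_subset {T : RTree n} (A : T.Vert) (Y : Finset (Fin (Nat.card (T.In A.1)))) :
    T.sub A.1 Y ⊆ A.1 := by
  have h1 := ((isBlock_sub (subset_refl T.edges) A).sub Y univ).2 (subset_univ _)
  rwa [T.sub_univ A.2.2] at h1

theorem exists_sub_eq {T S : RTree n} (h : T.edges ⊆ S.edges) {B : Finset (Fin n)}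
    (hB : B ∈ S.verts) : ∃ (A : T.Vert) (Y : Finset (Fin (Nat.card (T.In A.1)))),
      1 < Y.card ∧ T.sub A.1 Y = B := by
  rw [mem_verts] at hB
  obtain ⟨A, hA, hmin⟩ := exists_min_image (T.edges.filter fun A => B ⊆ A) card
    ⟨univ, mem_filter.2 ⟨T.root_mem, subset_univ _⟩⟩
  rw [mem_filter] at hA
  have hA1 : 1 < A.card := hB.2.trans_le (card_le_card hA.2)
  have hb := isBlock_sub h ⟨A, hA.1, hA1⟩
  have hu := T.sub_univ hA1
  rcases hb.exists_eq_or hB.1 (by rw [hu]; exact hA.2) with ⟨Y, hY⟩ | ⟨c, hc⟩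
  · refine ⟨⟨A, hA.1, hA1⟩, Y, ?_, hY⟩
    by_contra! hY1
    have hY0 := hb.nonempty Y (by rw [hY]; exact S.nonempty _ hB.1)
    obtain ⟨c, rfl⟩ := card_eq_one.1 (hY1.antisymm hY0.card_pos)
    have h1 := T.isInput_sub A c
    have h2 := hmin _ (mem_filter.2 ⟨h1.1, hY.symm.subset⟩)
    exact (card_lt_card h1.2.1).not_ge h2
  · have h1 := T.isInput_sub A c
    have h2 := hmin _ (mem_filter.2 ⟨h1.1, hc.1⟩)
    exact absurd (card_lt_card h1.2.1) h2.not_gt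

theorem sub_unique_aux {T : RTree n} {A A' : T.Vert} {Y : Finset (Fin (Nat.card (T.In A.1)))}
    {Y' : Finset (Fin (Nat.card (T.In A'.1)))} (hY' : 1 < Y'.card)
    (h : T.sub A.1 Y = T.sub A'.1 Y') : ¬ A.1 ⊂ A'.1 := by
  intro hA
  obtain ⟨c, hc⟩ := exists_subset_sub A' A.2.1 hA
  have h1 : T.sub A'.1 Y' ⊆ T.sub A'.1 {c} := h ▸ (sub_subset A Y).trans hc
  have h2 := card_le_card (((isBlock_sub (subset_refl T.edges) A').sub _ _).1 h1)
  rw [card_singleton] at h2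
  exact hY'.not_ge h2

theorem sub_unique {T : RTree n} {A A' : T.Vert} {Y : Finset (Fin (Nat.card (T.In A.1)))}
    {Y' : Finset (Fin (Nat.card (T.In A'.1)))} (hY : 1 < Y.card) (hY' : 1 < Y'.card)
    (h : T.sub A.1 Y = T.sub A'.1 Y') : A = A' := by
  rcases T.laminar _ A.2.1 _ A'.2.1 with h1 | h1 | h1
  · by_contra hne
    exact sub_unique_aux hY' h (h1.ssubset_of_ne fun h => hne (Subtype.ext h))
  · by_contra hne
    exact sub_unique_aux hY h.symm (h1.ssubset_of_ne fun h => hne (Subtype.ext h.symm))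
  · have hb := isBlock_sub (subset_refl T.edges) A
    have h2 := hb.one_lt_card hY
    obtain ⟨z, hz⟩ := card_pos.1 (zero_lt_one.trans h2)
    exact absurd (sub_subset A' Y' (h ▸ hz)) (disjoint_left.1 h1 (sub_subset A Y hz))

/-- The vertices of `S` are distributed over the vertices of a tree `T` with fewer edges. -/
noncomputable def partVert {T S : RTree n} (h : T.edges ⊆ S.edges) :
    (Σ A : T.Vert, (part h A).Vert) ≃ S.Vert :=
  Equiv.ofBijective (fun w => (isBlock_sub h w.1).vert w.2) (by
    constructor
    · rintro ⟨A, w⟩ ⟨A', w'⟩ hw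
      have h1 : T.sub A.1 w.1 = T.sub A'.1 w'.1 := congrArg Subtype.val hw
      obtain rfl := sub_unique w.2.2 w'.2.2 h1
      have h2 : w = w' := (isBlock_sub h A).vert_injective hw
      rw [h2]
    · rintro ⟨B, hB⟩
      obtain ⟨A, Y, hY, rfl⟩ := exists_sub_eq h (mem_verts.2 hB)
      exact ⟨⟨A, ⟨Y, (mem_restr _).2 hB.1, hY⟩⟩, rfl⟩)

noncomputable instance : Fintype (RTree n) :=
  Fintype.ofInjective RTree.edges fun _ _ h => RTree.ext h

/-- The tree obtained by replacing every vertex of a tree by a tree. -/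
noncomputable def glue (T : RTree n) (U : ∀ A : T.Vert, RTree (Nat.card (T.In A.1))) : RTree n where
  edges := T.edges ∪ univ.biUnion fun A : T.Vert => (U A).edges.image (T.sub A.1)
  nonempty B hB := by
    simp only [mem_union, mem_biUnion, mem_univ, true_and, mem_image] at hB
    rcases hB with hB | ⟨A, Y, hY, rfl⟩
    · exact T.nonempty _ hB
    · obtain ⟨c, hc⟩ := (U A).nonempty Y hY
      have hb := isBlock_sub (subset_refl T.edges) A
      exact (T.nonempty _ (hb.leaf c)).mono ((hb.sub _ _).2 (singleton_subset_iff.2 hc))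
  root_mem := mem_union_left _ T.root_mem
  leaf_mem c := mem_union_left _ (T.leaf_mem c)
  laminar := by
    have h1 : ∀ B ∈ T.edges, ∀ (A : T.Vert) (Y : Finset (Fin (Nat.card (T.In A.1)))),
        B ⊆ T.sub A.1 Y ∨ T.sub A.1 Y ⊆ B ∨ Disjoint B (T.sub A.1 Y) := by
      intro B hB A Y
      have hs := sub_subset A Y
      rcases T.laminar B hB A.1 A.2.1 with h | h | h
      · by_cases hBA : B = A.1
        · exact Or.inr (Or.inl (hBA ▸ hs))
        · rcases subset_or_disjoint_sub A hB (h.ssubset_of_ne hBA) Y with h | h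
          exacts [Or.inl h, Or.inr (Or.inr h)]
      · exact Or.inr (Or.inl (hs.trans h))
      · exact Or.inr (Or.inr (h.mono_right hs))
    intro B hB C hC
    simp only [mem_union, mem_biUnion, mem_univ, true_and, mem_image] at hB hC
    rcases hB with hB | ⟨A, Y, hY, rfl⟩ <;> rcases hC with hC | ⟨A', Y', hY', rfl⟩
    · exact T.laminar B hB C hC
    · exact h1 B hB A' Y'
    · rcases h1 C hC A Y with h | h | h
      exacts [Or.inr (Or.inl h), Or.inl h, Or.inr (Or.inr h.symm)]
    · by_cases hA : A = A'
      · subst hA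
        have hb := isBlock_sub (subset_refl T.edges) A
        rcases (U A).laminar Y hY Y' hY' with h | h | h
        · exact Or.inl ((hb.sub _ _).2 h)
        · exact Or.inr (Or.inl ((hb.sub _ _).2 h))
        · refine Or.inr (Or.inr (disjoint_left.2 fun z hz hz' => ?_))
          obtain ⟨c, hc, hz⟩ := hb.mem.1 hz
          obtain ⟨c', hc', hz'⟩ := hb.mem.1 hz'
          rw [hb.eq_of_mem hz hz'] at hc
          exact disjoint_left.1 h hc hc'
      · have hs := sub_subset A Y
        have hs' := sub_subset A' Y'
        have hne : A.1 ≠ A'.1 := fun h => hA (Subtype.ext h)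
        rcases T.laminar _ A.2.1 _ A'.2.1 with h | h | h
        · rcases subset_or_disjoint_sub A' A.2.1 (h.ssubset_of_ne hne) Y' with h | h
          · exact Or.inl (hs.trans h)
          · exact Or.inr (Or.inr (h.mono_left hs))
        · rcases subset_or_disjoint_sub A A'.2.1 (h.ssubset_of_ne hne.symm) Y with h | h
          · exact Or.inr (Or.inl (hs'.trans h))
          · exact Or.inr (Or.inr (h.mono_left hs').symm)
        · exact Or.inr (Or.inr ((h.mono_left hs).mono_right hs'))

theorem subset_glue (T : RTree n) (U : ∀ A : T.Vert, RTree (Nat.card (T.In A.1))) :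
    T.edges ⊆ (T.glue U).edges := subset_union_left

theorem part_glue (T : RTree n) (U : ∀ A : T.Vert, RTree (Nat.card (T.In A.1))) (A : T.Vert) :
    part (T.subset_glue U) A = U A := by
  refine eq_of_edges fun Y => ?_
  rw [mem_restr]
  simp only [glue, mem_union, mem_biUnion, mem_univ, true_and, mem_image]
  have hb := isBlock_sub (subset_refl T.edges) A
  have key : T.sub A.1 Y ∈ T.edges → Y ∈ (U A).edges := fun h => by
    rcases eq_univ_or_of_sub_mem A h with rfl | ⟨c, rfl⟩
    exacts [(U A).root_mem, (U A).leaf_mem c]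
  refine ⟨?_, fun h => Or.inr ⟨A, Y, h, rfl⟩⟩
  rintro (h | ⟨A', Y', hY', h⟩)
  · exact key h
  have hb' := isBlock_sub (subset_refl T.edges) A'
  by_cases h1 : 1 < Y'.card
  · by_cases h2 : 1 < Y.card
    · obtain rfl := sub_unique h2 h1 h.symm
      rwa [← hb.injective h]
    · obtain ⟨c, hc⟩ := (U A').nonempty _ hY'
      have h3 : (T.sub A.1 Y).Nonempty := by
        rw [← h]
        exact (T.nonempty _ (hb'.leaf c)).mono ((hb'.sub _ _).2 (singleton_subset_iff.2 hc))
      obtain ⟨c, rfl⟩ := card_eq_one.1 ((not_lt.1 h2).antisymm (hb.nonempty _ h3).card_pos)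
      exact (U A).leaf_mem c
  · obtain ⟨c, rfl⟩ := card_eq_one.1 ((not_lt.1 h1).antisymm ((U A').nonempty _ hY').card_pos)
    refine key ?_
    rw [← h]
    exact hb'.leaf c

/-- A vertex other than the root is the upper vertex of an inner edge. -/
theorem exists_innerEdge (T : RTree n) {B : Finset (Fin n)} (hB : B ∈ T.verts) (hu : B ≠ univ) :
    ∃ y : T.InnerEdge, y.1.2.1 = B := by
  rw [mem_verts] at hB
  obtain ⟨A, hA, hmin⟩ := exists_min_image (T.edges.filter fun A => B ⊂ A) card
    ⟨univ, mem_filter.2 ⟨T.root_mem, (subset_univ _).ssubset_of_ne hu⟩⟩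
  rw [mem_filter] at hA
  refine ⟨⟨(⟨A, hA.1, hB.2.trans_le (card_le_card hA.2.1)⟩, ⟨B, hB⟩), hB.1, hA.2, ?_⟩, rfl⟩
  intro C hC hBC hCA
  exact (card_lt_card hCA).not_ge (hmin C (mem_filter.2 ⟨hC, hBC⟩))

/-- The tree `T` with an edge of a tree `S` added. -/
def addEdge {T S : RTree n} (h : T.edges ⊆ S.edges) {B : Finset (Fin n)} (hB : B ∈ S.edges) :
    RTree n where
  edges := insert B T.edges
  nonempty A hA := S.nonempty A (insert_subset hB h hA)
  root_mem := mem_insert_of_mem T.root_mem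
  leaf_mem c := mem_insert_of_mem (T.leaf_mem c)
  laminar A hA C hC := S.laminar A (insert_subset hB h hA) C (insert_subset hB h hC)

theorem addEdge_subset {T S : RTree n} (h : T.edges ⊆ S.edges) {B : Finset (Fin n)}
    (hB : B ∈ S.edges) : (addEdge h hB).edges ⊆ S.edges := insert_subset hB h

theorem contract_subset {T S : RTree n} (h : T.edges ⊆ S.edges) (y : T.InnerEdge) :
    (T.contract y).edges ⊆ S.edges := (erase_subset _ _).trans h

end RTree

/-! ### Monomials in the cobar complex of an operad -/

theorem Function.Injective.exists_forall_eq {ι κ : Type*} {σ : ι → κ} (hσ : Function.Injective σ)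
    {X : κ → Type*} [∀ c, Nonempty (X c)] (g : ∀ i, X (σ i)) :
    ∃ q : ∀ c, X c, ∀ i, q (σ i) = g i := by
  classical
  have h : ∀ c, ∃ x : X c, ∀ i (h : σ i = c), h ▸ g i = x := fun c => by
    by_cases hc : ∃ i, σ i = c
    · obtain ⟨i, rfl⟩ := hc
      refine ⟨g i, fun j hj => ?_⟩
      obtain rfl := hσ hj
      rfl
    · exact ⟨Classical.arbitrary _, fun i hi => absurd ⟨i, hi⟩ hc⟩
  choose q hq using h
  exact ⟨q, fun i => (hq _ i rfl).symm⟩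

theorem MultilinearMap.eq_sum_basis {k : Type*} [Field k] {ι : Type*} [Fintype ι]
    {M : ι → Type*} [∀ i, AddCommGroup (M i)] [∀ i, Module k (M i)] {κ : ι → Type*}
    [∀ i, Fintype (κ i)] [Fintype (∀ i, κ i)] (b : ∀ i, Module.Basis (κ i) k (M i))
    (g : MultilinearMap k M k) (a : ∀ i, M i) :
    g a = ∑ I : ∀ i, κ i, (∏ i, (b i).repr (a i) (I i)) * g fun i => b i (I i) := by
  classical
  have h : a = fun i => ∑ j, (b i).repr (a i) j • b i j := funext fun i => ((b i).sum_repr _).symm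
  conv_lhs => rw [h]
  rw [g.map_sum]
  convert rfl with I
  exact (g.map_smul_univ (fun i => (b i).repr (a i) (I i)) fun i => b i (I i)).symm

namespace DGOperadData

variable {k : Type u} [Field k] {Q : DGOperadData.{u, v} k}

open El RTree Function

section General

variable {n m : ℕ} {i j : ℤ}

theorem IsMulti.add' {F : Q.Fn n} (hF : IsMulti F) {T : RTree n} [DecidableEq T.Vert]
    (p : Q.Dec T) (A : T.Vert) (i : ℤ) (a b : Q.obj _ i) :
    F T (update p A ⟨i, a + b⟩) = F T (update p A ⟨i, a⟩) + F T (update p A ⟨i, b⟩) := by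
  convert hF.add T p A i a b

theorem IsMulti.smul' {F : Q.Fn n} (hF : IsMulti F) {T : RTree n} [DecidableEq T.Vert]
    (p : Q.Dec T) (A : T.Vert) (c : k) (a : Q.El _) :
    F T (update p A (El.smul c a)) = c * F T (update p A a) := by
  convert hF.smul T p A c a

theorem update_mk {T : RTree n} (δ : T.Vert → ℤ) [DecidableEq T.Vert]
    (y : ∀ A : T.Vert, Q.obj (Nat.card (T.In A.1)) (δ A)) (A : T.Vert)
    (a : Q.obj (Nat.card (T.In A.1)) (δ A)) :
    (fun C => ⟨δ C, update y A a C⟩ : Q.Dec T) =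
      update (fun C => ⟨δ C, y C⟩ : Q.Dec T) A ⟨δ A, a⟩ := by
  funext C
  by_cases hC : C = A
  · subst hC
    rw [update_self, update_self]
  · rw [update_of_ne hC, update_of_ne hC]

/-- A multilinear function of decorated trees which is homogeneous of degree `i` is an element of
the cobar complex. -/
theorem exists_ev {F : Q.Fn n} (hF : IsMulti F)
    (hi : ∀ T p, F T p ≠ 0 → ∑ A, (1 - (p A).1) = i) : ∃ α : Q.cob.obj n i, ev α = F := by
  refine ⟨fun T δ =>
    { toFun := fun y => F T fun A => ⟨δ.1 A, y A⟩
      map_update_add' := fun y A a b => by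
        exact (congrArg (F T) (update_mk δ.1 y A _)).trans ((hF.add' _ A _ a b).trans
          (congrArg₂ (· + ·) (congrArg (F T) (update_mk δ.1 y A _)).symm
            (congrArg (F T) (update_mk δ.1 y A _)).symm))
      map_update_smul' := fun y A c a => by
        exact (congrArg (F T) (update_mk δ.1 y A _)).trans ((hF.smul' _ A c ⟨_, a⟩).trans
          (congrArg (c * ·) (congrArg (F T) (update_mk δ.1 y A _)).symm)) }, ?_⟩
  funext T p
  by_cases h : ∑ A, (1 - (p A).1) = i
  · rw [ev_of_eq _ _ _ h]
    rfl
  · rw [ev_of_ne _ _ _ h]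
    by_contra h'
    exact h (hi T p (Ne.symm h'))

/-- Linear functions of homogeneous elements. -/
structure IsLin {m : ℕ} (G : Q.El m → k) : Prop where
  add : ∀ (i : ℤ) (a b : Q.obj m i), G ⟨i, a + b⟩ = G ⟨i, a⟩ + G ⟨i, b⟩
  smul : ∀ (c : k) (a : Q.El m), G (El.smul c a) = c * G a

theorem isMulti_of_prod {F : Q.Fn n} (h : ∀ T, (∀ p, F T p = 0) ∨
    ∃ G : ∀ A : T.Vert, Q.El (Nat.card (T.In A.1)) → k,
      (∀ A, IsLin (G A)) ∧ ∀ p, F T p = ∏ A, G A (p A)) : IsMulti F := by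
  have key : ∀ {T : RTree n} (G : ∀ A : T.Vert, Q.El (Nat.card (T.In A.1)) → k) (p : Q.Dec T)
      (A : T.Vert) (a : Q.El _), ∏ C, G C (update p A a C) =
        G A a * ∏ C ∈ univ.erase A, G C (p C) := fun G p A a => by
    rw [← mul_prod_erase _ _ (mem_univ A), update_self]
    congr 1
    exact prod_congr rfl fun C hC => by rw [update_of_ne (mem_erase.1 hC).1]
  constructor
  · intro T p A i a b
    rcases h T with h | ⟨G, hG, h⟩
    · simp [h]
    · rw [h, h, h, key, key, key, (hG A).add, add_mul]
  · intro T p A c a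
    rcases h T with h | ⟨G, hG, h⟩
    · simp [h]
    · rw [h, h, key, key, (hG A).smul, mul_assoc]

theorem isMulti_sum {ι : Type*} (s : Finset ι) {F : ι → Q.Fn n} (hF : ∀ a ∈ s, IsMulti (F a)) :
    IsMulti (fun T p => ∑ a ∈ s, F a T p : Q.Fn n) where
  add T p A _ a b := by
    rw [← sum_add_distrib]
    exact sum_congr rfl fun x hx => (hF x hx).add T p A _ a b
  smul T p A c a := by
    rw [mul_sum]
    exact sum_congr rfl fun x hx => (hF x hx).smul T p A c a

theorem isLin_ev (T : RTree n) (p : Q.Dec T) :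
    IsLin fun y : Q.cob.El n => ev (i := y.1) (y.2 : Q.cob.obj n y.1) T p where
  add _ a b := congrFun (congrFun (ev_add' a b) T) p
  smul c a := congrFun (congrFun (ev_smul' c a.2) T) p

theorem ev_castDeg (h : i = j) (a : Q.cob.obj n i) : ev (Q.cob.castDeg n i j a) = ev a := by
  subst h; simp [castDeg]

theorem castDeg_of_ne {Q : DGOperadData.{u, v} k} (h : i ≠ j) (a : Q.obj n i) :
    Q.castDeg n i j a = 0 := by
  simp [castDeg, h]

theorem ev_sum {ι : Type*} (s : Finset ι) (f : ι → Q.cob.obj n i) :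
    ev (∑ a ∈ s, f a : Q.cob.obj n i) = ∑ a ∈ s, ev (f a) :=
  map_sum (AddMonoidHom.mk' (fun α : Q.cob.obj n i => ev α) ev_add') f s

/-- The value of a homogeneous element of the cobar complex on a decorated tree. -/
noncomputable def El.ev (y : Q.cob.El n) : Q.Fn n := DGOperadData.ev (i := y.1) y.2

theorem El.cob_ext {y z : Q.cob.El n} (h : y.1 = z.1) (h' : y.ev = z.ev) : y = z := by
  obtain ⟨i, y⟩ := y
  obtain ⟨j, z⟩ := z
  obtain rfl : i = j := h
  rw [DGOperadData.cob_ext (α := y) (β := z) h']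

theorem El.ev_smul (c : k) (y : Q.cob.El n) : (El.smul c y).ev = c • y.ev := ev_smul' c y.2

theorem El.isMulti_ev (y : Q.cob.El n) : IsMulti y.ev := isMulti_ev' (i := y.1) y.2

theorem IsMulti.smul_univ {F : Q.Fn n} (hF : IsMulti F) {T : RTree n} (c : T.Vert → k)
    (p : Q.Dec T) : F T (fun A => El.smul (c A) (p A)) = (∏ A, c A) * F T p := by
  classical
  have key : ∀ s : Finset T.Vert,
      F T (fun A => if A ∈ s then El.smul (c A) (p A) else p A) = (∏ A ∈ s, c A) * F T p := by
    intro s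
    induction s using Finset.induction_on with
    | empty => simp
    | insert A s hA ih =>
      rw [prod_insert hA, mul_assoc, ← ih]
      set q : Q.Dec T := fun C => if C ∈ s then El.smul (c C) (p C) else p C with hq
      have h1 : (fun C => if C ∈ insert A s then El.smul (c C) (p C) else p C : Q.Dec T) =
          update q A (El.smul (c A) (p A)) := by
        funext C
        by_cases hC : C = A
        · subst hC; simp
        · simp [hC, hq]
      have h2 : update q A (p A) = q := by
        rw [show p A = q A by simp [hq, hA], update_eq_self]
      rw [h1, hF.smul', h2]
  simpa using key univ

end General

end DGOperadData

namespace Operad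

open DGOperadData DGOperadData.El RTree Function

variable {k : Type u} [Field k] (P : Operad.{u, v} k)

variable {P}

variable {n m l : ℕ}

/-- A homogeneous element of `P.toDG` as an element of `P`. -/
def val (a : P.toDG.El n) : P.obj n := (show conc k (P.obj n) a.1 from a.2).1

/-- An element of `P` as a homogeneous element of `P.toDG`. -/
noncomputable def inj (a : P.obj n) : P.toDG.El n := ⟨0, concProj k _ 0 a⟩

@[simp] theorem inj_fst (a : P.obj n) : (inj a).1 = 0 := rfl

@[simp] theorem val_inj (a : P.obj n) : val (inj a) = a := concProj_zero_coe k a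

theorem inj_val {a : P.toDG.El n} (h : a.1 = 0) : inj (val a) = a := by
  obtain ⟨i, a⟩ := a
  obtain rfl : i = 0 := h
  exact congrArg (Sigma.mk (0 : ℤ)) (concProj_coe_zero (a : conc k (P.obj n) 0))

theorem val_of_ne {a : P.toDG.El n} (h : a.1 ≠ 0) : val a = 0 := by
  obtain ⟨i, a⟩ := a
  rw [P.toDG_eq_zero h a]
  rfl

theorem val_mk_add (i : ℤ) (a b : P.toDG.obj n i) :
    val (⟨i, a + b⟩ : P.toDG.El n) = val ⟨i, a⟩ + val ⟨i, b⟩ := rfl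

theorem val_smul (c : k) (a : P.toDG.El n) : val (El.smul c a) = c • val a := rfl

/-- Relabelling along a bijection of finite sets. -/
noncomputable def rel {X Y : Type} [Finite X] [Finite Y] (f : X ≃ Y) :
    P.obj (Nat.card X) →ₗ[k] P.obj (Nat.card Y) :=
  P.relabel ((Finite.equivFin X).symm.trans (f.trans (Finite.equivFin Y)))

theorem val_rel {X Y : Type} [Finite X] [Finite Y] (f : X ≃ Y) (a : P.toDG.El (Nat.card X)) :
    val (El.rel f a) = rel f (val a) := by
  by_cases h : a.1 = 0
  · obtain ⟨i, a⟩ := a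
    obtain rfl : i = 0 := h
    exact concProj_zero_coe k _
  · rw [val_of_ne h, val_of_ne (by exact h), map_zero]

theorem rel_inj {X Y : Type} [Finite X] [Finite Y] (f : X ≃ Y) (a : P.obj (Nat.card X)) :
    El.rel f (inj a) = inj (rel f a) := by
  rw [← inj_val (a := El.rel f (inj a)) rfl, val_rel, val_inj]

theorem rel_symm_rel {X Y : Type} [Finite X] [Finite Y] (f : X ≃ Y) (a : P.obj (Nat.card X)) :
    rel f.symm (rel f a) = a := by
  have h := El.rel_rel P.isDGOperad_toDG f f.symm (inj a)
  rw [El.rel_refl P.isDGOperad_toDG _ (by simp)] at h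
  rw [← val_inj a, ← val_rel, ← val_rel, h]

theorem rel_rel_symm {X Y : Type} [Finite X] [Finite Y] (f : X ≃ Y) (a : P.obj (Nat.card Y)) :
    rel f (rel f.symm a) = a := rel_symm_rel f.symm a

/-- Decorations of a tree by elements of `P`. -/
abbrev Dec (P : Operad.{u, v} k) (T : RTree n) : Type v := ∀ A : T.Vert, P.obj (Nat.card (T.In A.1))

/-- A decoration by elements of `P`, as a decoration of degree `0`. -/
noncomputable def toDec {T : RTree n} (a : P.Dec T) : P.toDG.Dec T := fun A => inj (a A)

theorem _root_.DGOperadData.IsMulti.eq_zero {F : P.toDG.Fn n} (hF : IsMulti F) {T : RTree n} {p : P.toDG.Dec T}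
    {A : T.Vert} (hA : (p A).1 ≠ 0) : F T p = 0 := by
  have h : p = update p A ⟨(p A).1, 0⟩ := by
    rw [← P.toDG_eq_zero hA (p A).2]
    exact (update_eq_self A p).symm
  rw [h]
  exact DGOperadData.IsMulti.zero hF p A _

theorem exists_toDec {T : RTree n} {p : P.toDG.Dec T} (h : ∀ A, (p A).1 = 0) :
    ∃ a : P.Dec T, p = toDec a :=
  ⟨fun A => val (p A), funext fun A => (inj_val (h A)).symm⟩

theorem _root_.DGOperadData.IsMulti.ext {F G : P.toDG.Fn n} (hF : IsMulti F) (hG : IsMulti G)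
    (h : ∀ T (a : P.Dec T), F T (toDec a) = G T (toDec a)) : F = G := by
  funext T p
  by_cases hp : ∃ A, (p A).1 ≠ 0
  · obtain ⟨A, hA⟩ := hp
    rw [IsMulti.eq_zero hF hA, IsMulti.eq_zero hG hA]
  · obtain ⟨a, rfl⟩ := exists_toDec (not_exists_not.1 hp)
    exact h T a

/-- The restriction of a multilinear function to the decorations of a tree by elements of `P`. -/
noncomputable def toMultilinear {F : P.toDG.Fn n} (hF : IsMulti F) (T : RTree n) :
    MultilinearMap k (fun A : T.Vert => P.obj (Nat.card (T.In A.1))) k where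
  toFun a := F T (toDec a)
  map_update_add' a A x y := by
    have h : ∀ z, toDec (@update _ _ _ a A z) = update (toDec a) A (inj z) := fun z => by
      funext C
      by_cases hC : C = A
      · subst hC; simp [toDec]
      · simp [toDec, hC]
    rw [h, h, h]
    simp only [inj, map_add]
    exact hF.add' _ _ _ _ _
  map_update_smul' a A c x := by
    have h : ∀ z, toDec (@update _ _ _ a A z) = update (toDec a) A (inj z) := fun z => by
      funext C
      by_cases hC : C = A
      · subst hC; simp [toDec]
      · simp [toDec, hC]
    rw [h, h]
    have h2 : (inj (c • x) : P.toDG.El _) = El.smul c (inj x) :=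
      congrArg (Sigma.mk (0 : ℤ)) (map_smul (concProj k _ 0) c x)
    rw [h2]
    exact hF.smul' _ _ _ _

/-- The product of functionals on the decorations of the vertices of `U`. -/
noncomputable def monFn (U : RTree n) (g : ∀ A : U.Vert, Module.Dual k (P.obj (Nat.card (U.In A.1)))) :
    P.toDG.Fn n := fun T p =>
  open scoped Classical in
  if h : T = U then ∏ A, g A (val ((h ▸ p : P.toDG.Dec U) A)) else 0

section MonFn

variable {U : RTree n} (g : ∀ A : U.Vert, Module.Dual k (P.obj (Nat.card (U.In A.1))))

theorem monFn_self (p : P.toDG.Dec U) : monFn U g U p = ∏ A, g A (val (p A)) := dif_pos rfl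

theorem monFn_of_ne {T : RTree n} (h : T ≠ U) (p : P.toDG.Dec T) : monFn U g T p = 0 := dif_neg h

theorem isLin_val {m : ℕ} (g : Module.Dual k (P.obj m)) : IsLin fun y : P.toDG.El m => g (val y) where
  add i a b := by rw [val_mk_add, map_add]
  smul c a := by rw [val_smul, map_smul, smul_eq_mul]

theorem isMulti_monFn : IsMulti (monFn U g) := by
  refine isMulti_of_prod fun T => ?_
  by_cases h : T = U
  · subst h
    exact Or.inr ⟨fun A y => g A (val y), fun A => isLin_val _, monFn_self g⟩
  · exact Or.inl (monFn_of_ne g h)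

theorem _root_.RTree.card_vert (T : RTree n) : Fintype.card T.Vert = T.verts.card := by
  have h := T.sum_vert (fun _ => 1)
  simpa using h

theorem sum_one_sub {T : RTree n} {p : P.toDG.Dec T} (h : ∀ A, (p A).1 = 0) :
    ∑ A, (1 - (p A).1) = T.verts.card := by
  simp [h, RTree.card_vert]

theorem sum_one_sub_of_monFn (T : RTree n) (p : P.toDG.Dec T) (h : monFn U g T p ≠ 0) :
    ∑ A, (1 - (p A).1) = U.verts.card := by
  by_cases hT : T = U
  · subst hT
    refine sum_one_sub fun A => ?_
    by_contra hA
    exact h (IsMulti.eq_zero (isMulti_monFn g) hA)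
  · exact absurd (monFn_of_ne g hT p) h

/-- The element of the cobar complex given by functionals on `P` at the vertices of a tree. -/
noncomputable def monEl : P.toDG.cob.El n :=
  ⟨U.verts.card, Classical.choose (exists_ev (isMulti_monFn g) (sum_one_sub_of_monFn g))⟩

@[simp] theorem monEl_fst : (monEl g).1 = U.verts.card := rfl

theorem ev_monEl : (monEl g).ev = monFn U g :=
  Classical.choose_spec (exists_ev (isMulti_monFn g) (sum_one_sub_of_monFn g))

end MonFn

/-- The cobar complex is spanned by monomials. -/
theorem mem_span_monEl [∀ n, FiniteDimensional k (P.obj n)] {i : ℤ} (y : P.toDG.cob.obj n i) :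
    y ∈ Submodule.span k {z | ∃ (U : RTree n) (g : ∀ A : U.Vert, Module.Dual k (P.obj (Nat.card (U.In A.1)))),
      (⟨i, z⟩ : P.toDG.cob.El n) = monEl g} := by
  classical
  let b : ∀ m, Module.Basis (Fin (Module.finrank k (P.obj m))) k (P.obj m) := fun m =>
    Module.finBasis k (P.obj m)
  let z : ∀ U : RTree n, (∀ A : U.Vert, Fin (Module.finrank k (P.obj (Nat.card (U.In A.1))))) →
      P.toDG.cob.obj n i := fun U I =>
    P.toDG.cob.castDeg n U.verts.card i (monEl fun A : U.Vert => (b _).coord (I A)).2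
  have hz : ∀ (U : RTree n) (I : ∀ A : U.Vert, Fin (Module.finrank k (P.obj (Nat.card (U.In A.1))))),
      (U.verts.card : ℤ) = i → ev (z U I) = monFn U fun A => (b _).coord (I A) := fun U I h =>
    (ev_castDeg h _).trans (ev_monEl _)
  have hy : y = ∑ U, ∑ I, ev y U (toDec fun A => b _ (I A)) • z U I := by
    refine DGOperadData.cob_ext (IsMulti.ext (isMulti_ev' y) (isMulti_ev' _) fun T a => ?_)
    simp only [ev_sum, ev_smul', Finset.sum_apply, Pi.smul_apply, smul_eq_mul]
    by_cases hT : (T.verts.card : ℤ) = i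
    · rw [sum_eq_single T]
      · have h1 := (toMultilinear (isMulti_ev' y) T).eq_sum_basis (fun A => b _) a
        refine h1.trans (sum_congr rfl fun I _ => ?_)
        rw [hz T I hT, monFn_self, mul_comm]
        simp only [toDec, val_inj, Module.Basis.coord_apply]
        rfl
      · intro U _ hU
        refine sum_eq_zero fun I _ => ?_
        by_cases hUi : (U.verts.card : ℤ) = i
        · rw [hz U I hUi, monFn_of_ne _ hU.symm, mul_zero]
        · rw [show z U I = 0 from castDeg_of_ne hUi _, ev_zero']
          simp
      · simp
    · have h0 : ∀ α : P.toDG.cob.obj n i, ev α T (toDec a) = 0 := fun α =>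
        ev_of_ne α T _ (by rwa [sum_one_sub fun A => rfl])
      rw [h0]
      refine (sum_eq_zero fun U _ => sum_eq_zero fun I _ => ?_).symm
      rw [h0, mul_zero]
  rw [hy]
  refine Submodule.sum_mem _ fun U _ => Submodule.sum_mem _ fun I _ => Submodule.smul_mem _ _ ?_
  by_cases hU : (U.verts.card : ℤ) = i
  · refine Submodule.subset_span ⟨U, _, mk_castDeg hU _⟩
  · rw [show z U I = 0 from castDeg_of_ne hU _]
    exact Submodule.zero_mem _

end Operad

/-! ### Monomials of blocks of a tree -/

namespace Operad

open DGOperadData DGOperadData.El RTree Function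

variable {k : Type u} [Field k] {P : Operad.{u, v} k} {n m l r : ℕ}

/-- Families of functionals on `P` at the vertices of a tree. -/
abbrev Cov (P : Operad.{u, v} k) (S : RTree n) : Type (max u v) :=
  ∀ A : S.Vert, Module.Dual k (P.obj (Nat.card (S.In A.1)))

variable {S : RTree l} {φ : Finset (Fin n) → Finset (Fin l)}

/-- The monomial on the part of `S` given by a block, for functionals at the vertices of `S`. -/
noncomputable def blkEl (h : S.IsBlock φ) (f : P.Cov S) : P.toDG.cob.El n :=
  monEl (U := S.restr φ h) fun A => f (h.vert A) ∘ₗ rel (h.inEquiv A.2.2)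

@[simp] theorem blkEl_fst (h : S.IsBlock φ) (f : P.Cov S) :
    (blkEl h f).1 = (S.restr φ h).verts.card := rfl

/-- The value of the functional at a vertex. -/
noncomputable def wt (f : P.Cov S) (b : P.Dec S) (B : Finset (Fin l)) : k :=
  if h : B ∈ S.edges ∧ 1 < B.card then f ⟨B, h⟩ (b ⟨B, h⟩) else 1

theorem prod_vert {M : Type*} [CommMonoid M] (T : RTree n) (F : Finset (Fin n) → M) :
    ∏ A : T.Vert, F A.1 = ∏ A ∈ T.verts, F A :=
  T.sum_vert (M := Additive M) F

theorem prod_verts_graft {M : Type*} [CommMonoid M] {T : RTree l} {x : Fin n}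
    {e : {c : Fin n // c ≠ x} ⊕ Fin m ≃ Fin l} (h : outer x e {x} ∈ T.edges)
    (F : Finset (Fin l) → M) : ∏ A ∈ T.verts, F A =
      (∏ A ∈ (T.restr _ (isBlock_outer h)).verts, F (outer x e A)) *
      ∏ A ∈ (T.restr _ (isBlock_inner h)).verts, F (inner x e A) :=
  sum_verts_graft (M := Additive M) h F

theorem wt_vert (f : P.Cov S) (b : P.Dec S) (A : S.Vert) : wt f b A.1 = f A (b A) := dif_pos A.2

theorem ev_blkEl_restr (h : S.IsBlock φ) (f : P.Cov S) (b : P.Dec S) :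
    (blkEl h f).ev (S.restr φ h) ((toDec b).restr φ h) =
      ∏ A ∈ (S.restr φ h).verts, wt f b (φ A) := by
  rw [blkEl, ev_monEl, monFn_self, ← prod_vert]
  refine prod_congr rfl fun A _ => ?_
  rw [show wt f b (φ A.1) = f (h.vert A) (b (h.vert A)) from wt_vert f b (h.vert A)]
  change f (h.vert A) (rel _ (val (El.rel _ (toDec b (h.vert A))))) = _
  rw [val_rel, rel_rel_symm, toDec, val_inj]

theorem ev_blkEl_of_ne (h : S.IsBlock φ) (f : P.Cov S) {T : RTree n} (hT : T ≠ S.restr φ h)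
    (p : P.toDG.Dec T) : (blkEl h f).ev T p = 0 := by
  rw [blkEl, ev_monEl, monFn_of_ne _ hT]

theorem exists_restr_toDec (h : S.IsBlock φ) (a : P.Dec (S.restr φ h)) :
    ∃ b : P.Dec S, (toDec b).restr φ h = toDec a := by
  obtain ⟨b, hb⟩ := h.vert_injective.exists_forall_eq
    (X := fun A : S.Vert => P.obj (Nat.card (S.In A.1))) fun A => rel (h.inEquiv A.2.2) (a A)
  refine ⟨b, funext fun A => ?_⟩
  change El.rel _ (inj (b (h.vert A))) = inj (a A)
  rw [hb, rel_inj, rel_symm_rel]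

theorem restr_toDec (h : S.IsBlock φ) (b : P.Dec S) :
    ∃ a : P.Dec (S.restr φ h), (toDec b).restr φ h = toDec a :=
  ⟨fun A => rel (h.inEquiv A.2.2).symm (b (h.vert A)), funext fun _ => rel_inj _ _⟩

theorem par_toDec {T : RTree n} (a : P.Dec T) {A : Finset (Fin n)} (hA : A ∈ T.verts) :
    Dec.par (toDec a) A = 1 := by
  rw [Dec.par_vert (toDec a) ⟨A, mem_verts.1 hA⟩]
  simp [toDec]

theorem kz_toDec {T : RTree n} (a : P.Dec T) (r s : Finset (Fin n) → Finset (Fin n) → Prop) :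
    kz T.verts r s (Dec.par (toDec a)) = kz T.verts r s fun _ => 1 :=
  kz_congr (fun _ _ _ _ => Iff.rfl) (fun _ _ _ _ => Iff.rfl) fun _ hA => par_toDec a hA

theorem restr_restr_eq (h : S.IsBlock φ) {ψ : Finset (Fin m) → Finset (Fin n)}
    (h' : (S.restr φ h).IsBlock ψ) {χ : Finset (Fin m) → Finset (Fin l)} (h'' : S.IsBlock χ)
    (hχ : ∀ A, φ (ψ A) = χ A) : (S.restr φ h).restr ψ h' = S.restr χ h'' :=
  eq_of_edges fun A => by rw [mem_restr, mem_restr, mem_restr, hχ]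

theorem ev_blkEl_restr_restr (h : S.IsBlock φ) {ψ : Finset (Fin m) → Finset (Fin n)}
    (h' : (S.restr φ h).IsBlock ψ) {χ : Finset (Fin m) → Finset (Fin l)} (h'' : S.IsBlock χ)
    (hχ : ∀ A, φ (ψ A) = χ A) (f : P.Cov S) (b : P.Dec S) :
    (blkEl h'' f).ev ((S.restr φ h).restr ψ h') (((toDec b).restr φ h).restr ψ h') =
      ∏ A ∈ (S.restr χ h'').verts, wt f b (χ A) := by
  rw [← ev_blkEl_restr]
  exact Fn.congr _ ((Dec.restr_restr P.isDGOperad_toDG _ h h').trans (Dec.restr_congr _ _ _ hχ))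

theorem ext_blkEl {y : P.toDG.cob.El n} (h : S.IsBlock φ) (c : k) (f : P.Cov S)
    (h1 : y.1 = (S.restr φ h).verts.card)
    (h2 : ∀ b : P.Dec S, y.ev (S.restr φ h) ((toDec b).restr φ h) =
      c * ∏ A ∈ (S.restr φ h).verts, wt f b (φ A))
    (h3 : ∀ (T : RTree n) (a : P.Dec T), T ≠ S.restr φ h → y.ev T (toDec a) = 0) :
    y = El.smul c (blkEl h f) := by
  refine El.cob_ext h1 (IsMulti.ext y.isMulti_ev (El.isMulti_ev _) fun T a => ?_)
  rw [El.ev_smul, Pi.smul_apply, Pi.smul_apply, smul_eq_mul]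
  by_cases hT : T = S.restr φ h
  · subst hT
    obtain ⟨b, hb⟩ := exists_restr_toDec h a
    rw [← hb, h2, ev_blkEl_restr]
  · rw [h3 T a hT, ev_blkEl_of_ne h f hT, mul_zero]

theorem exists_rel_blkEl {X Y : Type} [Finite X] [Finite Y] (g : X ≃ Y)
    {φ : Finset (Fin (Nat.card X)) → Finset (Fin l)} {ψ : Finset (Fin (Nat.card Y)) → Finset (Fin l)}
    (h : S.IsBlock φ) (h' : S.IsBlock ψ) (hφ : ∀ A, ψ (A.map
      ((Finite.equivFin X).symm.trans (g.trans (Finite.equivFin Y))).toEmbedding) = φ A) :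
    ∃ c : k, c ≠ 0 ∧ ∀ f : P.Cov S, El.rel g (blkEl h f) = El.smul c (blkEl h' f) := by
  set G := (Finite.equivFin X).symm.trans (g.trans (Finite.equivFin Y))
  refine ⟨sg k (kz (S.restr φ h).verts Before (Before on fun A => A.map G.toEmbedding) fun _ => 1),
    sg_ne_zero _, fun f => ?_⟩
  have hev : (El.rel g (blkEl h f)).ev = relFn G (blkEl h f).ev := ev_relabel G _
  have hr := restr_restr_eq h' ((S.restr ψ h').isBlock_map G) h hφ
  have hv := verts_map G (S.restr ψ h')
  rw [hr] at hv
  have hinj : Injective fun A : Finset (Fin (Nat.card X)) => A.map G.toEmbedding :=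
    map_injective _
  refine ext_blkEl h' _ f ?_ (fun b => ?_) fun T a hT => ?_
  · rw [rel_fst, blkEl_fst, hv, card_image_of_injective _ hinj]
  · rw [hev, relFn, ev_blkEl_restr_restr h' _ h hφ, hv, prod_image fun _ _ _ _ h => hinj h]
    simp only [hφ]
    obtain ⟨a, ha⟩ := restr_toDec h' b
    obtain ⟨a', ha'⟩ := restr_toDec ((S.restr ψ h').isBlock_map G) a
    rw [ha, ha', kz_toDec, hr]
  · rw [hev, relFn, ev_blkEl_of_ne, mul_zero]
    intro h1
    refine hT (eq_of_edges fun A => ?_)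
    rw [mem_restr, ← map_symm_map G A, hφ, ← mem_restr h, ← h1, mem_restr]

/-- The composition of two blocks of `S`. -/
theorem exists_comp_blkEl {X Y Z : Type} [Finite X] [Finite Y] [Finite Z] (x : X)
    (e : {c : X // c ≠ x} ⊕ Y ≃ Z) {φ : Finset (Fin (Nat.card X)) → Finset (Fin l)}
    {ψ : Finset (Fin (Nat.card Y)) → Finset (Fin l)} {χ : Finset (Fin (Nat.card Z)) → Finset (Fin l)}
    (h : S.IsBlock φ) (h' : S.IsBlock ψ) (h'' : S.IsBlock χ)
    (hφ : ∀ A, χ (outer _ (num e rfl) A) = φ A) (hψ : ∀ A, χ (inner _ (num e rfl) A) = ψ A) :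
    ∃ c : k, c ≠ 0 ∧ ∀ f : P.Cov S,
      El.comp x e (blkEl h f) (blkEl h' f) = El.smul c (blkEl h'' f) := by
  refine ⟨sg k (kz (S.restr χ h'').verts (graftRel _ (num e rfl)) Before fun _ => 1),
    sg_ne_zero _, fun f => ?_⟩
  have hev : (El.comp x e (blkEl h f) (blkEl h' f)).ev =
      graftFn _ (num e rfl) (blkEl h f).ev (blkEl h' f).ev := ev_comp rfl _ _
  have hx : outer _ (num e rfl) {Finite.equivFin X x} ∈ (S.restr χ h'').edges := by
    rw [mem_restr, hφ]
    exact h.leaf _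
  have hr := restr_restr_eq h'' (isBlock_outer hx) h hφ
  have hr' := restr_restr_eq h'' (isBlock_inner hx) h' hψ
  refine ext_blkEl h'' _ f ?_ (fun b => ?_) fun T a hT => ?_
  · have h1 := sum_verts_graft hx fun _ => 1
    rw [hr, hr'] at h1
    simp only [sum_const, smul_eq_mul, mul_one] at h1
    rw [comp_fst, blkEl_fst, blkEl_fst, h1, Nat.cast_add]
  · rw [hev, graftFn, dif_pos hx, ev_blkEl_restr_restr h'' _ h hφ, ev_blkEl_restr_restr h'' _ h' hψ,
      prod_verts_graft hx, hr, hr']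
    simp only [hφ, hψ]
    obtain ⟨a, ha⟩ := restr_toDec h'' b
    rw [ha, kz_toDec]
  · rw [hev]
    by_cases hTx : outer _ (num e rfl) {Finite.equivFin X x} ∈ T.edges
    · rw [graftFn, dif_pos hTx]
      by_cases h1 : T.restr _ (isBlock_outer hTx) = S.restr φ h
      · by_cases h2 : T.restr _ (isBlock_inner hTx) = S.restr ψ h'
        · refine absurd (eq_of_verts ?_) hT
          rw [verts_graft hTx, verts_graft hx, h1, h2, hr, hr']
        · rw [ev_blkEl_of_ne h' f h2, mul_zero, mul_zero]
      · rw [ev_blkEl_of_ne h f h1, zero_mul, mul_zero]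
    · exact graftFn_of_notMem hTx _ _ _

end Operad

/-! ### Monomials in the double cobar complex -/

open RTree

namespace RTree

variable {n : ℕ}

theorem mem_sub {T : RTree n} {A : Finset (Fin n)} {Y : Finset (Fin (Nat.card (T.In A)))}
    {z : Fin n} : z ∈ T.sub A Y ↔ ∃ B : T.In A, Finite.equivFin (T.In A) B ∈ Y ∧ z ∈ B.1 := by
  rw [sub, mem_biUnion]
  constructor
  · rintro ⟨c, hc, hz⟩
    exact ⟨_, by rwa [Equiv.apply_symm_apply], hz⟩
  · rintro ⟨B, hB, hz⟩
    exact ⟨_, hB, by rwa [Equiv.symm_apply_apply]⟩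

theorem sub_map {T T' : RTree n} {A A' : Finset (Fin n)} (g : T.In A ≃ T'.In A')
    (hg : ∀ z, (g z).1 = z.1) (Y : Finset (Fin (Nat.card (T.In A)))) :
    T'.sub A' (Y.map ((Finite.equivFin (T.In A)).symm.trans
      (g.trans (Finite.equivFin (T'.In A')))).toEmbedding) = T.sub A Y := by
  ext z
  rw [mem_sub, mem_sub]
  simp only [mem_map, Equiv.coe_toEmbedding, Equiv.trans_apply, EmbeddingLike.apply_eq_iff_eq]
  constructor
  · rintro ⟨B, ⟨c, hc, rfl⟩, hz⟩
    exact ⟨_, by rwa [Equiv.apply_symm_apply], by rwa [hg] at hz⟩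
  · rintro ⟨B, hB, hz⟩
    exact ⟨_, ⟨_, hB, rfl⟩, by rwa [Equiv.symm_apply_apply, hg]⟩

open DGOperadData.El in
theorem sub_outer (T : RTree n) (y : T.InnerEdge) (Y : Finset (Fin (Nat.card (T.In y.1.1.1))))
    {C : Finset (Fin n)} (hC : C = y.1.1.1) :
    (T.contract y).sub C (outer _ (num (T.contractEquiv y hC) rfl) Y) = T.sub y.1.1.1 Y := by
  ext z
  rw [mem_sub, mem_sub]
  constructor
  · rintro ⟨B, hB, hz⟩
    obtain ⟨s, rfl⟩ := (T.contractEquiv y hC).surjective B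
    rcases s with D | D
    · have hD : Finite.equivFin _ D.1 ≠ Finite.equivFin _ (⟨y.1.2.1, y.2⟩ : T.In y.1.1.1) :=
        fun h => D.2 ((Finite.equivFin _).injective h)
      rw [← num_inl _ rfl D.1 hD, mem_outer, collapse_inl] at hB
      exact ⟨D.1, hB, hz⟩
    · rw [← num_inr _ rfl D, mem_outer, collapse_inr] at hB
      exact ⟨_, hB, D.2.2.1.1 hz⟩
  · rintro ⟨B, hB, hz⟩
    by_cases hBy : B = ⟨y.1.2.1, y.2⟩
    · subst hBy
      obtain ⟨D, hD, hzD⟩ := T.exists_isInput y.1.2.2.2 hz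
      refine ⟨T.contractEquiv y hC (Sum.inr ⟨D, hD⟩), ?_, hzD⟩
      rw [← num_inr _ rfl, mem_outer, collapse_inr]
      exact hB
    · have hD : Finite.equivFin _ B ≠ Finite.equivFin _ (⟨y.1.2.1, y.2⟩ : T.In y.1.1.1) :=
        fun h => hBy ((Finite.equivFin _).injective h)
      refine ⟨T.contractEquiv y hC (Sum.inl ⟨B, hBy⟩), ?_, hz⟩
      rw [← num_inl _ rfl B hD, mem_outer, collapse_inl]
      exact hB

open DGOperadData.El in
theorem sub_inner (T : RTree n) (y : T.InnerEdge) (Y : Finset (Fin (Nat.card (T.In y.1.2.1))))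
    {C : Finset (Fin n)} (hC : C = y.1.1.1) :
    (T.contract y).sub C (inner _ (num (T.contractEquiv y hC) rfl) Y) = T.sub y.1.2.1 Y := by
  ext z
  rw [mem_sub, mem_sub]
  constructor
  · rintro ⟨B, hB, hz⟩
    rw [mem_inner] at hB
    obtain ⟨c, hc, hB⟩ := hB
    obtain ⟨D, rfl⟩ := (Finite.equivFin _).surjective c
    rw [num_inr] at hB
    rw [← (Finite.equivFin _).injective hB] at hz
    exact ⟨D, hc, hz⟩
  · rintro ⟨D, hD, hz⟩
    refine ⟨T.contractEquiv y hC (Sum.inr D), ?_, hz⟩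
    rw [← num_inr _ rfl, mem_inner]
    exact ⟨_, hD, rfl⟩

end RTree

namespace Operad

open DGOperadData DGOperadData.El Function

variable {k : Type u} [Field k] {P : Operad.{u, v} k} {n l : ℕ} {T S : RTree n}

/-- The decoration of a tree `T` by the monomials on the parts of a tree `S`. -/
noncomputable def mon (h : T.edges ⊆ S.edges) (f : P.Cov S) : P.toDG.cob.Dec T :=
  fun A => blkEl (isBlock_sub h A) f

theorem exists_contract_mon (h : T.edges ⊆ S.edges) (y : T.InnerEdge)
    (h' : (T.contract y).edges ⊆ S.edges) : ∃ c : (T.contract y).Vert → k, (∀ C, c C ≠ 0) ∧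
      ∀ f : P.Cov S, (mon h f).contract y = fun C => El.smul (c C) (mon h' f C) := by
  have key : ∀ C : (T.contract y).Vert, ∃ c : k, c ≠ 0 ∧ ∀ f : P.Cov S,
      (mon h f).contract y C = El.smul c (mon h' f C) := by
    intro C
    by_cases hC : C.1 = y.1.1.1
    · have h1 := fun Y => T.sub_outer y Y hC
      have h2 := fun Y => T.sub_inner y Y hC
      obtain ⟨c, hc, hf⟩ := exists_comp_blkEl (P := P) (X := T.In y.1.1.1) (Y := T.In y.1.2.1)
        (Z := (T.contract y).In C.1) (S := S) (φ := T.sub y.1.1.1) (ψ := T.sub y.1.2.1)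
        (χ := (T.contract y).sub C.1) ⟨y.1.2.1, y.2⟩ (T.contractEquiv y hC)
        (isBlock_sub h y.1.1) (isBlock_sub h y.1.2) (isBlock_sub h' C) h1 h2
      exact ⟨c, hc, fun f => (Dec.contract_self _ y C hC).trans (hf f)⟩
    · obtain ⟨c, hc, hf⟩ := exists_rel_blkEl (P := P) (S := S) (φ := T.sub C.1)
        (ψ := (T.contract y).sub C.1) (T.contractEquivOfNe y C hC)
        (isBlock_sub h (y.vert C)) (isBlock_sub h' C) (sub_map _ fun _ => rfl)
      exact ⟨c, hc, fun f => (Dec.contract_of_ne _ y C hC).trans (hf f)⟩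
  choose c hc hf using key
  exact ⟨c, hc, fun f => funext fun C => hf C f⟩

theorem _root_.DGOperadData.Dec.par_eq {Q : DGOperadData.{u, v} k} {p q : Q.Dec T}
    (h : ∀ A, (p A).1 = (q A).1) : p.par = q.par := by
  funext A
  by_cases hA : A ∈ T.edges ∧ 1 < A.card
  · rw [Dec.par_vert p ⟨A, hA⟩, Dec.par_vert q ⟨A, hA⟩, h]
  · rw [Dec.par, Dec.par, dif_neg hA, dif_neg hA]

theorem exists_opC_mon (h : T.edges ⊆ S.edges) (y : T.InnerEdge)
    (h' : (T.contract y).edges ⊆ S.edges) : ∃ c : k, c ≠ 0 ∧ ∀ F : P.toDG.cob.Fn n, IsMulti F →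
      ∀ f : P.Cov S, opC y.1.1.1 y.1.2.1 F T (mon h f) = c * F (T.contract y) (mon h' f) := by
  obtain ⟨c, hc, hf⟩ := exists_contract_mon (P := P) h y h'
  refine ⟨sg k (bef T.verts Before (mon h (0 : P.Cov S)).par y.1.1.1 + (1 + (mon h (0 : P.Cov S)).par y.1.1.1) +
    (mon h (0 : P.Cov S)).par y.1.2.1 * betw T.verts (mon h (0 : P.Cov S)).par y.1.1.1 y.1.2.1) *
    ∏ C, c C, mul_ne_zero (sg_ne_zero _) (prod_ne_zero_iff.2 fun C _ => hc C), fun F hF f => ?_⟩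
  rw [opC_apply F _ (inner_edge y)]
  have h1 : F (T.contract y) ((mon h f).contract y) = (∏ C, c C) * F (T.contract y) (mon h' f) := by
    rw [hf, hF.smul_univ]
  have h2 : (mon h f).par = (mon h (0 : P.Cov S)).par := Dec.par_eq fun _ => rfl
  rw [h2, mul_assoc]
  exact congrArg _ h1

/-- The differential of a function that vanishes on the decorations of `T`, on the monomials. -/
theorem exists_dFn_mon (h : T.edges ⊆ S.edges) : ∃ c : T.InnerEdge → k, (∀ y, c y ≠ 0) ∧
    ∀ F : P.toDG.cob.Fn n, IsMulti F → (∀ p, F T p = 0) → ∀ f : P.Cov S, dFn F T (mon h f) =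
      ∑ y, c y * F (T.contract y) (mon (contract_subset h y) f) := by
  have key := fun y => exists_opC_mon (P := P) h y (contract_subset h y)
  choose c hc hf using key
  refine ⟨c, hc, fun F hF hT f => ?_⟩
  rw [dFn_apply, sum_opI, sum_opC, sum_eq_zero, zero_add]
  · exact sum_congr rfl fun y _ => hf y F hF f
  · intro A _
    rw [opI_apply F _ A.2, hT, mul_zero]

section Multilinear

variable {φ : Finset (Fin l) → Finset (Fin n)}

theorem blkEl_congr (h : S.IsBlock φ) {f f' : P.Cov S} (hf : ∀ w, f (h.vert w) = f' (h.vert w)) :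
    blkEl h f = blkEl h f' := by
  simp only [blkEl, hf]

theorem ev_blkEl_update [DecidableEq S.Vert] (h : S.IsBlock φ) (f : P.Cov S)
    (w : (S.restr φ h).Vert) (x : Module.Dual k (P.obj (Nat.card (S.In (h.vert w).1)))) (b : P.Dec S) :
    (blkEl h (update f (h.vert w) x)).ev (S.restr φ h) ((toDec b).restr φ h) =
      x (b (h.vert w)) * ∏ A ∈ (S.restr φ h).verts.erase w.1, wt f b (φ A) := by
  rw [ev_blkEl_restr, ← mul_prod_erase _ _ (mem_verts.2 w.2)]
  congr 1
  · refine (wt_vert _ b (h.vert w)).trans ?_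
    rw [update_self]
  · refine prod_congr rfl fun A hA => ?_
    obtain ⟨hA, hA'⟩ := mem_erase.1 hA
    have h1 := h.vert_injective.ne (a₁ := ⟨A, mem_verts.1 hA'⟩) (a₂ := w)
      fun h => hA (congrArg Subtype.val h)
    have h2 := wt_vert f b (h.vert ⟨A, mem_verts.1 hA'⟩)
    have h3 := wt_vert (update f (h.vert w) x) b (h.vert ⟨A, mem_verts.1 hA'⟩)
    rw [update_of_ne h1] at h3
    exact h3.trans h2.symm

/-- The element of the cobar complex underlying `blkEl`. -/
noncomputable def blk (h : S.IsBlock φ) (f : P.Cov S) :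
    P.toDG.cob.obj l ((S.restr φ h).verts.card : ℤ) := (blkEl h f).2

theorem blkEl_update_add [DecidableEq S.Vert] (h : S.IsBlock φ) (f : P.Cov S)
    (w : (S.restr φ h).Vert) (x y : Module.Dual k (P.obj (Nat.card (S.In (h.vert w).1)))) :
    blkEl h (update f (h.vert w) (x + y)) = ⟨((S.restr φ h).verts.card : ℤ),
      blk h (update f (h.vert w) x) + blk h (update f (h.vert w) y)⟩ := by
  refine congrArg (Sigma.mk ((S.restr φ h).verts.card : ℤ)) ?_
  refine DGOperadData.cob_ext (IsMulti.ext (isMulti_ev' _) (isMulti_ev' _) fun U a => ?_)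
  rw [ev_add', Pi.add_apply, Pi.add_apply]
  change (blkEl h _).ev _ _ = (blkEl h _).ev _ _ + (blkEl h _).ev _ _
  by_cases hU : U = S.restr φ h
  · subst hU
    obtain ⟨b, hb⟩ := exists_restr_toDec h a
    rw [← hb, ev_blkEl_update, ev_blkEl_update, ev_blkEl_update, LinearMap.add_apply, add_mul]
  · rw [ev_blkEl_of_ne _ _ hU, ev_blkEl_of_ne _ _ hU, ev_blkEl_of_ne _ _ hU, add_zero]

theorem blkEl_update_smul [DecidableEq S.Vert] (h : S.IsBlock φ) (f : P.Cov S)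
    (w : (S.restr φ h).Vert) (c : k) (x : Module.Dual k (P.obj (Nat.card (S.In (h.vert w).1)))) :
    blkEl h (update f (h.vert w) (c • x)) = El.smul c (blkEl h (update f (h.vert w) x)) := by
  refine ext_blkEl h _ _ rfl (fun b => ?_) fun U a hU => ev_blkEl_of_ne _ _ hU _
  rw [ev_blkEl_update, ← ev_blkEl_restr, ev_blkEl_update, LinearMap.smul_apply, smul_eq_mul,
    mul_assoc]

theorem mon_update [DecidableEq S.Vert] (h : T.edges ⊆ S.edges) (f : P.Cov S) (A : T.Vert)
    (w : (part h A).Vert)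
    (x : Module.Dual k (P.obj (Nat.card (S.In ((isBlock_sub h A).vert w).1)))) :
    mon h (update f ((isBlock_sub h A).vert w) x) =
      update (mon h f) A (blkEl (isBlock_sub h A) (update f ((isBlock_sub h A).vert w) x)) := by
  funext C
  by_cases hC : C = A
  · subst hC
    rw [update_self]
    rfl
  · rw [update_of_ne hC]
    refine blkEl_congr _ fun w' => update_of_ne (fun h1 => hC ?_) _ _
    exact congrArg Sigma.fst ((partVert h).injective (a₁ := ⟨C, w'⟩) (a₂ := ⟨A, w⟩) h1)

/-- The values on monomials depend on the functionals in a multilinear way. -/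
noncomputable def monMultilinear {F : P.toDG.cob.Fn n} (hF : IsMulti F) (h : T.edges ⊆ S.edges) :
    MultilinearMap k (fun A : S.Vert => Module.Dual k (P.obj (Nat.card (S.In A.1)))) k where
  toFun f := F T (mon h f)
  map_update_add' f v x y := by
    obtain ⟨A, w, rfl⟩ : ∃ A w, (isBlock_sub h A).vert w = v := by
      obtain ⟨w, rfl⟩ := (partVert h).surjective v
      exact ⟨w.1, w.2, rfl⟩
    have h1 := mon_update h f A w
    have h2 := blkEl_update_add (isBlock_sub h A) f w x y
    rw [h1, h1, h1, h2]
    exact hF.add' _ _ _ _ _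
  map_update_smul' f v c x := by
    obtain ⟨A, w, rfl⟩ : ∃ A w, (isBlock_sub h A).vert w = v := by
      obtain ⟨w, rfl⟩ := (partVert h).surjective v
      exact ⟨w.1, w.2, rfl⟩
    have h1 := mon_update h f A w
    have h2 := blkEl_update_smul (isBlock_sub h A) f w c x
    rw [h1, h1, h2]
    exact hF.smul' _ _ _ _

end Multilinear

theorem exists_mon (h : T.edges ⊆ S.edges) {U : ∀ A : T.Vert, RTree (Nat.card (T.In A.1))}
    (hU : U = fun A => part h A) (g : ∀ A, P.Cov (U A)) :
    ∃ f : P.Cov S, mon h f = fun A => monEl (g A) := by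
  subst hU
  obtain ⟨f, hf⟩ := (partVert h).injective.exists_forall_eq
    (X := fun v : S.Vert => Module.Dual k (P.obj (Nat.card (S.In v.1))))
    fun w => g w.1 w.2 ∘ₗ rel ((isBlock_sub h w.1).inEquiv w.2.2.2).symm
  refine ⟨f, funext fun A => ?_⟩
  have h1 : (fun w => f ((isBlock_sub h A).vert w) ∘ₗ rel ((isBlock_sub h A).inEquiv w.2.2)) = g A := by
    funext w
    rw [show f ((isBlock_sub h A).vert w) = _ from hf ⟨A, w⟩]
    refine LinearMap.ext fun a => ?_
    exact congrArg (g A w) (rel_symm_rel _ a)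
  change monEl _ = monEl _
  rw [← h1]

/-- A function which vanishes on monomials is zero. -/
theorem eq_zero_of_mon [∀ n, FiniteDimensional k (P.obj n)] {F : P.toDG.cob.Fn n} (hF : IsMulti F)
    (h0 : ∀ (S : RTree n) (h : T.edges ⊆ S.edges) (f : P.Cov S), F T (mon h f) = 0)
    (p : P.toDG.cob.Dec T) : F T p = 0 := by
  classical
  have key : ∀ (s : Finset T.Vert) (p : P.toDG.cob.Dec T),
      (∀ A ∉ s, ∃ (U : RTree _) (g : P.Cov U), p A = monEl g) → F T p = 0 := by
    intro s
    induction s using Finset.induction_on with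
    | empty =>
      intro p hp
      choose U g hg using fun A => hp A (notMem_empty A)
      obtain ⟨f, hf⟩ := exists_mon (T.subset_glue U) (funext fun A => (T.part_glue U A).symm) g
      rw [show p = fun A => monEl (g A) from funext hg, ← hf]
      exact h0 _ _ f
    | insert A s hA ih =>
      intro p hp
      have h1 : ∀ y : P.toDG.cob.obj _ (p A).1, F T (update p A ⟨(p A).1, y⟩) = 0 := by
        intro y
        induction mem_span_monEl y using Submodule.span_induction with
        | mem z hz =>
          obtain ⟨U, g, hz⟩ := hz
          rw [hz]
          refine ih _ fun C hC => ?_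
          by_cases hCA : C = A
          · subst hCA
            exact ⟨U, g, update_self _ _ _⟩
          · rw [update_of_ne hCA]
            exact hp C fun h => (mem_insert.1 h).elim hCA hC
        | zero => exact DGOperadData.IsMulti.zero hF p A _
        | add y z _ _ hy hz => rw [hF.add, hy, hz, add_zero]
        | smul c y _ hy =>
          have h2 := hF.smul T p A c ⟨_, y⟩
          rw [hy, mul_zero] at h2
          exact h2
      have h2 := h1 (p A).2
      rwa [show (⟨(p A).1, (p A).2⟩ : P.toDG.cob.El _) = p A from rfl, update_eq_self] at h2
  exact key univ p fun A hA => absurd (mem_univ A) hA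

end Operad

/-! ### Elements of the double cobar complex with given values on monomials -/

namespace RTree

variable {n : ℕ}

theorem sum_card_part {T S : RTree n} (h : T.edges ⊆ S.edges) :
    ∑ A : T.Vert, (part h A).verts.card = S.verts.card := by
  rw [← card_vert, ← Fintype.card_congr (partVert h), Fintype.card_sigma]
  exact sum_congr rfl fun A _ => (card_vert _).symm

theorem eq_of_part {T S S' : RTree n} (h : T.edges ⊆ S.edges) (h' : T.edges ⊆ S'.edges)
    (hp : ∀ A, part h A = part h' A) : S = S' := by
  have key : ∀ {S S' : RTree n} (h : T.edges ⊆ S.edges) (h' : T.edges ⊆ S'.edges),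
      (∀ A, part h A = part h' A) → S.verts ⊆ S'.verts := by
    intro S S' h h' hp B hB
    obtain ⟨A, Y, hY, rfl⟩ := exists_sub_eq h hB
    rw [mem_verts] at hB ⊢
    have h1 : Y ∈ (part h' A).edges := by
      rw [← hp A]
      exact (mem_restr _).2 hB.1
    exact ⟨(mem_restr _).1 h1, hB.2⟩
  exact eq_of_verts ((key h h' hp).antisymm (key h' h fun A => (hp A).symm))

end RTree

namespace DGOperadData

variable {k : Type u} [Field k] {Q : DGOperadData.{u, v} k} {n : ℕ} {i : ℤ}

theorem ev_sub' (α β : Q.cob.obj n i) : ev (α - β : Q.cob.obj n i) = ev α - ev β :=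
  map_sub (AddMonoidHom.mk' (fun α : Q.cob.obj n i => ev α) ev_add') α β

theorem dFn_sub (F G : Q.Fn n) : dFn (F - G) = dFn F - dFn G := by
  have hI : ∀ A (T : RTree n) (p : Q.Dec T), opI A (F - G) T p = opI A F T p - opI A G T p := by
    intro A T p
    by_cases h : A ∈ T.edges ∧ 1 < A.card
    · rw [opI_apply _ _ h, opI_apply _ _ h, opI_apply _ _ h, ← mul_sub]; rfl
    · rw [opI_of_notMem _ _ h, opI_of_notMem _ _ h, opI_of_notMem _ _ h, sub_zero]
  have hC : ∀ A B (T : RTree n) (p : Q.Dec T), opC A B (F - G) T p = opC A B F T p - opC A B G T p := by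
    intro A B T p
    by_cases h : T.Inner A B
    · rw [opC_apply _ _ h, opC_apply _ _ h, opC_apply _ _ h, ← mul_sub]; rfl
    · rw [opC_of_not _ _ h, opC_of_not _ _ h, opC_of_not _ _ h, sub_zero]
  funext T p
  rw [Pi.sub_apply, Pi.sub_apply, dFn_apply, dFn_apply, dFn_apply]
  simp only [hI, hC, sum_sub_distrib]
  ring

theorem dFn_eq_zero {F : Q.Fn n} {T : RTree n} (h : ∀ p, F T p = 0)
    (h' : ∀ (y : T.InnerEdge) p, F (T.contract y) p = 0) (p : Q.Dec T) : dFn F T p = 0 := by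
  rw [dFn_apply, sum_opI, sum_opC, sum_eq_zero, sum_eq_zero, zero_add]
  · intro y _
    rw [opC_apply _ _ (inner_edge y)]
    exact (congrArg _ (h' y _)).trans (mul_zero _)
  · intro A _
    rw [opI_apply _ _ A.2, h, mul_zero]

end DGOperadData

open RTree

namespace Operad

open DGOperadData DGOperadData.El Function

variable {k : Type u} [Field k] {P : Operad.{u, v} k} {n : ℕ} {T S : RTree n}

open scoped Classical in
/-- The function of decorated trees which evaluates the decorations of the vertices of a tree with
fewer edges than `S` on the parts of a decoration of `S`. -/
noncomputable def elt (b : P.Dec S) : P.toDG.cob.Fn n := fun T p =>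
  if h : T.edges ⊆ S.edges then
    ∏ A : T.Vert, (p A).ev (part h A) ((toDec b).restr _ (isBlock_sub h A))
  else 0

theorem elt_of_subset (b : P.Dec S) (h : T.edges ⊆ S.edges) (p : P.toDG.cob.Dec T) :
    elt b T p = ∏ A : T.Vert, (p A).ev (part h A) ((toDec b).restr _ (isBlock_sub h A)) :=
  dif_pos h

theorem elt_of_not_subset (b : P.Dec S) (h : ¬ T.edges ⊆ S.edges) (p : P.toDG.cob.Dec T) :
    elt b T p = 0 := dif_neg h

theorem isMulti_elt (b : P.Dec S) : IsMulti (elt b) := by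
  refine isMulti_of_prod fun T => ?_
  by_cases h : T.edges ⊆ S.edges
  · exact Or.inr ⟨_, fun A => isLin_ev _ _, elt_of_subset b h⟩
  · exact Or.inl (elt_of_not_subset b h)

theorem fst_of_ev_ne_zero {m : ℕ} {y : P.toDG.cob.El m} {U : RTree m} {a : P.Dec U}
    (h : y.ev U (toDec a) ≠ 0) : y.1 = U.verts.card := by
  by_contra h'
  refine h (ev_of_ne _ _ _ ?_)
  rw [sum_one_sub fun A => rfl]
  exact Ne.symm h'

theorem sum_fst_of_elt_ne_zero {b : P.Dec S} {p : P.toDG.cob.Dec T} (h : elt b T p ≠ 0) :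
    ∑ A, (1 - (p A).1) = T.verts.card - S.verts.card := by
  by_cases hT : T.edges ⊆ S.edges
  · rw [elt_of_subset b hT, prod_ne_zero_iff] at h
    have h1 : ∀ A, (p A).1 = (part hT A).verts.card := fun A => by
      obtain ⟨a, ha⟩ := restr_toDec (isBlock_sub hT A) b
      have h2 := h A (mem_univ A)
      rw [ha] at h2
      exact fst_of_ev_ne_zero h2
    simp only [h1, sum_sub_distrib, ← sum_card_part hT, Nat.cast_sum]
    simp [card_vert]
  · exact absurd (elt_of_not_subset b hT p) h

theorem sum_mon (h : T.edges ⊆ S.edges) (f : P.Cov S) :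
    ∑ A, (1 - (mon h f A).1) = T.verts.card - S.verts.card := by
  rw [← sum_card_part h, Nat.cast_sum, sum_sub_distrib]
  simp [card_vert, mon]

theorem elt_mon (b : P.Dec S) (h : T.edges ⊆ S.edges) (f : P.Cov S) :
    elt b T (mon h f) = ∏ A, f A (b A) := by
  rw [elt_of_subset b h, ← (partVert h).prod_comp, ← univ_sigma_univ, prod_sigma]
  refine prod_congr rfl fun A _ => ?_
  refine (ev_blkEl_restr _ f b).trans ?_
  rw [← prod_vert]
  exact prod_congr rfl fun w _ => wt_vert f b ((isBlock_sub h A).vert w)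

theorem elt_mon_of_ne {S' : RTree n} (hS : S' ≠ S) (b : P.Dec S) (h : T.edges ⊆ S'.edges)
    (f : P.Cov S') : elt b T (mon h f) = 0 := by
  by_cases hT : T.edges ⊆ S.edges
  · have h1 : ∃ A, part hT A ≠ part h A := by
      by_contra! h1
      exact hS (eq_of_part hT h h1).symm
    obtain ⟨A, hA⟩ := h1
    rw [elt_of_subset b hT]
    exact prod_eq_zero (mem_univ A) (ev_blkEl_of_ne _ f hA _)
  · exact elt_of_not_subset b hT _

/-- There are elements of the double cobar complex with given values on monomials. -/
theorem exists_ev_mon [∀ n, FiniteDimensional k (P.obj n)] {i : ℤ}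
    (γ : ∀ T S : RTree n,
      MultilinearMap k (fun A : S.Vert => Module.Dual k (P.obj (Nat.card (S.In A.1)))) k)
    (hγ : ∀ T S f, γ T S f ≠ 0 → (T.verts.card : ℤ) - S.verts.card = i) :
    ∃ α : P.toDG.cob.cob.obj n i, ∀ (T S : RTree n) (h : T.edges ⊆ S.edges) (f : P.Cov S),
      ev α T (mon h f) = γ T S f := by
  classical
  let b : ∀ m, Module.Basis (Fin (Module.finrank k (P.obj m))) k (P.obj m) := fun m =>
    Module.finBasis k (P.obj m)
  let Ix : RTree n → Type := fun S => ∀ A : S.Vert, Fin (Module.finrank k (P.obj (Nat.card (S.In A.1))))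
  let F : P.toDG.cob.Fn n := fun T p => ∑ S : RTree n, ∑ I : Ix S,
    γ T S (fun A => (b _).coord (I A)) * elt (P := P) (S := S) (fun A => b _ (I A)) T p
  have hF : IsMulti F := by
    refine isMulti_sum _ fun S _ => isMulti_sum _ fun I _ => ?_
    have h1 := isMulti_elt (P := P) (S := S) fun A => b _ (I A)
    exact ⟨fun T p A i x y => by rw [h1.add, mul_add], fun T p A c x => by
      rw [h1.smul, mul_left_comm]⟩
  have hi : ∀ T p, F T p ≠ 0 → ∑ A, (1 - (p A).1) = i := by
    intro T p h
    obtain ⟨S, -, h⟩ := exists_ne_zero_of_sum_ne_zero h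
    obtain ⟨I, -, h⟩ := exists_ne_zero_of_sum_ne_zero h
    rw [sum_fst_of_elt_ne_zero (right_ne_zero_of_mul h)]
    exact hγ _ _ _ (left_ne_zero_of_mul h)
  obtain ⟨α, hα⟩ := exists_ev hF hi
  refine ⟨α, fun T S h f => ?_⟩
  rw [hα]
  refine (sum_eq_single S (fun S' _ hS => sum_eq_zero fun I _ => ?_) fun h => absurd (mem_univ S) h).trans ?_
  · rw [elt_mon_of_ne hS.symm, mul_zero]
  · rw [(γ T S).eq_sum_basis (fun A => (b _).dualBasis) f]
    refine sum_congr rfl fun I _ => ?_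
    rw [elt_mon, mul_comm]
    simp only [Module.Basis.dualBasis_repr, Module.Basis.coe_dualBasis]

/-! ### The acyclicity of the double cobar complex -/

/-- The coefficients of the differential on monomials. -/
noncomputable def coefD (P : Operad.{u, v} k) (h : T.edges ⊆ S.edges) : T.InnerEdge → k :=
  Classical.choose (exists_dFn_mon (P := P) h)

theorem coefD_ne_zero (h : T.edges ⊆ S.edges) (y : T.InnerEdge) : coefD P h y ≠ 0 :=
  (Classical.choose_spec (exists_dFn_mon (P := P) h)).1 y

theorem dFn_mon (h : T.edges ⊆ S.edges) {F : P.toDG.cob.Fn n} (hF : IsMulti F)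
    (hT : ∀ p, F T p = 0) (f : P.Cov S) : dFn F T (mon h f) =
      ∑ y, coefD P h y * F (T.contract y) (mon (contract_subset h y) f) :=
  (Classical.choose_spec (exists_dFn_mon (P := P) h)).2 F hF hT f

theorem eq_of_upper {y y' : T.InnerEdge} (h : y.1.2.1 = y'.1.2.1) : y = y' := by
  obtain ⟨⟨A, B⟩, hy⟩ := y
  obtain ⟨⟨A', B'⟩, hy'⟩ := y'
  obtain rfl : B = B' := Subtype.ext h
  obtain rfl : A = A' := Subtype.ext (IsInput.unique A.2.1 A'.2.1 hy hy')
  rfl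

theorem card_contract (y : T.InnerEdge) : (T.contract y).verts.card + 1 = T.verts.card := by
  rw [verts_contract, card_erase_add_one (mem_verts.2 y.1.2.2)]

theorem insert_contract (y : T.InnerEdge) : insert y.1.2.1 (T.contract y).verts = T.verts := by
  rw [verts_contract, insert_erase (mem_verts.2 y.1.2.2)]

/-- A chosen vertex of the tree `S` which is not the root, if there is one. -/
noncomputable def pick (S : RTree n) : Finset (Fin n) :=
  open scoped Classical in
  if h : ∃ B ∈ S.verts, B ≠ univ then Classical.choose h else ∅

theorem pick_spec (h : ∃ B ∈ S.verts, B ≠ univ) : pick S ∈ S.verts ∧ pick S ≠ univ := by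
  rw [pick, dif_pos h]
  exact Classical.choose_spec h

theorem exists_ne_univ (h : 2 ≤ S.verts.card) : ∃ B ∈ S.verts, B ≠ univ := by
  obtain ⟨B, hB, hne⟩ := exists_mem_ne (Nat.lt_of_succ_le h) univ
  exact ⟨B, hB, hne⟩

theorem verts_subset (h : T.edges ⊆ S.edges) : T.verts ⊆ S.verts := fun A hA => by
  rw [mem_verts] at hA ⊢
  exact ⟨h hA.1, hA.2⟩

/-- The tree `T` with the chosen vertex of `S` added. -/
theorem exists_add_pick (h : T.edges ⊆ S.edges) (hS : ∃ B ∈ S.verts, B ≠ univ)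
    (hT : pick S ∉ T.verts) : ∃ (T' : RTree n) (y : T'.InnerEdge), T'.edges ⊆ S.edges ∧
      y.1.2.1 = pick S ∧ T'.contract y = T := by
  obtain ⟨h1, h2⟩ := pick_spec hS
  have h3 := mem_verts.1 h1
  obtain ⟨y, hy⟩ := (addEdge h h3.1).exists_innerEdge (mem_verts.2 ⟨mem_insert_self _ _, h3.2⟩) h2
  refine ⟨addEdge h h3.1, y, addEdge_subset h h3.1, hy, eq_of_edges fun A => ?_⟩
  rw [mem_contract, hy]
  constructor
  · rintro ⟨hA, hA'⟩
    exact (mem_insert.1 hA').resolve_left hA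
  · intro hA
    refine ⟨?_, mem_insert_of_mem hA⟩
    rintro rfl
    exact hT (mem_verts.2 ⟨hA, h3.2⟩)

variable {i : ℤ}

theorem ev_mon_eq_zero (α : P.toDG.cob.cob.obj n i) (h : T.edges ⊆ S.edges) (f : P.Cov S)
    (hi : (T.verts.card : ℤ) - S.verts.card ≠ i) : ev α T (mon h f) = 0 :=
  ev_of_ne _ _ _ (by rwa [sum_mon])

/-- A function with vanishing differential which vanishes on trees with the chosen vertex also
vanishes on the other ones. -/
theorem ev_mon_of_pick {F : P.toDG.cob.Fn n} (hF : IsMulti F) {t : ℕ}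
    (h1 : ∀ T, t < T.verts.card → ∀ p, F T p = 0)
    (h2 : ∀ T, t < T.verts.card → ∀ p, dFn F T p = 0) (hS : ∃ B ∈ S.verts, B ≠ univ) (f : P.Cov S)
    (h3 : ∀ (T : RTree n) (h : T.edges ⊆ S.edges), T.verts.card = t → pick S ∈ T.verts →
      F T (mon h f) = 0)
    (h : T.edges ⊆ S.edges) (hT : T.verts.card = t) : F T (mon h f) = 0 := by
  by_cases hp : pick S ∈ T.verts
  · exact h3 T h hT hp
  obtain ⟨T', y, h', hy, rfl⟩ := exists_add_pick h hS hp
  have hc := card_contract y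
  have h4 := dFn_mon h' hF (h1 T' (by omega)) f
  rw [h2 T' (by omega), sum_eq_single y] at h4
  · exact (mul_eq_zero.1 h4.symm).resolve_left (coefD_ne_zero h' y)
  · intro y' _ hne
    have hc' := card_contract y'
    rw [h3 _ _ (by omega), mul_zero]
    rw [verts_contract, mem_erase, ← hy]
    exact ⟨fun h => hne (eq_of_upper h.symm), mem_verts.2 y.1.2.2⟩
  · exact fun h => absurd (mem_univ y) h

theorem exists_sub_d_step [∀ n, FiniteDimensional k (P.obj n)] (α : P.toDG.cob.cob.obj n i) {t : ℕ}
    (ht : 2 ≤ t) (h1 : ∀ T, t < T.verts.card → ∀ p, ev α T p = 0)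
    (h2 : ∀ T, t < T.verts.card → ∀ p, dFn (ev α) T p = 0) :
    ∃ β : P.toDG.cob.cob.obj n (i - 1), ∀ T, t ≤ T.verts.card →
      ∀ p, (ev α - dFn (ev β)) T p = 0 := by
  have hF := isMulti_ev' α
  have key : ∀ T S : RTree n,
      ∃ γ : MultilinearMap k (fun A : S.Vert => Module.Dual k (P.obj (Nat.card (S.In A.1)))) k,
        (∀ (T' : RTree n) (h : T'.edges ⊆ S.edges) (y : T'.InnerEdge), y.1.2.1 = pick S →
          T'.contract y = T → T'.verts.card = t →
            ∀ f, coefD P h y * γ f = ev α T' (mon h f)) ∧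
        ∀ f, γ f ≠ 0 → T.verts.card + 1 = t ∧ pick S ∉ T.verts ∧
          (T.verts.card : ℤ) - S.verts.card = i - 1 := by
    intro T S
    by_cases hex : ∃ (T' : RTree n) (_ : T'.edges ⊆ S.edges) (y : T'.InnerEdge),
      y.1.2.1 = pick S ∧ T'.contract y = T ∧ T'.verts.card = t
    · obtain ⟨T', h, y, hy, hT, hc⟩ := hex
      refine ⟨(coefD P h y)⁻¹ • monMultilinear hF h, ?_, ?_⟩
      · intro T'' h' y' hy' hT' hc' f
        obtain rfl : T' = T'' := eq_of_verts (by
          rw [← insert_contract y, ← insert_contract y', hy, hy', hT, hT'])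
        obtain rfl : y = y' := eq_of_upper (hy.trans hy'.symm)
        exact mul_inv_cancel_left₀ (coefD_ne_zero h y) _
      · intro f hf
        have h3 : ev α T' (mon h f) ≠ 0 := right_ne_zero_of_mul hf
        have h4 : (T'.verts.card : ℤ) - S.verts.card = i := by
          by_contra h4
          exact h3 (ev_mon_eq_zero α h f h4)
        have h5 := card_contract y
        rw [hT] at h5
        refine ⟨by omega, ?_, by omega⟩
        rw [← hT, verts_contract, hy]
        exact notMem_erase _ _
    · refine ⟨0, fun T' h y hy hT hc f => absurd ⟨T', h, y, hy, hT, hc⟩ hex, fun f hf => ?_⟩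
      exact absurd rfl hf
  choose γ hγ hγ' using key
  obtain ⟨β, hβ⟩ := exists_ev_mon (i := i - 1) γ fun T S f hf => (hγ' T S f hf).2.2
  have hβ0 : ∀ T : RTree n, t ≤ T.verts.card → ∀ p, ev β T p = 0 := fun T hT =>
    eq_zero_of_mon (isMulti_ev' β) fun S h f => by
      rw [hβ]
      by_contra h3
      have := (hγ' T S f h3).1
      omega
  have hdβ : ∀ T : RTree n, t < T.verts.card → ∀ p, dFn (ev β) T p = 0 := fun T hT =>
    dFn_eq_zero (hβ0 T hT.le) fun y => hβ0 _ (by have := card_contract y; omega)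
  have hev : ev (α - P.toDG.cob.cob.d n (i - 1) i β : P.toDG.cob.cob.obj n i) = ev α - dFn (ev β) := by
    rw [ev_sub', ev_d (sub_add_cancel i 1)]
  have hM : IsMulti (ev α - dFn (ev β)) := by
    rw [← hev]
    exact isMulti_ev' _
  have hdd : dFn (dFn (ev β)) = 0 :=
    dFn_dFn (isDGOperad_cob P.isDGOperad_toDG) (isMulti_ev' β)
  have h3 : ∀ T : RTree n, t < T.verts.card → ∀ p, (ev α - dFn (ev β)) T p = 0 := fun T hT p => by
    rw [Pi.sub_apply, Pi.sub_apply, h1 T hT, hdβ T hT, sub_zero]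
  refine ⟨β, fun T hT => ?_⟩
  rcases hT.lt_or_eq with hT | hT
  · exact h3 T hT
  refine eq_zero_of_mon hM fun S h f => ?_
  have hS : ∃ B ∈ S.verts, B ≠ univ :=
    exists_ne_univ (ht.trans (hT.trans_le (card_le_card (verts_subset h))))
  refine ev_mon_of_pick hM h3 (fun T hT p => ?_) hS f (fun T h hT hp => ?_) h hT.symm
  · rw [dFn_sub, hdd, sub_zero, h2 T hT]
  · obtain ⟨y, hy⟩ := T.exists_innerEdge hp (pick_spec hS).2
    rw [Pi.sub_apply, Pi.sub_apply, dFn_mon h (isMulti_ev' β) (hβ0 T hT.ge), sum_eq_single y,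
      hβ, hγ _ S T h y hy rfl hT, sub_self]
    · intro y' _ hne
      rw [hβ]
      by_contra h4
      refine (hγ' _ _ _ (right_ne_zero_of_mul h4)).2.1 ?_
      rw [verts_contract, mem_erase, ← hy]
      exact ⟨fun h => hne (eq_of_upper h.symm), mem_verts.2 y.1.2.2⟩
    · exact fun h => absurd (mem_univ y) h

/-- Up to a coboundary, an element whose differential vanishes on all trees with at least two
vertices takes non-zero values only on the monomials for the tree with one vertex. -/
theorem exists_sub_d [∀ n, FiniteDimensional k (P.obj n)] (hn : 1 < n) (α : P.toDG.cob.cob.obj n i)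
    (h : ∀ T, 2 ≤ T.verts.card → ∀ p, dFn (ev α) T p = 0) :
    ∃ β : P.toDG.cob.cob.obj n (i - 1), ∀ (T S : RTree n) (h : T.edges ⊆ S.edges) (f : P.Cov S),
      S.verts.card ≠ 1 → (ev α - dFn (ev β)) T (mon h f) = 0 := by
  have hdd : ∀ β : P.toDG.cob.cob.obj n (i - 1), dFn (dFn (ev β)) = 0 := fun β =>
    dFn_dFn (isDGOperad_cob P.isDGOperad_toDG) (isMulti_ev' β)
  have hev : ∀ β, ev (α - P.toDG.cob.cob.d n (i - 1) i β : P.toDG.cob.cob.obj n i) =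
      ev α - dFn (ev β) := fun β => by
    rw [ev_sub', ev_d (sub_add_cancel i 1)]
  have key : ∀ s t : ℕ, 2 ≤ t → (univ : Finset (Finset (Fin n))).card < t + s →
      ∃ β : P.toDG.cob.cob.obj n (i - 1), ∀ T, t ≤ T.verts.card →
        ∀ p, (ev α - dFn (ev β)) T p = 0 := by
    intro s
    induction s with
    | zero =>
      intro t _ hs
      refine ⟨0, fun T hT => ?_⟩
      have := card_le_univ T.verts
      rw [← card_univ] at this
      omega
    | succ s ih =>
      intro t ht hs
      obtain ⟨β, hβ⟩ := ih (t + 1) (by omega) (by omega)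
      have h1 := hev β
      obtain ⟨β', hβ'⟩ := exists_sub_d_step (α - P.toDG.cob.cob.d n (i - 1) i β) ht
        (fun T hT p => by rw [h1]; exact hβ T hT p)
        (fun T hT p => by rw [h1, dFn_sub, hdd, sub_zero, h T (by omega)])
      refine ⟨β + β', fun T hT p => ?_⟩
      have h2 := hβ' T hT p
      rw [h1] at h2
      have h3 : ev (P.toDG.cob.cob.d n (i - 1) i (β + β')) = dFn (ev β) + dFn (ev β') := by
        rw [map_add, ev_add', ev_d (sub_add_cancel i 1), ev_d (sub_add_cancel i 1)]
      rw [ev_d (sub_add_cancel i 1)] at h3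
      rw [h3, ← sub_sub]
      exact h2
  obtain ⟨β, hβ⟩ := key (univ : Finset (Finset (Fin n))).card 2 le_rfl (by omega)
  refine ⟨β, fun T S hTS f hS => ?_⟩
  have hu : ∀ T : RTree n, univ ∈ T.verts := fun T => mem_verts.2 ⟨T.root_mem, by simpa using hn⟩
  have hpos : ∀ T : RTree n, 1 ≤ T.verts.card := fun T => card_pos.2 ⟨_, hu T⟩
  by_cases hT : 2 ≤ T.verts.card
  · exact hβ T hT _
  have hS' : ∃ B ∈ S.verts, B ≠ univ := exists_ne_univ (by have := hpos S; omega)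
  have hM : IsMulti (ev α - dFn (ev β)) := by
    rw [← hev]
    exact isMulti_ev' _
  refine ev_mon_of_pick (t := 1) hM (fun T hT => hβ T hT) (fun T hT p => ?_) hS' f
    (fun T h hT hp => ?_) hTS (by have := hpos T; omega)
  · rw [dFn_sub, hdd, sub_zero, h T hT]
  · exact absurd (card_le_one.1 hT.le _ hp _ (hu T)) (pick_spec hS').2

end Operad

/-! ### Corollas -/

namespace RTree

variable {n l : ℕ}

theorem univ_mem_verts (hn : 1 < n) (T : RTree n) : univ ∈ T.verts :=
  mem_verts.2 ⟨T.root_mem, by simpa using hn⟩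

theorem eq_corolla_of_card (hn : 1 < n) {T : RTree n} (hT : T.verts.card = 1) : T.verts = {univ} := by
  obtain ⟨A, hA⟩ := card_eq_one.1 hT
  have h := T.univ_mem_verts hn
  rw [hA, mem_singleton] at h
  rw [hA, h]

/-- The tree with one vertex. -/
def corolla (hn : 1 < n) : RTree n where
  edges := insert univ (univ.image singleton)
  nonempty A hA := by
    rcases mem_insert.1 hA with rfl | hA
    · exact ⟨⟨0, by omega⟩, mem_univ _⟩
    · obtain ⟨c, -, rfl⟩ := mem_image.1 hA
      exact singleton_nonempty c
  root_mem := mem_insert_self _ _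
  leaf_mem c := mem_insert_of_mem (mem_image_of_mem _ (mem_univ c))
  laminar A hA B hB := by
    rcases mem_insert.1 hA with rfl | hA
    · exact Or.inr (Or.inl (subset_univ B))
    rcases mem_insert.1 hB with rfl | hB
    · exact Or.inl (subset_univ A)
    obtain ⟨c, -, rfl⟩ := mem_image.1 hA
    obtain ⟨d, -, rfl⟩ := mem_image.1 hB
    by_cases h : c = d
    · exact Or.inl (by rw [h])
    · exact Or.inr (Or.inr (disjoint_singleton.2 h))

theorem verts_corolla (hn : 1 < n) : (corolla hn).verts = {univ} := by
  refine eq_singleton_iff_unique_mem.2 ⟨univ_mem_verts hn _, fun A hA => ?_⟩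
  rw [mem_verts] at hA
  rcases mem_insert.1 hA.1 with h | h
  · exact h
  · obtain ⟨c, -, rfl⟩ := mem_image.1 h
    exact absurd hA.2 (by simp)

variable {T : RTree n}

theorem vert_eq_univ (hT : T.verts = {univ}) (A : T.Vert) : A.1 = univ := by
  have h := mem_verts.2 A.2
  rwa [hT, mem_singleton] at h

theorem subsingleton_vert (hT : T.verts = {univ}) : Subsingleton T.Vert :=
  ⟨fun A B => Subtype.ext ((vert_eq_univ hT A).trans (vert_eq_univ hT B).symm)⟩

theorem isEmpty_innerEdge (hT : T.verts = {univ}) : IsEmpty T.InnerEdge :=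
  ⟨fun y => y.ne ((vert_eq_univ hT y.1.1).trans (vert_eq_univ hT y.1.2).symm)⟩

/-- The root vertex. -/
def root (hT : T.verts = {univ}) : T.Vert :=
  ⟨univ, mem_verts.1 (by rw [hT]; exact mem_singleton_self _)⟩

/-- The inputs of the vertex of a corolla. -/
noncomputable def leaf (hT : T.verts = {univ}) (A : T.Vert) : Fin n ≃ T.In A.1 :=
  Equiv.ofBijective (fun c => ⟨{c}, T.leaf_mem c, by
      rw [vert_eq_univ hT A]
      refine (subset_univ _).ssubset_of_ne fun h => ?_
      have h1 := A.2.2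
      rw [vert_eq_univ hT A, ← h, card_singleton] at h1
      exact lt_irrefl _ h1, fun C hC h h' => by
      have h1 : C ∈ T.verts := mem_verts.2 ⟨hC, by simpa using card_lt_card h⟩
      rw [hT, mem_singleton] at h1
      rw [h1, vert_eq_univ hT A] at h'
      exact h'.2 (subset_univ _)⟩)
    ⟨fun c d h => singleton_injective (congrArg Subtype.val h), fun ⟨B, hB⟩ => by
      have h1 : ¬ 1 < B.card := fun h => by
        have h2 := mem_verts.2 ⟨hB.1, h⟩
        rw [hT, mem_singleton] at h2
        have h3 := hB.2.1
        rw [vert_eq_univ hT A, h2] at h3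
        exact h3.2 (subset_univ _)
      obtain ⟨c, rfl⟩ := card_eq_one.1 ((not_lt.1 h1).antisymm (T.nonempty _ hB.1).card_pos)
      exact ⟨c, rfl⟩⟩

@[simp] theorem leaf_val (hT : T.verts = {univ}) (A : T.Vert) (c : Fin n) :
    (leaf hT A c).1 = {c} := rfl

theorem one_lt_of_vert (A : T.Vert) : 1 < n := by
  have h := card_le_univ A.1
  rw [Fintype.card_fin] at h
  exact A.2.2.trans_le h

theorem verts_restr_corolla {m : ℕ} (hm : 1 < m) (hT : T.verts = {univ})
    {φ : Finset (Fin m) → Finset (Fin n)} (h : T.IsBlock φ) : (T.restr φ h).verts = {univ} := by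
  refine eq_singleton_iff_unique_mem.2 ⟨univ_mem_verts hm _, fun A hA => ?_⟩
  have h1 := vert_eq_univ hT (h.vert ⟨A, mem_verts.1 hA⟩)
  refine (subset_univ A).antisymm ((h.sub _ _).1 ?_)
  rw [show φ A = univ from h1]
  exact subset_univ _

theorem edges_eq_of_subset {S T : RTree n} (hn : 1 < n) (h : T.edges ⊆ S.edges)
    (hS : S.verts = {univ}) : T = S :=
  eq_of_verts ((Operad.verts_subset h).antisymm (by
    rw [hS]
    exact singleton_subset_iff.2 (univ_mem_verts hn T)))

end RTree

open RTree

namespace DGOperadData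

variable {k : Type u} [Field k] {Q : DGOperadData.{u, v} k} {n m l : ℕ}

theorem kz_corolla {α : Type*} {a : α} {r s : α → α → Prop} {d : α → ZMod 2} (h : ¬ (r a a ∧ s a a)) :
    kz {a} r s d = 0 := by
  simp [kz, ind_false h]

theorem not_before_self (A : Finset (Fin n)) : ¬ Before A A := lt_irrefl _

theorem graftFn_corolla (hn : 1 < n) (hm : 1 < m) {x : Fin n}
    {e : {c : Fin n // c ≠ x} ⊕ Fin m ≃ Fin l} (F : Q.Fn n) (G : Q.Fn m) {T : RTree l}
    (hT : T.verts = {univ}) (p : Q.Dec T) : graftFn x e F G T p = 0 := by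
  refine graftFn_of_notMem (fun h => ?_) F G p
  have h1 := sum_verts_graft h fun _ => 1
  simp only [sum_const, smul_eq_mul, mul_one, hT, card_singleton] at h1
  have h2 := card_pos.2 ⟨_, univ_mem_verts hn (T.restr _ (isBlock_outer h))⟩
  have h3 := card_pos.2 ⟨_, univ_mem_verts hm (T.restr _ (isBlock_inner h))⟩
  omega

end DGOperadData

namespace Operad

open DGOperadData DGOperadData.El Function

variable {k : Type u} [Field k] {P : Operad.{u, v} k} {n m l : ℕ}

theorem inj_smul (c : k) (a : P.obj n) : inj (c • a) = El.smul c (inj a) :=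
  congrArg (Sigma.mk (0 : ℤ)) (map_smul (concProj k _ 0) c a)

theorem opI_eq_zero {F : P.toDG.Fn n} (hF : IsMulti F) (A : Finset (Fin n)) (T : RTree n)
    (p : P.toDG.Dec T) : opI A F T p = 0 := by
  by_cases h : A ∈ T.edges ∧ 1 < A.card
  · rw [opI_apply _ _ h]
    exact (congrArg _ (DGOperadData.IsMulti.zero hF p ⟨A, h⟩ _)).trans (mul_zero _)
  · exact opI_of_notMem _ _ h

theorem dFn_eq_sum {F : P.toDG.Fn n} (hF : IsMulti F) (T : RTree n) (p : P.toDG.Dec T) :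
    dFn F T p = ∑ y : T.InnerEdge, opC y.1.1.1 y.1.2.1 F T p := by
  rw [dFn_apply, sum_eq_zero fun A _ => opI_eq_zero hF A T p, zero_add, sum_opC]

theorem dFn_corolla {F : P.toDG.Fn n} (hF : IsMulti F) {T : RTree n} (hT : T.verts = {univ})
    (p : P.toDG.Dec T) : dFn F T p = 0 := by
  have := isEmpty_innerEdge hT
  rw [dFn_eq_sum hF, Fintype.sum_empty]

theorem relabel_symm_relabel (f : Fin n ≃ Fin l) (a : P.obj n) :
    P.relabel f.symm (P.relabel f a) = a := by
  rw [← P.relabel_trans, Equiv.self_trans_symm, P.relabel_refl]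

theorem relabel_relabel_symm (f : Fin n ≃ Fin l) (a : P.obj l) :
    P.relabel f (P.relabel f.symm a) = a := by
  rw [← P.relabel_trans, Equiv.symm_trans_self, P.relabel_refl]

variable {T : RTree n}

/-- The numbering of the inputs of the vertex of a corolla. -/
noncomputable def num (hT : T.verts = {univ}) (A : T.Vert) : Fin n ≃ Fin (Nat.card (T.In A.1)) :=
  (leaf hT A).trans (Finite.equivFin _)

/-- The decoration of a corolla by an element of `P`. -/
noncomputable def cdec (hT : T.verts = {univ}) (a : P.obj n) : P.Dec T := fun A =>
  P.relabel (num hT A) a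

theorem restr_cdec {T : RTree l} (hT : T.verts = {univ}) {φ : Finset (Fin n) → Finset (Fin l)}
    (h : T.IsBlock φ) (h' : (T.restr φ h).verts = {univ}) (g : Fin l ≃ Fin n)
    (hg : ∀ c, φ {g c} = {c}) (a : P.obj l) :
    (toDec (cdec hT a)).restr φ h = toDec (cdec h' (P.relabel g a)) := by
  funext A
  change El.rel (h.inEquiv A.2.2).symm (inj (P.relabel (num hT (h.vert A)) a)) =
    inj (P.relabel (num h' A) (P.relabel g a))
  rw [rel_inj, rel, ← P.relabel_trans, ← P.relabel_trans]
  refine congrArg (fun g => inj (P.relabel g a)) (Equiv.ext fun c => ?_)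
  simp only [num, Equiv.trans_apply, Equiv.symm_apply_apply]
  refine congrArg _ ?_
  rw [Equiv.symm_apply_eq]
  exact Subtype.ext (hg c).symm

theorem relFn_cdec (f : Fin n ≃ Fin l) (F : P.toDG.Fn n) {T : RTree l} {T' : RTree n}
    (hT : T.verts = {univ}) (hT' : T'.verts = {univ}) (a : P.obj l) :
    relFn f F T (toDec (cdec hT a)) = F T' (toDec (cdec hT' (P.relabel f.symm a))) := by
  have h := T.isBlock_map f
  have hn : 1 < n := one_lt_of_vert (root hT')
  have h' := verts_restr_corolla hn hT h
  obtain rfl : T' = T.restr _ h := eq_of_verts (hT'.trans h'.symm)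
  rw [relFn, h', kz_corolla fun h => not_before_self _ h.1, sg_zero, one_mul,
    restr_cdec hT h hT' f.symm fun c => by simp]

theorem elt_cdec {S : RTree n} (hS : S.verts = {univ}) (hT : T.verts = {univ}) (a : P.obj n)
    (p : P.toDG.cob.Dec T) {U : ∀ A : T.Vert, RTree (Nat.card (T.In A.1))}
    (hU : ∀ A, (U A).verts = {univ}) : elt (cdec hS a) T p =
      ∏ A : T.Vert, (p A).ev (U A) (toDec (cdec (hU A) (P.relabel (num hT A) a))) := by
  obtain rfl : T = S := eq_of_verts (hT.trans hS.symm)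
  rw [elt_of_subset _ (subset_refl T.edges)]
  refine prod_congr rfl fun A _ => ?_
  have hb := isBlock_sub (subset_refl T.edges) A
  have h := verts_restr_corolla (T.one_lt_card_in A) hT hb
  have h2 : U A = T.restr _ hb := eq_of_verts ((hU A).trans h.symm)
  rw [restr_cdec hT hb h (num hT A)]
  · have key : ∀ {V V' : RTree (Nat.card (T.In A.1))} (hV : V.verts = {univ})
        (hV' : V'.verts = {univ}), V = V' → ∀ b : P.obj (Nat.card (T.In A.1)),
          (p A).ev V (toDec (cdec hV b)) = (p A).ev V' (toDec (cdec hV' b)) := by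
      rintro V _ hV hV' rfl b
      rfl
    exact key h (hU A) h2.symm _
  · intro c
    rw [sub_singleton, num, Equiv.trans_apply, Equiv.symm_apply_apply, leaf_val]

section Iota

variable (hn : 1 < n)

/-- The function of decorated trees given by an element of `P`. -/
noncomputable def iotaFn (a : P.obj n) : P.toDG.cob.Fn n := elt (cdec (verts_corolla hn) a)

theorem iotaFn_of_ne (a : P.obj n) (hT : T.verts ≠ {univ}) (p : P.toDG.cob.Dec T) :
    iotaFn hn a T p = 0 :=
  elt_of_not_subset _ (fun h => hT (by
    rw [edges_eq_of_subset hn h (verts_corolla hn), verts_corolla])) p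

theorem iotaFn_eq (hT : T.verts = {univ}) (a : P.obj n) (p : P.toDG.cob.Dec T)
    {U : RTree (Nat.card (T.In (root hT).1))} (hU : U.verts = {univ}) : iotaFn hn a T p =
      (p (root hT)).ev U (toDec (cdec hU (P.relabel (num hT (root hT)) a))) := by
  have := subsingleton_vert hT
  rw [iotaFn, elt_cdec (verts_corolla hn) hT a p (U := fun A => corolla (T.one_lt_card_in A))
    fun A => verts_corolla _, Fintype.prod_subsingleton _ (root hT)]
  obtain rfl : U = corolla (T.one_lt_card_in (root hT)) :=
    eq_of_verts (hU.trans (verts_corolla _).symm)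
  rfl

theorem isMulti_iotaFn (a : P.obj n) : IsMulti (iotaFn hn a) := isMulti_elt _

theorem sum_of_iotaFn (a : P.obj n) (T : RTree n) (p : P.toDG.cob.Dec T) (h : iotaFn hn a T p ≠ 0) :
    ∑ A, (1 - (p A).1) = 0 := by
  by_cases hT : T.verts = {univ}
  · rw [sum_fst_of_elt_ne_zero h, hT, verts_corolla, sub_self]
  · exact absurd (iotaFn_of_ne hn a hT p) h

theorem toDec_cdec (hT : T.verts = {univ}) (a : P.obj n) :
    toDec (cdec hT a) = update (toDec (0 : P.Dec T)) (root hT) (inj (P.relabel (num hT (root hT)) a)) := by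
  have := subsingleton_vert hT
  funext A
  obtain rfl := Subsingleton.elim (root hT) A
  rw [update_self]
  rfl

theorem iotaFn_add (a b : P.obj n) : iotaFn hn (a + b) = iotaFn hn a + iotaFn hn b := by
  funext T p
  rw [Pi.add_apply, Pi.add_apply]
  by_cases hT : T.verts = {univ}
  · have hU := verts_corolla (T.one_lt_card_in (root hT))
    rw [iotaFn_eq hn hT _ p hU, iotaFn_eq hn hT _ p hU, iotaFn_eq hn hT _ p hU, toDec_cdec,
      toDec_cdec, toDec_cdec]
    simp only [map_add, inj]
    exact (p (root hT)).isMulti_ev.add _ _ _ _ _ _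
  · rw [iotaFn_of_ne hn _ hT, iotaFn_of_ne hn _ hT, iotaFn_of_ne hn _ hT, add_zero]

theorem iotaFn_smul (c : k) (a : P.obj n) : iotaFn hn (c • a) = c • iotaFn hn a := by
  funext T p
  rw [Pi.smul_apply, Pi.smul_apply, smul_eq_mul]
  by_cases hT : T.verts = {univ}
  · have hU := verts_corolla (T.one_lt_card_in (root hT))
    rw [iotaFn_eq hn hT _ p hU, iotaFn_eq hn hT _ p hU, toDec_cdec, toDec_cdec, map_smul, map_smul,
      inj_smul, IsMulti.smul' (p (root hT)).isMulti_ev]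
  · rw [iotaFn_of_ne hn _ hT, iotaFn_of_ne hn _ hT, mul_zero]

theorem dFn_iotaFn (a : P.obj n) : dFn (iotaFn hn a) = 0 := by
  funext T p
  rw [dFn_apply, sum_opI, sum_opC, Pi.zero_apply, Pi.zero_apply, sum_eq_zero, sum_eq_zero, zero_add]
  · intro y _
    rw [opC_apply _ _ (inner_edge y)]
    by_cases hT : (T.contract y).verts = {univ}
    · have hU := verts_corolla ((T.contract y).one_lt_card_in (root hT))
      have hy : (root hT).1 = y.1.1.1 := (vert_eq_univ hT y.merged).symm
      refine (congrArg _ ((iotaFn_eq hn hT a _ hU).trans ?_)).trans (mul_zero _)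
      rw [Dec.contract_self p y _ hy]
      have hev : (El.comp ⟨y.1.2.1, y.2⟩ (T.contractEquiv y hy) (p y.1.1) (p y.1.2)).ev =
        graftFn _ (El.num (T.contractEquiv y hy) rfl) (p y.1.1).ev (p y.1.2).ev := ev_comp rfl _ _
      rw [hev]
      exact graftFn_corolla (T.one_lt_card_in _) (T.one_lt_card_in _) _ _ hU _
    · exact (congrArg _ (iotaFn_of_ne hn a hT _)).trans (mul_zero _)
  · intro A _
    rw [opI_apply _ _ A.2]
    by_cases hT : T.verts = {univ}
    · have hU := verts_corolla (T.one_lt_card_in (root hT))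
      have := subsingleton_vert hT
      obtain rfl := Subsingleton.elim (root hT) A
      rw [iotaFn_eq hn hT a _ hU, Dec.dAt, update_self]
      have hev : (p (root hT)).d.ev = dFn (p (root hT)).ev := ev_d rfl _
      rw [hev, dFn_corolla (El.isMulti_ev _) hU, mul_zero]
    · rw [iotaFn_of_ne hn a hT, mul_zero]

theorem relFn_iotaFn (hl : 1 < l) (f : Fin n ≃ Fin l) (a : P.obj n) :
    relFn f (iotaFn hn a) = iotaFn hl (P.relabel f a) := by
  funext T p
  have hb := T.isBlock_map f
  by_cases hT : T.verts = {univ}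
  · have h' := verts_restr_corolla hn hT hb
    have hU := verts_corolla (T.one_lt_card_in (root hT))
    have hU' := verts_corolla ((T.restr _ hb).one_lt_card_in (root h'))
    have hv : hb.vert (root h') = root hT := (subsingleton_vert hT).elim _ _
    rw [relFn, h', kz_corolla fun h => not_before_self _ h.1, sg_zero, one_mul,
      iotaFn_eq hn h' a _ hU']
    have hU2 := verts_corolla (T.one_lt_card_in (hb.vert (root h')))
    have h1 : iotaFn hl (P.relabel f a) T p = (p (hb.vert (root h'))).ev _ (toDec (cdec hU2
        (P.relabel (num hT (hb.vert (root h'))) (P.relabel f a)))) := by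
      have h3 : ∀ (A : T.Vert) (hA : root hT = A), (p (root hT)).ev _ (toDec (cdec hU
          (P.relabel (num hT (root hT)) (P.relabel f a)))) = (p A).ev _ (toDec (cdec
            (verts_corolla (T.one_lt_card_in A)) (P.relabel (num hT A) (P.relabel f a)))) := by
        rintro A rfl
        rfl
      rw [iotaFn_eq hl hT _ p hU]
      exact h3 _ hv.symm
    rw [h1]
    have hev : ((p.restr _ hb) (root h')).ev = relFn _ (p (hb.vert (root h'))).ev :=
      ev_relabel _ _
    rw [hev, relFn_cdec _ _ hU' hU2, ← P.relabel_trans, ← P.relabel_trans]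
    refine congrArg (fun g => (p (hb.vert (root h'))).ev _ (toDec (cdec hU2 (P.relabel g a))))
      (Equiv.ext fun c => ?_)
    simp only [num, Equiv.trans_apply, Equiv.symm_apply_apply, Equiv.symm_trans_apply,
      Equiv.symm_symm]
    refine congrArg _ (Subtype.ext ?_)
    rw [leaf_val]
    refine (show _ = Finset.map f.toEmbedding (leaf h' (root h') c).1 from rfl).trans ?_
    simp
  · rw [iotaFn_of_ne hl _ hT, relFn, iotaFn_of_ne, mul_zero]
    intro h
    refine hT (eq_corolla_of_card hl ?_)
    rw [verts_map f T, card_image_of_injective _ (map_injective _), h, card_singleton]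

theorem exists_iota (a : P.obj n) : ∃ α : P.toDG.cob.cob.obj n 0, ev α = iotaFn hn a :=
  exists_ev (isMulti_iotaFn hn a) (sum_of_iotaFn hn a)

/-- The cocycle given by an element of `P`. -/
noncomputable def iota : P.obj n →ₗ[k] P.toDG.cob.cob.obj n 0 where
  toFun a := Classical.choose (exists_iota hn a)
  map_add' a b := DGOperadData.cob_ext (by
    rw [ev_add', Classical.choose_spec (exists_iota hn _), Classical.choose_spec (exists_iota hn _),
      Classical.choose_spec (exists_iota hn _), iotaFn_add])
  map_smul' c a := DGOperadData.cob_ext (by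
    rw [ev_smul', Classical.choose_spec (exists_iota hn _), Classical.choose_spec (exists_iota hn _),
      iotaFn_smul]
    rfl)

theorem ev_iota (a : P.obj n) : ev (iota hn a) = iotaFn hn a :=
  Classical.choose_spec (exists_iota hn a)

end Iota

end Operad

/-! ### The cohomology of the double cobar complex in arity at least two -/

open RTree

namespace Operad

open DGOperadData DGOperadData.El Function

variable {k : Type u} [Field k] {P : Operad.{u, v} k} {n : ℕ}

theorem cdec_root {T : RTree n} (hT : T.verts = {univ}) (a : P.obj n) (f : P.Cov T) :
    ∏ A, f A (cdec hT a A) = f (root hT) (P.relabel (num hT (root hT)) a) := by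
  have := subsingleton_vert hT
  exact Fintype.prod_subsingleton _ (root hT)

theorem iotaFn_mon (hn : 1 < n) (a : P.obj n) (f : P.Cov (corolla hn)) :
    iotaFn hn a (corolla hn) (mon (Subset.refl _) f) =
      f (root (verts_corolla hn)) (P.relabel (num (verts_corolla hn) (root (verts_corolla hn))) a) := by
  rw [iotaFn, elt_mon, cdec_root]

theorem d_iota (hn : 1 < n) (a : P.obj n) : P.toDG.cob.cob.d n 0 (0 + 1) (iota hn a) = 0 :=
  DGOperadData.cob_ext (by rw [ev_d rfl, ev_iota, dFn_iotaFn, ev_zero'])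

theorem relabel_iota {l : ℕ} (hn : 1 < n) (hl : 1 < l) (f : Fin n ≃ Fin l) (a : P.obj n) :
    P.toDG.cob.cob.relabel f 0 (iota hn a) = iota hl (P.relabel f a) :=
  DGOperadData.cob_ext (by rw [ev_relabel, ev_iota, ev_iota, relFn_iotaFn])

variable [∀ n, FiniteDimensional k (P.obj n)]

/-- An element of degree `0` which vanishes on the monomials for all trees with at least two
vertices comes from an element of `P`. -/
theorem exists_eq_iota (hn : 1 < n) (α : P.toDG.cob.cob.obj n 0)
    (hα : ∀ (T S : RTree n) (h : T.edges ⊆ S.edges) (f : P.Cov S), S.verts.card ≠ 1 →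
      ev α T (mon h f) = 0) : ∃ a : P.obj n, α = iota hn a := by
  classical
  set hK := verts_corolla hn
  have hsub := subsingleton_vert hK
  let L := monMultilinear (isMulti_ev' α) (Subset.refl (corolla hn).edges)
  let φ : Module.Dual k (Module.Dual k (P.obj n)) :=
    L.toLinearMap 0 (root hK) ∘ₗ Module.Dual.transpose (R := k) (P.relabel (num hK (root hK)).symm)
  have hφ := Module.apply_evalEquiv_symm_apply k (P.obj n) (g := φ)
  set a := (Module.evalEquiv k (P.obj n)).symm φ
  refine ⟨a, DGOperadData.cob_ext (sub_eq_zero.1 ?_)⟩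
  rw [← ev_sub']
  funext T p
  refine eq_zero_of_mon (isMulti_ev' _) (fun S h f => ?_) p
  rw [ev_sub', ev_iota, Pi.sub_apply, Pi.sub_apply]
  by_cases hS : S.verts.card = 1
  · obtain rfl : S = corolla hn := eq_of_verts ((eq_corolla_of_card hn hS).trans hK.symm)
    obtain rfl : T = corolla hn := edges_eq_of_subset hn h hK
    rw [iotaFn_mon, sub_eq_zero]
    have h1 := hφ (f (root hK) ∘ₗ P.relabel (num hK (root hK)))
    refine Eq.trans ?_ h1.symm
    have h2 : update (0 : P.Cov (corolla hn)) (root hK) ((f (root hK) ∘ₗ P.relabel (num hK (root hK))) ∘ₗ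
        P.relabel (num hK (root hK)).symm) = f := by
      funext A
      obtain rfl := Subsingleton.elim (root hK) A
      rw [update_self]
      refine LinearMap.ext fun b => congrArg (f (root hK)) ?_
      exact relabel_relabel_symm _ b
    exact congrArg L h2.symm
  · rw [hα T S h f hS, iotaFn, elt_mon_of_ne, sub_self]
    rintro rfl
    exact hS (by rw [hK, card_singleton])

/-- An element of non-zero degree whose differential vanishes on all trees with at least two
vertices is a coboundary. -/
theorem exists_eq_d (hn : 1 < n) {i : ℤ} (hi : i ≠ 0) (α : P.toDG.cob.cob.obj n i)
    (hα : ∀ T, 2 ≤ T.verts.card → ∀ p, dFn (ev α) T p = 0) :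
    ∃ β, P.toDG.cob.cob.d n (i - 1) i β = α := by
  obtain ⟨β, hβ⟩ := exists_sub_d hn α hα
  refine ⟨β, (sub_eq_zero.1 ?_).symm⟩
  have hev : ev (α - P.toDG.cob.cob.d n (i - 1) i β : P.toDG.cob.cob.obj n i) =
      ev α - dFn (ev β) := by
    rw [ev_sub', ev_d (sub_add_cancel i 1)]
  refine DGOperadData.cob_ext (funext fun T => funext fun p => ?_)
  rw [ev_zero']
  refine eq_zero_of_mon (isMulti_ev' _) (fun S h f => ?_) p
  by_cases hS : S.verts.card = 1
  · refine ev_mon_eq_zero _ h f fun h1 => hi ?_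
    rw [← h1, edges_eq_of_subset hn h (eq_corolla_of_card hn hS), sub_self]
  · rw [hev]
    exact hβ T S h f hS

theorem eq_zero_of_iota_eq_d (hn : 1 < n) {a : P.obj n} {α : P.toDG.cob.cob.obj n (0 - 1)}
    (h : P.toDG.cob.cob.d n (0 - 1) 0 α = iota hn a) : a = 0 := by
  have h1 := congrArg (fun γ : P.toDG.cob.cob.obj n 0 => ev γ) h
  simp only [ev_iota, ev_d (sub_add_cancel 0 1)] at h1
  obtain ⟨β, rfl⟩ := exists_eq_d hn (by omega) α fun T hT p => by
    rw [h1]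
    refine iotaFn_of_ne hn a (fun h => ?_) p
    rw [h, card_singleton] at hT
    omega
  rw [ev_d (sub_add_cancel _ 1), dFn_dFn (isDGOperad_cob P.isDGOperad_toDG) (isMulti_ev' β)] at h1
  rw [← relabel_symm_relabel (num (verts_corolla hn) (root (verts_corolla hn))) a]
  refine (congrArg _ ((Module.forall_dual_apply_eq_zero_iff k _).1 fun φ => ?_)).trans (map_zero _)
  have hsub := subsingleton_vert (verts_corolla hn)
  obtain ⟨f, rfl⟩ : ∃ f : P.Cov (corolla hn), f (root (verts_corolla hn)) = φ := by
    classical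
    exact ⟨update 0 _ φ, update_self _ _ _⟩
  rw [← iotaFn_mon, ← h1]
  rfl

/-- Every cocycle of degree `0` comes from `P` up to a coboundary. -/
theorem exists_sub_iota_eq_d (hn : 1 < n) (α : P.toDG.cob.cob.obj n 0)
    (hα : P.toDG.cob.cob.d n 0 (0 + 1) α = 0) :
    ∃ a β, P.toDG.cob.cob.d n (0 - 1) 0 β = α - iota hn a := by
  have h1 : dFn (ev α) = 0 := by
    rw [← ev_d (j := 0 + 1) rfl, hα, ev_zero']
  obtain ⟨β, hβ⟩ := exists_sub_d hn α fun T _ p => by rw [h1]; rfl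
  have hev : ev (α - P.toDG.cob.cob.d n (0 - 1) 0 β : P.toDG.cob.cob.obj n 0) =
      ev α - dFn (ev β) := by
    rw [ev_sub', ev_d (sub_add_cancel 0 1)]
  obtain ⟨a, ha⟩ := exists_eq_iota hn _ fun T S h f hS => by
    rw [hev]
    exact hβ T S h f hS
  exact ⟨a, β, by rw [← ha, sub_sub_cancel]⟩

end Operad

/-! ### Trees with two vertices -/

namespace RTree

variable {n m l : ℕ}

/-- The tree with the root and one more edge which is not a leaf. -/
def addToCorolla (hl : 1 < l) {A : Finset (Fin l)} (hA : A.Nonempty) : RTree l where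
  edges := insert A (corolla hl).edges
  nonempty B hB := by
    rcases mem_insert.1 hB with rfl | hB
    · exact hA
    · exact (corolla hl).nonempty B hB
  root_mem := mem_insert_of_mem (corolla hl).root_mem
  leaf_mem c := mem_insert_of_mem ((corolla hl).leaf_mem c)
  laminar := by
    have key : ∀ B ∈ (corolla hl).edges, A ⊆ B ∨ B ⊆ A ∨ Disjoint A B := fun B hB => by
      rcases mem_insert.1 hB with rfl | hB
      · exact Or.inl (subset_univ A)
      · obtain ⟨c, -, rfl⟩ := mem_image.1 hB
        by_cases hc : c ∈ A
        · exact Or.inr (Or.inl (singleton_subset_iff.2 hc))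
        · exact Or.inr (Or.inr (disjoint_singleton_right.2 hc))
    intro B hB C hC
    rcases mem_insert.1 hB with h1 | hB <;> rcases mem_insert.1 hC with h2 | hC
    · exact Or.inl (by rw [h1, h2])
    · rw [h1]
      exact key C hC
    · rw [h2]
      rcases key B hB with h | h | h
      · exact Or.inr (Or.inl h)
      · exact Or.inl h
      · exact Or.inr (Or.inr h.symm)
    · exact (corolla hl).laminar B hB C hC

theorem verts_addToCorolla (hl : 1 < l) {A : Finset (Fin l)} (hA : 1 < A.card) :
    (addToCorolla hl (card_pos.1 (zero_lt_one.trans hA))).verts = {univ, A} := by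
  ext B
  have h1 : B = univ ↔ B ∈ (corolla hl).verts := by rw [verts_corolla, mem_singleton]
  rw [mem_insert, mem_singleton, h1, mem_verts, mem_verts]
  constructor
  · rintro ⟨h, h'⟩
    rcases mem_insert.1 h with rfl | h
    · exact Or.inr rfl
    · exact Or.inl ⟨h, h'⟩
  · rintro (h | rfl)
    · exact ⟨mem_insert_of_mem h.1, h.2⟩
    · exact ⟨mem_insert_self _ _, hA⟩

open DGOperadData

variable {x : Fin n} {e : {c : Fin n // c ≠ x} ⊕ Fin m ≃ Fin l} {S : RTree l}

theorem outer_univ : outer x e univ = univ := by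
  ext; simp [mem_outer]

theorem outer_self_ne_univ (hx : outer x e {x} ∈ S.edges) (hn : 1 < n) : outer x e {x} ≠ univ := by
  rw [← outer_univ (x := x) (e := e)]
  intro h
  have h1 := congrArg card ((isBlock_outer hx).injective h)
  rw [card_singleton, card_univ, Fintype.card_fin] at h1
  omega

theorem verts_eq_pair (hx : outer x e {x} ∈ S.edges)
    (hO : (S.restr _ (isBlock_outer hx)).verts = {univ})
    (hI : (S.restr _ (isBlock_inner hx)).verts = {univ}) : S.verts = {univ, outer x e {x}} := by
  rw [verts_graft hx, hO, hI, image_singleton, image_singleton, inner_univ, outer_univ]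
  rfl

theorem verts_outer_of_pair (hx : outer x e {x} ∈ S.edges) (hn : 1 < n)
    (hS : S.verts = {univ, outer x e {x}}) : (S.restr _ (isBlock_outer hx)).verts = {univ} := by
  refine eq_singleton_iff_unique_mem.2 ⟨univ_mem_verts hn _, fun A hA => ?_⟩
  have h1 : outer x e A ∈ S.verts := by
    rw [verts_graft hx]
    exact mem_union_left _ (mem_image_of_mem _ hA)
  rw [hS, mem_insert, mem_singleton] at h1
  rcases h1 with h1 | h1
  · exact (isBlock_outer hx).injective (h1.trans outer_univ.symm)
  · exact absurd h1.subset (outer_not_subset hx (mem_verts.1 hA).2)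

theorem verts_inner_of_pair (hx : outer x e {x} ∈ S.edges) (hn : 1 < n) (hm : 1 < m)
    (hS : S.verts = {univ, outer x e {x}}) : (S.restr _ (isBlock_inner hx)).verts = {univ} := by
  refine eq_singleton_iff_unique_mem.2 ⟨univ_mem_verts hm _, fun A hA => ?_⟩
  have h1 : inner x e A ∈ S.verts := by
    rw [verts_graft hx]
    exact mem_union_right _ (mem_image_of_mem _ hA)
  rw [hS, mem_insert, mem_singleton] at h1
  rcases h1 with h1 | h1
  · have h2 := inner_subset (x := x) (e := e) A
    rw [h1] at h2
    exact absurd ((subset_univ _).antisymm h2) (outer_self_ne_univ hx hn)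
  · exact (isBlock_inner hx).injective (h1.trans inner_univ.symm)

section GraftEdge

variable (hx : outer x e {x} ∈ S.edges) (hO : (S.restr _ (isBlock_outer hx)).verts = {univ})
    (hI : (S.restr _ (isBlock_inner hx)).verts = {univ})

/-- The inner edge of the grafting of two corollas. -/
def graftEdge : S.InnerEdge :=
  ⟨((isBlock_outer hx).vert (root hO), (isBlock_inner hx).vert (root hI)), by
    have h := ((isBlock_outer hx).inEquiv (root hO).2.2 (leaf hO (root hO) x)).2
    have h' : inner x e (root hI).1 = outer x e {x} := inner_univ
    change S.IsInput _ (inner x e (root hI).1)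
    rw [h']
    exact h⟩

theorem verts_contract_graftEdge : (S.contract (graftEdge hx hO hI)).verts = {univ} := by
  have h := outer_self_ne_univ hx (one_lt_of_vert (root hO))
  have h' : (graftEdge hx hO hI).1.2.1 = outer x e {x} := inner_univ
  rw [verts_contract, h', verts_eq_pair hx hO hI, pair_comm, erase_insert]
  rwa [mem_singleton]

theorem eq_graftEdge (y : S.InnerEdge) : y = graftEdge hx hO hI := by
  refine Operad.eq_of_upper ?_
  have h' : (graftEdge hx hO hI).1.2.1 = outer x e {x} := inner_univ
  rw [h']
  have h := mem_verts.2 y.1.2.2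
  rw [verts_eq_pair hx hO hI, mem_insert, mem_singleton] at h
  exact h.resolve_left y.ne_univ.symm

end GraftEdge

/-- The numbering of the inputs of the vertex of a block which is a corolla. -/
noncomputable def blkNum {φ : Finset (Fin n) → Finset (Fin l)} (h : S.IsBlock φ)
    (hT : (S.restr φ h).verts = {univ}) : Fin n ≃ Fin (Nat.card (S.In (h.vert (root hT)).1)) :=
  ((leaf hT (root hT)).trans (h.inEquiv (root hT).2.2)).trans (Finite.equivFin _)

theorem not_before_univ (A : Finset (Fin l)) : ¬ Before A univ := fun h =>
  not_le_of_gt h (Colex.toColex_mono (subset_univ A))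

end RTree

open RTree

namespace DGOperadData

variable {k : Type u} [Field k] {Q : DGOperadData.{u, v} k} {n m l : ℕ}

theorem bef_univ (V : Finset (Finset (Fin l))) (d : Finset (Fin l) → ZMod 2) :
    bef V Before d univ = 0 :=
  sum_eq_zero fun C _ => by rw [ind_false (not_before_univ C), zero_mul]

theorem betw_pair (A B : Finset (Fin l)) (d : Finset (Fin l) → ZMod 2) : betw {A, B} d A B = 0 :=
  sum_eq_zero fun C hC => by
    rw [ind_false, zero_mul]
    rcases mem_insert.1 hC with rfl | hC
    · exact fun h => not_before_self _ h.1
    · rw [mem_singleton.1 hC]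
      exact fun h => not_before_self _ h.2

theorem kz_pair {x : Fin n} {e : {c : Fin n // c ≠ x} ⊕ Fin m ≃ Fin l} {S : RTree l}
    (hx : outer x e {x} ∈ S.edges) (hS : S.verts = {univ, outer x e {x}})
    (hA : outer x e {x} ≠ univ) (d : Finset (Fin l) → ZMod 2) :
    kz S.verts (graftRel x e) Before d = 0 := by
  refine sum_eq_zero fun C hC => sum_eq_zero fun D hD => ?_
  rw [ind_false, zero_mul]
  rintro ⟨h1, h2⟩
  have h3 : graftRel x e univ (outer x e {x}) :=
    Or.inl ⟨fun h => hA ((subset_univ _).antisymm h), Subset.refl _⟩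
  have h4 := (tourOn_graftRel hx).asymm C hC D hD h1
  rw [hS, mem_insert, mem_singleton] at hC hD
  rcases hC with rfl | rfl
  · exact not_before_univ _ h2
  · rcases hD with rfl | rfl
    · exact h4 h3
    · exact not_before_self _ h2

theorem relFn_symm_relFn (hQ : IsDGOperad Q) (f : Fin n ≃ Fin l) (F : Q.Fn n) :
    relFn f.symm (relFn f F) = F := by
  rw [← relFn_trans hQ, Equiv.self_trans_symm, relFn_refl hQ]

theorem relFn_graftFn_symm (hQ : IsDGOperad Q) {n' m' l' : ℕ} (x : Fin n)
    (e : {c : Fin n // c ≠ x} ⊕ Fin m ≃ Fin l) (f : Fin l ≃ Fin l') (g : Fin n ≃ Fin n')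
    (h : Fin m ≃ Fin m') (e' : {c : Fin n' // c ≠ g x} ⊕ Fin m' ≃ Fin l')
    (h1 : ∀ c : {c : Fin n // c ≠ x},
      f (e (Sum.inl c)) = e' (Sum.inl ⟨g c.1, fun hc => c.2 (g.injective hc)⟩))
    (h2 : ∀ c : Fin m, f (e (Sum.inr c)) = e' (Sum.inr (h c))) (F : Q.Fn n') (G : Q.Fn m') :
    relFn f.symm (graftFn (g x) e' F G) = graftFn x e (relFn g.symm F) (relFn h.symm G) := by
  have h3 := relFn_graftFn hQ x e f g h e' h1 h2 (relFn g.symm F) (relFn h.symm G)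
  have h4 := relFn_symm_relFn hQ g.symm F
  have h5 := relFn_symm_relFn hQ h.symm G
  rw [Equiv.symm_symm] at h4 h5
  rw [h4, h5] at h3
  rw [← h3, relFn_symm_relFn hQ]

theorem El.ev_comp {X Y Z : Type} [Finite X] [Finite Y] [Finite Z] {x : X}
    (e : {c : X // c ≠ x} ⊕ Y ≃ Z) {z : Fin (Nat.card X)} (hz : Finite.equivFin X x = z)
    (a : Q.cob.El (Nat.card X)) (b : Q.cob.El (Nat.card Y)) :
    (El.comp x e a b).ev = graftFn z (El.num e hz) a.ev b.ev := by
  subst hz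
  exact DGOperadData.ev_comp rfl _ _

section Compat

variable {x : Fin n} {e : {c : Fin n // c ≠ x} ⊕ Fin m ≃ Fin l} {S : RTree l}
    (hx : outer x e {x} ∈ S.edges) (hO : (S.restr _ (isBlock_outer hx)).verts = {univ})
    (hI : (S.restr _ (isBlock_inner hx)).verts = {univ})

theorem blkNum_graft : Finite.equivFin (S.In (graftEdge hx hO hI).1.1.1)
      ⟨(graftEdge hx hO hI).1.2.1, (graftEdge hx hO hI).2⟩ = blkNum (isBlock_outer hx) hO x :=
  congrArg _ (Subtype.ext inner_univ)

variable (hT : (S.contract (graftEdge hx hO hI)).verts = {univ})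
  (C : (S.contract (graftEdge hx hO hI)).Vert) (hC : C.1 = (graftEdge hx hO hI).1.1.1)

theorem num_graft_inl (c : {c : Fin n // c ≠ x}) : Operad.num hT C (e (Sum.inl c)) =
    El.num (S.contractEquiv (graftEdge hx hO hI) hC) (blkNum_graft hx hO hI)
      (Sum.inl ⟨blkNum (isBlock_outer hx) hO c.1, fun h =>
        c.2 ((blkNum (isBlock_outer hx) hO).injective h)⟩) := by
  refine Eq.trans ?_ (El.num_inl _ (blkNum_graft hx hO hI) _ _).symm
  refine congrArg (Finite.equivFin _) (Subtype.ext ?_)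
  rw [leaf_val, contractEquiv_inl]
  exact (outer_singleton c.2).symm

theorem num_graft_inr (c : Fin m) : Operad.num hT C (e (Sum.inr c)) =
    El.num (S.contractEquiv (graftEdge hx hO hI) hC) (blkNum_graft hx hO hI)
      (Sum.inr (blkNum (isBlock_inner hx) hI c)) := by
  refine Eq.trans ?_ (El.num_inr _ (blkNum_graft hx hO hI) _).symm
  refine congrArg (Finite.equivFin _) (Subtype.ext ?_)
  change {e (Sum.inr c)} = RTree.inner x e {c}
  rw [RTree.inner, map_singleton]
  rfl

end Compat

end DGOperadData

namespace Operad

open DGOperadData DGOperadData.El Function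

variable {k : Type u} [Field k] {P : Operad.{u, v} k} {n m l : ℕ}

theorem comp_inj {X Y Z : Type} [Finite X] [Finite Y] [Finite Z] {x : X}
    (e : {c : X // c ≠ x} ⊕ Y ≃ Z) {z : Fin (Nat.card X)} (hz : Finite.equivFin X x = z)
    (a : P.obj (Nat.card X)) (b : P.obj (Nat.card Y)) :
    El.comp x e (inj a) (inj b) = inj (P.comp z (El.num e hz) a b) := by
  subst hz
  rw [← inj_val (a := El.comp x e (inj a) (inj b)) rfl]
  refine congrArg inj ((concProj_zero_coe k _).trans ?_)
  exact congrArg₂ (fun a b => P.comp _ _ a b) (val_inj a) (val_inj b)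

section Block

variable {S : RTree l} {φ : Finset (Fin n) → Finset (Fin l)} (h : S.IsBlock φ)
    (hT : (S.restr φ h).verts = {univ})

theorem restr_eq_cdec {p : P.Dec S} {a : P.obj n}
    (hp : p (h.vert (root hT)) = P.relabel (blkNum h hT) a) :
    (toDec p).restr φ h = toDec (cdec hT a) := by
  have := subsingleton_vert hT
  funext A
  obtain rfl := Subsingleton.elim (root hT) A
  change El.rel (h.inEquiv (root hT).2.2).symm (inj (p (h.vert (root hT)))) = inj _
  rw [hp, rel_inj, cdec, rel, ← P.relabel_trans]
  refine congrArg (fun g => inj (P.relabel g a)) (Equiv.ext fun c => ?_)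
  simp [num, blkNum]

theorem relFn_restr_ev (q : P.toDG.cob.Dec S) :
    relFn (num hT (root hT)).symm ((q.restr φ h) (root hT)).ev =
      relFn (blkNum h hT).symm (q (h.vert (root hT))).ev := by
  have hev : ((q.restr φ h) (root hT)).ev = relFn _ (q (h.vert (root hT))).ev := ev_relabel _ _
  rw [hev, ← relFn_trans P.isDGOperad_toDG]
  refine congrArg (fun g => relFn g _) (Equiv.ext fun c => ?_)
  simp [num, blkNum]

end Block

/-- The value on corollas decorated by elements of the cobar complex, evaluated on a decorated
tree. -/
noncomputable def evFn {S : RTree n} (c : P.Dec S) : P.toDG.cob.Fn n := fun T p =>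
  open scoped Classical in
  if hT : T.verts = {univ} then
    relFn (num hT (root hT)).symm (p (root hT)).ev S (toDec c) else 0

variable {S T : RTree n} (c : P.Dec S)

theorem evFn_eq (hT : T.verts = {univ}) (p : P.toDG.cob.Dec T) :
    evFn c T p = relFn (num hT (root hT)).symm (p (root hT)).ev S (toDec c) := dif_pos hT

theorem evFn_of_ne (hT : T.verts ≠ {univ}) (p : P.toDG.cob.Dec T) : evFn c T p = 0 := dif_neg hT

theorem isMulti_relFn {F : P.toDG.cob.El m} (f : Fin m ≃ Fin n) : IsMulti (relFn f F.ev) :=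
  (ev_relabel (i := F.1) f F.2) ▸ isMulti_ev' _

theorem isMulti_evFn : IsMulti (evFn c) := by
  refine isMulti_of_prod fun T => ?_
  by_cases hT : T.verts = {univ}
  · have := subsingleton_vert hT
    refine Or.inr ⟨fun A y => relFn (num hT A).symm y.ev S (toDec c), fun A => ?_, fun p => ?_⟩
    · have h := isLin_ev (Q := P.toDG) (S.restr _ (S.isBlock_map (num hT A).symm))
        ((toDec c).restr _ (S.isBlock_map (num hT A).symm))
      exact ⟨fun i a b => (congrArg _ (h.add i a b)).trans (mul_add _ _ _), fun x a =>
        (congrArg _ (h.smul x a)).trans (mul_left_comm _ _ _)⟩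
    · rw [evFn_eq c hT, Fintype.prod_subsingleton _ (root hT)]
  · exact Or.inl (evFn_of_ne c hT)

theorem fst_of_relFn_ne_zero {y : P.toDG.cob.El m} {f : Fin m ≃ Fin n}
    (h : relFn f y.ev S (toDec c) ≠ 0) : y.1 = S.verts.card := by
  obtain ⟨a, ha⟩ := restr_toDec (S.isBlock_map f) c
  have h1 := right_ne_zero_of_mul h
  rw [ha] at h1
  rw [fst_of_ev_ne_zero h1, verts_map f S, card_image_of_injective _ (map_injective _)]

theorem sum_of_evFn (T : RTree n) (p : P.toDG.cob.Dec T) (h : evFn c T p ≠ 0) :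
    ∑ A, (1 - (p A).1) = 1 - (S.verts.card : ℤ) := by
  by_cases hT : T.verts = {univ}
  · have := subsingleton_vert hT
    rw [evFn_eq c hT] at h
    rw [Fintype.sum_subsingleton _ (root hT), fst_of_relFn_ne_zero c h]
  · exact absurd (evFn_of_ne c hT p) h

theorem iotaFn_eq_evFn (hn : 1 < n) (hS : S.verts = {univ}) (a : P.obj n) :
    iotaFn hn a = evFn (cdec hS a) := by
  funext T p
  by_cases hT : T.verts = {univ}
  · have hU := verts_corolla (T.one_lt_card_in (root hT))
    rw [evFn_eq _ hT, relFn_cdec _ _ hS hU, iotaFn_eq hn hT a p hU, Equiv.symm_symm]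
  · rw [iotaFn_of_ne hn a hT, evFn_of_ne _ hT]

end Operad

/-! ### The compatibility with the compositions -/

open RTree

namespace Operad

open DGOperadData DGOperadData.El Function

variable {k : Type u} [Field k] {P : Operad.{u, v} k} {n m l : ℕ} {x : Fin n}
  {e : {c : Fin n // c ≠ x} ⊕ Fin m ≃ Fin l} {S T : RTree l}

section Pair

variable (hx : outer x e {x} ∈ S.edges) (hO : (S.restr _ (isBlock_outer hx)).verts = {univ})
    (hI : (S.restr _ (isBlock_inner hx)).verts = {univ})

theorem exists_pairDec (a : P.obj n) (b : P.obj m) : ∃ c : P.Dec S,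
    c (graftEdge hx hO hI).1.1 = P.relabel (blkNum (isBlock_outer hx) hO) a ∧
    c (graftEdge hx hO hI).1.2 = P.relabel (blkNum (isBlock_inner hx) hI) b := by
  let σ : Bool → S.Vert := fun s => if s then (graftEdge hx hO hI).1.1 else (graftEdge hx hO hI).1.2
  have hne := (graftEdge hx hO hI).ne
  have hσ : Injective σ := by
    intro s t h
    cases s <;> cases t
    · rfl
    · exact absurd (congrArg Subtype.val h).symm hne
    · exact absurd (congrArg Subtype.val h) hne
    · rfl
  obtain ⟨c, hc⟩ := hσ.exists_forall_eq (X := fun A : S.Vert => P.obj (Nat.card (S.In A.1)))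
    fun s => match s with
      | true => P.relabel (blkNum (isBlock_outer hx) hO) a
      | false => P.relabel (blkNum (isBlock_inner hx) hI) b
  exact ⟨c, hc true, hc false⟩

variable {a : P.obj n} {b : P.obj m} {c : P.Dec S}
  (ha : c (graftEdge hx hO hI).1.1 = P.relabel (blkNum (isBlock_outer hx) hO) a)
  (hb : c (graftEdge hx hO hI).1.2 = P.relabel (blkNum (isBlock_inner hx) hI) b)

include ha hb

theorem contract_pairDec : (toDec c).contract (graftEdge hx hO hI) =
    toDec (cdec (verts_contract_graftEdge hx hO hI) (P.comp x e a b)) := by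
  funext C
  have hT := verts_contract_graftEdge hx hO hI
  have hC : C.1 = (graftEdge hx hO hI).1.1.1 :=
    (vert_eq_univ hT C).trans (vert_eq_univ hT (graftEdge hx hO hI).merged).symm
  rw [Dec.contract_self _ _ C hC]
  change El.comp _ _ (inj (c (graftEdge hx hO hI).1.1)) (inj (c (graftEdge hx hO hI).1.2)) =
    inj (P.relabel (num hT C) (P.comp x e a b))
  rw [comp_inj _ (blkNum_graft hx hO hI), ha, hb]
  refine congrArg inj (P.relabel_comp _ _ _ _ _ _ ?_ ?_ a b).symm
  · exact num_graft_inl hx hO hI hT C hC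
  · exact num_graft_inr hx hO hI hT C hC

theorem dFn_pairDec {F : P.toDG.Fn l} (hF : IsMulti F) : dFn F S (toDec c) =
    F _ (toDec (cdec (verts_contract_graftEdge hx hO hI) (P.comp x e a b))) := by
  have hS := verts_eq_pair hx hO hI
  have hU : (graftEdge hx hO hI).1.1.1 = univ := outer_univ
  have hA : (graftEdge hx hO hI).1.2.1 = outer x e {x} := inner_univ
  rw [dFn_eq_sum hF, sum_eq_single (graftEdge hx hO hI),
    opC_apply _ _ (inner_edge (graftEdge hx hO hI))]
  · have h1 : F (S.contract (inner_edge (graftEdge hx hO hI)).edge)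
        ((toDec c).contract (inner_edge (graftEdge hx hO hI)).edge) = F _ (toDec (cdec
          (verts_contract_graftEdge hx hO hI) (P.comp x e a b))) :=
      congrArg (F _) (contract_pairDec hx hO hI ha hb)
    rw [h1, par_toDec c (mem_verts.2 (graftEdge hx hO hI).1.1.2), hU, hA, hS, bef_univ, betw_pair,
      mul_zero, add_zero, zero_add, show (1 + 1 : ZMod 2) = 0 from by decide, sg_zero, one_mul]
  · exact fun y _ hy => absurd (eq_graftEdge hx hO hI y) hy
  · exact fun h => absurd (mem_univ _) h

theorem dFn_evFn_corolla (hl : 1 < l) (hT : T.verts = {univ}) (q : P.toDG.cob.Dec T) :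
    dFn (evFn c) T q = - iotaFn hl (P.comp x e a b) T q := by
  have := isEmpty_innerEdge hT
  have hsub := subsingleton_vert hT
  have hR : bef T.verts Before q.par (root hT).1 = 0 := bef_univ _ _
  have hev : (q (root hT)).d.ev = dFn (q (root hT)).ev := ev_d rfl _
  rw [dFn_apply, sum_opI, sum_opC, Fintype.sum_subsingleton _ (root hT), Fintype.sum_empty, add_zero,
    opI_apply _ _ (root hT).2, evFn_eq c hT, Dec.dAt,
    update_self, hev, ← dFn_relFn _ P.isDGOperad_toDG,
    dFn_pairDec hx hO hI ha hb (isMulti_relFn _), hR, add_zero, sg_one, neg_one_mul,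
    iotaFn_eq_evFn hl (verts_contract_graftEdge hx hO hI), evFn_eq _ hT]

theorem evFn_contract (hT : (S.contract (graftEdge hx hO hI)).verts = {univ})
    (q : P.toDG.cob.Dec S) : evFn c _ (q.contract (graftEdge hx hO hI)) =
      relFn (blkNum (isBlock_outer hx) hO).symm (q (graftEdge hx hO hI).1.1).ev _ (toDec (cdec hO a)) *
      relFn (blkNum (isBlock_inner hx) hI).symm (q (graftEdge hx hO hI).1.2).ev _ (toDec (cdec hI b)) := by
  have hC : (root hT).1 = (graftEdge hx hO hI).1.1.1 :=
    (vert_eq_univ hT (graftEdge hx hO hI).merged).symm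
  rw [evFn_eq c hT, Dec.contract_self _ _ _ hC, El.ev_comp _ (blkNum_graft hx hO hI)]
  refine (congrFun (congrFun (relFn_graftFn_symm P.isDGOperad_toDG x e (num hT (root hT))
    (blkNum (isBlock_outer hx) hO) (blkNum (isBlock_inner hx) hI) _
    (num_graft_inl hx hO hI hT _ hC) (num_graft_inr hx hO hI hT _ hC) _ _) S) (toDec c)).trans ?_
  rw [graftFn, dif_pos hx,
    kz_pair hx (verts_eq_pair hx hO hI) (outer_self_ne_univ hx (one_lt_of_vert (root hO))), sg_zero,
    one_mul, restr_eq_cdec (isBlock_outer hx) hO ha, restr_eq_cdec (isBlock_inner hx) hI hb]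

theorem dFn_evFn_pair (hn : 1 < n) (hm : 1 < m) (q : P.toDG.cob.Dec S) :
    dFn (evFn c) S q = - graftFn x e (iotaFn hn a) (iotaFn hm b) S q := by
  have hS := verts_eq_pair hx hO hI
  have hU : (graftEdge hx hO hI).1.1.1 = univ := outer_univ
  have hA : (graftEdge hx hO hI).1.2.1 = outer x e {x} := inner_univ
  have hne := outer_self_ne_univ hx hn
  have hS1 : S.verts ≠ {univ} := fun h => hne (by
    have h1 : outer x e {x} ∈ S.verts := by rw [hS]; simp
    rwa [h, mem_singleton] at h1)
  have hT := verts_contract_graftEdge hx hO hI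
  rw [graftFn, dif_pos hx, kz_pair hx hS hne, sg_zero, one_mul, iotaFn_eq_evFn hn hO,
    iotaFn_eq_evFn hm hI, evFn_eq _ hO, evFn_eq _ hI, relFn_restr_ev, relFn_restr_ev]
  have h1 := evFn_contract hx hO hI ha hb hT q
  rw [dFn_apply, sum_opI, sum_opC, sum_eq_zero, zero_add, sum_eq_single (graftEdge hx hO hI),
    opC_apply _ _ (inner_edge (graftEdge hx hO hI))]
  · refine (congrArg _ h1).trans ?_
    have hp := q.par_vert (graftEdge hx hO hI).1.1
    have hs : bef S.verts Before q.par (graftEdge hx hO hI).1.1.1 +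
        (1 + q.par (graftEdge hx hO hI).1.1.1) + q.par (graftEdge hx hO hI).1.2.1 *
          betw S.verts q.par (graftEdge hx hO hI).1.1.1 (graftEdge hx hO hI).1.2.1 =
        1 + q.par (graftEdge hx hO hI).1.1.1 := by
      rw [hA, hU, hS, bef_univ, betw_pair, mul_zero, add_zero, zero_add]
    rw [hs, hp]
    by_cases h2 : relFn (blkNum (isBlock_outer hx) hO).symm (q (graftEdge hx hO hI).1.1).ev _
        (toDec (cdec hO a)) = 0
    · rw [h2, zero_mul, mul_zero]
      exact (neg_eq_zero.2 (mul_eq_zero_of_left h2 _)).symm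
    · have h3 := fst_of_relFn_ne_zero _ h2
      rw [hO, card_singleton] at h3
      rw [h3, show ((1 - ((1 : ℕ) : ℤ) : ℤ) : ZMod 2) = 0 from by simp, add_zero, sg_one,
        neg_one_mul]
      rfl
  · exact fun y _ hy => absurd (eq_graftEdge hx hO hI y) hy
  · exact fun h => absurd (mem_univ _) h
  · intro A _
    rw [opI_apply _ _ A.2, evFn_of_ne c hS1, mul_zero]

end Pair

theorem map_num_symm (hT : T.verts = {univ}) (A : T.Vert) (Y : Finset (Fin (Nat.card (T.In A.1)))) :
    Y.map (num hT A).symm.toEmbedding = T.sub A.1 Y := by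
  ext t
  rw [mem_sub, mem_map_equiv, Equiv.symm_symm]
  constructor
  · intro h
    exact ⟨leaf hT A t, h, mem_singleton_self t⟩
  · rintro ⟨B, hB, ht⟩
    obtain ⟨c, rfl⟩ := (leaf hT A).surjective B
    rw [leaf_val, mem_singleton] at ht
    rwa [ht]

theorem dFn_evFn_of_ne {A : Finset (Fin l)} (hS : S.verts = {univ, A}) (c : P.Dec S) (hTS : T ≠ S)
    (hT : T.verts ≠ {univ}) (q : P.toDG.cob.Dec T) : dFn (evFn c) T q = 0 := by
  rw [dFn_apply, sum_opI, sum_opC, sum_eq_zero, sum_eq_zero, zero_add]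
  · intro y _
    rw [opC_apply _ _ (inner_edge y)]
    refine (congrArg _ (?_ : evFn c (T.contract y) (q.contract y) = 0)).trans (mul_zero _)
    by_cases hy : (T.contract y).verts = {univ}
    · have hC : (root hy).1 = y.1.1.1 := (vert_eq_univ hy y.merged).symm
      rw [evFn_eq c hy, Dec.contract_self _ _ _ hC, El.ev_comp _ rfl, relFn, graftFn_of_notMem,
        mul_zero]
      rw [mem_restr, ← inner_univ, map_num_symm hy, T.sub_inner y _ hC, sub_univ T y.1.2.2.2]
      intro h
      have h1 := mem_verts.2 ⟨h, y.1.2.2.2⟩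
      rw [hS, mem_insert, mem_singleton] at h1
      refine hTS (eq_of_verts ?_)
      rw [← insert_contract y, hy, h1.resolve_left y.ne_univ.symm, hS, pair_comm]
    · exact evFn_of_ne c hy _
  · intro A _
    rw [opI_apply _ _ A.2, evFn_of_ne c hT, mul_zero]

/-- The composition of the cocycles given by two elements of `P` is cohomologous, up to a sign, to
the cocycle given by their composition. -/
theorem exists_d_eq_comp (hn : 1 < n) (hm : 1 < m) (hl : 1 < l) (x : Fin n)
    (e : {c : Fin n // c ≠ x} ⊕ Fin m ≃ Fin l) (a : P.obj n) (b : P.obj m) :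
    ∃ β, P.toDG.cob.cob.d l (0 - 1) 0 β =
      - (iota hl (P.comp x e a b) + P.toDG.cob.cob.comp x e 0 0 0 (iota hn a) (iota hm b)) := by
  have hg : 1 < (outer x e {x}).card := by
    rw [← inner_univ, RTree.inner, card_map, card_univ, Fintype.card_fin]
    exact hm
  obtain ⟨S, hx, hS⟩ : ∃ S : RTree l, outer x e {x} ∈ S.edges ∧ S.verts = {univ, outer x e {x}} :=
    ⟨_, mem_insert_self _ _, verts_addToCorolla hl hg⟩
  have hO := verts_outer_of_pair hx hn hS
  have hI := verts_inner_of_pair hx hn hm hS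
  have hne := outer_self_ne_univ hx hn
  obtain ⟨c, ha, hb⟩ := exists_pairDec hx hO hI a b
  obtain ⟨β, hβ⟩ := exists_ev (i := 0 - 1) (isMulti_evFn c) fun T p h => by
    rw [sum_of_evFn c T p h, hS, card_pair hne.symm]
    rfl
  refine ⟨β, DGOperadData.cob_ext ?_⟩
  have hsum : ev (- (iota hl (P.comp x e a b) +
      P.toDG.cob.cob.comp x e 0 0 0 (iota hn a) (iota hm b)) : P.toDG.cob.cob.obj l 0) =
      - (iotaFn hl (P.comp x e a b) + graftFn x e (iotaFn hn a) (iotaFn hm b)) := by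
    rw [← zero_sub, ev_sub', ev_zero', ev_add', DGOperadData.ev_comp (add_zero 0), ev_iota, ev_iota, ev_iota,
      zero_sub]
  rw [ev_d (sub_add_cancel 0 1), hβ, hsum]
  funext T q
  rw [Pi.neg_apply, Pi.neg_apply, Pi.add_apply, Pi.add_apply]
  by_cases hT : T.verts = {univ}
  · rw [dFn_evFn_corolla hx hO hI ha hb hl hT, graftFn_corolla hn hm _ _ hT, add_zero]
  rw [iotaFn_of_ne hl _ hT, zero_add]
  by_cases hTS : T = S
  · subst hTS
    exact dFn_evFn_pair hx hO hI ha hb hn hm q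
  · rw [dFn_evFn_of_ne hS c hTS hT]
    by_cases hxT : outer x e {x} ∈ T.edges
    · rw [graftFn, dif_pos hxT]
      by_cases hO' : (T.restr _ (isBlock_outer hxT)).verts = {univ}
      · by_cases hI' : (T.restr _ (isBlock_inner hxT)).verts = {univ}
        · exact absurd (eq_of_verts ((verts_eq_pair hxT hO' hI').trans hS.symm)) hTS
        · rw [iotaFn_of_ne hm _ hI', mul_zero, mul_zero, neg_zero]
      · rw [iotaFn_of_ne hn _ hO', zero_mul, mul_zero, neg_zero]
    · rw [graftFn_of_notMem hxT, neg_zero]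

end Operad

/-! ### The isomorphism -/

open RTree

namespace Operad

open DGOperadData Function

variable {k : Type u} [Field k] {P : Operad.{u, v} k}

section Cohomology

variable {Q : DGOperadData.{u, w} k} (hQ : IsDGOperad Q)
    (j : ∀ n, P.obj n →ₗ[k] Q.obj n 0)

theorem _root_.DGOperadData.castDeg_self {n : ℕ} {i : ℤ} (a : Q.obj n i) : Q.castDeg n i i a = a := by
  simp [castDeg]

theorem castDeg_mem (hd : ∀ n a, j n a ∈ IsDGOperad.cocycles Q n 0) (n : ℕ) (i : ℤ) (a : P.obj n) :
    Q.castDeg n 0 i (j n a) ∈ IsDGOperad.cocycles Q n i := by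
  by_cases hi : 0 = i
  · subst hi
    rw [castDeg_self]
    exact hd n a
  · rw [castDeg_of_ne hi]
    exact Submodule.zero_mem _

variable (hd : ∀ n a, j n a ∈ IsDGOperad.cocycles Q n 0)

/-- The map to the cohomology given by a map to the cocycles of degree `0`. -/
noncomputable def toCohomology (n : ℕ) (i : ℤ) : P.toDG.obj n i →ₗ[k] hQ.cohomology.obj n i :=
  (IsDGOperad.coboundaries Q n i).mkQ ∘ₗ
    LinearMap.codRestrict (IsDGOperad.cocycles Q n i) (Q.castDeg n 0 i ∘ₗ j n ∘ₗ
      (conc k (P.obj n) i).subtype) fun _ => castDeg_mem j hd n i _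

theorem toCohomology_zero (n : ℕ) (a : P.toDG.obj n 0) : toCohomology hQ j hd n 0 a =
    Submodule.Quotient.mk ⟨j n (show conc k (P.obj n) 0 from a).1, hd n _⟩ := by
  refine congrArg Submodule.Quotient.mk (Subtype.ext ?_)
  exact DGOperadData.castDeg_self (Q := Q) (i := 0) _

variable (hinj : ∀ n a β, Q.d n (0 - 1) 0 β = j n a → a = 0)
  (hsurj : ∀ n α, Q.d n 0 (0 + 1) α = 0 → ∃ a β, Q.d n (0 - 1) 0 β = α - j n a)
  (hne : ∀ n i, i ≠ 0 → ∀ α, Q.d n i (i + 1) α = 0 → ∃ β, Q.d n (i - 1) i β = α)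

include hd hinj hsurj hne

theorem bijective_toCohomology (n : ℕ) (i : ℤ) : Bijective (toCohomology hQ j hd n i) := by
  by_cases hi : i = 0
  · subst hi
    constructor
    · refine (injective_iff_map_eq_zero _).2 fun a ha => ?_
      obtain ⟨β, hβ⟩ := (Submodule.Quotient.mk_eq_zero _).1
        ((toCohomology_zero hQ j hd n a).symm.trans ha)
      exact Subtype.ext (hinj n _ β hβ)
    · intro α
      obtain ⟨⟨α, hα⟩, rfl⟩ := Submodule.Quotient.mk_surjective _ α
      obtain ⟨a, β, hβ⟩ := hsurj n α hα
      let a' : P.toDG.obj n 0 := concProj k (P.obj n) 0 a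
      refine ⟨a', (toCohomology_zero hQ j hd n a').trans ?_⟩
      have h1 : (⟨α, hα⟩ - ⟨j n (concProj k (P.obj n) 0 a).1, hd n _⟩ :
          IsDGOperad.cocycles Q n 0) ∈ IsDGOperad.coboundaries Q n 0 :=
        ⟨β, hβ.trans (congrArg (fun b => α - j n b) (concProj_zero_coe k a).symm)⟩
      exact ((Submodule.Quotient.eq _).2 h1).symm
  · constructor
    · intro a b _
      rw [P.toDG_eq_zero hi a, P.toDG_eq_zero hi b]
    · intro α
      obtain ⟨⟨α, hα⟩, rfl⟩ := Submodule.Quotient.mk_surjective _ α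
      obtain ⟨β, hβ⟩ := hne n i hi α hα
      refine ⟨0, ?_⟩
      have h1 : (⟨α, hα⟩ : IsDGOperad.cocycles Q n i) ∈ IsDGOperad.coboundaries Q n i := ⟨β, hβ⟩
      exact (map_zero _).trans ((Submodule.Quotient.mk_eq_zero _).2 h1).symm

/-- A map of an operad to the cocycles of degree `0` which is bijective on cohomology and is
compatible with the operations up to coboundaries gives an isomorphism. -/
theorem nonempty_iso (hone : j 1 P.one = Q.one)
    (hrel : ∀ {n l : ℕ} (f : Fin n ≃ Fin l) a, Q.relabel f 0 (j n a) = j l (P.relabel f a))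
    (hcomp : ∀ {n m l : ℕ} (x : Fin n) (e : {c : Fin n // c ≠ x} ⊕ Fin m ≃ Fin l) a b,
      ∃ β, Q.d l (0 - 1) 0 β = Q.comp x e 0 0 0 (j n a) (j m b) - j l (P.comp x e a b)) :
    Nonempty (DGOperadIso hQ.cohomology P.toDG) := by
  have hbij := bijective_toCohomology hQ j hd hinj hsurj hne
  let E : ∀ n i, P.toDG.obj n i ≃ₗ[k] hQ.cohomology.obj n i := fun n i =>
    LinearEquiv.ofBijective (toCohomology hQ j hd n i) (hbij n i)
  refine ⟨⟨fun n i => (E n i).symm, ?_, ?_, ?_, ?_⟩⟩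
  · rw [LinearEquiv.symm_apply_eq]
    refine Eq.trans ?_ (toCohomology_zero hQ j hd 1 _).symm
    refine congrArg Submodule.Quotient.mk (Subtype.ext ?_)
    exact hone.symm.trans (congrArg (j 1) (concProj_zero_coe k _).symm)
  · intro n l f i a
    obtain ⟨a, rfl⟩ := (E n i).surjective a
    rw [LinearEquiv.symm_apply_eq, LinearEquiv.symm_apply_apply]
    by_cases hi : i = 0
    · subst hi
      refine (congrArg _ (toCohomology_zero hQ j hd n a)).trans
        (Eq.trans ?_ (toCohomology_zero hQ j hd l _).symm)
      refine congrArg Submodule.Quotient.mk (Subtype.ext ?_)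
      exact (hrel f _).trans (congrArg (j l) (concProj_zero_coe k _).symm)
    · rw [P.toDG_eq_zero hi a, map_zero, map_zero, map_zero, map_zero]
  · intro n m l x e i i' t a b
    obtain ⟨a, rfl⟩ := (E n i).surjective a
    obtain ⟨b, rfl⟩ := (E m i').surjective b
    rw [LinearEquiv.symm_apply_eq, LinearEquiv.symm_apply_apply, LinearEquiv.symm_apply_apply]
    by_cases hi : i = 0
    · by_cases hi' : i' = 0
      · subst hi hi'
        have h1 : E n 0 a = _ := toCohomology_zero hQ j hd n a
        have h2 : E m 0 b = _ := toCohomology_zero hQ j hd m b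
        rw [h1, h2]
        by_cases ht : 0 = t
        · subst ht
          refine Eq.trans ?_ (toCohomology_zero hQ j hd l _).symm
          obtain ⟨β, hβ⟩ := hcomp x e (show conc k (P.obj n) 0 from a).1
            (show conc k (P.obj m) 0 from b).1
          refine (Submodule.Quotient.eq _).2 ⟨β, hβ.trans ?_⟩
          exact congrArg (fun c => Q.comp x e 0 0 0 (j n _) (j m _) - j l c)
            (concProj_zero_coe k _).symm
        · rw [P.toDG_eq_zero (Ne.symm ht) (P.toDG.comp x e 0 0 t a b), map_zero]
          refine (Submodule.Quotient.mk_eq_zero _).2 ⟨0, ?_⟩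
          rw [map_zero]
          change 0 = Q.comp x e 0 0 t _ _
          rw [hQ.comp_shape x e 0 0 t (by simpa using ht)]
          rfl
      · rw [P.toDG_eq_zero hi' b]
        simp only [map_zero]
    · rw [P.toDG_eq_zero hi a]
      simp only [map_zero, LinearMap.zero_apply]
  · intro n i i' a
    exact map_zero _

end Cohomology

end Operad

/-! ### The double cobar complex in small arities -/

open RTree

namespace DGOperadData

variable {k : Type u} [Field k] {Q : DGOperadData.{u, v} k} {n m l : ℕ}

theorem isEmpty_vert_one (T : RTree 1) : IsEmpty T.Vert :=
  ⟨fun A => lt_irrefl 1 (one_lt_of_vert A)⟩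

theorem ev_one (T : RTree 1) (p : Q.Dec T) : ev (Q.cob.one : Q.cob.obj 1 0) T p = 1 :=
  (tw_before _ T p).symm.trans (tw_ev_cobOne T p Before)

theorem eq_smul_one (α : Q.cob.obj 1 0) : ∃ c : k, α = c • Q.cob.one := by
  have h1 : ∀ T T' : RTree 1, T = T' := fun T T' => eq_of_verts (by
    rw [eq_empty_of_forall_notMem fun A hA => (isEmpty_vert_one T).false ⟨A, mem_verts.1 hA⟩,
      eq_empty_of_forall_notMem fun A hA => (isEmpty_vert_one T').false ⟨A, mem_verts.1 hA⟩])
  by_cases h : ∃ (T : RTree 1) (p : Q.Dec T), True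
  · obtain ⟨T, p, -⟩ := h
    refine ⟨ev α T p, DGOperadData.cob_ext (funext fun T' => funext fun p' => ?_)⟩
    obtain rfl := h1 T T'
    have := isEmpty_vert_one T
    rw [ev_smul', Pi.smul_apply, Pi.smul_apply, ev_one, smul_eq_mul, mul_one, Subsingleton.elim p p']
  · exact ⟨0, DGOperadData.cob_ext (funext fun T => funext fun p => absurd ⟨T, p, trivial⟩ h)⟩

theorem subsingleton_one {i : ℤ} (hi : i ≠ 0) : Subsingleton (Q.cob.obj 1 i) :=
  subsingleton_of_forall_eq 0 fun α => DGOperadData.cob_ext (funext fun T => funext fun p => by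
    have := isEmpty_vert_one T
    rw [ev_zero']
    exact ev_of_ne (α : Q.CobObj 1 i) T p (by simpa using hi.symm))

theorem smul_one_eq_zero {c : k} (h : c • (Q.cob.one : Q.cob.obj 1 0) = 0) : c = 0 := by
  let T : RTree 1 :=
    { edges := {univ}
      nonempty := fun A hA => by rw [mem_singleton.1 hA]; exact univ_nonempty
      root_mem := mem_singleton_self _
      leaf_mem := fun c => by rw [mem_singleton]; ext; simp [Subsingleton.elim c 0]
      laminar := fun A hA B hB => Or.inl (by rw [mem_singleton.1 hA, mem_singleton.1 hB]) }
  have h1 := congrArg (fun γ : Q.cob.obj 1 0 => ev γ T fun A => ((isEmpty_vert_one T).false A).elim) h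
  simp only [ev_smul', ev_zero', Pi.smul_apply, ev_one, smul_eq_mul, mul_one] at h1
  exact h1

end DGOperadData

namespace Operad

open DGOperadData Function

variable {k : Type u} [Field k] {P : Operad.{u, v} k} (hone : Bijective fun c : k => c • P.one)

/-- The map of the operad to the cocycles of its double cobar complex. -/
noncomputable def toCobCob : ∀ n, P.obj n →ₗ[k] P.toDG.cob.cob.obj n 0
  | 0 => 0
  | 1 => LinearMap.toSpanSingleton k _ P.toDG.cob.cob.one ∘ₗ
      (LinearEquiv.ofBijective (LinearMap.toSpanSingleton k _ P.one) hone).symm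
  | n + 2 => - iota (by omega)

theorem toCobCob_of_one_lt {n : ℕ} (hn : 1 < n) : toCobCob hone n = - iota hn := by
  obtain ⟨n, rfl⟩ := Nat.exists_eq_add_of_le' hn
  rfl

theorem toCobCob_smul_one (c : k) : toCobCob hone 1 (c • P.one) = c • P.toDG.cob.cob.one := by
  have h : (LinearEquiv.ofBijective (LinearMap.toSpanSingleton k _ P.one) hone).symm (c • P.one) = c :=
    (LinearEquiv.symm_apply_eq _).2 rfl
  exact congrArg (fun c : k => c • P.toDG.cob.cob.one) h

theorem isDGOperad_cob_cob (P : Operad.{u, v} k) : IsDGOperad P.toDG.cob.cob :=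
  isDGOperad_cob (isDGOperad_cob P.isDGOperad_toDG)

theorem arity_cases (n : ℕ) : n = 0 ∨ n = 1 ∨ 1 < n := by omega

theorem d_toCobCob (n : ℕ) (a : P.obj n) :
    toCobCob hone n a ∈ IsDGOperad.cocycles P.toDG.cob.cob n 0 := by
  rcases arity_cases n with rfl | rfl | hn
  · exact Submodule.zero_mem _
  · obtain ⟨c, rfl⟩ := hone.2 a
    change toCobCob hone 1 (c • P.one) ∈ _
    rw [toCobCob_smul_one]
    exact Submodule.smul_mem _ _ (isDGOperad_cob_cob P).one_mem
  · rw [toCobCob_of_one_lt hone hn]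
    exact Submodule.neg_mem _ (d_iota hn a)

theorem relabel_toCobCob {n l : ℕ} (f : Fin n ≃ Fin l) (a : P.obj n) :
    P.toDG.cob.cob.relabel f 0 (toCobCob hone n a) = toCobCob hone l (P.relabel f a) := by
  have h := isDGOperad_cob_cob P
  obtain rfl : n = l := by simpa using Fintype.card_congr f
  rcases arity_cases n with rfl | rfl | hn
  · exact (h.obj_zero 0).elim _ _
  · obtain rfl : f = Equiv.refl _ := Subsingleton.elim _ _
    rw [h.relabel_refl, P.relabel_refl]
  · rw [toCobCob_of_one_lt hone hn, LinearMap.neg_apply, LinearMap.neg_apply, map_neg,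
      relabel_iota hn hn]

theorem exists_d_eq_comp_toCobCob {n m l : ℕ} (x : Fin n)
    (e : {c : Fin n // c ≠ x} ⊕ Fin m ≃ Fin l) (a : P.obj n) (b : P.obj m) :
    ∃ β, P.toDG.cob.cob.d l (0 - 1) 0 β = P.toDG.cob.cob.comp x e 0 0 0 (toCobCob hone n a)
      (toCobCob hone m b) - toCobCob hone l (P.comp x e a b) := by
  have h := isDGOperad_cob_cob P
  rcases arity_cases n with rfl | rfl | hn
  · exact x.elim0
  · obtain rfl : x = 0 := Subsingleton.elim _ _
    obtain ⟨c, rfl⟩ := hone.2 a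
    let f : Fin m ≃ Fin l := Equiv.ofBijective (fun c => e (Sum.inr c))
      ⟨e.injective.comp Sum.inr_injective, fun z => by
        obtain ⟨s | s, rfl⟩ := e.surjective z
        · exact absurd (Subsingleton.elim _ _) s.2
        · exact ⟨s, rfl⟩⟩
    refine ⟨0, ?_⟩
    change _ = P.toDG.cob.cob.comp 0 e 0 0 0 (toCobCob hone 1 (c • P.one)) _ -
      toCobCob hone l (P.comp 0 e (c • P.one) b)
    rw [toCobCob_smul_one, map_smul, map_smul, LinearMap.smul_apply, LinearMap.smul_apply,
      P.one_comp e f (fun _ => rfl), h.one_comp e f (fun _ => rfl), relabel_toCobCob, map_smul,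
      sub_self, map_zero]
  rcases arity_cases m with rfl | rfl | hm
  · obtain rfl : b = 0 := P.obj_zero.elim _ _
    exact ⟨0, by simp only [map_zero, sub_self]⟩
  · obtain ⟨c, rfl⟩ := hone.2 b
    let f : Fin n ≃ Fin l := Equiv.ofBijective
      (fun c => if h : c = x then e (Sum.inr 0) else e (Sum.inl ⟨c, h⟩)) (by
        constructor
        · intro c c' hc
          by_cases h : c = x <;> by_cases h' : c' = x
          · rw [h, h']
          · simp [h, h'] at hc
          · simp [h, h'] at hc
          · simpa [h, h'] using hc
        · intro z
          obtain ⟨s | s, rfl⟩ := e.surjective z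
          · exact ⟨s.1, by simp [s.2]⟩
          · exact ⟨x, by simp [Subsingleton.elim s 0]⟩)
    have hf : ∀ c : {c : Fin n // c ≠ x}, e (Sum.inl c) = f c.1 := fun c => by simp [f, c.2]
    have hf' : e (Sum.inr 0) = f x := by simp [f]
    refine ⟨0, ?_⟩
    change _ = P.toDG.cob.cob.comp x e 0 0 0 _ (toCobCob hone 1 (c • P.one)) -
      toCobCob hone l (P.comp x e a (c • P.one))
    rw [toCobCob_smul_one, map_smul, map_smul, P.comp_one x e f hf hf', h.comp_one x e f hf hf',
      relabel_toCobCob, map_smul, sub_self, map_zero]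
  · have hl : 1 < l := by
      have h1 := Fintype.card_le_of_injective _ (e.injective.comp Sum.inr_injective)
      rw [Fintype.card_fin, Fintype.card_fin] at h1
      omega
    obtain ⟨β, hβ⟩ := exists_d_eq_comp hn hm hl x e a b
    refine ⟨-β, ?_⟩
    rw [map_neg, hβ, toCobCob_of_one_lt hone hn, toCobCob_of_one_lt hone hm,
      toCobCob_of_one_lt hone hl]
    simp only [LinearMap.neg_apply, map_neg, neg_neg]
    abel

theorem eq_zero_of_toCobCob_eq_d [∀ n, FiniteDimensional k (P.obj n)] (n : ℕ) (a : P.obj n)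
    (β : P.toDG.cob.cob.obj n (0 - 1)) (hβ : P.toDG.cob.cob.d n (0 - 1) 0 β = toCobCob hone n a) :
    a = 0 := by
  rcases arity_cases n with rfl | rfl | hn
  · exact P.obj_zero.elim _ _
  · obtain ⟨c, rfl⟩ := hone.2 a
    have hs : Subsingleton (P.toDG.cob.cob.obj 1 (0 - 1)) := subsingleton_one (by omega)
    change _ = toCobCob hone 1 (c • P.one) at hβ
    rw [Subsingleton.elim β 0, map_zero, toCobCob_smul_one] at hβ
    change c • P.one = 0
    rw [smul_one_eq_zero hβ.symm, zero_smul]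
  · rw [toCobCob_of_one_lt hone hn, LinearMap.neg_apply, ← map_neg] at hβ
    exact neg_eq_zero.1 (eq_zero_of_iota_eq_d hn hβ)

theorem exists_sub_toCobCob_eq_d [∀ n, FiniteDimensional k (P.obj n)] (n : ℕ)
    (α : P.toDG.cob.cob.obj n 0) (hα : P.toDG.cob.cob.d n 0 (0 + 1) α = 0) :
    ∃ a β, P.toDG.cob.cob.d n (0 - 1) 0 β = α - toCobCob hone n a := by
  rcases arity_cases n with rfl | rfl | hn
  · exact ⟨0, 0, ((isDGOperad_cob_cob P).obj_zero 0).elim _ _⟩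
  · obtain ⟨c, rfl⟩ := eq_smul_one α
    exact ⟨c • P.one, 0, by rw [toCobCob_smul_one, sub_self, map_zero]⟩
  · obtain ⟨a, β, h⟩ := exists_sub_iota_eq_d hn α hα
    refine ⟨-a, β, ?_⟩
    rw [h, toCobCob_of_one_lt hone hn, LinearMap.neg_apply, map_neg, neg_neg]

theorem exists_d_eq [∀ n, FiniteDimensional k (P.obj n)] (n : ℕ) (i : ℤ) (hi : i ≠ 0)
    (α : P.toDG.cob.cob.obj n i) (hα : P.toDG.cob.cob.d n i (i + 1) α = 0) :
    ∃ β, P.toDG.cob.cob.d n (i - 1) i β = α := by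
  rcases arity_cases n with rfl | rfl | hn
  · exact ⟨0, ((isDGOperad_cob_cob P).obj_zero i).elim _ _⟩
  · exact ⟨0, (subsingleton_one hi).elim _ _⟩
  · have h1 : dFn (ev α) = 0 := by
      rw [← ev_d (j := i + 1) rfl, hα, ev_zero']
    exact exists_eq_d hn hi α fun T _ p => by rw [h1]; rfl

end Operad

/-- For every operad `P` with `P(1) = k` and finite-dimensional components, the cobar complex and
the double cobar complex of `P` are differential graded operads, and the cohomology of the double
cobar complex is isomorphic to `P`, concentrated in degree `0`, as a graded operad. -/
theorem mainTheorem3 {k : Type u} [Field k] (P : Operad.{u, v} k)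
    (hone : Function.Bijective fun c : k => c • P.one)
    (hfin : ∀ n : ℕ, FiniteDimensional k (P.obj n)) :
    IsDGOperad P.toDG.cob ∧
      ∃ h : IsDGOperad P.toDG.cob.cob, Nonempty (DGOperadIso h.cohomology P.toDG) := by
  have := hfin
  exact ⟨DGOperadData.isDGOperad_cob P.isDGOperad_toDG, Operad.isDGOperad_cob_cob P,
    Operad.nonempty_iso _ (Operad.toCobCob hone) (Operad.d_toCobCob hone)
      (Operad.eq_zero_of_toCobCob_eq_d hone) (Operad.exists_sub_toCobCob_eq_d hone)
      Operad.exists_d_eq (by simpa using Operad.toCobCob_smul_one hone 1)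
      (Operad.relabel_toCobCob hone) (Operad.exists_d_eq_comp_toCobCob hone)⟩
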